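/- Let $(\omega_s)_{s\in\mathbb Z^2}$ be nonnegative weights and let $\mathcal S=\{s:\omega_s\neq 0\}\subseteq\{-1,0,1\}^2\setminus\{(0,0)\}$, where no closed half-plane through the origin contains $\mathcal S$. Let $\mathcal Q=\mathbb Z_{\ge0}^2$, let $q((u,v),(k,l);n)$ be the weighted number of $n$-step walks in $\mathcal Q$ from $(u,v)$ to $(k,l)$ with steps in $\mathcal S$, and let $Q_{u,v}(x,y;t)=\sum_{n,k,l\ge0}q((u,v),(k,l);n)\,x^ky^lt^n$. Put $S(x,y)=\sum_{(i,j)\in\mathcal S}\omega_{(i,j)}x^iy^j=\sum_{j=-1}^{1}A_j(x)y^j=\sum_{i=-1}^{1}B_i(y)x^i$. Let $\mathcal G$ be the group generated by the birational involutions $\Phi(x,y)=\bigl(x,\,y^{-1}A_{-1}(x)/A_1(x)\bigr)$ and $\Psi(x,y)=\bigl(x^{-1}B_{-1}(y)/B_1(y),\,y\bigr)$; let $\operatorname{sgn}(g)=1$ if $g=(\Phi\circ\Psi)^k$ for some $k$, and $\operatorname{sgn}(g)=-1$ otherwise. Assume that the model is orbit-summable, i.e. that $\mathcal G$ is finite and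 that for all $u,v\ge0$ $$xy\,Q_{u,v}(x,y;t)=[x^>][y^>]\;\frac{\sum_{g\in\mathcal G}\operatorname{sgn}(g)\,g(x^{u+1}y^{v+1})}{1-tS(x,y)},$$ where the fraction is expanded in powers of $t$, then of $y$, then of $x$, and $[x^>][y^>]$ keeps the terms with positive exponents of both $x$ and $y$. Assume also that the drift is zero, i.e. $\sum_{(i,j)\in\mathcal S} i\,\omega_{(i,j)}=\sum_{(i,j)\in\mathcal S} j\,\omega_{(i,j)}=0$. Let $(x_0,y_0)$ be a dominant saddle point, i.e. a minimizer of $S$ on $(0,\infty)^2$, and put $\gamma=S(x_0,y_0)$. Then the set of points $(x_i,y_i)\in\mathbb C^2$ with $|x_i|=x_0$, $|y_i|=y_0$ and $|S(x_i,y_i)|=\gamma$ is finite, say $1\le i\le r$; write $(x_i,y_i)=(\alpha_ix_0,\beta_iy_0)$ and $S(x_i,y_i)=\zeta_i\gamma$. There are $c\in\mathbb N$ and real polynomials $v_p(k,l,u,v)$, $p\ge1$, such that for all $m\in\mathbb N$ and all fixed $(u,v),(k,l)\in\mathcal Q$, as $n\to\infty$, $$q((u,v),(k,l);n)=\frac{\gamma^n}{n^c}\left[\sum_{p=1}^{m-1}\frac{v_p(k,l,u,v)\sum_{i=1}^r\alpha_i^{u-k}\beta_i^{v-l}\zeta_i^n}{n^p}+\mathcal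 O\!\left(\frac1{n^m}\right)\right].\tag{$*$}$$ Moreover, for every $c\in\mathbb N$ and all real polynomials $v_p$ that satisfy $(*)$, and for every $p\ge1$, there are real constants $a_{i,j}$ and functions $h_i^j,g_i^j$ such that on $\mathcal Q\times\mathcal Q$ $$v_p(k,l,u,v)=\sum_{\substack{1\le i,j\le p\\ i+j\le p+1}}a_{i,j}\,h_i^j(k,l)\,g_i^j(u,v),$$ where each $h_i^j$ is polyharmonic of degree at most $i$ and each $g_i^j$ is adjoint polyharmonic of degree at most $p+1-i$. Here a function $f$ on $\mathcal Q$, extended by $0$ to $\mathbb Z^2$, is called polyharmonic of degree at most $d$ if $\triangle^df=0$ on $\mathcal Q$, where $\triangle f(z)=\sum_{s\in\mathcal S}\omega_sf(z-s)-\gamma f(z)$ for $z\in\mathcal Q$ and $\triangle f$ is again extended by $0$; it is called adjoint polyharmonic if the same holds with $f(z+s)$ in place of $f(z-s)$. -/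

import Mathlib

open Filter Asymptotics

noncomputable section

/-- The nine vectors of `{-1, 0, 1}²`. -/
def smallBox : Finset (ℤ × ℤ) := Finset.Icc (-1) 1 ×ˢ Finset.Icc (-1) 1

/-- The quarter plane `ℤ≥0 × ℤ≥0`, as a subset of `ℤ²`. -/
def quarterPlane : Set (ℤ × ℤ) := {z | 0 ≤ z.1 ∧ 0 ≤ z.2}

/-- A weighted small-step model. A vector `s` is an allowed step if `weight s ≠ 0`; weights of
allowed steps are positive, steps lie in `{-1, 0, 1}² \ {(0, 0)}`, and no closed half-plane through
the origin contains all the steps. -/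
structure StepModel where
  weight : ℤ × ℤ → ℝ
  weight_nonneg : ∀ s, 0 ≤ weight s
  small : ∀ s, weight s ≠ 0 → s ∈ smallBox
  weight_zero : weight (0, 0) = 0
  nondegenerate : ∀ a b : ℝ, (a, b) ≠ (0, 0) →
    ∃ s, weight s ≠ 0 ∧ a * (s.1 : ℝ) + b * (s.2 : ℝ) < 0

namespace StepModel

variable (M : StepModel)

/-- The model with all the steps reversed. -/
def reverse : StepModel where
  weight s := M.weight (-s)
  weight_nonneg s := M.weight_nonneg (-s)
  small s hs := by
    have h := M.small (-s) hs
    simp only [smallBox, Finset.mem_product, Finset.mem_Icc, Prod.fst_neg, Prod.snd_neg] at h ⊢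
    omega
  weight_zero := by simpa using M.weight_zero
  nondegenerate a b hab := by
    obtain ⟨s, hs, h⟩ := M.nondegenerate (-a) (-b) (by simpa using hab)
    refine ⟨-s, by simpa using hs, ?_⟩
    simp only [Prod.fst_neg, Prod.snd_neg, Int.cast_neg]
    linarith

/-- The drift of the model vanishes. -/
def ZeroDrift : Prop :=
  ∑ s ∈ smallBox, (s.1 : ℝ) * M.weight s = 0 ∧ ∑ s ∈ smallBox, (s.2 : ℝ) * M.weight s = 0

/-- The step-counting Laurent polynomial `S(x, y) = ∑ ω_(i,j) x^i y^j`, evaluated in a field. -/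
def stepPoly {K : Type} [Field K] [Algebra ℝ K] (x y : K) : K :=
  ∑ s ∈ smallBox, algebraMap ℝ K (M.weight s) * x ^ s.1 * y ^ s.2

open Classical in
/-- `M.walkCount u v n (k, l)` is the weighted number of walks of length `n` in the quarter plane
from `(u, v)` to `(k, l)`, sorted by their last step; it is `0` if `(k, l)` is not in the quarter
plane. -/
def walkCount (u v : ℕ) : ℕ → ℤ × ℤ → ℝ
  | 0, z => if z = ((u : ℤ), (v : ℤ)) then 1 else 0
  | n + 1, z => if z ∈ quarterPlane then
      ∑ s ∈ smallBox, M.weight s * walkCount u v n (z - s) else 0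

/-! ### Discrete polyharmonic functions -/

open Classical in
/-- The discrete Laplacian `f ↦ (x ↦ ∑ ω_s f(x - s) - t f(x))` as an operator on functions on the
quarter plane, which are identified with the functions on `ℤ²` that vanish off the quarter plane
(Dirichlet condition). -/
def laplacian (t : ℝ) (f : ℤ × ℤ → ℝ) : ℤ × ℤ → ℝ := fun z =>
  if z ∈ quarterPlane then ∑ s ∈ smallBox, M.weight s * f (z - s) - t * f z else 0

/-- `f` is (discrete) `t`-polyharmonic of degree (at most) `p`. -/
def IsPolyharmonic (t : ℝ) (p : ℕ) (f : ℤ × ℤ → ℝ) : Prop :=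
  (∀ z ∈ quarterPlane, (M.laplacian t)^[p] f z = 0) ∧ ∀ z, z ∉ quarterPlane → f z = 0

/-- `f` is adjoint `t`-polyharmonic of degree (at most) `p`: it is so for the reversed steps. -/
def IsAdjointPolyharmonic (t : ℝ) (p : ℕ) (f : ℤ × ℤ → ℝ) : Prop :=
  M.reverse.IsPolyharmonic t p f

/-! ### The group of the model and orbit summation -/

/-- The field `ℝ(x)(y) = ℝ(x, y)` of rational functions. -/
abbrev RatXY : Type := RatFunc (RatFunc ℝ)

/-- The rational function `x`. -/
def ratX : RatXY := RatFunc.C RatFunc.X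

/-- The rational function `y`. -/
def ratY : RatXY := RatFunc.X

/-- The coefficient of `x^i y^j` in the expansion of a rational function in `ℝ((x))((y))`:
expand in powers of `y` with coefficients in `ℝ(x)`, then expand the coefficient in powers
of `x`. -/
def coeffXY (f : RatXY) (i j : ℤ) : ℝ :=
  (((f : LaurentSeries (RatFunc ℝ)).coeff j : RatFunc ℝ) : LaurentSeries ℝ).coeff i

/-- `∑_i ω_(i,j) x^i`, the coefficient of `y^j` in `S(x, y)`. -/
def rowPoly (j : ℤ) (x : RatXY) : RatXY :=
  ∑ i ∈ Finset.Icc (-1 : ℤ) 1, algebraMap ℝ RatXY (M.weight (i, j)) * x ^ i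

/-- `∑_j ω_(i,j) y^j`, the coefficient of `x^i` in `S(x, y)`. -/
def colPoly (i : ℤ) (y : RatXY) : RatXY :=
  ∑ j ∈ Finset.Icc (-1 : ℤ) 1, algebraMap ℝ RatXY (M.weight (i, j)) * y ^ j

/-- The birational transformation `Φ : (x, y) ↦ (x, y⁻¹ c(x) / a(x))`. A birational transformation
`g` is represented by the pair `(g(x), g(y))` of rational functions, and composing with `Φ` from
the left is evaluation of `Φ` at that pair. -/
def Phi (g : RatXY × RatXY) : RatXY × RatXY :=
  (g.1, g.2⁻¹ * (M.rowPoly (-1) g.1 / M.rowPoly 1 g.1))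

/-- The birational transformation `Ψ : (x, y) ↦ (x⁻¹ c̃(y) / ã(y), y)`. -/
def Psi (g : RatXY × RatXY) : RatXY × RatXY :=
  (g.1⁻¹ * (M.colPoly (-1) g.2 / M.colPoly 1 g.2), g.2)

/-- Membership in the group of the model: the compositions of copies of `Φ` and `Ψ`
(both are involutions). -/
inductive InGroup : RatXY × RatXY → Prop
  | one : InGroup (ratX, ratY)
  | phi (g : RatXY × RatXY) : InGroup g → InGroup (M.Phi g)
  | psi (g : RatXY × RatXY) : InGroup g → InGroup (M.Psi g)

/-- The group of the model, as a set of birational transformations. -/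
def group : Set (RatXY × RatXY) := {g | M.InGroup g}

open Classical in
/-- The sign of an element of a finite group: `1` if it is a power of `Φ ∘ Ψ`, otherwise `-1`. -/
def sgn (g : RatXY × RatXY) : ℤ :=
  if ∃ k : ℕ, g = (M.Phi ∘ M.Psi)^[k] (ratX, ratY) then 1 else -1

/-- The alternating orbit sum `∑_g sgn(g) g(x^(u+1) y^(v+1))` (for a finite group). -/
def orbitSum (u v : ℕ) : RatXY :=
  ∑ᶠ g ∈ M.group, (M.sgn g : RatXY) * (g.1 ^ (u + 1) * g.2 ^ (v + 1))

/-- The model is orbit-summable: its group is finite and, for every starting point `(u, v)`,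
`x y Q_(u,v)(x, y; t) = [x^>] [y^>] (∑_g sgn(g) g(x^(u+1) y^(v+1))) / (1 - t S(x, y))`.
The identity is stated for the coefficients of `x^(k+1) y^(l+1) t^n`. -/
def IsOrbitSummable : Prop :=
  M.group.Finite ∧ ∀ u v k l n : ℕ,
    M.walkCount u v n ((k : ℤ), (l : ℤ)) =
      coeffXY (M.orbitSum u v * M.stepPoly ratX ratY ^ n) ((k : ℤ) + 1) ((l : ℤ) + 1)

/-! ### Saddle points and the asymptotic expansion -/

/-- `(x₀, y₀)` minimizes `S` on the positive quadrant. -/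
def IsDominantSaddlePoint (x₀ y₀ : ℝ) : Prop :=
  0 < x₀ ∧ 0 < y₀ ∧ ∀ x y : ℝ, 0 < x → 0 < y → M.stepPoly x₀ y₀ ≤ M.stepPoly x y

/-- `z` is a saddle point associated with `(x₀, y₀)`, possibly `(x₀, y₀)` itself. -/
def IsAssociatedSaddlePoint (x₀ y₀ : ℝ) (z : ℂ × ℂ) : Prop :=
  ‖z.1‖ = x₀ ∧ ‖z.2‖ = y₀ ∧ ‖M.stepPoly z.1 z.2‖ = M.stepPoly x₀ y₀

/-- `∑_i α_i^(u-k) β_i^(v-l) ζ_i^n` over a set `T` of saddle points `(x_i, y_i)`, with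
`(x_i, y_i) = (α_i x₀, β_i y₀)` and `S(x_i, y_i) = ζ_i S(x₀, y₀)`. -/
def periodicFactor (x₀ y₀ : ℝ) (T : Finset (ℂ × ℂ)) (k l u v n : ℕ) : ℂ :=
  ∑ z ∈ T, (z.1 / (x₀ : ℂ)) ^ ((u : ℤ) - (k : ℤ)) * (z.2 / (y₀ : ℂ)) ^ ((v : ℤ) - (l : ℤ)) *
    (M.stepPoly z.1 z.2 / (M.stepPoly x₀ y₀ : ℂ)) ^ n

/-- The value at `(k, l, u, v)` of a polynomial in four variables. -/
def evalAt (P : MvPolynomial (Fin 4) ℝ) (k l u v : ℕ) : ℝ :=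
  MvPolynomial.eval ![(k : ℝ), (l : ℝ), (u : ℝ), (v : ℝ)] P

/-- The polynomials `w 1, w 2, …` are the coefficients in the full asymptotic expansion of the
number of walks with exponent `c`: for all `m` and all fixed `(u, v)` and `(k, l)`, as `n → ∞`,
`q((u,v),(k,l);n) = γ^n / n^c * (∑_(1 ≤ p < m) w_p(k,l,u,v) (∑_i α_i^(u-k) β_i^(v-l) ζ_i^n) / n^p
+ O(1 / n^m))`, where `γ = S(x₀, y₀)`. -/
def IsExpansion (x₀ y₀ : ℝ) (T : Finset (ℂ × ℂ)) (c : ℕ)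
    (w : ℕ → MvPolynomial (Fin 4) ℝ) : Prop :=
  ∀ m k l u v : ℕ,
    (fun n : ℕ => (M.walkCount u v n ((k : ℤ), (l : ℤ)) : ℂ) -
      (M.stepPoly x₀ y₀ : ℂ) ^ n / (n : ℂ) ^ c *
        ∑ p ∈ Finset.Ico 1 m,
          (evalAt (w p) k l u v : ℂ) * M.periodicFactor x₀ y₀ T k l u v n / (n : ℂ) ^ p)
    =O[atTop] fun n : ℕ => M.stepPoly x₀ y₀ ^ n / (n : ℝ) ^ c * (1 / (n : ℝ) ^ m)

/-- The pairs `(i, j)` with `1 ≤ i, j ≤ p` and `i + j ≤ p + 1`. -/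
def indexSet (p : ℕ) : Finset (ℕ × ℕ) :=
  (Finset.Icc 1 p ×ˢ Finset.Icc 1 p).filter fun ij => ij.1 + ij.2 ≤ p + 1

end StepModel

end

open Filter Asymptotics

noncomputable section

namespace OrbitSum

/-! ### Laurent polynomials in two variables -/

/-- Complex Laurent polynomials in two variables. -/
abbrev Laur : Type := AddMonoidAlgebra ℂ (ℤ × ℤ)

/-- The monomial `x ^ z.1 * y ^ z.2`. -/
def mon (z : ℤ × ℤ) : Laur := AddMonoidAlgebra.single z 1

lemma mon_zero : mon 0 = 1 := rfl

lemma mon_add (z w : ℤ × ℤ) : mon (z + w) = mon z * mon w := by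
  simp [mon, AddMonoidAlgebra.single_mul_single]

lemma mon_mul_mon_neg (z : ℤ × ℤ) : mon z * mon (-z) = 1 := by
  rw [← mon_add, add_neg_cancel, mon_zero]

lemma smul_mon (c : ℂ) (z : ℤ × ℤ) : c • mon z = AddMonoidAlgebra.single z c := by
  simp [mon]

lemma mon_pow (z : ℤ × ℤ) (n : ℕ) : mon z ^ n = mon (n • z) := by
  simp [mon, AddMonoidAlgebra.single_pow]

lemma isUnit_mon (z : ℤ × ℤ) : IsUnit (mon z) :=
  IsUnit.of_mul_eq_one _ (mon_mul_mon_neg z)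

theorem laur_induction {P : Laur → Prop} (f : Laur) (hmon : ∀ z, P (mon z))
    (hadd : ∀ f g, P f → P g → P (f + g)) (hsmul : ∀ (c : ℂ) f, P f → P (c • f)) : P f := by
  refine AddMonoidAlgebra.induction_linear f ?_ (fun f g => hadd f g) fun z c => ?_
  · simpa using hsmul 0 _ (hmon 0)
  · rw [← smul_mon]
    exact hsmul _ _ (hmon z)

/-- Evaluation of Laurent polynomials at a pair of units of a commutative algebra. -/
def liftUnits {B : Type*} [CommRing B] [Algebra ℂ B] (a b : Bˣ) : Laur →ₐ[ℂ] B :=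
  AddMonoidAlgebra.lift ℂ B (ℤ × ℤ)
    { toFun := fun z => ((a ^ z.toAdd.1 * b ^ z.toAdd.2 : Bˣ) : B)
      map_one' := by simp
      map_mul' := fun z w => by
        rw [← Units.val_mul]
        congr 1
        simp only [toAdd_mul, Prod.fst_add, Prod.snd_add, zpow_add]
        exact mul_mul_mul_comm _ _ _ _ }

lemma liftUnits_mon {B : Type*} [CommRing B] [Algebra ℂ B] (a b : Bˣ) (z : ℤ × ℤ) :
    liftUnits a b (mon z) = ((a ^ z.1 * b ^ z.2 : Bˣ) : B) := by
  simp [liftUnits, mon]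

theorem laur_algHom_ext {B : Type*} [Semiring B] [Algebra ℂ B] {f g : Laur →ₐ[ℂ] B}
    (h : ∀ z, f (mon z) = g (mon z)) : f = g := by
  refine AlgHom.ext fun F => ?_
  induction F using laur_induction with
  | hmon z => exact h z
  | hadd F G hF hG => rw [map_add, map_add, hF, hG]
  | hsmul c F hF => rw [map_smul, map_smul, hF]

/-- The constant term of a Laurent polynomial. -/
def ct : Laur →ₗ[ℂ] ℂ :=
  Finsupp.lapply 0 ∘ₗ (AddMonoidAlgebra.coeffLinearEquiv ℂ).toLinearMap

lemma ct_mon (z : ℤ × ℤ) : ct (mon z) = if z = 0 then 1 else 0 := by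
  simp [ct, mon, AddMonoidAlgebra.coeffLinearEquiv, Finsupp.single_apply]

lemma ct_mon_mul (z : ℤ × ℤ) (f : Laur) : ct (mon (-z) * f) = f.coeff z := by
  simp [ct, AddMonoidAlgebra.coeffLinearEquiv, mon]

/-- The derivation multiplying the monomial of exponent `z` with `φ z`. -/
def theta (φ : ℤ × ℤ →+ ℂ) : Derivation ℂ Laur Laur :=
  Derivation.mk'
    ((Finsupp.linearCombination ℂ fun z => φ z • mon z) ∘ₗ
      (AddMonoidAlgebra.coeffLinearEquiv ℂ).toLinearMap) (by
    have key : ∀ z, ((Finsupp.linearCombination ℂ fun z => φ z • mon z) ∘ₗ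
      (AddMonoidAlgebra.coeffLinearEquiv ℂ).toLinearMap) (mon z) = φ z • mon z := by
      intro z
      simp [mon, AddMonoidAlgebra.coeffLinearEquiv]
    generalize (Finsupp.linearCombination ℂ fun z => φ z • mon z) ∘ₗ
      (AddMonoidAlgebra.coeffLinearEquiv ℂ).toLinearMap = L at key
    intro f g
    induction f using laur_induction with
    | hmon z =>
      induction g using laur_induction with
      | hmon w =>
        rw [← mon_add, key, key, key, map_add, mon_add, smul_eq_mul, smul_eq_mul,
          mul_smul_comm, mul_smul_comm, mul_comm (mon w), add_smul, add_comm]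
      | hadd g₁ g₂ h₁ h₂ =>
        simp only [mul_add, map_add, h₁, h₂, smul_eq_mul, add_mul]
        ring
      | hsmul c g h =>
        simp only [mul_smul_comm, map_smul, h, smul_eq_mul, smul_mul_assoc, smul_add]
    | hadd f₁ f₂ h₁ h₂ =>
      simp only [add_mul, map_add, h₁, h₂, smul_eq_mul, mul_add]
      ring
    | hsmul c f h =>
      simp only [smul_mul_assoc, map_smul, h, smul_eq_mul, mul_smul_comm, smul_add])

lemma theta_mon (φ : ℤ × ℤ →+ ℂ) (z : ℤ × ℤ) : theta φ (mon z) = φ z • mon z := by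
  simp [theta, mon, AddMonoidAlgebra.coeffLinearEquiv]

lemma ct_theta (φ : ℤ × ℤ →+ ℂ) (f : Laur) : ct (theta φ f) = 0 := by
  induction f using laur_induction with
  | hmon z =>
    rw [theta_mon, map_smul, ct_mon]
    split_ifs with h <;> simp [h]
  | hadd f g hf hg => rw [map_add, map_add, hf, hg, add_zero]
  | hsmul c f hf => rw [Derivation.map_smul, map_smul, hf, smul_zero]

lemma theta_comm (φ χ : ℤ × ℤ →+ ℂ) (f : Laur) :
    theta φ (theta χ f) = theta χ (theta φ f) := by
  induction f using laur_induction with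
  | hmon z => simp only [theta_mon, Derivation.map_smul, smul_comm (χ z)]
  | hadd f g hf hg => simp only [map_add, hf, hg]
  | hsmul c f hf => simp only [Derivation.map_smul, hf]

/-- The homomorphism `z ↦ z.1`. -/
def fstHom : ℤ × ℤ →+ ℂ := (Int.castAddHom ℂ).comp (AddMonoidHom.fst ℤ ℤ)

/-- The homomorphism `z ↦ z.2`. -/
def sndHom : ℤ × ℤ →+ ℂ := (Int.castAddHom ℂ).comp (AddMonoidHom.snd ℤ ℤ)

@[simp] lemma fstHom_apply (z : ℤ × ℤ) : fstHom z = z.1 := rfl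

@[simp] lemma sndHom_apply (z : ℤ × ℤ) : sndHom z = z.2 := rfl

/-! ### Evaluation on the torus -/

/-- The two-dimensional torus. -/
abbrev Tor : Type := Circle × Circle

/-- Evaluation of a Laurent polynomial at a point of the torus. -/
def ev (p : Tor) : Laur →ₐ[ℂ] ℂ := liftUnits (Circle.toUnits p.1) (Circle.toUnits p.2)

/-- The character of the lattice given by a point of the torus. -/
def chr (p : Tor) (z : ℤ × ℤ) : Circle := p.1 ^ z.1 * p.2 ^ z.2

lemma ev_mon (p : Tor) (z : ℤ × ℤ) : ev p (mon z) = chr p z := by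
  simp [ev, liftUnits_mon, chr]

lemma chr_add (p : Tor) (z w : ℤ × ℤ) : chr p (z + w) = chr p z * chr p w := by
  simp only [chr, Prod.fst_add, Prod.snd_add, zpow_add]
  exact mul_mul_mul_comm _ _ _ _

lemma chr_mul (p q : Tor) (z : ℤ × ℤ) : chr (p * q) z = chr p z * chr q z := by
  simp only [chr, Prod.fst_mul, Prod.snd_mul, mul_zpow]
  exact mul_mul_mul_comm _ _ _ _

@[simp] lemma chr_one (z : ℤ × ℤ) : chr 1 z = 1 := by simp [chr]

@[simp] lemma chr_zero (p : Tor) : chr p 0 = 1 := by simp [chr]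

lemma chr_inv (p : Tor) (z : ℤ × ℤ) : chr p⁻¹ z = (chr p z)⁻¹ := by
  simp [chr, mul_comm]

/-- The substitution `x ↦ z₁ x`, `y ↦ z₂ y`. -/
def scale (z : Tor) : Laur →ₐ[ℂ] Laur :=
  AddMonoidAlgebra.lift ℂ Laur (ℤ × ℤ)
    { toFun := fun w => (chr z w.toAdd : ℂ) • mon w.toAdd
      map_one' := by simp [mon_zero]
      map_mul' := fun w v => by
        simp only [toAdd_mul, chr_add, mon_add, Circle.coe_mul]
        rw [smul_mul_smul_comm] }

lemma scale_mon (z : Tor) (w : ℤ × ℤ) : scale z (mon w) = (chr z w : ℂ) • mon w := by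
  simp [scale, mon]

lemma ev_scale (z p : Tor) (f : Laur) : ev p (scale z f) = ev (z * p) f := by
  have : (ev p).comp (scale z) = ev (z * p) := by
    refine laur_algHom_ext fun w => ?_
    simp [scale_mon, ev_mon, chr_mul]
  exact congrArg (fun F : Laur →ₐ[ℂ] ℂ => F f) this

lemma scale_scale (z w : Tor) (f : Laur) : scale z (scale w f) = scale (z * w) f := by
  have : (scale z).comp (scale w) = scale (z * w) := by
    refine laur_algHom_ext fun v => ?_
    simp [scale_mon, chr_mul, smul_smul, mul_comm]
  exact congrArg (fun F : Laur →ₐ[ℂ] Laur => F f) this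

lemma ct_scale (z : Tor) (f : Laur) : ct (scale z f) = ct f := by
  induction f using laur_induction with
  | hmon w =>
    rw [scale_mon, map_smul, ct_mon]
    split_ifs with h <;> simp [h]
  | hadd f g hf hg => simp only [map_add, hf, hg]
  | hsmul c f hf => simp only [map_smul, hf]

lemma laur_eq_sum (f : Laur) : f = ∑ z ∈ f.coeff.support, f.coeff z • mon z := by
  conv_lhs => rw [← AddMonoidAlgebra.sum_coeff_single f]
  simp only [Finsupp.sum, smul_mon]

lemma continuous_ev (f : Laur) : Continuous fun p : Tor => ev p f := by
  induction f using laur_induction with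
  | hmon z =>
    simp only [ev_mon, chr, Circle.coe_mul]
    have h1 : Continuous fun p : Tor => p.1 ^ z.1 := continuous_fst.zpow z.1
    have h2 : Continuous fun p : Tor => p.2 ^ z.2 := continuous_snd.zpow z.2
    have h : Continuous ((↑) : Circle → ℂ) := continuous_subtype_val
    exact (h.comp h1).mul (h.comp h2)
  | hadd f g hf hg =>
    simp only [map_add]
    exact hf.add hg
  | hsmul c f hf =>
    simp only [map_smul]
    exact hf.const_smul c

lemma exists_norm_ev_le (f : Laur) : ∃ C, 0 ≤ C ∧ ∀ p : Tor, ‖ev p f‖ ≤ C := by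
  obtain ⟨C, hC⟩ := (isCompact_range (continuous_ev f)).isBounded.exists_norm_le
  exact ⟨C, (norm_nonneg _).trans (hC _ ⟨1, rfl⟩), fun p => hC _ ⟨p, rfl⟩⟩

lemma sum_circle_pow_zpow {N : ℕ} {ζ : Circle} (hζ : IsPrimitiveRoot ζ N) {j : ℤ}
    (hj : |j| < N) : ∑ a ∈ Finset.range N, (((ζ ^ a) ^ j : Circle) : ℂ) =
      if j = 0 then (N : ℂ) else 0 := by
  have h : ∀ a : ℕ, (((ζ ^ a) ^ j : Circle) : ℂ) = ((ζ ^ j : Circle) : ℂ) ^ a := by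
    intro a
    rw [← Circle.coe_pow, ← zpow_natCast, ← zpow_natCast, zpow_comm]
  simp only [h]
  split_ifs with h0
  · simp [h0]
  · have h1 : ((ζ ^ j : Circle) : ℂ) ≠ 1 := by
      intro h1
      have h2 : ζ ^ j = 1 := Circle.ext (by rw [h1, Circle.coe_one])
      rw [hζ.zpow_eq_one_iff_dvd] at h2
      exact h0 (Int.eq_zero_of_abs_lt_dvd h2 hj)
    rw [geom_sum_eq h1]
    have h2 : ((ζ ^ j : Circle) : ℂ) ^ N = 1 := by
      rw [← Circle.coe_pow, ← zpow_natCast, zpow_comm, zpow_natCast, hζ.pow_eq_one]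
      simp
    rw [h2]
    simp

/-- The constant term is bounded by the supremum on the torus. -/
theorem norm_ct_le {f : Laur} {B : ℝ} (hB : ∀ p : Tor, ‖ev p f‖ ≤ B) : ‖ct f‖ ≤ B := by
  obtain ⟨N, hN0, hN⟩ : ∃ N : ℕ, 0 < N ∧ ∀ z ∈ f.coeff.support, |z.1| < N ∧ |z.2| < N := by
    refine ⟨1 + ∑ z ∈ f.coeff.support, (z.1.natAbs + z.2.natAbs), by omega, fun z hz => ?_⟩
    have := Finset.single_le_sum (f := fun z : ℤ × ℤ => z.1.natAbs + z.2.natAbs)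
      (fun _ _ => Nat.zero_le _) hz
    rw [Int.abs_eq_natAbs, Int.abs_eq_natAbs]
    constructor <;> omega
  obtain ⟨ζ, hζ⟩ : ∃ ζ : Circle, IsPrimitiveRoot ζ N := by
    refine ⟨Circle.exp (2 * Real.pi / N), ?_⟩
    have := Complex.isPrimitiveRoot_exp N hN0.ne'
    have h2 : ((Circle.exp (2 * Real.pi / N) : Circle) : ℂ) =
        Complex.exp (2 * Real.pi * Complex.I / N) := by
      rw [Circle.coe_exp]
      congr 1
      push_cast
      ring
    rw [← h2] at this
    exact this.of_map_of_injective (f := Circle.coeHom) Circle.coe_injective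
  have key : (N : ℂ) ^ 2 * ct f =
      ∑ a ∈ Finset.range N, ∑ b ∈ Finset.range N, ev (ζ ^ a, ζ ^ b) f := by
    conv_rhs =>
      enter [2, a, 2, b]
      rw [laur_eq_sum f]
    conv_lhs => rw [laur_eq_sum f]
    simp only [map_sum, map_smul, ev_mon, ct_mon, smul_eq_mul]
    rw [Finset.mul_sum]
    have : ∀ a ∈ Finset.range N, ∑ b ∈ Finset.range N, ∑ z ∈ f.coeff.support,
        f.coeff z * (chr (ζ ^ a, ζ ^ b) z : ℂ) = ∑ z ∈ f.coeff.support, ∑ b ∈ Finset.range N,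
        f.coeff z * (chr (ζ ^ a, ζ ^ b) z : ℂ) := fun a _ => Finset.sum_comm
    rw [Finset.sum_congr rfl this, Finset.sum_comm]
    refine Finset.sum_congr rfl fun z hz => ?_
    have e : ∑ a ∈ Finset.range N, ∑ b ∈ Finset.range N, f.coeff z * (chr (ζ ^ a, ζ ^ b) z : ℂ) =
        f.coeff z * ((∑ a ∈ Finset.range N, (((ζ ^ a) ^ z.1 : Circle) : ℂ)) *
          ∑ b ∈ Finset.range N, (((ζ ^ b) ^ z.2 : Circle) : ℂ)) := by
      rw [Finset.sum_mul_sum, Finset.mul_sum]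
      refine Finset.sum_congr rfl fun a _ => ?_
      rw [Finset.mul_sum]
      simp [chr]
    rw [e, sum_circle_pow_zpow hζ (hN z hz).1, sum_circle_pow_zpow hζ (hN z hz).2]
    by_cases h1 : z.1 = 0 <;> by_cases h2 : z.2 = 0 <;> simp [h1, h2, Prod.ext_iff]
    ring
  have hNpos : (0 : ℝ) < (N : ℝ) ^ 2 := by positivity
  have h3 : (N : ℝ) ^ 2 * ‖ct f‖ ≤ (N : ℝ) ^ 2 * B := by
    have : ‖(N : ℂ) ^ 2 * ct f‖ = (N : ℝ) ^ 2 * ‖ct f‖ := by simp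
    rw [← this, key]
    refine (norm_sum_le_of_le _ fun a _ => norm_sum_le_of_le _ fun b _ => hB _).trans ?_
    simp only [Finset.sum_const, Finset.card_range, nsmul_eq_mul]
    exact le_of_eq (by ring)
  exact le_of_mul_le_mul_left h3 hNpos

end OrbitSum

noncomputable section

namespace OrbitSum

/-! ### The step polynomial on the torus -/

variable (M : StepModel)

/-- The total weight `S(1, 1)` of the steps. -/
def gam : ℝ := ∑ s ∈ smallBox, M.weight s

/-- The step polynomial as a Laurent polynomial. -/
def lau : Laur := ∑ s ∈ smallBox, (M.weight s : ℂ) • mon s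

/-- The step polynomial, normalised to have the value `1` at `(1, 1)`. -/
def nor : Laur := ((gam M : ℂ)⁻¹) • lau M

lemma exists_step : ∃ s, M.weight s ≠ 0 := by
  obtain ⟨s, hs, _⟩ := M.nondegenerate 1 0 (by simp)
  exact ⟨s, hs⟩

lemma weight_pos {s : ℤ × ℤ} (hs : M.weight s ≠ 0) : 0 < M.weight s :=
  lt_of_le_of_ne (M.weight_nonneg s) hs.symm

lemma gam_pos : 0 < gam M := by
  obtain ⟨s, hs⟩ := exists_step M
  exact Finset.sum_pos' (fun s _ => M.weight_nonneg s) ⟨s, M.small s hs, weight_pos M hs⟩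

lemma gam_ne_zero : (gam M : ℂ) ≠ 0 := by exact_mod_cast (gam_pos M).ne'

lemma gam_smul_nor : (gam M : ℂ) • nor M = lau M := by
  rw [nor, smul_smul, mul_inv_cancel₀ (gam_ne_zero M), one_smul]

lemma ev_lau (p : Tor) : ev p (lau M) = ∑ s ∈ smallBox, (M.weight s : ℂ) * (chr p s : ℂ) := by
  rw [lau, map_sum]
  simp only [map_smul, ev_mon, smul_eq_mul]

lemma ev_one_nor : ev 1 (nor M) = 1 := by
  rw [nor, map_smul, ev_lau, smul_eq_mul, inv_mul_eq_one₀ (gam_ne_zero M)]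
  simp [gam]

lemma norm_chr (p : Tor) (z : ℤ × ℤ) : ‖(chr p z : ℂ)‖ = 1 := Circle.norm_coe _

lemma norm_chr_sub_sq (p : Tor) (s s' : ℤ × ℤ) : ‖(chr p s : ℂ) - chr p s'‖ ^ 2 =
    2 - 2 * ((chr p s : ℂ) * (starRingEnd ℂ) (chr p s')).re := by
  have h := Complex.sq_norm_sub_sq_re ((chr p s : ℂ) * (starRingEnd ℂ) (chr p s'))
  rw [← Complex.normSq_eq_norm_sq, Complex.normSq_sub, Complex.normSq_eq_norm_sq,
    Complex.normSq_eq_norm_sq, norm_chr, norm_chr]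
  norm_num

lemma gam_sq_sub_norm_sq (p : Tor) : gam M ^ 2 - ‖ev p (lau M)‖ ^ 2 =
    (∑ s ∈ smallBox, ∑ s' ∈ smallBox,
      M.weight s * M.weight s' * ‖(chr p s : ℂ) - chr p s'‖ ^ 2) / 2 := by
  have h : ‖ev p (lau M)‖ ^ 2 = ∑ s ∈ smallBox, ∑ s' ∈ smallBox,
      M.weight s * M.weight s' * ((chr p s : ℂ) * (starRingEnd ℂ) (chr p s')).re := by
    have h1 : ‖ev p (lau M)‖ ^ 2 = (ev p (lau M) * (starRingEnd ℂ) (ev p (lau M))).re := by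
      rw [Complex.mul_conj, Complex.ofReal_re, Complex.normSq_eq_norm_sq]
    rw [h1, ev_lau, map_sum, Finset.sum_mul_sum, Complex.re_sum]
    refine Finset.sum_congr rfl fun s _ => ?_
    rw [Complex.re_sum]
    refine Finset.sum_congr rfl fun s' _ => ?_
    rw [map_mul, Complex.conj_ofReal, mul_mul_mul_comm, ← Complex.ofReal_mul,
      Complex.re_ofReal_mul]
  rw [h, gam, sq, Finset.sum_mul_sum, eq_div_iff two_ne_zero, sub_mul, Finset.sum_mul,
    Finset.sum_mul, ← Finset.sum_sub_distrib]
  refine Finset.sum_congr rfl fun s _ => ?_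
  rw [Finset.sum_mul, Finset.sum_mul, ← Finset.sum_sub_distrib]
  refine Finset.sum_congr rfl fun s' _ => ?_
  rw [norm_chr_sub_sq]
  ring

/-- `1 - |S(p)| ^ 2 / S(1, 1) ^ 2`. -/
def gapSq (p : Tor) : ℝ := 1 - ‖ev p (nor M)‖ ^ 2

lemma gapSq_eq (p : Tor) : gam M ^ 2 * gapSq M p = gam M ^ 2 - ‖ev p (lau M)‖ ^ 2 := by
  rw [gapSq, ← gam_smul_nor M, map_smul, norm_smul, Complex.norm_real, Real.norm_eq_abs, mul_pow,
    sq_abs]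
  ring

lemma gapSq_nonneg (p : Tor) : 0 ≤ gapSq M p := by
  have h : 0 ≤ gam M ^ 2 * gapSq M p := by
    rw [gapSq_eq, gam_sq_sub_norm_sq]
    exact div_nonneg (Finset.sum_nonneg fun s _ => Finset.sum_nonneg fun s' _ =>
      mul_nonneg (mul_nonneg (M.weight_nonneg s) (M.weight_nonneg s')) (sq_nonneg _)) zero_le_two
  have := gam_pos M
  exact nonneg_of_mul_nonneg_right h (by positivity)

/-- The square root of `1 - |S(p)| ^ 2 / S(1, 1) ^ 2`. -/
def gap (p : Tor) : ℝ := √(gapSq M p)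

lemma gap_nonneg (p : Tor) : 0 ≤ gap M p := Real.sqrt_nonneg _

lemma gap_sq (p : Tor) : gap M p ^ 2 = gapSq M p := Real.sq_sqrt (gapSq_nonneg M p)

lemma norm_chr_sub_le_step {s s' : ℤ × ℤ} (hs : M.weight s ≠ 0) (hs' : M.weight s' ≠ 0) :
    ∃ C, 0 ≤ C ∧ ∀ p, ‖(chr p s : ℂ) - chr p s'‖ ≤ C * gap M p := by
  have h1 := weight_pos M hs
  have h2 := weight_pos M hs'
  have hg := gam_pos M
  refine ⟨√(2 * gam M ^ 2 / (M.weight s * M.weight s')), Real.sqrt_nonneg _, fun p => ?_⟩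
  refine le_of_sq_le_sq ?_ (mul_nonneg (Real.sqrt_nonneg _) (gap_nonneg M p))
  rw [mul_pow, gap_sq, Real.sq_sqrt (by positivity), div_mul_eq_mul_div, le_div_iff₀ (by positivity),
    mul_assoc, gapSq_eq, gam_sq_sub_norm_sq, mul_div_cancel₀ _ two_ne_zero, mul_comm]
  refine le_trans ?_ (Finset.single_le_sum (f := fun s => ∑ s' ∈ smallBox,
      M.weight s * M.weight s' * ‖(chr p s : ℂ) - chr p s'‖ ^ 2) (fun s _ =>
      Finset.sum_nonneg fun s' _ =>
      mul_nonneg (mul_nonneg (M.weight_nonneg s) (M.weight_nonneg s')) (sq_nonneg _))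
      (M.small s hs))
  exact Finset.single_le_sum (f := fun s' =>
      M.weight s * M.weight s' * ‖(chr p s : ℂ) - chr p s'‖ ^ 2) (fun s' _ =>
      mul_nonneg (mul_nonneg (M.weight_nonneg s) (M.weight_nonneg s')) (sq_nonneg _))
      (M.small s' hs')

/-! ### The periods -/

/-- The points of the torus at which the step polynomial has maximal modulus. -/
def per : Subgroup Tor where
  carrier := {z | ∀ s s', M.weight s ≠ 0 → M.weight s' ≠ 0 → chr z s = chr z s'}
  mul_mem' := fun ha hb s s' hs hs' => by rw [chr_mul, chr_mul, ha s s' hs hs', hb s s' hs hs']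
  one_mem' := fun s s' _ _ => by simp
  inv_mem' := fun ha s s' hs hs' => by rw [chr_inv, chr_inv, ha s s' hs hs']

lemma mem_per_iff_gap {z : Tor} : z ∈ per M ↔ gap M z = 0 := by
  constructor
  · intro hz
    rw [gap, Real.sqrt_eq_zero (gapSq_nonneg M z)]
    have h : gam M ^ 2 * gapSq M z = 0 := by
      rw [gapSq_eq, gam_sq_sub_norm_sq, div_eq_zero_iff]
      refine Or.inl (Finset.sum_eq_zero fun s _ => Finset.sum_eq_zero fun s' _ => ?_)
      by_cases hs : M.weight s = 0
      · simp [hs]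
      by_cases hs' : M.weight s' = 0
      · simp [hs']
      rw [hz s s' hs hs']
      simp
    exact (mul_eq_zero.1 h).resolve_left (pow_ne_zero _ (gam_pos M).ne')
  · intro h s s' hs hs'
    obtain ⟨C, _, hC⟩ := norm_chr_sub_le_step M hs hs'
    have := hC z
    rw [h, mul_zero, norm_le_zero_iff, sub_eq_zero] at this
    exact Circle.ext this

/-- The common value of the characters of a period at the steps. -/
def zet (z : Tor) : ℂ := ev z (nor M)

lemma zet_eq_chr {z : Tor} (hz : z ∈ per M) {s : ℤ × ℤ} (hs : M.weight s ≠ 0) :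
    zet M z = chr z s := by
  rw [zet, nor, map_smul, ev_lau, smul_eq_mul, inv_mul_eq_iff_eq_mul₀ (gam_ne_zero M), gam,
    Complex.ofReal_sum, Finset.sum_mul]
  refine Finset.sum_congr rfl fun s' _ => ?_
  by_cases hs' : M.weight s' = 0
  · simp [hs']
  rw [hz s s' hs hs']

lemma norm_zet {z : Tor} (hz : z ∈ per M) : ‖zet M z‖ = 1 := by
  obtain ⟨s, hs⟩ := exists_step M
  rw [zet_eq_chr M hz hs, norm_chr]

lemma scale_lau {z : Tor} (hz : z ∈ per M) : scale z (lau M) = zet M z • lau M := by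
  rw [lau, map_sum, Finset.smul_sum]
  refine Finset.sum_congr rfl fun s _ => ?_
  by_cases hs : M.weight s = 0
  · simp [hs]
  rw [map_smul, scale_mon, zet_eq_chr M hz hs, smul_comm]

lemma scale_nor {z : Tor} (hz : z ∈ per M) : scale z (nor M) = zet M z • nor M := by
  rw [nor, map_smul, scale_lau M hz, smul_comm]

lemma chr_zsmul (p : Tor) (k : ℤ) (z : ℤ × ℤ) : chr p (k • z) = chr p z ^ k := by
  simp [chr, mul_zpow, ← zpow_mul, mul_comm k]

lemma circle_norm_mul_sub (a b c : Circle) : ‖((a * b : Circle) : ℂ) - (a * c : Circle)‖ =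
    ‖(b : ℂ) - c‖ := by
  rw [Circle.coe_mul, Circle.coe_mul, ← mul_sub, norm_mul, Circle.norm_coe, one_mul]

lemma circle_pow_sub_le (a b : Circle) (k : ℕ) :
    ‖((a ^ k : Circle) : ℂ) - (b ^ k : Circle)‖ ≤ k * ‖(a : ℂ) - b‖ := by
  induction k with
  | zero => simp
  | succ k ih =>
    have : ((a ^ (k + 1) : Circle) : ℂ) - (b ^ (k + 1) : Circle) =
        a * (((a ^ k : Circle) : ℂ) - (b ^ k : Circle)) + (a - b) * (b ^ k : Circle) := by
      push_cast
      ring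
    rw [this]
    refine (norm_add_le _ _).trans ?_
    rw [norm_mul, norm_mul, Circle.norm_coe, Circle.norm_coe]
    rw [Nat.cast_succ]
    linarith

lemma circle_zpow_sub_le (a b : Circle) (k : ℤ) :
    ‖((a ^ k : Circle) : ℂ) - (b ^ k : Circle)‖ ≤ k.natAbs * ‖(a : ℂ) - b‖ := by
  obtain ⟨n, rfl | rfl⟩ := k.eq_nat_or_neg
  · simpa using circle_pow_sub_le a b n
  · have h := circle_pow_sub_le b a n
    rw [← circle_norm_mul_sub (a ^ n * b ^ n)]
    rw [norm_sub_rev (b : ℂ)] at h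
    simpa [mul_comm, mul_assoc] using h

lemma circle_zpow_sub_one_le (a : Circle) (k : ℤ) :
    ‖((a ^ k : Circle) : ℂ) - 1‖ ≤ k.natAbs * ‖(a : ℂ) - 1‖ := by
  simpa using circle_zpow_sub_le a 1 k

lemma exists_pow_sub_one_le : ∃ m : ℕ, 0 < m ∧ ∃ C, 0 ≤ C ∧ ∀ p : Tor,
    ‖((p.1 ^ m : Circle) : ℂ) - 1‖ ≤ C * gap M p ∧
    ‖((p.2 ^ m : Circle) : ℂ) - 1‖ ≤ C * gap M p := by
  obtain ⟨s, s', s'', hs, hs', hs'', hdet⟩ : ∃ s s' s'' : ℤ × ℤ, M.weight s ≠ 0 ∧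
      M.weight s' ≠ 0 ∧ M.weight s'' ≠ 0 ∧
      (s' - s).1 * (s'' - s).2 - (s' - s).2 * (s'' - s).1 ≠ 0 := by
    obtain ⟨s, hs, h1⟩ := M.nondegenerate 1 0 (by simp)
    obtain ⟨s', hs', h2⟩ := M.nondegenerate (-1) 0 (by simp)
    have h3 : (s' - s).1 ≠ 0 := by
      intro h
      have : (s'.1 : ℝ) = s.1 := by
        have : s'.1 = s.1 := by simpa [sub_eq_zero] using h
        exact_mod_cast this
      linarith
    set d := s' - s with hd
    have h4 : ((d.2 : ℝ), -(d.1 : ℝ)) ≠ (0, 0) := by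
      simp only [ne_eq, Prod.mk.injEq, neg_eq_zero, Int.cast_eq_zero, not_and]
      exact fun _ => h3
    obtain ⟨t, ht, h5⟩ := M.nondegenerate _ _ h4
    obtain ⟨t', ht', h6⟩ := M.nondegenerate (-(d.2 : ℝ)) (d.1 : ℝ) (by
      simpa using fun _ => h3)
    by_contra! hcon
    have e1 := hcon s s' t hs hs' ht
    have e2 := hcon s s' t' hs hs' ht'
    rw [← hd] at e1 e2
    simp only [Prod.fst_sub, Prod.snd_sub] at e1 e2
    have e1' : (d.1 : ℝ) * (t.2 - s.2) - d.2 * (t.1 - s.1) = 0 := by exact_mod_cast e1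
    have e2' : (d.1 : ℝ) * (t'.2 - s.2) - d.2 * (t'.1 - s.1) = 0 := by exact_mod_cast e2
    linarith
  set d := s' - s
  set e := s'' - s
  set D := d.1 * e.2 - d.2 * e.1 with hD
  obtain ⟨C₁, hC₁, h₁⟩ := norm_chr_sub_le_step M hs' hs
  obtain ⟨C₂, hC₂, h₂⟩ := norm_chr_sub_le_step M hs'' hs
  have hd : ∀ p, ‖(chr p d : ℂ) - 1‖ ≤ C₁ * gap M p := fun p => by
    refine le_of_eq_of_le ?_ (h₁ p)
    have := circle_norm_mul_sub (chr p s) (chr p d) 1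
    rwa [← chr_add, mul_one, add_sub_cancel, Circle.coe_one, eq_comm] at this
  have he : ∀ p, ‖(chr p e : ℂ) - 1‖ ≤ C₂ * gap M p := fun p => by
    refine le_of_eq_of_le ?_ (h₂ p)
    have := circle_norm_mul_sub (chr p s) (chr p e) 1
    rwa [← chr_add, mul_one, add_sub_cancel, Circle.coe_one, eq_comm] at this
  have key : ∀ (p : Tor) (i j : ℤ), ‖(chr p (i • d + j • e) : ℂ) - 1‖ ≤
      (i.natAbs * C₁ + j.natAbs * C₂) * gap M p := by
    intro p i j
    have : (chr p (i • d + j • e) : ℂ) - 1 = (chr p d ^ i : Circle) *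
        (((chr p e ^ j : Circle) : ℂ) - 1) + (((chr p d ^ i : Circle) : ℂ) - 1) := by
      rw [chr_add, chr_zsmul, chr_zsmul, Circle.coe_mul]
      ring
    rw [this]
    refine (norm_add_le _ _).trans ?_
    rw [norm_mul, Circle.norm_coe, one_mul]
    have a1 := (circle_zpow_sub_one_le (chr p d) i).trans
      (mul_le_mul_of_nonneg_left (hd p) (Nat.cast_nonneg _))
    have a2 := (circle_zpow_sub_one_le (chr p e) j).trans
      (mul_le_mul_of_nonneg_left (he p) (Nat.cast_nonneg _))
    linarith
  have hpow : ∀ a : Circle, ‖((a ^ D.natAbs : Circle) : ℂ) - 1‖ ≤ ‖((a ^ D : Circle) : ℂ) - 1‖ := by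
    intro a
    generalize D = D
    obtain ⟨n, rfl | rfl⟩ := D.eq_nat_or_neg
    · simp
    · have := circle_norm_mul_sub (a ^ n) 1 (a ^ (-(n : ℤ)))
      rw [zpow_neg, zpow_natCast, mul_inv_cancel, mul_one, Circle.coe_one, norm_sub_rev 1] at this
      rw [Int.natAbs_neg, Int.natAbs_natCast, zpow_neg, zpow_natCast]
      exact this.le
  refine ⟨D.natAbs, Int.natAbs_pos.2 hdet, (e.2.natAbs * C₁ + d.2.natAbs * C₂) +
    (e.1.natAbs * C₁ + d.1.natAbs * C₂), by positivity,
    fun p => ⟨(hpow _).trans ?_, (hpow _).trans ?_⟩⟩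
  · have := key p e.2 (-d.2)
    have h : e.2 • d + (-d.2) • e = (D, 0) := by
      ext <;> simp [hD] <;> ring
    rw [h] at this
    simp only [chr, zpow_zero, mul_one, Int.natAbs_neg] at this
    refine this.trans (mul_le_mul_of_nonneg_right ?_ (gap_nonneg M p))
    have : 0 ≤ (e.1.natAbs * C₁ + d.1.natAbs * C₂) := by positivity
    linarith
  · have := key p (-e.1) d.1
    have h : (-e.1) • d + d.1 • e = (0, D) := by
      ext <;> simp [hD] <;> ring
    rw [h] at this
    simp only [chr, zpow_zero, one_mul, Int.natAbs_neg] at this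
    refine this.trans (mul_le_mul_of_nonneg_right ?_ (gap_nonneg M p))
    have : 0 ≤ (e.2.natAbs * C₁ + d.2.natAbs * C₂) := by positivity
    linarith

lemma exists_near_root {m : ℕ} (hm : 0 < m) (a : Circle) :
    ∃ w : Circle, w ^ m = 1 ∧ ‖(a : ℂ) - w‖ ≤ 2 * ‖((a ^ m : Circle) : ℂ) - 1‖ := by
  set t := Complex.arg (a ^ m : Circle) with ht
  set u := Circle.exp (t / m) with hu
  have hm' : (m : ℝ) ≠ 0 := by exact_mod_cast hm.ne'
  have hum : u ^ m = a ^ m := by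
    rw [hu, ← Circle.exp_nsmul, nsmul_eq_mul, mul_div_cancel₀ _ hm', ht, Circle.exp_arg]
  have h1 : ‖(u : ℂ) - 1‖ ≤ |t / m| := by
    have := Real.norm_exp_I_mul_ofReal_sub_one_le (x := t / m)
    rwa [mul_comm, ← Circle.coe_exp] at this
  have h2 : 2 / Real.pi * |t| ≤ ‖((a ^ m : Circle) : ℂ) - 1‖ := by
    have h := Complex.norm_exp_I_mul_ofReal_sub_one t
    rw [mul_comm, ← Circle.coe_exp, ht, Circle.exp_arg, ← ht, Real.norm_eq_abs, abs_mul] at h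
    have h3 : |t / 2| ≤ Real.pi / 2 := by
      rw [abs_div, abs_two]
      have := Complex.abs_arg_le_pi (a ^ m : Circle)
      linarith
    have h4 := Real.mul_abs_le_abs_sin h3
    rw [h, abs_two]
    rw [abs_div, abs_two] at h4
    linarith
  refine ⟨a / u, by rw [div_pow, hum, div_self'], ?_⟩
  have h3 : ‖(a : ℂ) - (a / u : Circle)‖ = ‖(u : ℂ) - 1‖ := by
    have := circle_norm_mul_sub (a / u) u 1
    rwa [div_mul_cancel, mul_one] at this
  rw [h3]
  refine h1.trans ?_
  have h4 : |t / m| ≤ |t| := by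
    rw [abs_div, Nat.abs_cast]
    exact div_le_self (abs_nonneg _) (by exact_mod_cast hm)
  have h5 : |t| ≤ 2 * (2 / Real.pi * |t|) := by
    have := Real.pi_lt_four
    have hp := Real.pi_pos
    rw [← mul_assoc, ← mul_div_assoc]
    refine le_mul_of_one_le_left (abs_nonneg _) ?_
    rw [le_div_iff₀ hp]
    linarith
  linarith

/-- The `ℓ¹` distance on the torus. -/
def dst (p q : Tor) : ℝ := ‖(p.1 : ℂ) - q.1‖ + ‖(p.2 : ℂ) - q.2‖

lemma dst_nonneg (p q : Tor) : 0 ≤ dst p q := by unfold dst; positivity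

lemma dst_le_four (p q : Tor) : dst p q ≤ 4 := by
  have h1 := norm_sub_le (p.1 : ℂ) q.1
  have h2 := norm_sub_le (p.2 : ℂ) q.2
  simp only [Circle.norm_coe] at h1 h2
  unfold dst
  linarith

lemma exists_lipschitz (f : Laur) : ∃ C, 0 ≤ C ∧ ∀ p q, ‖ev p f - ev q f‖ ≤ C * dst p q := by
  induction f using laur_induction with
  | hmon z =>
    refine ⟨z.1.natAbs + z.2.natAbs, by positivity, fun p q => ?_⟩
    rw [ev_mon, ev_mon, chr, chr]
    have : ((p.1 ^ z.1 * p.2 ^ z.2 : Circle) : ℂ) - (q.1 ^ z.1 * q.2 ^ z.2 : Circle) =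
        (p.1 ^ z.1 : Circle) * (((p.2 ^ z.2 : Circle) : ℂ) - (q.2 ^ z.2 : Circle)) +
        (((p.1 ^ z.1 : Circle) : ℂ) - (q.1 ^ z.1 : Circle)) * (q.2 ^ z.2 : Circle) := by
      push_cast
      ring
    rw [this]
    refine (norm_add_le _ _).trans ?_
    rw [norm_mul, norm_mul, Circle.norm_coe, Circle.norm_coe, one_mul, mul_one, dst]
    have h1 := circle_zpow_sub_le p.1 q.1 z.1
    have h2 := circle_zpow_sub_le p.2 q.2 z.2
    have h3 : 0 ≤ (z.1.natAbs : ℝ) * ‖(p.2 : ℂ) - q.2‖ := by positivity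
    have h4 : 0 ≤ (z.2.natAbs : ℝ) * ‖(p.1 : ℂ) - q.1‖ := by positivity
    linarith
  | hadd f g hf hg =>
    obtain ⟨C, hC, h⟩ := hf
    obtain ⟨D, hD, h'⟩ := hg
    refine ⟨C + D, add_nonneg hC hD, fun p q => ?_⟩
    rw [map_add, map_add, add_sub_add_comm, add_mul]
    exact (norm_add_le _ _).trans (add_le_add (h p q) (h' p q))
  | hsmul c f hf =>
    obtain ⟨C, hC, h⟩ := hf
    refine ⟨‖c‖ * C, by positivity, fun p q => ?_⟩
    rw [map_smul, map_smul, ← smul_sub, norm_smul, mul_assoc]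
    exact mul_le_mul_of_nonneg_left (h p q) (norm_nonneg _)

lemma finite_torsion {m : ℕ} (hm : 0 < m) : {w : Tor | w.1 ^ m = 1 ∧ w.2 ^ m = 1}.Finite := by
  have h : {a : Circle | a ^ m = 1}.Finite := by
    refine Set.Finite.of_finite_image (f := fun a : Circle => (a : ℂ)) ?_
      Circle.coe_injective.injOn
    refine (Polynomial.nthRootsFinset m (1 : ℂ)).finite_toSet.subset ?_
    rintro _ ⟨a, ha, rfl⟩
    simp only [Finset.mem_coe, Polynomial.mem_nthRootsFinset hm]
    rw [← Circle.coe_pow, ha, Circle.coe_one]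
  exact (h.prod h).subset fun w hw => hw

theorem finite_per : Finite (per M) := by
  obtain ⟨m, hm, C, _, hC⟩ := exists_pow_sub_one_le M
  refine ((finite_torsion hm).subset fun z hz => ?_ : Set.Finite (per M : Set Tor)).to_subtype
  have := hC z
  rw [(mem_per_iff_gap M).1 hz, mul_zero, norm_le_zero_iff, norm_le_zero_iff, sub_eq_zero,
    sub_eq_zero] at this
  exact ⟨Circle.ext this.1, Circle.ext this.2⟩

theorem exists_near_per : ∃ C, 0 ≤ C ∧ ∀ p, ∃ z ∈ per M, dst p z ≤ C * gap M p := by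
  obtain ⟨m, hm, C, hC0, hC⟩ := exists_pow_sub_one_le M
  have hw : ∀ w : Tor, w ∉ per M → ∃ C', 0 ≤ C' ∧ ∀ p, dst p w ≤ 4 * C * gap M p →
      1 ≤ C' * gap M p := by
    intro w hw
    obtain ⟨s, s', hs, hs', hne⟩ : ∃ s s', M.weight s ≠ 0 ∧ M.weight s' ≠ 0 ∧
        chr w s ≠ chr w s' := by
      by_contra! h
      exact hw fun s s' hs hs' => h s s' hs hs'
    obtain ⟨A, hA, hA'⟩ := norm_chr_sub_le_step M hs hs'
    obtain ⟨B, hB, hB'⟩ := exists_lipschitz (mon s - mon s')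
    have hpos : 0 < ‖(chr w s : ℂ) - chr w s'‖ := by
      rw [norm_pos_iff, sub_ne_zero]
      exact fun h => hne (Circle.ext h)
    refine ⟨(A + B * (4 * C)) / ‖(chr w s : ℂ) - chr w s'‖, by positivity, fun p hp => ?_⟩
    rw [div_mul_eq_mul_div, le_div_iff₀ hpos, one_mul]
    have h1 := hB' p w
    simp only [map_sub, ev_mon] at h1
    have h2 := norm_sub_norm_le ((chr w s : ℂ) - chr w s') ((chr p s : ℂ) - chr p s')
    rw [norm_sub_rev (_ - _) (_ - _)] at h2
    have h3 := hA' p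
    have h4 := mul_le_mul_of_nonneg_left hp hB
    linarith
  have : ∃ C', 0 ≤ C' ∧ ∀ w ∈ (finite_torsion hm).toFinset, w ∉ per M → ∀ p,
      dst p w ≤ 4 * C * gap M p → 1 ≤ C' * gap M p := by
    choose! F hF0 hF using hw
    refine ⟨∑ w ∈ (finite_torsion hm).toFinset, |F w|,
      Finset.sum_nonneg fun _ _ => abs_nonneg _, fun w hw hwp p hp => ?_⟩
    refine (hF w hwp p hp).trans (mul_le_mul_of_nonneg_right ?_ (gap_nonneg M p))
    exact (le_abs_self _).trans (Finset.single_le_sum (f := fun w => |F w|)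
      (fun _ _ => abs_nonneg _) hw)
  obtain ⟨C', hC'0, hC'⟩ := this
  refine ⟨4 * C + 4 * C', by positivity, fun p => ?_⟩
  obtain ⟨a, ha, ha'⟩ := exists_near_root hm p.1
  obtain ⟨b, hb, hb'⟩ := exists_near_root hm p.2
  have hd : dst p (a, b) ≤ 4 * C * gap M p := by
    have := hC p
    simp only [dst]
    linarith
  have hg := gap_nonneg M p
  by_cases hab : (a, b) ∈ per M
  · refine ⟨_, hab, hd.trans ?_⟩
    have : 0 ≤ C' * gap M p := by positivity
    linarith
  · refine ⟨1, one_mem _, (dst_le_four _ _).trans ?_⟩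
    have h1 := hC' (a, b) (by simpa using ⟨ha, hb⟩) hab p hd
    have : 0 ≤ C * gap M p := by positivity
    linarith

/-! ### Laurent polynomials vanishing to high order -/

/-- The maximal ideal of a point of the torus. -/
def maxId (w : Tor) : Ideal Laur := RingHom.ker (ev w)

lemma mem_maxId {w : Tor} {f : Laur} : f ∈ maxId w ↔ ev w f = 0 := RingHom.mem_ker

lemma exists_bound_of_mem_pow {w : Tor} {N : ℕ} {f : Laur} (hf : f ∈ maxId w ^ N) :
    ∃ C, 0 ≤ C ∧ ∀ p, ‖ev p f‖ ≤ C * dst p w ^ N := by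
  induction N generalizing f with
  | zero => simpa using exists_norm_ev_le f
  | succ N ih =>
    rw [pow_succ] at hf
    refine Submodule.mul_induction_on hf (fun a ha b hb => ?_) fun a b ha hb => ?_
    · obtain ⟨C, hC, h⟩ := ih ha
      obtain ⟨D, hD, h'⟩ := exists_lipschitz b
      refine ⟨C * D, by positivity, fun p => ?_⟩
      have h2 := h' p w
      rw [mem_maxId.1 hb, sub_zero] at h2
      rw [map_mul, norm_mul, pow_succ, mul_mul_mul_comm]
      have := dst_nonneg p w
      exact mul_le_mul (h p) h2 (norm_nonneg _) (by positivity)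
    · obtain ⟨C, hC, h⟩ := ha
      obtain ⟨D, hD, h'⟩ := hb
      refine ⟨C + D, by positivity, fun p => ?_⟩
      rw [map_add, add_mul]
      exact (norm_add_le _ _).trans (add_le_add (h p) (h' p))

/-- The Laurent polynomials that vanish to order `N` at all periods. -/
def van (N : ℕ) : Ideal Laur := ⨅ w ∈ per M, maxId w ^ N

lemma mem_van {N : ℕ} {f : Laur} : f ∈ van M N ↔ ∀ w ∈ per M, f ∈ maxId w ^ N := by
  simp [van, Submodule.mem_iInf]

theorem exists_bound_of_mem_van {N : ℕ} {f : Laur} (hf : f ∈ van M N) :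
    ∃ C, 0 ≤ C ∧ ∀ p, ‖ev p f‖ ≤ C * gap M p ^ N := by
  have := finite_per M
  have := Fintype.ofFinite (per M)
  obtain ⟨D, hD, hnear⟩ := exists_near_per M
  choose C hC h using fun w : per M => exists_bound_of_mem_pow ((mem_van M).1 hf w w.2)
  refine ⟨(∑ w, C w) * D ^ N, mul_nonneg (Finset.sum_nonneg fun _ _ => hC _) (by positivity),
    fun p => ?_⟩
  obtain ⟨z, hz, hd⟩ := hnear p
  refine (h ⟨z, hz⟩ p).trans ?_
  rw [mul_assoc, ← mul_pow]
  have h1 := dst_nonneg p z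
  exact mul_le_mul (Finset.single_le_sum (f := C) (fun _ _ => hC _) (Finset.mem_univ (⟨z, hz⟩ : per M)))
    (pow_le_pow_left₀ h1 hd N) (by positivity) (Finset.sum_nonneg fun _ _ => hC _)

lemma norm_nor_pow_le (p : Tor) (n : ℕ) :
    ‖ev p (nor M)‖ ^ n ≤ Real.exp (-(gap M p ^ 2 * n / 2)) := by
  have h1 : ‖ev p (nor M)‖ ^ 2 ≤ Real.exp (-(gap M p ^ 2)) := by
    have := Real.add_one_le_exp (-(gap M p ^ 2))
    have h2 : gap M p ^ 2 = 1 - ‖ev p (nor M)‖ ^ 2 := gap_sq M p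
    linarith
  have h2 : ‖ev p (nor M)‖ ≤ Real.exp (-(gap M p ^ 2 / 2)) := by
    refine le_of_sq_le_sq ?_ (Real.exp_pos _).le
    rw [← Real.exp_nat_mul]
    refine h1.trans_eq ?_
    congr 1
    push_cast
    ring
  refine (pow_le_pow_left₀ (norm_nonneg _) h2 n).trans_eq ?_
  rw [← Real.exp_nat_mul]
  congr 1
  ring

theorem ct_mul_pow_isBigO {K : ℕ} {f : Laur} (hf : f ∈ van M (2 * K)) :
    (fun n : ℕ => ct (f * nor M ^ n)) =O[atTop] fun n : ℕ => ((n : ℝ) ^ K)⁻¹ := by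
  obtain ⟨C, hC, h⟩ := exists_bound_of_mem_van M hf
  refine IsBigO.of_bound (C * (K.factorial * 2 ^ K)) ?_
  filter_upwards [eventually_gt_atTop 0] with n hn
  have hn' : (0 : ℝ) < n := by exact_mod_cast hn
  rw [Real.norm_of_nonneg (by positivity)]
  refine norm_ct_le fun p => ?_
  rw [map_mul, map_pow, norm_mul, norm_pow]
  have h1 := Real.pow_div_factorial_le_exp (gap M p ^ 2 * n / 2) (by positivity) K
  have h2 := norm_nor_pow_le M p n
  rw [Real.exp_neg] at h2
  have hg := gap_nonneg M p
  calc ‖ev p f‖ * ‖ev p (nor M)‖ ^ n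
      ≤ (C * gap M p ^ (2 * K)) * (Real.exp (gap M p ^ 2 * n / 2))⁻¹ :=
        mul_le_mul (h p) h2 (by positivity) (by positivity)
    _ ≤ _ := by
        rw [← div_eq_mul_inv, div_le_iff₀ (Real.exp_pos _)]
        have h3 : C * (K.factorial * 2 ^ K) * ((n : ℝ) ^ K)⁻¹ *
            ((gap M p ^ 2 * n / 2) ^ K / K.factorial) = C * gap M p ^ (2 * K) := by
          have : (K.factorial : ℝ) ≠ 0 := by positivity
          rw [div_pow, mul_pow, ← pow_mul]
          field_simp
        rw [← h3]
        exact mul_le_mul_of_nonneg_left h1 (by positivity)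

end OrbitSum

end

noncomputable section

namespace OrbitSum

/-! ### The maximal ideal at the saddle point -/

/-- `x - 1`. -/
def lx : Laur := mon (1, 0) - 1

/-- `y - 1`. -/
def ly : Laur := mon (0, 1) - 1

lemma lx_mem : lx ∈ maxId 1 := by simp [mem_maxId, lx, ev_mon]

lemma ly_mem : ly ∈ maxId 1 := by simp [mem_maxId, ly, ev_mon]

lemma mon_induction {P : ℤ × ℤ → Prop} (h10 : P (1, 0)) (h01 : P (0, 1)) (h0 : P 0)
    (hadd : ∀ z w, P z → P w → P (z + w)) (hneg : ∀ z, P z → P (-z)) (z : ℤ × ℤ) : P z := by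
  let S : AddSubgroup (ℤ × ℤ) :=
    { carrier := {z | P z}, add_mem' := fun {a b} => hadd a b, zero_mem' := h0,
      neg_mem' := fun {a} => hneg a }
  have : z = z.1 • ((1, 0) : ℤ × ℤ) + z.2 • ((0, 1) : ℤ × ℤ) := by ext <;> simp
  rw [this]
  exact S.add_mem (S.zsmul_mem h10 _) (S.zsmul_mem h01 _)

lemma mon_sub_one_mem (z : ℤ × ℤ) : mon z - 1 ∈ maxId 1 := by
  simp [mem_maxId, ev_mon]

lemma sub_ev_mem (w : Tor) (f : Laur) : f - ev w f • (1 : Laur) ∈ maxId w := by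
  simp [mem_maxId]

theorem maxId_one_le : maxId 1 ≤ Ideal.span {lx, ly} := by
  have hm : ∀ z, mon z - 1 ∈ Ideal.span {lx, ly} := by
    intro z
    induction z using mon_induction with
    | h10 => exact Ideal.subset_span (by simp [lx])
    | h01 => exact Ideal.subset_span (by simp [ly])
    | h0 => simp [mon_zero]
    | hadd z w hz hw =>
      have : mon (z + w) - 1 = mon z * (mon w - 1) + (mon z - 1) := by rw [mon_add]; ring
      rw [this]
      exact add_mem (Ideal.mul_mem_left _ _ hw) hz
    | hneg z hz =>
      have : mon (-z) - 1 = -mon (-z) * (mon z - 1) := by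
        have := mon_mul_mon_neg z
        linear_combination this
      rw [this]
      exact Ideal.mul_mem_left _ _ hz
  have : ∀ f : Laur, f - ev 1 f • (1 : Laur) ∈ Ideal.span {lx, ly} := by
    intro f
    induction f using laur_induction with
    | hmon z => simpa [ev_mon] using hm z
    | hadd f g hf hg =>
      rw [map_add, add_smul, add_sub_add_comm]
      exact add_mem hf hg
    | hsmul c f hf =>
      rw [map_smul, smul_assoc, ← smul_sub]
      exact Submodule.smul_of_tower_mem _ c hf
  intro f hf
  have h := this f
  rwa [mem_maxId.1 hf, zero_smul, sub_zero] at h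

lemma mon_second_order (z : ℤ × ℤ) :
    mon z - 1 - (z.1 : ℂ) • lx - (z.2 : ℂ) • ly ∈ maxId 1 ^ 2 := by
  induction z using mon_induction with
  | h10 => simp [lx]
  | h01 => simp [ly]
  | h0 => simp [mon_zero]
  | hadd z w hz hw =>
    have : mon (z + w) - 1 - ((z + w).1 : ℂ) • lx - ((z + w).2 : ℂ) • ly =
        (mon z - 1) * (mon w - 1) + (mon z - 1 - (z.1 : ℂ) • lx - (z.2 : ℂ) • ly) +
        (mon w - 1 - (w.1 : ℂ) • lx - (w.2 : ℂ) • ly) := by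
      rw [mon_add, Prod.fst_add, Prod.snd_add, Int.cast_add, Int.cast_add, add_smul, add_smul]
      ring
    rw [this]
    refine add_mem (add_mem ?_ hz) hw
    rw [sq]
    exact Ideal.mul_mem_mul (mon_sub_one_mem z) (mon_sub_one_mem w)
  | hneg z hz =>
    have : mon (-z) - 1 - ((-z).1 : ℂ) • lx - ((-z).2 : ℂ) • ly =
        mon (-z) * ((mon z - 1) * (mon z - 1)) -
          (mon z - 1 - (z.1 : ℂ) • lx - (z.2 : ℂ) • ly) := by
      rw [Prod.fst_neg, Prod.snd_neg, Int.cast_neg, Int.cast_neg, neg_smul, neg_smul]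
      have := mon_mul_mon_neg z
      linear_combination (-(mon z - 2)) * this
    rw [this]
    refine sub_mem (Ideal.mul_mem_left _ _ ?_) hz
    rw [sq]
    exact Ideal.mul_mem_mul (mon_sub_one_mem z) (mon_sub_one_mem z)

lemma theta_mem_pow {w : Tor} (φ : ℤ × ℤ →+ ℂ) {N : ℕ} {f : Laur} (hf : f ∈ maxId w ^ N) :
    theta φ f ∈ maxId w ^ (N - 1) := by
  induction N generalizing f with
  | zero => simp
  | succ N ih =>
    rw [pow_succ] at hf
    refine Submodule.mul_induction_on hf (fun a ha b hb => ?_) fun a b ha hb => ?_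
    · rw [Derivation.leibniz, smul_eq_mul, smul_eq_mul, Nat.add_sub_cancel]
      refine add_mem (Ideal.mul_mem_right _ _ ha) ?_
      rcases N with _ | N
      · simp
      · rw [pow_succ', ]
        exact Ideal.mul_mem_mul hb (ih ha)
    · rw [map_add]
      exact add_mem ha hb

lemma smul_mem_ideal (I : Ideal Laur) (c : ℂ) {f : Laur} (hf : f ∈ I) : c • f ∈ I :=
  Submodule.smul_of_tower_mem I c hf

variable (M : StepModel)

/-! ### Second moments -/

/-- The moments of the normalised steps. -/
def sm (a b : ℕ) : ℝ := (∑ s ∈ smallBox, M.weight s * (s.1 : ℝ) ^ a * (s.2 : ℝ) ^ b) / gam M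

lemma sm_form_pos {a b : ℝ} (hab : (a, b) ≠ (0, 0)) :
    0 < a ^ 2 * sm M 2 0 + 2 * a * b * sm M 1 1 + b ^ 2 * sm M 0 2 := by
  have h : a ^ 2 * sm M 2 0 + 2 * a * b * sm M 1 1 + b ^ 2 * sm M 0 2 =
      (∑ s ∈ smallBox, M.weight s * (a * s.1 + b * s.2) ^ 2) / gam M := by
    simp only [sm, mul_div_assoc', ← add_div, Finset.mul_sum, ← Finset.sum_add_distrib]
    congr 1
    exact Finset.sum_congr rfl fun s _ => by ring
  rw [h]
  refine div_pos ?_ (gam_pos M)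
  obtain ⟨s, hs, hlt⟩ := M.nondegenerate a b hab
  exact Finset.sum_pos' (fun s _ => mul_nonneg (M.weight_nonneg s) (sq_nonneg _))
    ⟨s, M.small s hs, mul_pos (weight_pos M hs) (by nlinarith)⟩

lemma sm02_pos : 0 < sm M 0 2 := by simpa using sm_form_pos M (a := 0) (b := 1) (by simp)

lemma sm20_pos : 0 < sm M 2 0 := by simpa using sm_form_pos M (a := 1) (b := 0) (by simp)

/-- The discriminant of the quadratic form of second moments. -/
def smDisc : ℝ := sm M 2 0 * sm M 0 2 - sm M 1 1 ^ 2

lemma smDisc_pos : 0 < smDisc M := by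
  have h0 := sm02_pos M
  have h := sm_form_pos M (a := sm M 0 2) (b := -sm M 1 1) (by simp [h0.ne'])
  have : 0 < sm M 0 2 * smDisc M := by
    unfold smDisc
    linarith
  exact pos_of_mul_pos_right this h0.le

/-- A root of the quadratic form of second moments. -/
def omg : ℂ := (-(sm M 1 1 : ℂ) + Complex.I * (√(smDisc M) : ℝ)) / (sm M 0 2 : ℂ)

/-- `ω` is a root of the quadratic form of second moments. -/
def IsRootForm (ω : ℂ) : Prop :=
  (sm M 0 2 : ℂ) * ω ^ 2 + 2 * (sm M 1 1 : ℂ) * ω + (sm M 2 0 : ℂ) = 0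

/-- Half the derivative of the quadratic form at a root. -/
def mu (ω : ℂ) : ℂ := (sm M 1 1 : ℂ) + ω * (sm M 0 2 : ℂ)

lemma mu_omg : mu M (omg M) = Complex.I * (√(smDisc M) : ℝ) := by
  have h : (sm M 0 2 : ℂ) ≠ 0 := by exact_mod_cast (sm02_pos M).ne'
  rw [mu, omg, div_mul_cancel₀ _ h]
  ring

lemma isRootForm_iff {ω : ℂ} : IsRootForm M ω ↔ mu M ω ^ 2 = -(smDisc M : ℂ) := by
  have h : (sm M 0 2 : ℂ) ≠ 0 := by exact_mod_cast (sm02_pos M).ne'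
  have e : mu M ω ^ 2 + (smDisc M : ℂ) = (sm M 0 2 : ℂ) *
      ((sm M 0 2 : ℂ) * ω ^ 2 + 2 * (sm M 1 1 : ℂ) * ω + (sm M 2 0 : ℂ)) := by
    simp only [mu, smDisc]
    push_cast
    ring
  rw [IsRootForm, ← add_eq_zero_iff_eq_neg, e, mul_eq_zero]
  simp [h]

lemma isRootForm_omg : IsRootForm M (omg M) := by
  rw [isRootForm_iff, mu_omg, mul_pow, Complex.I_sq, ← Complex.ofReal_pow,
    Real.sq_sqrt (smDisc_pos M).le]
  ring

/-- The conjugate root. -/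
def omgBar : ℂ := (starRingEnd ℂ) (omg M)

lemma mu_omgBar : mu M (omgBar M) = -mu M (omg M) := by
  have : mu M (omgBar M) = (starRingEnd ℂ) (mu M (omg M)) := by
    simp [mu, omgBar]
  rw [this, mu_omg]
  simp

lemma isRootForm_omgBar : IsRootForm M (omgBar M) := by
  rw [isRootForm_iff, mu_omgBar, neg_sq, ← isRootForm_iff]
  exact isRootForm_omg M

lemma mu_omg_ne_zero : mu M (omg M) ≠ 0 := by
  rw [mu_omg]
  have := Real.sqrt_pos.2 (smDisc_pos M)
  simp [this.ne']

lemma mu_omgBar_ne_zero : mu M (omgBar M) ≠ 0 := by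
  rw [mu_omgBar]
  exact neg_ne_zero.2 (mu_omg_ne_zero M)

lemma omg_ne_omgBar : omg M ≠ omgBar M := by
  intro h
  have := mu_omgBar M
  rw [← h, eq_neg_iff_add_eq_zero, ← two_mul] at this
  exact mu_omg_ne_zero M ((mul_eq_zero.1 this).resolve_left two_ne_zero)

/-- The homomorphism `z ↦ z.1 + ω * z.2`. -/
def linHom (ω : ℂ) : ℤ × ℤ →+ ℂ := fstHom + (AddMonoidHom.mulLeft ω).comp sndHom

lemma linHom_apply (ω : ℂ) (z : ℤ × ℤ) : linHom ω z = z.1 + ω * z.2 := rfl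

/-- The local coordinate `(y - 1) - ω (x - 1)`. -/
def psi (ω : ℂ) : Laur := ly - ω • lx

lemma psi_mem (ω : ℂ) : psi ω ∈ maxId 1 := sub_mem ly_mem (smul_mem_ideal _ _ lx_mem)

lemma ev_theta_psi (ω ω' : ℂ) : ev 1 (theta (linHom ω) (psi ω')) = ω - ω' := by
  simp [psi, lx, ly, theta_mon, linHom_apply, ev_mon]

/-- The drift of the model vanishes, in complex form. -/
lemma drift_linHom (hdrift : M.ZeroDrift) (ω : ℂ) :
    ∑ s ∈ smallBox, (M.weight s : ℂ) * linHom ω s = 0 := by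
  have h1 : ∑ s ∈ smallBox, (M.weight s : ℂ) * (s.1 : ℂ) = 0 := by
    have := congrArg (fun r : ℝ => (r : ℂ)) hdrift.1
    simpa [mul_comm] using this
  have h2 : ∑ s ∈ smallBox, (M.weight s : ℂ) * (s.2 : ℂ) = 0 := by
    have := congrArg (fun r : ℝ => (r : ℂ)) hdrift.2
    simpa [mul_comm] using this
  have : ∀ s ∈ smallBox, (M.weight s : ℂ) * linHom ω s =
      (M.weight s : ℂ) * (s.1 : ℂ) + ω * ((M.weight s : ℂ) * (s.2 : ℂ)) := fun s _ => by
    rw [linHom_apply]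
    ring
  rw [Finset.sum_congr rfl this, Finset.sum_add_distrib, ← Finset.mul_sum, h1, h2, mul_zero,
    add_zero]

lemma theta_nor (φ : ℤ × ℤ →+ ℂ) : theta φ (nor M) =
    (gam M : ℂ)⁻¹ • ∑ s ∈ smallBox, ((M.weight s : ℂ) * φ s) • mon s := by
  rw [nor, lau, Derivation.map_smul, map_sum]
  simp only [Derivation.map_smul, theta_mon, smul_smul]

theorem theta_nor_sub_mem (hdrift : M.ZeroDrift) {ω : ℂ} (hω : IsRootForm M ω) :
    theta (linHom ω) (nor M) - mu M ω • psi ω ∈ maxId 1 ^ 2 := by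
  have hg := gam_ne_zero M
  have h1 : (gam M : ℂ)⁻¹ * ∑ s ∈ smallBox, (M.weight s : ℂ) * linHom ω s * (s.1 : ℂ) =
      -(mu M ω * ω) := by
    have : -(mu M ω * ω) = (sm M 2 0 : ℂ) + ω * sm M 1 1 := by
      rw [mu]
      rw [IsRootForm] at hω
      linear_combination -hω
    rw [this, sm, sm]
    push_cast
    rw [mul_div_assoc', ← add_div, eq_div_iff hg, mul_comm, ← mul_assoc, mul_inv_cancel₀ hg, one_mul,
      Finset.mul_sum, ← Finset.sum_add_distrib]
    exact Finset.sum_congr rfl fun s _ => by rw [linHom_apply]; ring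
  have h2 : (gam M : ℂ)⁻¹ * ∑ s ∈ smallBox, (M.weight s : ℂ) * linHom ω s * (s.2 : ℂ) =
      mu M ω := by
    rw [mu, sm, sm]
    push_cast
    rw [mul_div_assoc', ← add_div, eq_div_iff hg, mul_comm, ← mul_assoc, mul_inv_cancel₀ hg, one_mul,
      Finset.mul_sum, ← Finset.sum_add_distrib]
    exact Finset.sum_congr rfl fun s _ => by rw [linHom_apply]; ring
  have h3 : theta (linHom ω) (nor M) - mu M ω • psi ω = (gam M : ℂ)⁻¹ • ∑ s ∈ smallBox,
      ((M.weight s : ℂ) * linHom ω s) • (mon s - 1 - (s.1 : ℂ) • lx - (s.2 : ℂ) • ly) := by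
    rw [theta_nor]
    simp only [smul_sub, Finset.sum_sub_distrib, smul_smul, ← Finset.sum_smul]
    rw [drift_linHom M hdrift, h1, h2, psi]
    simp only [mul_zero, zero_smul, smul_sub, smul_smul, neg_smul]
    abel
  rw [h3]
  exact smul_mem_ideal _ _ (sum_mem fun s _ => smul_mem_ideal _ _ (mon_second_order s))

theorem exists_eq_psi {j : ℕ} {f : Laur} (hf : f ∈ maxId 1 ^ (j + 1)) :
    ∃ a ∈ maxId 1 ^ j, ∃ b ∈ maxId 1 ^ j, f = psi (omg M) * a + psi (omgBar M) * b := by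
  rw [pow_succ] at hf
  refine Submodule.mul_induction_on hf (fun a ha b hb => ?_) fun f g hf hg => ?_
  · obtain ⟨c, d, rfl⟩ := Ideal.mem_span_pair.1 (maxId_one_le hb)
    have hne : omgBar M - omg M ≠ 0 := sub_ne_zero.2 (omg_ne_omgBar M).symm
    have hx : lx = (omgBar M - omg M)⁻¹ • (psi (omg M) - psi (omgBar M)) := by
      rw [eq_inv_smul_iff₀ hne, psi, psi, sub_smul]
      abel
    have hy : ly = psi (omg M) + omg M • lx := by rw [psi]; abel
    refine ⟨(omgBar M - omg M)⁻¹ • (a * (c + omg M • d)) + a * d, ?_,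
      -((omgBar M - omg M)⁻¹ • (a * (c + omg M • d))), ?_, ?_⟩
    · exact add_mem (smul_mem_ideal _ _ (Ideal.mul_mem_right _ _ ha)) (Ideal.mul_mem_right _ _ ha)
    · exact neg_mem (smul_mem_ideal _ _ (Ideal.mul_mem_right _ _ ha))
    · rw [hy, hx]
      simp only [Algebra.smul_def]
      ring
  · obtain ⟨a, ha, b, hb, rfl⟩ := hf
    obtain ⟨a', ha', b', hb', rfl⟩ := hg
    exact ⟨a + a', add_mem ha ha', b + b', add_mem hb hb', by ring⟩

theorem nor_sub_one_mem (hdrift : M.ZeroDrift) : nor M - 1 ∈ maxId 1 ^ 2 := by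
  have hg := gam_ne_zero M
  have h1 := drift_linHom M hdrift 0
  have h2 := drift_linHom M hdrift 1
  have h3 : ∑ s ∈ smallBox, (M.weight s : ℂ) * (s.2 : ℂ) = 0 := by
    have : ∀ s ∈ smallBox, (M.weight s : ℂ) * (s.2 : ℂ) =
        (M.weight s : ℂ) * linHom 1 s - (M.weight s : ℂ) * linHom 0 s := fun s _ => by
      simp only [linHom_apply]
      ring
    rw [Finset.sum_congr rfl this, Finset.sum_sub_distrib, h1, h2, sub_zero]
  simp only [linHom_apply, zero_mul, add_zero] at h1
  have h4 : nor M - 1 = (gam M : ℂ)⁻¹ • ∑ s ∈ smallBox,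
      (M.weight s : ℂ) • (mon s - 1 - (s.1 : ℂ) • lx - (s.2 : ℂ) • ly) := by
    simp only [smul_sub, Finset.sum_sub_distrib, smul_smul, ← Finset.sum_smul, h1, h3, nor, lau,
      zero_smul, sub_zero]
    rw [← Complex.ofReal_sum, ← gam, inv_mul_cancel₀ hg, one_smul]
  rw [h4]
  exact smul_mem_ideal _ _ (sum_mem fun s _ => smul_mem_ideal _ _ (mon_second_order s))

end OrbitSum

end

noncomputable section

namespace OrbitSum

/-! ### Asymptotic expansions -/

/-- The error scale `(n + 1) ^ (1 / 2 - K)`. -/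
def err (K : ℕ) (n : ℕ) : ℝ := √((n : ℝ) + 1) / ((n : ℝ) + 1) ^ K

lemma err_pos (K n : ℕ) : 0 < err K n := by unfold err; positivity

lemma err_succ (K n : ℕ) : err (K + 1) n = err K n / ((n : ℝ) + 1) := by
  rw [err, err, pow_succ, div_div]

lemma err_anti {K K' : ℕ} (h : K ≤ K') (n : ℕ) : err K' n ≤ err K n := by
  unfold err
  have : (1 : ℝ) ≤ (n : ℝ) + 1 := by linarith [(Nat.cast_nonneg n : (0 : ℝ) ≤ n)]
  gcongr

lemma inv_pow_le_err (K n : ℕ) : (((n : ℝ) + 1) ^ K)⁻¹ ≤ err K n := by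
  have : (1 : ℝ) ≤ (n : ℝ) + 1 := by linarith [(Nat.cast_nonneg n : (0 : ℝ) ≤ n)]
  rw [err, ← one_div]
  gcongr
  exact Real.one_le_sqrt.2 this

lemma isBigO_err_of_inv {K : ℕ} {f : ℕ → ℂ} (h : f =O[atTop] fun n : ℕ => (((n : ℝ) + 1) ^ K)⁻¹) :
    f =O[atTop] err K := by
  refine h.trans (IsBigO.of_bound 1 (Eventually.of_forall fun n => ?_))
  rw [one_mul, Real.norm_of_nonneg (by positivity), Real.norm_of_nonneg (err_pos K n).le]
  exact inv_pow_le_err K n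

/-- `f n = b R(1 / (n + 1)) + O((n + 1) ^ (1 / 2 - K))` for a polynomial `R` divisible
by `X ^ d`. -/
def HasExp (b : ℂ) (K d : ℕ) (f : ℕ → ℂ) : Prop :=
  ∃ R : Polynomial ℂ, Polynomial.X ^ d ∣ R ∧
    (fun n : ℕ => f n - b * R.eval ((n : ℂ) + 1)⁻¹) =O[atTop] err K

namespace HasExp

variable {b : ℂ} {K d : ℕ} {f g : ℕ → ℂ}

lemma of_isBigO (h : f =O[atTop] err K) : HasExp b K d f :=
  ⟨0, dvd_zero _, by simpa using h⟩

lemma congr (h : HasExp b K d f) (hfg : ∀ n, f n = g n) : HasExp b K d g := by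
  rwa [← funext hfg]

lemma mono {K' d' : ℕ} (h : HasExp b K d f) (hK : K' ≤ K) (hd : d' ≤ d) : HasExp b K' d' f := by
  obtain ⟨R, hR, h⟩ := h
  refine ⟨R, (pow_dvd_pow _ hd).trans hR, h.trans (IsBigO.of_bound 1
    (Eventually.of_forall fun n => ?_))⟩
  rw [one_mul, Real.norm_of_nonneg (err_pos _ n).le, Real.norm_of_nonneg (err_pos _ n).le]
  exact err_anti hK n

lemma add (hf : HasExp b K d f) (hg : HasExp b K d g) : HasExp b K d fun n => f n + g n := by
  obtain ⟨R, hR, h⟩ := hf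
  obtain ⟨S, hS, h'⟩ := hg
  refine ⟨R + S, dvd_add hR hS, (h.add h').congr_left fun n => ?_⟩
  rw [Polynomial.eval_add]
  ring

lemma const_mul (c : ℂ) (hf : HasExp b K d f) : HasExp b K d fun n => c * f n := by
  obtain ⟨R, hR, h⟩ := hf
  refine ⟨Polynomial.C c * R, hR.mul_left _, (h.const_mul_left c).congr_left fun n => ?_⟩
  rw [Polynomial.eval_mul, Polynomial.eval_C]
  ring

lemma neg (hf : HasExp b K d f) : HasExp b K d fun n => -f n :=
  (hf.const_mul (-1)).congr fun n => by ring

lemma sub (hf : HasExp b K d f) (hg : HasExp b K d g) : HasExp b K d fun n => f n - g n :=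
  (hf.add hg.neg).congr fun n => by ring

lemma div_succ (hf : HasExp b K d f) : HasExp b (K + 1) (d + 1) fun n => f n / ((n : ℂ) + 1) := by
  obtain ⟨R, hR, h⟩ := hf
  refine ⟨R * Polynomial.X, by rw [pow_succ]; exact mul_dvd_mul_right hR _, ?_⟩
  have h1 : (fun n : ℕ => ((n : ℂ) + 1)⁻¹) =O[atTop] fun n : ℕ => ((n : ℝ) + 1)⁻¹ := by
    refine IsBigO.of_bound 1 (Eventually.of_forall fun n => ?_)
    have : ‖((n : ℂ) + 1)‖ = (n : ℝ) + 1 := by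
      have := Complex.norm_natCast (n + 1)
      push_cast at this
      exact this
    rw [norm_inv, this, one_mul, Real.norm_of_nonneg (by positivity)]
  refine (h.mul h1).congr (fun n => ?_) fun n => ?_
  · rw [Polynomial.eval_mul, Polynomial.eval_X]
    ring
  · rw [err_succ, div_eq_mul_inv]

lemma mul_succ (hf : HasExp b (K + 1) (d + 1) f) : HasExp b K d fun n => ((n : ℂ) + 1) * f n := by
  obtain ⟨R, hR, h⟩ := hf
  obtain ⟨S, rfl⟩ := hR
  refine ⟨Polynomial.X ^ d * S, dvd_mul_right _ _, ?_⟩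
  have h1 : (fun n : ℕ => ((n : ℂ) + 1)) =O[atTop] fun n : ℕ => ((n : ℝ) + 1) := by
    refine IsBigO.of_bound 1 (Eventually.of_forall fun n => ?_)
    have : ‖((n : ℂ) + 1)‖ = (n : ℝ) + 1 := by
      have := Complex.norm_natCast (n + 1)
      push_cast at this
      exact this
    rw [this, one_mul, Real.norm_of_nonneg (by positivity)]
  refine (h1.mul h).congr (fun n => ?_) fun n => ?_
  · have : (n : ℂ) + 1 ≠ 0 := by exact_mod_cast n.succ_ne_zero
    simp only [Polynomial.eval_mul, Polynomial.eval_pow, Polynomial.eval_X]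
    rw [pow_succ]
    field_simp
  · have : (n : ℝ) + 1 ≠ 0 := by positivity
    rw [err_succ]
    field_simp

end HasExp

lemma tendsto_err {K : ℕ} : Tendsto (err (K + 1)) atTop (nhds 0) := by
  have h1 : Tendsto (fun n : ℕ => (√((n : ℝ) + 1))⁻¹) atTop (nhds 0) :=
    (Real.tendsto_sqrt_atTop.comp
      (tendsto_atTop_add_const_right _ 1 tendsto_natCast_atTop_atTop)).inv_tendsto_atTop
  refine squeeze_zero (fun n => (err_pos _ n).le) (fun n => ?_) h1
  refine (err_anti (by omega : 1 ≤ K + 1) n).trans (le_of_eq ?_)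
  have : (0 : ℝ) ≤ (n : ℝ) + 1 := by positivity
  rw [err, pow_one, Real.sqrt_div_self', one_div]

lemma err_telescope (K n : ℕ) : err (K + 2) n ≤ 8 * (err (K + 1) n - err (K + 1) (n + 1)) := by
  have h : err 2 n ≤ 8 * (err 1 n - err 1 (n + 1)) := by
    set x : ℝ := √((n : ℝ) + 1) with hx
    set y : ℝ := √((n : ℝ) + 1 + 1) with hy
    have hx2 : x ^ 2 = n + 1 := Real.sq_sqrt (by positivity)
    have hy2 : y ^ 2 = n + 1 + 1 := Real.sq_sqrt (by positivity)
    have hx0 : 0 < x := Real.sqrt_pos.2 (by positivity)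
    have hy0 : 0 < y := Real.sqrt_pos.2 (by positivity)
    have hn : (0 : ℝ) ≤ n := Nat.cast_nonneg n
    have hyx : y ≤ 2 * x := by
      refine le_of_sq_le_sq ?_ (by positivity)
      rw [mul_pow, hx2, hy2]
      linarith
    have e1 : err 2 n = 1 / x ^ 3 := by
      rw [err, ← hx, ← hx2]
      field_simp
    have e2 : err 1 n = 1 / x := by
      rw [err, ← hx, ← hx2]
      field_simp
    have e3 : err 1 (n + 1) = 1 / y := by
      rw [err]
      push_cast
      rw [← hy, ← hy2]
      field_simp
    have hxy : x ≤ y := Real.sqrt_le_sqrt (by linarith)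
    have e4 : 1 / x - 1 / y = 1 / (x * y * (x + y)) := by
      have : (y - x) * (x + y) = 1 := by nlinarith
      field_simp
      linarith
    rw [e1, e2, e3, e4, mul_one_div, div_le_div_iff₀ (by positivity) (by positivity), one_mul]
    have : x * y * (x + y) ≤ x * (2 * x) * (x + 2 * x) := by gcongr
    nlinarith [pow_pos hx0 3]
  have h1 : err (K + 2) n = err 2 n / ((n : ℝ) + 1) ^ K := by
    rw [err, err, div_div]
    ring
  have h2 : err (K + 1) n = err 1 n / ((n : ℝ) + 1) ^ K := by
    rw [err, err, div_div]
    ring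
  have h3 : err (K + 1) (n + 1) ≤ err 1 (n + 1) / ((n : ℝ) + 1) ^ K := by
    have : err (K + 1) (n + 1) = err 1 (n + 1) / (((n + 1 : ℕ) : ℝ) + 1) ^ K := by
      rw [err, err, div_div]
      ring
    rw [this]
    have := err_pos 1 (n + 1)
    gcongr
    linarith
  rw [h1]
  calc _ ≤ (8 * (err 1 n - err 1 (n + 1))) / ((n : ℝ) + 1) ^ K := by gcongr
    _ = 8 * (err 1 n / ((n : ℝ) + 1) ^ K - err 1 (n + 1) / ((n : ℝ) + 1) ^ K) := by ring
    _ ≤ _ := by rw [h2]; linarith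

lemma err_one_telescope (n : ℕ) : err 1 n ≤ 2 * (√((n : ℝ) + 1) - √n) := by
  set x : ℝ := √n with hx
  set y : ℝ := √((n : ℝ) + 1) with hy
  have hx2 : x ^ 2 = n := Real.sq_sqrt (by positivity)
  have hy2 : y ^ 2 = n + 1 := Real.sq_sqrt (by positivity)
  have hx0 : 0 ≤ x := Real.sqrt_nonneg _
  have hy0 : 0 < y := Real.sqrt_pos.2 (by positivity)
  have hxy : x ≤ y := Real.sqrt_le_sqrt (by linarith)
  rw [err, pow_one, ← hy, ← hy2, div_le_iff₀ (by positivity)]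
  nlinarith [mul_nonneg (sub_nonneg.2 hxy) (sub_nonneg.2 hxy)]

lemma exists_bound_err {K : ℕ} {f : ℕ → ℂ} (h : f =O[atTop] err K) :
    ∃ C, 0 < C ∧ ∀ n, ‖f n‖ ≤ C * err K n := by
  obtain ⟨C, hC, hb⟩ := bound_of_isBigO_nat_atTop h
  refine ⟨C, hC, fun n => ?_⟩
  have := hb (err_pos K n).ne'
  rwa [Real.norm_of_nonneg (err_pos K n).le] at this

theorem isBigO_of_diff_err_one {A : ℕ → ℂ} (h : (fun n => A (n + 1) - A n) =O[atTop] err 1) :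
    A =O[atTop] err 0 := by
  obtain ⟨C, hC, hb⟩ := exists_bound_err h
  have key : ∀ n, ‖A n‖ ≤ ‖A 0‖ + C * (2 * √n) := by
    intro n
    induction n with
    | zero => simp
    | succ n ih =>
      have h1 : ‖A (n + 1)‖ ≤ ‖A (n + 1) - A n‖ + ‖A n‖ := by
        simpa using norm_add_le (A (n + 1) - A n) (A n)
      have h2 := (hb n).trans (mul_le_mul_of_nonneg_left (err_one_telescope n) hC.le)
      push_cast
      linarith
  refine IsBigO.of_bound (‖A 0‖ + 2 * C) (Eventually.of_forall fun n => (key n).trans ?_)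
  rw [Real.norm_of_nonneg (err_pos 0 n).le, err, pow_zero, div_one]
  have h1 : √n ≤ √((n : ℝ) + 1) := Real.sqrt_le_sqrt (by linarith)
  have h2 : 1 ≤ √((n : ℝ) + 1) :=
    Real.one_le_sqrt.2 (by linarith [(Nat.cast_nonneg n : (0 : ℝ) ≤ n)])
  nlinarith [norm_nonneg (A 0)]

theorem exists_limit_of_diff {K : ℕ} {A : ℕ → ℂ}
    (h : (fun n => A (n + 1) - A n) =O[atTop] err (K + 2)) :
    ∃ l, Tendsto A atTop (nhds l) ∧ (fun n => A n - l) =O[atTop] err (K + 1) := by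
  obtain ⟨C, hC, hb⟩ := exists_bound_err h
  have key : ∀ n m, ‖A (n + m) - A n‖ ≤ 8 * C * (err (K + 1) n - err (K + 1) (n + m)) := by
    intro n m
    induction m with
    | zero => simp
    | succ m ih =>
      have h1 := norm_add_le (A (n + (m + 1)) - A (n + m)) (A (n + m) - A n)
      rw [sub_add_sub_cancel] at h1
      have h2 := (hb (n + m)).trans (mul_le_mul_of_nonneg_left (err_telescope K (n + m)) hC.le)
      rw [add_assoc n m 1] at h2
      linarith
  have key2 : ∀ n m, n ≤ m → ‖A m - A n‖ ≤ 8 * C * err (K + 1) n := by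
    intro n m hnm
    obtain ⟨k, rfl⟩ := Nat.exists_eq_add_of_le hnm
    refine (key n k).trans (mul_le_mul_of_nonneg_left ?_ (by positivity))
    linarith [err_pos (K + 1) (n + k)]
  have hcau : CauchySeq A := by
    refine cauchySeq_of_le_tendsto_0' (fun n => 8 * C * err (K + 1) n) (fun n m hnm => ?_) ?_
    · rw [dist_comm, dist_eq_norm]
      exact key2 n m hnm
    · simpa using tendsto_err.const_mul (8 * C)
  obtain ⟨l, hl⟩ := cauchySeq_tendsto_of_complete hcau
  refine ⟨l, hl, IsBigO.of_bound (8 * C) (Eventually.of_forall fun n => ?_)⟩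
  rw [Real.norm_of_nonneg (err_pos _ n).le, norm_sub_rev]
  refine le_of_tendsto ((hl.sub_const (A n)).norm) ?_
  filter_upwards [eventually_ge_atTop n] with m hm
  exact key2 n m hm

/-! ### Solving difference equations -/

open Polynomial in
lemma exists_polynomial_diff (T U : ℂ[X]) (hT : T = X - X ^ 2 * U) (hU : U.coeff 0 = 1) (K : ℕ)
    (Q : ℂ[X]) (i : ℕ) (hi : 2 ≤ i) :
    ∃ P : ℂ[X], X ∣ P ∧ X ^ K ∣ P.comp T - P - X ^ i * Q := by
  by_cases hK : K ≤ i
  · exact ⟨0, dvd_zero _, by simpa using (pow_dvd_pow X hK).mul_right Q⟩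
  · obtain ⟨k, rfl⟩ := Nat.exists_eq_add_of_le hi
    have hk : ((k : ℂ) + 1) ≠ 0 := by exact_mod_cast k.succ_ne_zero
    set c := -Q.coeff 0 / ((k : ℂ) + 1) with hc
    have h1 : ∀ n : ℕ, ∃ W : ℂ[X], (1 - X * U) ^ n = 1 - C (n : ℂ) * (X * U) + X ^ 2 * W := by
      intro n
      induction n with
      | zero => exact ⟨0, by simp⟩
      | succ n ih =>
        obtain ⟨W, hW⟩ := ih
        refine ⟨C (n : ℂ) * U ^ 2 + W * (1 - X * U), ?_⟩
        rw [pow_succ, hW, Nat.cast_succ, C_add, C_1]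
        ring
    have h2 : X ^ (k + 3) ∣ (C c * X ^ (k + 1)).comp T - C c * X ^ (k + 1) - X ^ (2 + k) * Q := by
      obtain ⟨W, hW⟩ := h1 (k + 1)
      obtain ⟨U', hU'⟩ : X ∣ U - C (1 : ℂ) := X_dvd_iff.2 (by simp [hU])
      obtain ⟨Q', hQ'⟩ : X ∣ Q - C (Q.coeff 0) := X_dvd_iff.2 (by simp)
      have hc' : C c * C (((k + 1 : ℕ) : ℂ)) = -C (Q.coeff 0) := by
        rw [← C_mul, ← C_neg, hc]
        push_cast
        rw [div_mul_cancel₀ _ hk]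
      have hT' : T ^ (k + 1) = X ^ (k + 1) * (1 - X * U) ^ (k + 1) := by
        rw [← mul_pow, hT]
        ring
      refine ⟨C (Q.coeff 0) * U' + C c * W - Q', ?_⟩
      rw [mul_comp, C_comp, pow_comp, X_comp, hT', hW]
      rw [sub_eq_iff_eq_add] at hU' hQ'
      rw [C_1] at hU'
      generalize Q.coeff 0 = q at hQ' hc'
      rw [hQ', hU']
      linear_combination (-X ^ (k + 2) * (X * U' + 1)) * hc'
    obtain ⟨V, hV⟩ := h2
    obtain ⟨P, hP, hP'⟩ := exists_polynomial_diff T U hT hU K (-V) (2 + k + 1) (by omega)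
    refine ⟨C c * X ^ (k + 1) + P, dvd_add ((dvd_pow_self X (by omega)).mul_left _) hP, ?_⟩
    have : (C c * X ^ (k + 1) + P).comp T - (C c * X ^ (k + 1) + P) - X ^ (2 + k) * Q =
        P.comp T - P - X ^ (2 + k + 1) * -V := by
      rw [add_comp]
      have e : k + 3 = 2 + k + 1 := by omega
      rw [e] at hV
      linear_combination hV
    rwa [this]
  termination_by K - i
  decreasing_by omega

lemma exists_bound_eval_sub (P : Polynomial ℂ) : ∃ C, 0 ≤ C ∧ ∀ x y : ℂ, ‖x‖ ≤ 2 → ‖y‖ ≤ 2 →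
    ‖P.eval x - P.eval y‖ ≤ C * ‖x - y‖ := by
  obtain ⟨C, hC⟩ := (isCompact_closedBall (0 : ℂ) 2).exists_bound_of_continuousOn
    P.derivative.continuous.continuousOn
  have h0 : (0 : ℂ) ∈ Metric.closedBall (0 : ℂ) 2 := by simp
  refine ⟨C, (norm_nonneg _).trans (hC 0 h0), fun x y hx hy => ?_⟩
  exact (convex_closedBall (0 : ℂ) 2).norm_image_sub_le_of_norm_hasDerivWithin_le
    (fun z _ => (P.hasDerivAt z).hasDerivWithinAt) hC (by simpa using hy) (by simpa using hx)

lemma norm_succ_inv (n : ℕ) : ‖((n : ℂ) + 1)⁻¹‖ = ((n : ℝ) + 1)⁻¹ := by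
  have := Complex.norm_natCast (n + 1)
  push_cast at this
  rw [norm_inv, this]

lemma norm_succ_inv_le (n : ℕ) : ‖((n : ℂ) + 1)⁻¹‖ ≤ 1 := by
  rw [norm_succ_inv]
  exact inv_le_one_of_one_le₀ (by linarith [(Nat.cast_nonneg n : (0 : ℝ) ≤ n)])

lemma isBigO_of_X_pow_dvd {K : ℕ} {P : Polynomial ℂ} (h : Polynomial.X ^ K ∣ P) :
    (fun n : ℕ => P.eval ((n : ℂ) + 1)⁻¹) =O[atTop] fun n : ℕ => (((n : ℝ) + 1) ^ K)⁻¹ := by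
  obtain ⟨S, rfl⟩ := h
  obtain ⟨C, hC, hS⟩ := exists_bound_eval_sub S
  refine IsBigO.of_bound (‖S.eval 0‖ + C) (Eventually.of_forall fun n => ?_)
  have h1 := hS _ 0 ((norm_succ_inv_le n).trans one_le_two) (by simp)
  have h2 : ‖S.eval ((n : ℂ) + 1)⁻¹‖ ≤ ‖S.eval 0‖ + C := by
    have h3 := norm_le_norm_add_norm_sub (S.eval 0) (S.eval ((n : ℂ) + 1)⁻¹)
    rw [norm_sub_rev] at h3
    have h4 := norm_succ_inv_le n
    rw [sub_zero] at h1
    nlinarith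
  rw [Polynomial.eval_mul, Polynomial.eval_pow, Polynomial.eval_X, norm_mul, norm_pow,
    norm_succ_inv, inv_pow, Real.norm_of_nonneg (by positivity), mul_comm]
  gcongr

theorem exists_sum_expansion (K : ℕ) {R : Polynomial ℂ} (hR : Polynomial.X ^ 2 ∣ R) :
    ∃ P : Polynomial ℂ, Polynomial.X ∣ P ∧ (fun n : ℕ => P.eval ((n : ℂ) + 1 + 1)⁻¹ -
      P.eval ((n : ℂ) + 1)⁻¹ - R.eval ((n : ℂ) + 1)⁻¹) =O[atTop] err K := by
  obtain ⟨Q, rfl⟩ := hR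
  set U : Polynomial ℂ := ∑ i ∈ Finset.range (K + 1), (-Polynomial.X) ^ i with hU
  set T : Polynomial ℂ := Polynomial.X - Polynomial.X ^ 2 * U with hT
  have hU0 : U.coeff 0 = 1 := by
    rw [Polynomial.coeff_zero_eq_eval_zero, hU, Polynomial.eval_finsetSum,
      Finset.sum_range_succ']
    simp
  obtain ⟨P, hP, hP'⟩ := exists_polynomial_diff T U hT hU0 K Q 2 le_rfl
  refine ⟨P, hP, ?_⟩
  have hTU : (1 + Polynomial.X) * T = Polynomial.X + (-Polynomial.X) ^ (K + 3) := by
    have := mul_neg_geom_sum (-(Polynomial.X : Polynomial ℂ)) (K + 1)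
    rw [← hU] at this
    rw [hT]
    linear_combination (-Polynomial.X ^ 2) * this
  obtain ⟨C, hC, hPC⟩ := exists_bound_eval_sub P
  have hT' : ∀ n : ℕ, ‖T.eval ((n : ℂ) + 1)⁻¹ - ((n : ℂ) + 1 + 1)⁻¹‖ ≤
      (((n : ℝ) + 1) ^ (K + 3))⁻¹ := by
    intro n
    have h1 : (n : ℂ) + 1 ≠ 0 := by exact_mod_cast n.succ_ne_zero
    have h2 : (n : ℂ) + 1 + 1 ≠ 0 := by exact_mod_cast (n + 1).succ_ne_zero
    have h3 := congrArg (Polynomial.eval ((n : ℂ) + 1)⁻¹) hTU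
    simp only [Polynomial.eval_mul, Polynomial.eval_add, Polynomial.eval_one, Polynomial.eval_X,
      Polynomial.eval_pow, Polynomial.eval_neg] at h3
    have h4 : T.eval ((n : ℂ) + 1)⁻¹ - ((n : ℂ) + 1 + 1)⁻¹ =
        (((n : ℂ) + 1) * ((n : ℂ) + 1 + 1)⁻¹) * (-((n : ℂ) + 1)⁻¹) ^ (K + 3) := by
      have h5 : (1 + ((n : ℂ) + 1)⁻¹) = ((n : ℂ) + 1 + 1) * ((n : ℂ) + 1)⁻¹ := by
        field_simp
      rw [h5] at h3
      have h6 : T.eval ((n : ℂ) + 1)⁻¹ = ((n : ℂ) + 1) * ((n : ℂ) + 1 + 1)⁻¹ *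
          (((n : ℂ) + 1 + 1) * ((n : ℂ) + 1)⁻¹ * T.eval ((n : ℂ) + 1)⁻¹) := by
        field_simp
      rw [h6, h3, mul_add]
      field_simp
      ring
    rw [h4, norm_mul, norm_pow, norm_neg, norm_succ_inv, inv_pow]
    refine mul_le_of_le_one_left (by positivity) ?_
    have h7 := Complex.norm_natCast (n + 1)
    have h8 := norm_succ_inv (n + 1)
    push_cast at h7 h8
    rw [norm_mul, h7, h8, ← div_eq_mul_inv, div_le_one (by positivity)]
    linarith
  have e1 : (fun n : ℕ => P.eval ((n : ℂ) + 1 + 1)⁻¹ - P.eval (T.eval ((n : ℂ) + 1)⁻¹)) =O[atTop]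
      fun n : ℕ => (((n : ℝ) + 1) ^ K)⁻¹ := by
    refine IsBigO.of_bound C (Eventually.of_forall fun n => ?_)
    have h9 := norm_succ_inv_le (n + 1)
    push_cast at h9
    have h1 : (1 : ℝ) ≤ (n : ℝ) + 1 := by linarith [(Nat.cast_nonneg n : (0 : ℝ) ≤ n)]
    have h2 := hT' n
    have h3 : (((n : ℝ) + 1) ^ (K + 3))⁻¹ ≤ (((n : ℝ) + 1) ^ K)⁻¹ := by
      gcongr
      omega
    have h4 : (((n : ℝ) + 1) ^ K)⁻¹ ≤ 1 := inv_le_one_of_one_le₀ (one_le_pow₀ h1)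
    have h5 := norm_le_norm_add_norm_sub' (T.eval ((n : ℂ) + 1)⁻¹) ((n : ℂ) + 1 + 1)⁻¹
    rw [Real.norm_of_nonneg (by positivity)]
    refine (hPC _ _ (by linarith) (by linarith)).trans (mul_le_mul_of_nonneg_left ?_ hC)
    rw [norm_sub_rev]
    exact h2.trans h3
  have e2 := isBigO_of_X_pow_dvd hP'
  refine isBigO_err_of_inv ((e1.add e2).congr_left fun n => ?_)
  simp only [Polynomial.eval_sub, Polynomial.eval_comp]
  ring

theorem HasExp.of_diff {b : ℂ} {K : ℕ} {A : ℕ → ℂ}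
    (h : HasExp b (K + 2) 2 fun n => A (n + 1) - A n) (hA : Tendsto A atTop (nhds b)) :
    HasExp b (K + 1) 0 A := by
  obtain ⟨R, hR, h⟩ := h
  obtain ⟨P, hP, hP'⟩ := exists_sum_expansion (K + 2) hR
  have h1 : (fun n : ℕ => (A (n + 1) - b * P.eval (((n + 1 : ℕ) : ℂ) + 1)⁻¹) -
      (A n - b * P.eval ((n : ℂ) + 1)⁻¹)) =O[atTop] err (K + 2) := by
    refine (h.sub (hP'.const_mul_left b)).congr_left fun n => ?_
    push_cast
    ring
  obtain ⟨l, hl, hl'⟩ := exists_limit_of_diff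
    (A := fun n => A n - b * P.eval ((n : ℂ) + 1)⁻¹) h1
  have h2 : Tendsto (fun n : ℕ => P.eval ((n : ℂ) + 1)⁻¹) atTop (nhds 0) := by
    have h3 : Tendsto (fun n : ℕ => ((n : ℂ) + 1)⁻¹) atTop (nhds 0) := by
      have := tendsto_one_div_add_atTop_nhds_zero_nat (𝕜 := ℂ)
      simpa using this
    have h4 := (P.continuous.tendsto 0).comp h3
    have h5 : P.eval 0 = 0 := by
      rw [← Polynomial.coeff_zero_eq_eval_zero]
      exact Polynomial.X_dvd_iff.1 hP
    rwa [h5] at h4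
  have h3 : l = b := by
    refine tendsto_nhds_unique hl ?_
    simpa using hA.sub (h2.const_mul b)
  refine ⟨1 + P, by simp, hl'.congr_left fun n => ?_⟩
  rw [h3, Polynomial.eval_add, Polynomial.eval_one]
  ring

end OrbitSum

end

noncomputable section

namespace OrbitSum

/-! ### Local expansions at the saddle point -/

variable (M : StepModel)

/-- `E` agrees with `1` to order `L` at the saddle point, and with `0` at the other periods. -/
structure IsCutoff (L : ℕ) (E : Laur) : Prop where
  sub_one_mem : E - 1 ∈ maxId 1 ^ L
  mem : ∀ w ∈ per M, w ≠ 1 → E ∈ maxId w ^ L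

lemma maxId_ne {w w' : Tor} (h : w ≠ w') : maxId w ≠ maxId w' := by
  intro he
  have h1 : mon (1, 0) - (w.1 : ℂ) • (1 : Laur) ∈ maxId w' := by
    rw [← he]; simp [mem_maxId, ev_mon, chr]
  have h2 : mon (0, 1) - (w.2 : ℂ) • (1 : Laur) ∈ maxId w' := by
    rw [← he]; simp [mem_maxId, ev_mon, chr]
  simp only [mem_maxId, map_sub, ev_mon, chr, map_smul, map_one, zpow_one, zpow_zero, mul_one,
    one_mul, smul_eq_mul, sub_eq_zero] at h1 h2
  exact h (Prod.ext (Circle.ext h1.symm) (Circle.ext h2.symm))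

lemma isMaximal_maxId (w : Tor) : (maxId w).IsMaximal :=
  RingHom.ker_isMaximal_of_surjective (ev w) fun c => ⟨c • (1 : Laur), by simp⟩

theorem exists_isCutoff (L : ℕ) : ∃ E, IsCutoff M L E := by
  have := finite_per M
  have := Fintype.ofFinite (per M)
  obtain ⟨E, hE⟩ := Ideal.exists_forall_sub_mem_ideal (I := fun w : per M => maxId w ^ L)
    (fun i j hij => by
      have := isMaximal_maxId (i : Tor)
      have := isMaximal_maxId (j : Tor)
      exact (Ideal.isCoprime_of_isMaximal (maxId_ne fun h => hij (Subtype.ext h))).pow)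
    (open Classical in fun w => if (w : Tor) = 1 then 1 else 0)
  refine ⟨E, ?_, fun w hw hw1 => ?_⟩
  · simpa using hE 1
  · simpa [hw1] using hE ⟨w, hw⟩

/-- The local part of the constant term of `f * S ^ n`. -/
def loc (E : Laur) (f : Laur) (n : ℕ) : ℂ := ct (E * f * nor M ^ n)

section

variable {M} {L : ℕ} {E : Laur}

lemma loc_add (f g : Laur) (n : ℕ) : loc M E (f + g) n = loc M E f n + loc M E g n := by
  rw [loc, mul_add, add_mul, map_add, loc, loc]

lemma loc_sub (f g : Laur) (n : ℕ) : loc M E (f - g) n = loc M E f n - loc M E g n := by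
  rw [loc, mul_sub, sub_mul, map_sub, loc, loc]

lemma loc_smul (c : ℂ) (f : Laur) (n : ℕ) : loc M E (c • f) n = c * loc M E f n := by
  rw [loc, mul_smul_comm, smul_mul_assoc, map_smul, smul_eq_mul, loc]

lemma loc_succ (f : Laur) (n : ℕ) : loc M E f (n + 1) = loc M E (nor M * f) n := by
  rw [loc, loc, pow_succ]
  congr 1
  ring

lemma IsCutoff.mul_mem_van (hE : IsCutoff M L E) {j : ℕ} (hj : j ≤ L) {f : Laur}
    (hf : f ∈ maxId 1 ^ j) : E * f ∈ van M j := by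
  rw [mem_van]
  intro w hw
  by_cases h1 : w = 1
  · rw [h1]
    exact Ideal.mul_mem_left _ _ hf
  · exact Ideal.mul_mem_right _ _ (Ideal.pow_le_pow_right hj (hE.mem w hw h1))

lemma IsCutoff.theta_mem_van (hE : IsCutoff M L E) (φ : ℤ × ℤ →+ ℂ) :
    theta φ E ∈ van M (L - 1) := by
  rw [mem_van]
  intro w hw
  by_cases h1 : w = 1
  · have := theta_mem_pow φ hE.sub_one_mem
    rw [h1]
    simpa using this
  · exact theta_mem_pow φ (hE.mem w hw h1)

lemma van_anti {j k : ℕ} (h : j ≤ k) : van M k ≤ van M j := by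
  intro f hf
  rw [mem_van] at hf ⊢
  exact fun w hw => Ideal.pow_le_pow_right h (hf w hw)

lemma isBigO_inv_succ {K : ℕ} {f : ℕ → ℂ} (h : f =O[atTop] fun n : ℕ => ((n : ℝ) ^ K)⁻¹) :
    f =O[atTop] fun n : ℕ => (((n : ℝ) + 1) ^ K)⁻¹ := by
  refine h.trans (IsBigO.of_bound (2 ^ K) ?_)
  filter_upwards [eventually_ge_atTop 1] with n hn
  have hn' : (1 : ℝ) ≤ n := by exact_mod_cast hn
  rw [Real.norm_of_nonneg (by positivity), Real.norm_of_nonneg (by positivity), ← div_eq_mul_inv,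
    le_div_iff₀ (by positivity), ← div_eq_inv_mul, ← div_pow]
  refine pow_le_pow_left₀ (by positivity) ?_ K
  rw [div_le_iff₀ (by positivity)]
  linarith

lemma ct_mul_pow_isBigO' {K j : ℕ} {f : Laur} (hf : f ∈ van M j) (hj : 2 * K ≤ j) :
    (fun n : ℕ => ct (f * nor M ^ n)) =O[atTop] err K :=
  isBigO_err_of_inv (isBigO_inv_succ (ct_mul_pow_isBigO M (van_anti hj hf)))

lemma IsCutoff.loc_isBigO (hE : IsCutoff M L E) {j K : ℕ} (hj : 2 * K ≤ j) (hL : 2 * K ≤ L)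
    {f : Laur} (hf : f ∈ maxId 1 ^ j) : loc M E f =O[atTop] err K :=
  ct_mul_pow_isBigO' (hE.mul_mem_van hL (Ideal.pow_le_pow_right hj hf)) le_rfl

lemma loc_by_parts (φ : ℤ × ℤ →+ ℂ) (f : Laur) (n : ℕ) :
    ((n : ℂ) + 1) * loc M E (f * theta φ (nor M)) n =
      -loc M E (nor M * theta φ f) n - ct (theta φ E * (f * nor M) * nor M ^ n) := by
  have h := ct_theta φ (E * f * nor M ^ (n + 1))
  have h2 : theta φ (E * f * nor M ^ (n + 1)) = E * (nor M * theta φ f) * nor M ^ n +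
      theta φ E * (f * nor M) * nor M ^ n +
      ((n : ℂ) + 1) • (E * (f * theta φ (nor M)) * nor M ^ n) := by
    rw [Derivation.leibniz, Derivation.leibniz, Derivation.leibniz_pow, Nat.add_sub_cancel]
    simp only [smul_eq_mul, nsmul_eq_mul]
    rw [Algebra.smul_def, map_add, map_natCast, map_one]
    push_cast
    ring
  rw [h2, map_add, map_add, map_smul, smul_eq_mul] at h
  simp only [loc]
  linear_combination h

/-- The local expansions hold up to order `K` at vanishing order `j`. -/
def LocExp (M : StepModel) (E : Laur) (b : ℂ) (K j : ℕ) : Prop :=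
  ∀ f ∈ maxId 1 ^ j, HasExp b K ((j + 1) / 2 + 1) (loc M E f)

variable {b : ℂ}

lemma IsCutoff.by_parts_hasExp (hE : IsCutoff M L E) {K j : ℕ} (hL : 2 * K + 1 ≤ L)
    (h : LocExp M E b K (j - 2)) (φ : ℤ × ℤ →+ ℂ) {f : Laur} (hf : f ∈ maxId 1 ^ (j - 1))
    (hj : 1 ≤ j) : HasExp b (K + 1) ((j + 1) / 2 + 1) (loc M E (f * theta φ (nor M))) := by
  have h1 : HasExp b K ((j - 2 + 1) / 2 + 1) (loc M E (nor M * theta φ f)) := by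
    refine h _ (Ideal.mul_mem_left _ _ ?_)
    have := theta_mem_pow φ hf
    rwa [show j - 1 - 1 = j - 2 by omega] at this
  have h2 : HasExp b K ((j - 2 + 1) / 2 + 1) fun n => ct (theta φ E * (f * nor M) * nor M ^ n) :=
    HasExp.of_isBigO (ct_mul_pow_isBigO' (Ideal.mul_mem_right _ _ (hE.theta_mem_van φ)) (by omega))
  refine ((h1.neg.sub h2).div_succ.mono le_rfl (by omega)).congr fun n => ?_
  have hn : (n : ℂ) + 1 ≠ 0 := by exact_mod_cast n.succ_ne_zero
  rw [div_eq_iff hn, ← loc_by_parts, mul_comm]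

lemma IsCutoff.psi_hasExp (hE : IsCutoff M L E) (hdrift : M.ZeroDrift) {K j : ℕ}
    (hL : 2 * K + 1 ≤ L) (h : LocExp M E b K (j - 2)) (h' : LocExp M E b (K + 1) (j + 1))
    (hj : 1 ≤ j) {ω : ℂ} (hω : IsRootForm M ω) (hmu : mu M ω ≠ 0) {f : Laur}
    (hf : f ∈ maxId 1 ^ (j - 1)) :
    HasExp b (K + 1) ((j + 1) / 2 + 1) (loc M E (psi ω * f)) := by
  have h1 := hE.by_parts_hasExp hL h (linHom ω) hf hj
  have h2 := h' (f * (theta (linHom ω) (nor M) - mu M ω • psi ω)) (by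
    have := Ideal.mul_mem_mul hf (theta_nor_sub_mem M hdrift hω)
    rwa [← pow_add, show j - 1 + 2 = j + 1 by omega] at this)
  refine ((h1.sub (h2.mono le_rfl (by omega))).const_mul (mu M ω)⁻¹).congr fun n => ?_
  rw [← loc_sub, ← mul_sub, sub_sub_cancel, mul_smul_comm, loc_smul, ← mul_assoc,
    inv_mul_cancel₀ hmu, one_mul, mul_comm]

theorem IsCutoff.locExp_succ (hE : IsCutoff M L E) (hdrift : M.ZeroDrift) {K j₀ : ℕ}
    (hL : 2 * K + 2 ≤ L) (hj₀ : 1 ≤ j₀) (h : ∀ j, j₀ ≤ j + 2 → LocExp M E b K j)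
    (h0 : j₀ = 1 → LocExp M E b K 0) (j : ℕ) (hj : j₀ ≤ j) : LocExp M E b (K + 1) j := by
  by_cases hjK : 2 * (K + 1) ≤ j
  · exact fun f hf => HasExp.of_isBigO (hE.loc_isBigO hjK (by omega) hf)
  · intro f hf
    have h1 : LocExp M E b K (j - 2) := h (j - 2) (by omega)
    have h2 : LocExp M E b (K + 1) (j + 1) := hE.locExp_succ hdrift hL hj₀ h h0 (j + 1) (by omega)
    obtain ⟨i, rfl⟩ : ∃ i, j = i + 1 := ⟨j - 1, by omega⟩
    obtain ⟨a, ha, c, hc, rfl⟩ := exists_eq_psi M hf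
    refine ((hE.psi_hasExp hdrift (by omega) h1 h2 (by omega) (isRootForm_omg M)
      (mu_omg_ne_zero M) ha).add (hE.psi_hasExp hdrift (by omega) h1 h2 (by omega)
      (isRootForm_omgBar M) (mu_omgBar_ne_zero M) hc)).congr fun n => (loc_add _ _ n).symm
  termination_by 2 * K + 2 - j
  decreasing_by omega

theorem exists_diff_eq (hdrift : M.ZeroDrift) (E : Laur) :
    ∃ f ∈ maxId 1, ∃ g ∈ maxId 1 ^ 3, ∃ (φ χ : ℤ × ℤ →+ ℂ) (p q : Laur), ∀ n : ℕ,
      ((n : ℂ) + 1 + 1) * loc M E 1 (n + 1) - ((n : ℂ) + 1) * loc M E 1 n =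
        -loc M E f n - ct (theta φ E * p * nor M ^ n) - ct (theta χ E * q * nor M ^ n) -
          ((n : ℂ) + 1) * loc M E g n + loc M E (nor M - 1) n := by
  obtain ⟨a, ha, c, hc, he⟩ := exists_eq_psi (j := 1) M (nor_sub_one_mem M hdrift)
  rw [pow_one] at ha hc
  set ω := omg M
  set ω' := omgBar M
  set m := mu M ω with hm
  set m' := mu M ω' with hm'
  have hm0 : m ≠ 0 := mu_omg_ne_zero M
  have hm0' : m' ≠ 0 := mu_omgBar_ne_zero M
  have hr := theta_nor_sub_mem M hdrift (isRootForm_omg M)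
  have hr' := theta_nor_sub_mem M hdrift (isRootForm_omgBar M)
  set r := theta (linHom ω) (nor M) - m • psi ω with hrd
  set r' := theta (linHom ω') (nor M) - m' • psi ω' with hrd'
  -- the constant terms of the derivatives of the coefficients
  have hG : m⁻¹ * ev 1 (theta (linHom ω) a) + m'⁻¹ * ev 1 (theta (linHom ω') c) = 1 := by
    have hmm : m' = -m := mu_omgBar M
    have key : ev 1 (theta (linHom ω') (theta (linHom ω) (nor M))) = m * (ω' - ω) := by
      have h1 : theta (linHom ω) (nor M) = r + m • psi ω := by rw [hrd]; abel
      have h2 := theta_mem_pow (linHom ω') hr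
      rw [pow_one, mem_maxId] at h2
      rw [h1, map_add, map_add, h2, Derivation.map_smul, map_smul, ev_theta_psi, zero_add,
        smul_eq_mul]
    have h3 : nor M = 1 + (psi ω * a + psi ω' * c) := by rw [← he]; ring
    have ha0 := mem_maxId.1 ha
    have hc0 := mem_maxId.1 hc
    have hp0 := mem_maxId.1 (psi_mem ω)
    have hp0' := mem_maxId.1 (psi_mem ω')
    rw [h3] at key
    simp only [map_add, Derivation.leibniz, Derivation.map_one_eq_zero, smul_eq_mul, map_mul,
      ha0, hc0, hp0, hp0', ev_theta_psi, sub_self, zero_mul, zero_add, mul_zero,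
      add_zero] at key
    have hne : ω' - ω ≠ 0 := sub_ne_zero.2 (omg_ne_omgBar M).symm
    rw [hmm]
    field_simp
    apply mul_left_cancel₀ hne
    linear_combination key
  set G := m⁻¹ • (nor M * theta (linHom ω) a) + m'⁻¹ • (nor M * theta (linHom ω') c) with hGd
  refine ⟨G - 1, ?_, m⁻¹ • (a * r) + m'⁻¹ • (c * r'), ?_, linHom ω, linHom ω',
    m⁻¹ • (a * nor M), m'⁻¹ • (c * nor M), fun n => ?_⟩
  · rw [mem_maxId, map_sub, hGd]
    simp [ev_one_nor, hG]
  · rw [show 3 = 1 + 2 from rfl, pow_add, pow_one]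
    exact add_mem (smul_mem_ideal _ _ (Ideal.mul_mem_mul ha hr))
      (smul_mem_ideal _ _ (Ideal.mul_mem_mul hc hr'))
  · have e1 := loc_by_parts (M := M) (E := E) (linHom ω) a n
    have e2 := loc_by_parts (M := M) (E := E) (linHom ω') c n
    have h1 : theta (linHom ω) (nor M) = r + m • psi ω := by rw [hrd]; abel
    have h1' : theta (linHom ω') (nor M) = r' + m' • psi ω' := by rw [hrd']; abel
    rw [h1, mul_add, mul_smul_comm, loc_add, loc_smul] at e1
    rw [h1', mul_add, mul_smul_comm, loc_add, loc_smul] at e2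
    have e3 : loc M E (nor M - 1) n = loc M E (a * psi ω) n + loc M E (c * psi ω') n := by
      rw [he, loc_add, mul_comm a, mul_comm c]
    have e4 : loc M E 1 (n + 1) = loc M E 1 n + loc M E (nor M - 1) n := by
      rw [loc_succ, mul_one, loc_sub]
      ring
    rw [e4, e3, hGd, loc_sub, loc_add, loc_add, loc_smul, loc_smul, loc_smul, loc_smul]
    simp only [mul_smul_comm, smul_mul_assoc, map_smul, smul_eq_mul]
    have i1 : m * m⁻¹ = 1 := mul_inv_cancel₀ hm0
    have i2 : m' * m'⁻¹ = 1 := mul_inv_cancel₀ hm0'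
    linear_combination m⁻¹ * e1 + m'⁻¹ * e2 -
      ((n : ℂ) + 1) * loc M E (a * psi ω) n * i1 - ((n : ℂ) + 1) * loc M E (c * psi ω') n * i2

lemma IsCutoff.diff_hasExp (hE : IsCutoff M L E) (hdrift : M.ZeroDrift) {K : ℕ}
    (hL : 2 * K + 4 ≤ L) (h : ∀ j, LocExp M E b K j) :
    (∀ j, 1 ≤ j → LocExp M E b (K + 1) j) ∧
    HasExp b (K + 1) 2 fun n : ℕ => (((n + 1 : ℕ) : ℂ) + 1) * loc M E 1 (n + 1) -
      ((n : ℂ) + 1) * loc M E 1 n := by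
  have h1 : ∀ j, 1 ≤ j → LocExp M E b (K + 1) j :=
    hE.locExp_succ hdrift (j₀ := 1) (by omega) le_rfl (fun j _ => h j) fun _ => h 0
  have h3 : ∀ j, 3 ≤ j → LocExp M E b (K + 2) j :=
    hE.locExp_succ hdrift (j₀ := 3) (by omega) (by omega) (fun j hj => h1 j (by omega)) (by omega)
  refine ⟨h1, ?_⟩
  obtain ⟨f, hf, g, hg, φ, χ, p, q, hd⟩ := exists_diff_eq hdrift E
  have e1 : HasExp b (K + 1) 2 (loc M E f) := h1 1 le_rfl f (by simpa using hf)
  have e2 : ∀ (φ : ℤ × ℤ →+ ℂ) (p : Laur), HasExp b (K + 1) 2 fun n =>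
      ct (theta φ E * p * nor M ^ n) := fun φ p =>
    HasExp.of_isBigO (ct_mul_pow_isBigO' (Ideal.mul_mem_right _ _ (hE.theta_mem_van φ)) (by omega))
  have e3 : HasExp b (K + 1) 2 fun n => ((n : ℂ) + 1) * loc M E g n :=
    HasExp.mul_succ (h3 3 le_rfl g hg)
  have e4 : HasExp b (K + 1) 2 (loc M E (nor M - 1)) :=
    h1 2 (by omega) _ (nor_sub_one_mem M hdrift)
  refine ((((e1.neg.sub (e2 φ p)).sub (e2 χ q)).sub e3).add e4).congr fun n => ?_
  push_cast
  exact (hd n).symm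

lemma locExp_of_one {K : ℕ} (h : ∀ j, 1 ≤ j → LocExp M E b K j) (h1 : HasExp b K 1 (loc M E 1))
    (j : ℕ) : LocExp M E b K j := by
  rcases Nat.eq_zero_or_pos j with rfl | hj
  · intro f _
    have h2 := h 1 le_rfl (f - ev 1 f • (1 : Laur)) (by simpa using sub_ev_mem 1 f)
    refine ((h2.mono le_rfl (by omega)).add (h1.const_mul (ev 1 f))).congr fun n => ?_
    rw [loc_sub, loc_smul]
    ring
  · exact h j hj

theorem IsCutoff.exists_locExp (hE : IsCutoff M L E) (hdrift : M.ZeroDrift) (hL : 6 ≤ L) :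
    ∃ b : ℂ, Tendsto (fun n : ℕ => ((n : ℂ) + 1) * loc M E 1 n) atTop (nhds b) ∧
      ∀ K, 2 * K + 2 ≤ L → ∀ j, LocExp M E b K j := by
  have base : ∀ b j, LocExp M E b 0 j := fun b j f hf =>
    HasExp.of_isBigO (hE.loc_isBigO (by omega) (by omega) hf)
  have base1 : ∀ j, LocExp M E 0 1 j := by
    obtain ⟨h1, h2⟩ := hE.diff_hasExp hdrift (K := 0) (by omega) (base 0)
    refine locExp_of_one h1 ?_
    obtain ⟨R, -, h2⟩ := h2
    have h3 := isBigO_of_diff_err_one (A := fun n : ℕ => ((n : ℂ) + 1) * loc M E 1 n)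
      (by simpa using h2)
    refine (HasExp.of_isBigO h3).div_succ.congr fun n => ?_
    have hn : (n : ℂ) + 1 ≠ 0 := by exact_mod_cast n.succ_ne_zero
    rw [mul_div_cancel_left₀ _ hn]
  obtain ⟨b, hb⟩ : ∃ b : ℂ, Tendsto (fun n : ℕ => ((n : ℂ) + 1) * loc M E 1 n) atTop (nhds b) := by
    obtain ⟨h1, R, -, h2⟩ := hE.diff_hasExp hdrift (K := 1) (by omega) base1
    obtain ⟨l, hl, -⟩ := exists_limit_of_diff (K := 0)
      (A := fun n : ℕ => ((n : ℂ) + 1) * loc M E 1 n) (by simpa using h2)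
    exact ⟨l, hl⟩
  refine ⟨b, hb, fun K => ?_⟩
  induction K with
  | zero => exact fun _ => base b
  | succ K ih =>
    intro hK
    rcases K with _ | K
    · intro j f hf
      obtain ⟨R, -, h⟩ := base1 j f hf
      exact HasExp.of_isBigO (by simpa using h)
    · obtain ⟨h1, h2⟩ := hE.diff_hasExp hdrift (K := K + 1) (by omega) (ih (by omega))
      refine locExp_of_one h1 ?_
      refine (HasExp.of_diff (A := fun n : ℕ => ((n : ℂ) + 1) * loc M E 1 n) h2 hb).div_succ.congr
        fun n => ?_
      have hn : (n : ℂ) + 1 ≠ 0 := by exact_mod_cast n.succ_ne_zero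
      rw [mul_div_cancel_left₀ _ hn]

end

end OrbitSum

end

noncomputable section

namespace OrbitSum

/-! ### Laurent series -/

section LaurentSeries

variable {R R' : Type} [CommRing R] [CommRing R']

/-- The additive map of Laurent series given by a family of maps of the coefficients. -/
def coefMap (D : ℤ → R →+ R) : LaurentSeries R →+ LaurentSeries R where
  toFun f :=
    { coeff := fun n => D n (f.coeff n)
      isPWO_support' := f.isPWO_support.mono fun n hn => by
        contrapose! hn
        simp only [HahnSeries.mem_support, not_not] at hn
        simp [hn] }
  map_zero' := by ext n; simp
  map_add' f g := by ext n; simp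

lemma coeff_coefMap (D : ℤ → R →+ R) (f : LaurentSeries R) (n : ℤ) :
    (coefMap D f).coeff n = D n (f.coeff n) := rfl

lemma coefMap_mul (D : ℤ → R →+ R)
    (hD : ∀ i j f g, D (i + j) (f * g) = f * D j g + g * D i f) (f g : LaurentSeries R) :
    coefMap D (f * g) = f * coefMap D g + g * coefMap D f := by
  have hs : ∀ f : LaurentSeries R, (coefMap D f).support ⊆ f.support := by
    intro f n hn
    contrapose! hn
    simp only [HahnSeries.mem_support, not_not, coeff_coefMap] at hn ⊢
    simp [hn]
  ext n
  rw [HahnSeries.coeff_add, coeff_coefMap]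
  rw [mul_comm g, HahnSeries.coeff_mul_right' g.isPWO_support (hs g),
    HahnSeries.coeff_mul_left' f.isPWO_support (hs f), HahnSeries.coeff_mul, map_sum,
    ← Finset.sum_add_distrib]
  refine Finset.sum_congr rfl fun ij hij => ?_
  rw [Finset.mem_antidiagonal] at hij
  rw [← hij.2.2, hD, coeff_coefMap, coeff_coefMap]
  ring

/-- Multiplication of the coefficients by their index. -/
def eulerMap (R : Type) [CommRing R] : LaurentSeries R →+ LaurentSeries R :=
  coefMap fun n => zsmulAddGroupHom n

lemma coeff_eulerMap (f : LaurentSeries R) (n : ℤ) : (eulerMap R f).coeff n = n • f.coeff n := rfl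

lemma eulerMap_mul (f g : LaurentSeries R) :
    eulerMap R (f * g) = f * eulerMap R g + g * eulerMap R f := by
  refine coefMap_mul _ (fun i j f g => ?_) f g
  simp only [zsmulAddGroupHom_apply, add_smul, mul_smul_comm]
  rw [mul_comm g, add_comm]

/-- The action of a ring homomorphism on the coefficients. -/
def serHom (σ : R →+* R') : LaurentSeries R →+* LaurentSeries R' where
  toFun f := HahnSeries.map f σ
  map_one' := HahnSeries.map_one σ.toMonoidWithZeroHom
  map_mul' f g := HahnSeries.map_mul (σ : R →ₙ+* R')
  map_zero' := by ext; simp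
  map_add' f g := by ext; simp

lemma coeff_C_mul (r : R) (f : LaurentSeries R) (n : ℤ) :
    ((HahnSeries.C r : LaurentSeries R) * f).coeff n = r * f.coeff n :=
  HahnSeries.coeff_single_zero_mul

end LaurentSeries

open scoped RatFunc in
/-- The Laurent expansion of rational functions. -/
def ratSer (F : Type) [Field F] : RatFunc F →+* LaurentSeries F := algebraMap _ _

lemma ratSer_X (F : Type) [Field F] : ratSer F RatFunc.X = HahnSeries.single 1 1 := RatFunc.coe_X

open scoped RatFunc in
lemma ratSer_C {F : Type} [Field F] (a : F) : ratSer F (RatFunc.C a) = HahnSeries.C a := by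
  have h1 : RatFunc.C a = algebraMap (Polynomial F) (RatFunc F) (Polynomial.C a) :=
    (RatFunc.algebraMap_C a).symm
  rw [ratSer, h1, ← IsScalarTower.algebraMap_apply]
  simp

/-! ### Iterated Laurent series -/

/-- The field `ℂ((x))((y))`. -/
def FF : Type := LaurentSeries (LaurentSeries ℂ)

instance : Field FF := inferInstanceAs (Field (LaurentSeries (LaurentSeries ℂ)))

/-- The coefficients of an iterated Laurent series. -/
def cf (f : FF) (z : ℤ × ℤ) : ℂ :=
  ((f : LaurentSeries (LaurentSeries ℂ)).coeff z.2).coeff z.1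

lemma FF_ext {f g : FF} (h : ∀ z, cf f z = cf g z) : f = g :=
  HahnSeries.ext (funext fun j => HahnSeries.ext (funext fun i => h (i, j)))

@[simp] lemma cf_add (f g : FF) (z : ℤ × ℤ) : cf (f + g) z = cf f z + cf g z := rfl

@[simp] lemma cf_zero (z : ℤ × ℤ) : cf 0 z = 0 := rfl

/-- The derivation `x ∂/∂x`. -/
def thX : FF →+ FF := (coefMap fun _ => eulerMap ℂ : LaurentSeries (LaurentSeries ℂ) →+ _)

/-- The derivation `y ∂/∂y`. -/
def thY : FF →+ FF := eulerMap (LaurentSeries ℂ)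

lemma thX_mul (f g : FF) : thX (f * g) = f * thX g + g * thX f :=
  coefMap_mul _ (fun _ _ => eulerMap_mul) (f : LaurentSeries (LaurentSeries ℂ)) g

lemma thY_mul (f g : FF) : thY (f * g) = f * thY g + g * thY f :=
  eulerMap_mul (f : LaurentSeries (LaurentSeries ℂ)) g

lemma cf_thX (f : FF) (z : ℤ × ℤ) : cf (thX f) z = z.1 * cf f z :=
  zsmul_eq_mul _ _

lemma cf_thY (f : FF) (z : ℤ × ℤ) : cf (thY f) z = z.2 * cf f z := by
  rw [← zsmul_eq_mul]
  exact congrFun (congrArg HahnSeries.coeff (coeff_eulerMap (R := LaurentSeries ℂ) f z.2)) z.1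

/-- The coefficient of `x ^ 0 * y ^ 0`. -/
def ctF : FF →+ ℂ where
  toFun f := cf f 0
  map_zero' := rfl
  map_add' _ _ := rfl

lemma ctF_thX (f : FF) : ctF (thX f) = 0 := by
  change cf (thX f) 0 = 0
  simp [cf_thX]

lemma ctF_thY (f : FF) : ctF (thY f) = 0 := by
  change cf (thY f) 0 = 0
  simp [cf_thY]

/-- The constants of the field `ℂ((x))((y))`. -/
def constF : ℂ →+* FF :=
  ((HahnSeries.C : _ →+* LaurentSeries (LaurentSeries ℂ)).comp
    (HahnSeries.C : ℂ →+* LaurentSeries ℂ))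

lemma cf_constF_mul (c : ℂ) (f : FF) (z : ℤ × ℤ) : cf (constF c * f) z = c * cf f z := by
  have h := coeff_C_mul (HahnSeries.C c : LaurentSeries ℂ) f z.2
  exact (congrFun (congrArg HahnSeries.coeff h) z.1).trans (coeff_C_mul c _ _)

/-- Monomials as iterated Laurent series. -/
def monF : Multiplicative (ℤ × ℤ) →* LaurentSeries (LaurentSeries ℂ) where
  toFun z := HahnSeries.single z.toAdd.2 (HahnSeries.single z.toAdd.1 (1 : ℂ))
  map_one' := rfl
  map_mul' z w := by simp [HahnSeries.single_mul_single]

/-- Laurent polynomials as iterated Laurent series. -/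
def emb : Laur →+* FF :=
  AddMonoidAlgebra.liftNCRingHom ((HahnSeries.C : _ →+* LaurentSeries (LaurentSeries ℂ)).comp
    (HahnSeries.C : ℂ →+* LaurentSeries ℂ)) monF fun _ _ => mul_comm _ _

lemma emb_single (z : ℤ × ℤ) (c : ℂ) : emb (AddMonoidAlgebra.single z c) =
    constF c * (show FF from monF (Multiplicative.ofAdd z)) :=
  AddMonoidAlgebra.liftNC_single _ _ _ _

lemma emb_mon (z : ℤ × ℤ) : emb (mon z) = (monF (Multiplicative.ofAdd z) : FF) := by
  rw [mon, emb_single, map_one, one_mul]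

lemma emb_smul (c : ℂ) (f : Laur) : emb (c • f) = constF c * emb f := by
  induction f using laur_induction with
  | hmon z => rw [smul_mon, emb_single, emb_mon]
  | hadd f g hf hg => rw [smul_add, map_add, map_add, hf, hg, mul_add]
  | hsmul d f hf =>
    have h1 : ∀ (d : ℂ) (f : Laur), emb (d • f) = emb (d • (1 : Laur)) * emb f := fun d f => by
      rw [← map_mul, smul_mul_assoc, one_mul]
    have h2 : ∀ d : ℂ, emb (d • (1 : Laur)) = constF d := fun d => by
      rw [← mon_zero, smul_mon, emb_single]
      exact mul_one _
    rw [h1, h2]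

lemma cf_emb (f : Laur) (z : ℤ × ℤ) : cf (emb f) z = f.coeff z := by
  induction f using laur_induction with
  | hmon w =>
    rw [emb_mon, mon, AddMonoidAlgebra.coeff_single, Finsupp.single_apply]
    change ((HahnSeries.single w.2 (HahnSeries.single w.1 (1 : ℂ))).coeff z.2).coeff z.1 = _
    rw [HahnSeries.coeff_single]
    by_cases h : z.2 = w.2
    · rw [if_pos h, HahnSeries.coeff_single]
      by_cases h' : z.1 = w.1
      · rw [if_pos h', if_pos (Prod.ext h'.symm h.symm)]
      · rw [if_neg h', if_neg fun h => h' (by rw [h])]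
    · rw [if_neg h, if_neg fun h' => h (by rw [h'])]
      simp
  | hadd f g hf hg => simp [hf, hg]
  | hsmul c f hf => simp [emb_smul, cf_constF_mul, hf]

lemma emb_injective : Function.Injective emb := by
  intro f g h
  ext z
  rw [← cf_emb, ← cf_emb, h]

lemma emb_eq_zero {f : Laur} : emb f = 0 ↔ f = 0 := map_eq_zero_iff emb emb_injective

lemma coeff_zero_eq_ct (f : Laur) : f.coeff 0 = ct f := by
  have := ct_mon_mul 0 f
  rwa [neg_zero, mon_zero, one_mul, eq_comm] at this

lemma ctF_emb (f : Laur) : ctF (emb f) = ct f := (cf_emb f 0).trans (coeff_zero_eq_ct f)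

lemma ctF_constF_mul (c : ℂ) (f : FF) : ctF (constF c * f) = c * ctF f := cf_constF_mul c f 0

lemma thX_emb (f : Laur) : thX (emb f) = emb (theta fstHom f) := by
  refine FF_ext fun z => ?_
  rw [cf_thX, cf_emb, cf_emb]
  induction f using laur_induction with
  | hmon w =>
    rw [theta_mon]
    simp only [mon, AddMonoidAlgebra.coeff_smul, AddMonoidAlgebra.coeff_single, Finsupp.smul_apply,
      Finsupp.single_apply, fstHom_apply, smul_eq_mul]
    split_ifs with h
    · rw [h]
    · simp
  | hadd f g hf hg => simp [mul_add, hf, hg]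
  | hsmul c f hf =>
    simp only [Derivation.map_smul, AddMonoidAlgebra.coeff_smul, Finsupp.smul_apply, smul_eq_mul,
      ← hf]
    ring

lemma thY_emb (f : Laur) : thY (emb f) = emb (theta sndHom f) := by
  refine FF_ext fun z => ?_
  rw [cf_thY, cf_emb, cf_emb]
  induction f using laur_induction with
  | hmon w =>
    rw [theta_mon]
    simp only [mon, AddMonoidAlgebra.coeff_smul, AddMonoidAlgebra.coeff_single, Finsupp.smul_apply,
      Finsupp.single_apply, sndHom_apply, smul_eq_mul]
    split_ifs with h
    · rw [h]
    · simp
  | hadd f g hf hg => simp [mul_add, hf, hg]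
  | hsmul c f hf =>
    simp only [Derivation.map_smul, AddMonoidAlgebra.coeff_smul, Finsupp.smul_apply, smul_eq_mul,
      ← hf]
    ring

lemma leibniz_zpow_of_leibniz {K : Type} [Field K] (d : K →+ K)
    (h : ∀ a b, d (a * b) = a * d b + b * d a) (a : K) (n : ℤ) :
    d (a ^ n) = n * (a ^ (n - 1) * d a) := by
  have := Derivation.leibniz_zpow (Derivation.mk' d.toIntLinearMap h : Derivation ℤ K K) a n
  have e : ∀ x, (Derivation.mk' d.toIntLinearMap h : Derivation ℤ K K) x = d x := fun _ => rfl
  rw [e, e, smul_eq_mul, zsmul_eq_mul] at this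
  exact this

/-- The Jacobian derivation `f ↦ ∂(f, s) / ∂(log x, log y)`. -/
def jac (s f : Laur) : Laur :=
  theta fstHom f * theta sndHom s - theta sndHom f * theta fstHom s

theorem ctF_jac_mul (s D : Laur) (j : ℤ) (n : ℕ) :
    ctF (emb (jac s D) * emb D ^ j * emb s ^ n) = 0 := by
  have hx := leibniz_zpow_of_leibniz thX thX_mul (emb s) ((n + 1 : ℕ) : ℤ)
  have hy := leibniz_zpow_of_leibniz thY thY_mul (emb s) ((n + 1 : ℕ) : ℤ)
  rw [zpow_natCast, show ((n + 1 : ℕ) : ℤ) - 1 = (n : ℤ) by push_cast; ring, zpow_natCast] at hx hy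
  have hn : (n : ℂ) + 1 ≠ 0 := by exact_mod_cast n.succ_ne_zero
  have hcomm : thY (thX (emb D)) = thX (thY (emb D)) := by
    rw [thX_emb, thY_emb, thY_emb, thX_emb, theta_comm]
  have key : constF ((n : ℂ) + 1) * (emb (jac s D) * emb D ^ j * emb s ^ n) =
      thY (thX (emb D) * emb D ^ j * emb s ^ (n + 1)) -
      thX (thY (emb D) * emb D ^ j * emb s ^ (n + 1)) := by
    rw [thY_mul, thY_mul, thX_mul, thX_mul, hx, hy, leibniz_zpow_of_leibniz thX thX_mul,
      leibniz_zpow_of_leibniz thY thY_mul, hcomm, jac, map_sub, map_mul, map_mul,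
      ← thX_emb, ← thY_emb, ← thX_emb, ← thY_emb, map_add, map_natCast, map_one]
    push_cast
    ring
  have h2 := congrArg ctF key
  rw [ctF_constF_mul, map_sub, ctF_thX, ctF_thY, sub_zero] at h2
  exact (mul_eq_zero.1 h2).resolve_left hn

theorem ctF_jac_mul_aeval (s D : Laur) (j : ℤ) (p : Polynomial ℂ) :
    ctF (emb (jac s D) * emb D ^ j * emb (Polynomial.aeval s p)) = 0 := by
  rw [Polynomial.aeval_eq_sum_range, map_sum, Finset.mul_sum, map_sum]
  refine Finset.sum_eq_zero fun i _ => ?_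
  rw [emb_smul, map_pow, mul_left_comm, ctF_constF_mul, ctF_jac_mul, mul_zero]

/-! ### Rational functions as iterated Laurent series -/

/-- `ℝ(x) → ℂ((x))`. -/
def ratEmb₁ : RatFunc ℝ →+* LaurentSeries ℂ := (serHom Complex.ofRealHom).comp (ratSer ℝ)

/-- `ℝ(x, y) → ℂ((x))((y))`. -/
def ratEmb : StepModel.RatXY →+* FF := (serHom ratEmb₁).comp (ratSer (RatFunc ℝ))

lemma cf_ratEmb (f : StepModel.RatXY) (z : ℤ × ℤ) :
    cf (ratEmb f) z = (StepModel.coeffXY f z.1 z.2 : ℂ) := rfl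

lemma ratEmb_C (f : RatFunc ℝ) : ratEmb (RatFunc.C f) = (HahnSeries.C (ratEmb₁ f) :
    LaurentSeries (LaurentSeries ℂ)) := by
  refine HahnSeries.ext (funext fun j => ?_)
  change ratEmb₁ ((ratSer (RatFunc ℝ) (RatFunc.C f)).coeff j) = _
  rw [ratSer_C, HahnSeries.C_apply, HahnSeries.C_apply, HahnSeries.coeff_single,
    HahnSeries.coeff_single]
  split_ifs <;> simp

lemma ratEmb₁_C (c : ℝ) : ratEmb₁ (RatFunc.C c) = HahnSeries.C (c : ℂ) := by
  refine HahnSeries.ext (funext fun j => ?_)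
  change Complex.ofRealHom ((ratSer ℝ (RatFunc.C c)).coeff j) = _
  rw [ratSer_C, HahnSeries.C_apply, HahnSeries.C_apply, HahnSeries.coeff_single,
    HahnSeries.coeff_single]
  split_ifs <;> simp

lemma ratEmb₁_X : ratEmb₁ RatFunc.X = HahnSeries.single 1 1 := by
  refine HahnSeries.ext (funext fun j => ?_)
  change Complex.ofRealHom ((ratSer ℝ RatFunc.X).coeff j) = _
  rw [ratSer_X, HahnSeries.coeff_single, HahnSeries.coeff_single]
  split_ifs <;> simp

lemma ratEmb_X : ratEmb StepModel.ratX = emb (mon (1, 0)) := by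
  rw [StepModel.ratX, ratEmb_C, ratEmb₁_X, emb_mon]
  rfl

lemma ratEmb_Y : ratEmb StepModel.ratY = emb (mon (0, 1)) := by
  rw [emb_mon]
  refine HahnSeries.ext (funext fun j => ?_)
  change ratEmb₁ ((ratSer (RatFunc ℝ) RatFunc.X).coeff j) =
    (HahnSeries.single (1 : ℤ) (HahnSeries.single (0 : ℤ) (1 : ℂ))).coeff j
  rw [ratSer_X, HahnSeries.coeff_single, HahnSeries.coeff_single]
  split_ifs
  · rw [map_one]; rfl
  · simp

lemma ratEmb_algebraMap (c : ℝ) :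
    ratEmb (algebraMap ℝ StepModel.RatXY c) = constF (c : ℂ) := by
  have h : algebraMap ℝ StepModel.RatXY c = RatFunc.C (RatFunc.C c) := by
    rw [IsScalarTower.algebraMap_apply ℝ (RatFunc ℝ) StepModel.RatXY, RatFunc.algebraMap_eq_C,
      RatFunc.algebraMap_eq_C]
  rw [h, ratEmb_C, ratEmb₁_C]
  rfl

end OrbitSum

end

noncomputable section

namespace OrbitSum

variable (M : StepModel)

/-! ### Series that behave like Laurent polynomials -/

/-- The value of a polynomial at the normalised step polynomial. -/
def pS (p : Polynomial ℂ) : Laur := Polynomial.aeval (nor M) p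

lemma pS_mul (p q : Polynomial ℂ) : pS M (p * q) = pS M p * pS M q := map_mul _ _ _

lemma pS_one : pS M 1 = 1 := map_one _

/-- `F` is tame if, for a polynomial `q ≠ 0`, the series `q(S) F` agrees to any order at the
periods with a Laurent polynomial `f` such that the constant terms of `q(S) F p(S)` and `f p(S)`
coincide for all polynomials `p`. -/
def Tame (F : FF) : Prop :=
  ∃ q : Polynomial ℂ, q ≠ 0 ∧ ∀ N : ℕ, ∃ f b v : Laur, (∀ w ∈ per M, ev w b ≠ 0) ∧
    (∀ p, ctF (emb (pS M q) * F * emb (pS M p)) = ct (f * pS M p)) ∧ v ∈ van M N ∧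
    emb b * (emb (pS M q) * F - emb f) = emb v

namespace Tame

variable {M} {F G : FF}

lemma add (hF : Tame M F) (hG : Tame M G) : Tame M (F + G) := by
  obtain ⟨q, hq, h⟩ := hF
  obtain ⟨r, hr, h'⟩ := hG
  refine ⟨q * r, mul_ne_zero hq hr, fun N => ?_⟩
  obtain ⟨f, b, v, hb, hct, hv, he⟩ := h N
  obtain ⟨g, c, u, hc, hct', hu, he'⟩ := h' N
  refine ⟨pS M r * f + pS M q * g, b * c, pS M r * c * v + pS M q * b * u,
    fun w hw => ?_, fun p => ?_, ?_, ?_⟩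
  · rw [map_mul]
    exact mul_ne_zero (hb w hw) (hc w hw)
  · have h1 := hct (r * p)
    have h2 := hct' (q * p)
    rw [pS_mul, map_mul emb] at h1 h2
    have e1 : emb (pS M (q * r)) * (F + G) * emb (pS M p) =
        emb (pS M q) * F * (emb (pS M r) * emb (pS M p)) +
        emb (pS M r) * G * (emb (pS M q) * emb (pS M p)) := by
      rw [pS_mul, map_mul]
      ring
    have e2 : (pS M r * f + pS M q * g) * pS M p =
        f * (pS M r * pS M p) + g * (pS M q * pS M p) := by
      ring
    rw [e1, e2, map_add, map_add, h1, h2]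
  · exact add_mem (Ideal.mul_mem_left _ _ hv) (Ideal.mul_mem_left _ _ hu)
  · simp only [pS_mul, map_mul, map_add]
    linear_combination emb (pS M r) * emb c * he + emb (pS M q) * emb b * he'

lemma mul_pS (r : Polynomial ℂ) (hF : Tame M F) : Tame M (emb (pS M r) * F) := by
  obtain ⟨q, hq, h⟩ := hF
  refine ⟨q, hq, fun N => ?_⟩
  obtain ⟨f, b, v, hb, hct, hv, he⟩ := h N
  refine ⟨pS M r * f, b, pS M r * v, hb, fun p => ?_, Ideal.mul_mem_left _ _ hv, ?_⟩
  · have h1 := hct (r * p)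
    rw [pS_mul, map_mul emb] at h1
    rw [show emb (pS M q) * (emb (pS M r) * F) * emb (pS M p) =
      emb (pS M q) * F * (emb (pS M r) * emb (pS M p)) by ring, h1]
    congr 1
    ring
  · simp only [map_mul]
    linear_combination emb (pS M r) * he

lemma of_mul_pS {r : Polynomial ℂ} (hr : r ≠ 0) (hF : Tame M (emb (pS M r) * F)) : Tame M F := by
  obtain ⟨q, hq, h⟩ := hF
  refine ⟨q * r, mul_ne_zero hq hr, fun N => ?_⟩
  obtain ⟨f, b, v, hb, hct, hv, he⟩ := h N
  rw [pS_mul, map_mul]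
  simp only [mul_assoc] at hct he ⊢
  exact ⟨f, b, v, hb, hct, hv, he⟩

lemma neg (hF : Tame M F) : Tame M (-F) := by
  have := hF.mul_pS (-1)
  rwa [pS, map_neg, map_one, map_neg, map_one, neg_one_mul] at this

lemma sub (hF : Tame M F) (hG : Tame M G) : Tame M (F - G) := by
  rw [sub_eq_add_neg]
  exact hF.add hG.neg

variable (M) in
lemma of_emb (f : Laur) : Tame M (emb f) := by
  refine ⟨1, one_ne_zero, fun N => ⟨f, 1, 0, fun w _ => by simp, fun p => ?_, zero_mem _, ?_⟩⟩
  · rw [pS_one, map_one, one_mul, ← map_mul, ctF_emb]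
  · simp [pS_one]

theorem of_jac {D : Laur} (hD : ∀ w ∈ per M, ev w D ≠ 0) (m : ℕ) :
    Tame M (emb (jac (nor M) D) * (emb D ^ (m + 1))⁻¹) := by
  have := finite_per M
  have := Fintype.ofFinite (per M)
  have hD0 : emb D ≠ 0 := by
    rw [Ne, emb_eq_zero]
    rintro rfl
    exact hD 1 (one_mem _) (map_zero _)
  refine ⟨1, one_ne_zero, fun N => ?_⟩
  obtain ⟨A, B, hAB⟩ : IsCoprime (Polynomial.X ^ (m + 1) : Polynomial ℂ)
      (∏ w : per M, (Polynomial.X - Polynomial.C (ev (w : Tor) D)) ^ N) := by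
    refine IsCoprime.prod_right fun w _ => IsCoprime.pow ?_
    have h := Polynomial.isCoprime_X_sub_C_of_isUnit_sub (R := ℂ) (a := 0) (b := ev (w : Tor) D)
      (by rw [zero_sub]; exact (neg_ne_zero.2 (hD w w.2)).isUnit)
    simpa using h
  have hAB' := congrArg (Polynomial.aeval D) hAB
  simp only [map_add, map_mul, map_pow, Polynomial.aeval_X, map_one, map_prod, map_sub,
    Polynomial.aeval_C] at hAB'
  set W := ∏ w : per M, (D - algebraMap ℂ Laur (ev (w : Tor) D)) ^ N with hW
  refine ⟨Polynomial.aeval D A * jac (nor M) D, D ^ (m + 1),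
    jac (nor M) D * (Polynomial.aeval D B * W), fun w hw => ?_, fun p => ?_, ?_, ?_⟩
  · rw [map_pow]
    exact pow_ne_zero _ (hD w hw)
  · rw [pS_one, map_one, one_mul, ← zpow_natCast, ← zpow_neg, pS, ctF_jac_mul_aeval, ← ctF_emb,
      Polynomial.aeval_eq_sum_range, Finset.sum_mul, Finset.sum_mul, map_sum, map_sum, eq_comm]
    refine Finset.sum_eq_zero fun i _ => ?_
    have h := ctF_jac_mul_aeval (nor M) D i p
    rw [zpow_natCast, ← map_pow, ← map_mul, ← map_mul] at h
    rw [smul_mul_assoc, smul_mul_assoc, emb_smul, ctF_constF_mul, mul_comm (D ^ i), h, mul_zero]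
  · refine Ideal.mul_mem_left _ _ (Ideal.mul_mem_left _ _ ((mem_van M).2 fun w hw => ?_))
    have h1 : D - algebraMap ℂ Laur (ev w D) ∈ maxId w := by
      rw [mem_maxId, map_sub, AlgHom.commutes]
      simp
    exact Ideal.mem_of_dvd _ (Finset.dvd_prod_of_mem _ (Finset.mem_univ (⟨w, hw⟩ : per M)))
      (Ideal.pow_mem_pow h1 N)
  · rw [pS_one, map_one, one_mul]
    have h := congrArg emb hAB'
    simp only [map_add, map_mul, map_pow, map_one] at h
    simp only [map_mul, map_pow]
    have h2 : emb D ^ (m + 1) * (emb D ^ (m + 1))⁻¹ = 1 := mul_inv_cancel₀ (pow_ne_zero _ hD0)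
    linear_combination emb (jac (nor M) D) * h2 + (- emb (jac (nor M) D)) * h

end Tame

/-! ### Residues along a curve -/

section Residue

variable {M} {κ : Type} [Field κ] [Algebra ℂ κ] (π : Laur →ₐ[ℂ] κ)

/-- The series `X` is regular on the curve given by `π`, with residue `ξ`. -/
def Res (X : FF) (ξ : κ) : Prop :=
  ∃ a b : Laur, π b ≠ 0 ∧ emb b * X = emb a ∧ ξ * π b = π a

namespace Res

variable {π} {X Y : FF} {ξ η : κ}

lemma of_emb (f : Laur) : Res π (emb f) (π f) := ⟨f, 1, by simp, by simp, by simp⟩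

lemma of_const (c : ℂ) : Res π (constF c) (algebraMap ℂ κ c) := by
  have h1 : emb (c • (1 : Laur)) = constF c := by rw [emb_smul, map_one, mul_one]
  have h2 : π (c • (1 : Laur)) = algebraMap ℂ κ c := by
    rw [map_smul, map_one, Algebra.algebraMap_eq_smul_one]
  rw [← h1, ← h2]
  exact of_emb _

lemma add (hX : Res π X ξ) (hY : Res π Y η) : Res π (X + Y) (ξ + η) := by
  obtain ⟨a, b, hb, h, h'⟩ := hX
  obtain ⟨c, d, hd, k, k'⟩ := hY
  refine ⟨a * d + c * b, b * d, by rw [map_mul]; exact mul_ne_zero hb hd, ?_, ?_⟩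
  · simp only [map_mul, map_add]
    linear_combination emb d * h + emb b * k
  · simp only [map_mul, map_add]
    linear_combination π d * h' + π b * k'

lemma mul (hX : Res π X ξ) (hY : Res π Y η) : Res π (X * Y) (ξ * η) := by
  obtain ⟨a, b, hb, h, h'⟩ := hX
  obtain ⟨c, d, hd, k, k'⟩ := hY
  refine ⟨a * c, b * d, by rw [map_mul]; exact mul_ne_zero hb hd, ?_, ?_⟩
  · simp only [map_mul]
    rw [← h, ← k]
    ring
  · simp only [map_mul]
    rw [← h', ← k']
    ring

lemma inv (hX : Res π X ξ) (hξ : ξ ≠ 0) : Res π X⁻¹ ξ⁻¹ := by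
  obtain ⟨a, b, hb, h, h'⟩ := hX
  have ha : π a ≠ 0 := by
    rw [← h']
    exact mul_ne_zero hξ hb
  have hX0 : X ≠ 0 := by
    rintro rfl
    rw [mul_zero, eq_comm, emb_eq_zero] at h
    rw [h, map_zero] at ha
    exact ha rfl
  refine ⟨b, a, ha, ?_, ?_⟩
  · rw [← h, mul_inv_cancel_right₀ hX0]
  · rw [← h', inv_mul_cancel_left₀ hξ]

lemma pow (hX : Res π X ξ) (n : ℕ) : Res π (X ^ n) (ξ ^ n) := by
  induction n with
  | zero => simpa using of_const (π := π) 1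
  | succ n ih =>
    rw [pow_succ, pow_succ]
    exact ih.mul hX

lemma zpow (hX : Res π X ξ) (hξ : ξ ≠ 0) (n : ℤ) : Res π (X ^ n) (ξ ^ n) := by
  obtain ⟨n, rfl | rfl⟩ := n.eq_nat_or_neg
  · rw [zpow_natCast, zpow_natCast]
    exact hX.pow n
  · rw [zpow_neg, zpow_neg, zpow_natCast, zpow_natCast]
    exact (hX.pow n).inv (pow_ne_zero _ hξ)

lemma sum {ι : Type} (s : Finset ι) {X : ι → FF} {ξ : ι → κ} (h : ∀ i ∈ s, Res π (X i) (ξ i)) :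
    Res π (∑ i ∈ s, X i) (∑ i ∈ s, ξ i) := by
  classical
  induction s using Finset.induction_on with
  | empty => simpa using of_const (π := π) 0
  | insert i s hi ih =>
    rw [Finset.sum_insert hi, Finset.sum_insert hi]
    exact (h i (Finset.mem_insert_self _ _)).add
      (ih fun j hj => h j (Finset.mem_insert_of_mem hj))

end Res

/-- `∑ c_i ξ ^ i` over `-1 ≤ i ≤ 1`. -/
def triv (c : ℤ → ℂ) (ξ : κ) : κ := ∑ i ∈ Finset.Icc (-1 : ℤ) 1, algebraMap ℂ κ (c i) * ξ ^ i

lemma Icc_neg_one_one : Finset.Icc (-1 : ℤ) 1 = {-1, 0, 1} := rfl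

lemma triv_eq (c : ℤ → ℂ) (ξ : κ) : triv c ξ = algebraMap ℂ κ (c (-1)) * ξ⁻¹ +
    algebraMap ℂ κ (c 0) + algebraMap ℂ κ (c 1) * ξ := by
  rw [triv, Icc_neg_one_one]
  simp [add_assoc]

lemma mem_range_of_isAlgebraic {ξ : κ} (h : IsAlgebraic ℂ ξ) : ξ ∈ (algebraMap ℂ κ).range :=
  minpoly.mem_range_of_degree_eq_one _ _
    (IsAlgClosed.degree_eq_one_of_irreducible _ (minpoly.irreducible h.isIntegral))

open Polynomial in
lemma mem_range_of_triv_eq_zero {c : ℤ → ℂ} (hc : ∃ i ∈ Finset.Icc (-1 : ℤ) 1, c i ≠ 0) {ξ : κ}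
    (hξ : ξ ≠ 0) (h : triv c ξ = 0) : ξ ∈ (algebraMap ℂ κ).range := by
  refine mem_range_of_isAlgebraic ⟨C (c (-1)) + C (c 0) * X + C (c 1) * X ^ 2, ?_, ?_⟩
  · intro h0
    have h1 := congrArg (fun p : ℂ[X] => p.coeff 0) h0
    have h2 := congrArg (fun p : ℂ[X] => p.coeff 1) h0
    have h3 := congrArg (fun p : ℂ[X] => p.coeff 2) h0
    simp [coeff_X, coeff_C] at h1 h2 h3
    obtain ⟨i, hi, hne⟩ := hc
    rw [Icc_neg_one_one] at hi
    simp only [Finset.mem_insert, Finset.mem_singleton] at hi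
    rcases hi with rfl | rfl | rfl <;> contradiction
  · rw [triv_eq] at h
    simp only [map_add, map_mul, map_pow, aeval_C, aeval_X]
    field_simp at h
    linear_combination h

open IntermediateField in
lemma row_alternative {S : κ} (hS : Transcendental ℂ S) {c : ℤ → ℤ → ℂ}
    (h1 : ∃ i ∈ Finset.Icc (-1 : ℤ) 1, c i 1 ≠ 0) (h2 : ∃ i ∈ Finset.Icc (-1 : ℤ) 1, c i (-1) ≠ 0)
    {ξ η : κ} (hξ : ξ ≠ 0) (hη : η ≠ 0)
    (h : triv (fun i => c i (-1)) ξ * η⁻¹ + triv (fun i => c i 0) ξ +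
      triv (fun i => c i 1) ξ * η = S) :
    (triv (fun i => c i 1) ξ ≠ 0 ∧ triv (fun i => c i (-1)) ξ ≠ 0) ∨ (ξ ∈ ℂ⟮S⟯ ∧ η ∈ ℂ⟮S⟯) := by
  have hmem : ∀ z ∈ (algebraMap ℂ κ).range, z ∈ ℂ⟮S⟯ := by
    rintro _ ⟨z, rfl⟩
    exact IntermediateField.algebraMap_mem _ z
  have hSm : S ∈ ℂ⟮S⟯ := mem_adjoin_simple_self ℂ S
  have htr : ∀ d : ℤ → ℂ, ξ ∈ (algebraMap ℂ κ).range → triv d ξ ∈ (algebraMap ℂ κ).range := by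
    rintro d ⟨z, rfl⟩
    rw [triv_eq, ← map_inv₀, ← map_mul, ← map_mul, ← map_add, ← map_add]
    exact ⟨_, rfl⟩
  have hnr : S ∉ (algebraMap ℂ κ).range := by
    rintro ⟨z, rfl⟩
    exact hS (isAlgebraic_algebraMap z)
  by_cases e1 : triv (fun i => c i 1) ξ = 0
  · right
    have hr := mem_range_of_triv_eq_zero h1 hξ e1
    refine ⟨hmem _ hr, ?_⟩
    rw [e1, zero_mul, add_zero] at h
    by_cases e2 : triv (fun i => c i (-1)) ξ = 0
    · rw [e2, zero_mul, zero_add] at h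
      rw [← h] at hnr
      exact absurd (htr _ hr) hnr
    · have : η = (S - triv (fun i => c i 0) ξ)⁻¹ * triv (fun i => c i (-1)) ξ := by
        rw [← h, add_sub_cancel_right]
        field_simp
      rw [this]
      exact mul_mem (inv_mem (sub_mem hSm (hmem _ (htr _ hr)))) (hmem _ (htr _ hr))
  · by_cases e2 : triv (fun i => c i (-1)) ξ = 0
    · right
      have hr := mem_range_of_triv_eq_zero h2 hξ e2
      refine ⟨hmem _ hr, ?_⟩
      rw [e2, zero_mul, zero_add] at h
      have : η = (S - triv (fun i => c i 0) ξ) * (triv (fun i => c i 1) ξ)⁻¹ := by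
        rw [← h, add_sub_cancel_left]
        field_simp
      rw [this]
      exact mul_mem (sub_mem hSm (hmem _ (htr _ hr))) (inv_mem (hmem _ (htr _ hr)))
    · exact Or.inl ⟨e1, e2⟩

end Residue

end OrbitSum

end

noncomputable section

namespace OrbitSum

variable (M : StepModel)

section Dichotomy

variable {κ : Type} [Field κ] [Algebra ℂ κ] (π : Laur →ₐ[ℂ] κ)

/-- The value of the step polynomial. -/
def stepVal (ξ η : κ) : κ :=
  ∑ s ∈ smallBox, algebraMap ℂ κ (M.weight s : ℂ) * ξ ^ s.1 * η ^ s.2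

lemma sum_Icc_neg_one_one {α : Type} [AddCommMonoid α] (f : ℤ → α) :
    ∑ i ∈ Finset.Icc (-1 : ℤ) 1, f i = f (-1) + (f 0 + f 1) := by
  rw [Icc_neg_one_one]
  simp

lemma stepVal_eq_row (ξ η : κ) : stepVal M ξ η =
    triv (fun i => (M.weight (i, -1) : ℂ)) ξ * η⁻¹ + triv (fun i => (M.weight (i, 0) : ℂ)) ξ +
      triv (fun i => (M.weight (i, 1) : ℂ)) ξ * η := by
  rw [stepVal, smallBox, Finset.sum_product_right]
  simp only [← Finset.sum_mul]
  rw [sum_Icc_neg_one_one (fun j : ℤ => (∑ i ∈ Finset.Icc (-1 : ℤ) 1,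
    algebraMap ℂ κ (M.weight (i, j) : ℂ) * ξ ^ i) * η ^ j)]
  simp [triv, add_assoc]

lemma stepVal_eq_col (ξ η : κ) : stepVal M ξ η =
    triv (fun j => (M.weight (-1, j) : ℂ)) η * ξ⁻¹ + triv (fun j => (M.weight (0, j) : ℂ)) η +
      triv (fun j => (M.weight (1, j) : ℂ)) η * ξ := by
  have h : ∀ i j : ℤ, algebraMap ℂ κ (M.weight (i, j) : ℂ) * ξ ^ i * η ^ j =
      algebraMap ℂ κ (M.weight (i, j) : ℂ) * η ^ j * ξ ^ i := fun i j => by ring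
  rw [stepVal, smallBox, Finset.sum_product]
  simp only [h, ← Finset.sum_mul]
  rw [sum_Icc_neg_one_one (fun i : ℤ => (∑ j ∈ Finset.Icc (-1 : ℤ) 1,
    algebraMap ℂ κ (M.weight (i, j) : ℂ) * η ^ j) * ξ ^ i)]
  simp [triv, add_assoc]

lemma stepVal_pi : stepVal M (π (mon (1, 0))) (π (mon (0, 1))) = π (lau M) := by
  have hx : IsUnit (π (mon (1, 0))) := (isUnit_mon _).map π
  have hy : IsUnit (π (mon (0, 1))) := (isUnit_mon _).map π
  have hz : ∀ z : ℤ × ℤ, π (mon z) = π (mon (1, 0)) ^ z.1 * π (mon (0, 1)) ^ z.2 := by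
    intro z
    induction z using mon_induction with
    | h10 => simp
    | h01 => simp
    | h0 => simp [mon_zero]
    | hadd z w hz hw =>
      rw [mon_add, map_mul, hz, hw, Prod.fst_add, Prod.snd_add, zpow_add₀ hx.ne_zero,
        zpow_add₀ hy.ne_zero]
      ring
    | hneg z hz =>
      have h1 : π (mon z) * π (mon (-z)) = 1 := by rw [← map_mul, mon_mul_mon_neg, map_one]
      rw [eq_comm, ← inv_eq_of_mul_eq_one_right h1, hz, Prod.fst_neg, Prod.snd_neg, zpow_neg,
        zpow_neg, mul_inv]
  rw [lau, map_sum, stepVal]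
  refine Finset.sum_congr rfl fun s _ => ?_
  rw [map_smul, hz s, Algebra.smul_def, mul_assoc]

lemma exists_row (j : ℤ) (hj : j = 1 ∨ j = -1) :
    ∃ i ∈ Finset.Icc (-1 : ℤ) 1, (M.weight (i, j) : ℂ) ≠ 0 := by
  obtain ⟨s, hs, hlt⟩ := M.nondegenerate 0 (-j) (by rcases hj with rfl | rfl <;> simp)
  have hb := M.small s hs
  simp only [smallBox, Finset.mem_product, Finset.mem_Icc] at hb
  have h2 : s.2 = j := by
    have : 0 < j * s.2 := by
      have h3 : (0 : ℝ) < (j : ℝ) * s.2 := by linarith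
      exact_mod_cast h3
    rcases hj with rfl | rfl <;> omega
  refine ⟨s.1, Finset.mem_Icc.2 hb.1, ?_⟩
  rw [← h2]
  exact_mod_cast hs

lemma exists_col (i : ℤ) (hi : i = 1 ∨ i = -1) :
    ∃ j ∈ Finset.Icc (-1 : ℤ) 1, (M.weight (i, j) : ℂ) ≠ 0 := by
  obtain ⟨s, hs, hlt⟩ := M.nondegenerate (-i) 0 (by rcases hi with rfl | rfl <;> simp)
  have hb := M.small s hs
  simp only [smallBox, Finset.mem_product, Finset.mem_Icc] at hb
  have h2 : s.1 = i := by
    have : 0 < i * s.1 := by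
      have h3 : (0 : ℝ) < (i : ℝ) * s.1 := by linarith
      exact_mod_cast h3
    rcases hi with rfl | rfl <;> omega
  refine ⟨s.2, Finset.mem_Icc.2 hb.2, ?_⟩
  rw [← h2]
  exact_mod_cast hs

variable {M π}

lemma res_rowPoly {X : StepModel.RatXY} {ξ : κ} (h : Res π (ratEmb X) ξ) (hξ : ξ ≠ 0) (j : ℤ) :
    Res π (ratEmb (M.rowPoly j X)) (triv (fun i => (M.weight (i, j) : ℂ)) ξ) := by
  rw [StepModel.rowPoly, map_sum, triv]
  refine Res.sum _ fun i _ => ?_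
  rw [map_mul, map_zpow₀, ratEmb_algebraMap]
  exact (Res.of_const _).mul (h.zpow hξ i)

lemma res_colPoly {Y : StepModel.RatXY} {η : κ} (h : Res π (ratEmb Y) η) (hη : η ≠ 0) (i : ℤ) :
    Res π (ratEmb (M.colPoly i Y)) (triv (fun j => (M.weight (i, j) : ℂ)) η) := by
  rw [StepModel.colPoly, map_sum, triv]
  refine Res.sum _ fun j _ => ?_
  rw [map_mul, map_zpow₀, ratEmb_algebraMap]
  exact (Res.of_const _).mul (h.zpow hη j)

open IntermediateField in
lemma triv_mem {K : IntermediateField ℂ κ} (c : ℤ → ℂ) {ξ : κ} (hξ : ξ ∈ K) : triv c ξ ∈ K :=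
  sum_mem fun i _ => mul_mem (IntermediateField.algebraMap_mem _ _) (zpow_mem hξ i)

open IntermediateField in
/-- Along a curve on which the step polynomial is not constant, either the coordinates of a group
element are regular without zeros, or the curve is parametrized by the step polynomial. -/
theorem group_dichotomy (hS : Transcendental ℂ (π (lau M)))
    {g : StepModel.RatXY × StepModel.RatXY} (hg : M.InGroup g) :
    (∃ ξ η, Res π (ratEmb g.1) ξ ∧ Res π (ratEmb g.2) η ∧ ξ ≠ 0 ∧ η ≠ 0 ∧
      stepVal M ξ η = π (lau M) ∧ (ξ ∈ ℂ⟮π (lau M)⟯ → η ∈ ℂ⟮π (lau M)⟯ →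
        π (mon (1, 0)) ∈ ℂ⟮π (lau M)⟯ ∧ π (mon (0, 1)) ∈ ℂ⟮π (lau M)⟯)) ∨
    (π (mon (1, 0)) ∈ ℂ⟮π (lau M)⟯ ∧ π (mon (0, 1)) ∈ ℂ⟮π (lau M)⟯) := by
  induction hg with
  | one =>
    refine Or.inl ⟨π (mon (1, 0)), π (mon (0, 1)), ?_, ?_, ((isUnit_mon _).map π).ne_zero,
      ((isUnit_mon _).map π).ne_zero, stepVal_pi M π, fun h h' => ⟨h, h'⟩⟩
    · rw [ratEmb_X]
      exact Res.of_emb _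
    · rw [ratEmb_Y]
      exact Res.of_emb _
  | phi g hg ih =>
    rcases ih with ⟨ξ, η, hX, hY, hξ, hη, hs, hK⟩ | ih
    · have hs' := hs
      rw [stepVal_eq_row] at hs'
      rcases row_alternative hS (c := fun i j => (M.weight (i, j) : ℂ)) (exists_row M 1 (by simp))
        (exists_row M (-1) (by simp)) hξ hη hs' with ⟨h1, h2⟩ | ⟨h1, h2⟩
      · refine Or.inl ⟨ξ, η⁻¹ * (triv (fun i => (M.weight (i, -1) : ℂ)) ξ *
          (triv (fun i => (M.weight (i, 1) : ℂ)) ξ)⁻¹), hX, ?_, hξ,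
          mul_ne_zero (inv_ne_zero hη) (mul_ne_zero h2 (inv_ne_zero h1)), ?_, fun h h' => ?_⟩
        · simp only [StepModel.Phi]
          rw [div_eq_mul_inv, map_mul, map_inv₀, map_mul, map_inv₀]
          exact (hY.inv hη).mul ((res_rowPoly hX hξ _).mul ((res_rowPoly hX hξ _).inv h1))
        · rw [← hs', stepVal_eq_row]
          field_simp
          ring
        · refine hK h ?_
          have := mul_mem (inv_mem h') (mul_mem
            (triv_mem (fun i => (M.weight (i, -1) : ℂ)) h)
            (inv_mem (triv_mem (fun i => (M.weight (i, 1) : ℂ)) h)))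
          convert this using 1
          field_simp
      · exact Or.inr (hK h1 h2)
    · exact Or.inr ih
  | psi g hg ih =>
    rcases ih with ⟨ξ, η, hX, hY, hξ, hη, hs, hK⟩ | ih
    · have hs' := hs
      rw [stepVal_eq_col] at hs'
      rcases row_alternative hS (c := fun i j => (M.weight (j, i) : ℂ)) (exists_col M 1 (by simp))
        (exists_col M (-1) (by simp)) hη hξ hs' with ⟨h1, h2⟩ | ⟨h1, h2⟩
      · refine Or.inl ⟨ξ⁻¹ * (triv (fun j => (M.weight (-1, j) : ℂ)) η *
          (triv (fun j => (M.weight (1, j) : ℂ)) η)⁻¹), η, ?_, hY,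
          mul_ne_zero (inv_ne_zero hξ) (mul_ne_zero h2 (inv_ne_zero h1)), hη, ?_, fun h h' => ?_⟩
        · simp only [StepModel.Psi]
          rw [div_eq_mul_inv, map_mul, map_inv₀, map_mul, map_inv₀]
          exact (hX.inv hξ).mul ((res_colPoly hY hη _).mul ((res_colPoly hY hη _).inv h1))
        · rw [← hs', stepVal_eq_col]
          field_simp
          ring
        · refine hK ?_ h'
          have := mul_mem (inv_mem h) (mul_mem
            (triv_mem (fun j => (M.weight (-1, j) : ℂ)) h')
            (inv_mem (triv_mem (fun j => (M.weight (1, j) : ℂ)) h')))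
          convert this using 1
          field_simp
      · exact Or.inr (hK h2 h1)
    · exact Or.inr ih

/-! ### Curves parametrized by the step polynomial -/

open IntermediateField in
/-- Every Laurent polynomial is congruent to a fraction of polynomials in the step polynomial. -/
lemma exists_congr_pS
    (h : π (mon (1, 0)) ∈ ℂ⟮π (lau M)⟯ ∧ π (mon (0, 1)) ∈ ℂ⟮π (lau M)⟯) (f : Laur) :
    ∃ a b : Polynomial ℂ, b ≠ 0 ∧ π (pS M b * f - pS M a) = 0 := by
  have hz : ∀ z : ℤ × ℤ, π (mon z) ∈ ℂ⟮π (lau M)⟯ := by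
    intro z
    induction z using mon_induction with
    | h10 => exact h.1
    | h01 => exact h.2
    | h0 => rw [mon_zero, map_one]; exact one_mem _
    | hadd z w hz hw => rw [mon_add, map_mul]; exact mul_mem hz hw
    | hneg z hz =>
      have h1 : π (mon z) * π (mon (-z)) = 1 := by rw [← map_mul, mon_mul_mon_neg, map_one]
      rw [← inv_eq_of_mul_eq_one_right h1]
      exact inv_mem hz
  have hf : π f ∈ ℂ⟮π (lau M)⟯ := by
    induction f using laur_induction with
    | hmon z => exact hz z
    | hadd f g hf hg => rw [map_add]; exact add_mem hf hg
    | hsmul c f hf => rw [map_smul]; exact IntermediateField.smul_mem _ hf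
  have hle : ℂ⟮π (lau M)⟯ ≤ ℂ⟮π (nor M)⟯ := by
    rw [adjoin_simple_le_iff, ← gam_smul_nor, map_smul]
    exact IntermediateField.smul_mem _ (mem_adjoin_simple_self _ _)
  obtain ⟨a, b, hab⟩ := (mem_adjoin_simple_iff _ _).1 (hle hf)
  have hp : ∀ p, π (pS M p) = Polynomial.aeval (π (nor M)) p := fun p =>
    (Polynomial.aeval_algHom_apply π (nor M) p).symm
  by_cases hb : Polynomial.aeval (π (nor M)) b = 0
  · refine ⟨0, 1, one_ne_zero, ?_⟩
    rw [map_sub, map_mul, hp, hp, hab, hb]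
    simp
  · refine ⟨a, b, ?_, ?_⟩
    · rintro rfl
      simp at hb
    · rw [map_sub, map_mul, hp, hp, hab, mul_div_cancel₀ _ hb, sub_self]

lemma transcendental_nor (hS : Transcendental ℂ (π (lau M))) {p : Polynomial ℂ} (hp : p ≠ 0) :
    π (pS M p) ≠ 0 := by
  intro h
  have h1 : Polynomial.aeval (π (nor M)) p = 0 := by
    rw [Polynomial.aeval_algHom_apply]
    exact h
  have h2 : IsAlgebraic ℂ (π (nor M)) := ⟨p, hp, h1⟩
  refine hS ?_
  rw [← gam_smul_nor, map_smul]
  exact h2.smul _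

lemma theta_pS (φ : ℤ × ℤ →+ ℂ) (p : Polynomial ℂ) :
    theta φ (pS M p) = pS M (Polynomial.derivative p) * theta φ (nor M) := by
  rw [pS, pS, Derivation.map_aeval, smul_eq_mul]

lemma jac_ne_zero (hS : Transcendental ℂ (π (lau M)))
    (h : π (mon (1, 0)) ∈ IntermediateField.adjoin ℂ {π (lau M)} ∧
      π (mon (0, 1)) ∈ IntermediateField.adjoin ℂ {π (lau M)})
    {D : Laur} (hD : π D = 0) (hker : ∀ f, π f = 0 → D ∣ f) : π (jac (nor M) D) ≠ 0 := by
  intro hj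
  have hj' : π (theta fstHom D) * π (theta sndHom (nor M)) =
      π (theta sndHom D) * π (theta fstHom (nor M)) := by
    rw [jac, map_sub, map_mul, map_mul, sub_eq_zero] at hj
    exact hj
  have hx : π (mon (1, 0)) ≠ 0 := ((isUnit_mon _).map π).ne_zero
  have hy : π (mon (0, 1)) ≠ 0 := ((isUnit_mon _).map π).ne_zero
  obtain ⟨a, b, hb, hab⟩ := exists_congr_pS h (mon (1, 0))
  obtain ⟨a', b', hb', hab'⟩ := exists_congr_pS h (mon (0, 1))
  obtain ⟨f, hf⟩ := hker _ hab
  obtain ⟨f', hf'⟩ := hker _ hab'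
  have hb0 := transcendental_nor hS hb
  have hb0' := transcendental_nor hS hb'
  have e1 := congrArg (fun F => π (theta fstHom F)) hf
  have e2 := congrArg (fun F => π (theta sndHom F)) hf
  have e3 := congrArg (fun F => π (theta fstHom F)) hf'
  have e4 := congrArg (fun F => π (theta sndHom F)) hf'
  simp only [map_sub, Derivation.leibniz, theta_pS, theta_mon, smul_eq_mul, map_add, map_mul, hD,
    fstHom_apply, sndHom_apply, Int.cast_one, Int.cast_zero, one_smul, zero_smul,
    mul_zero, zero_mul, zero_add] at e1 e2 e3 e4
  set sx := π (theta fstHom (nor M))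
  set sy := π (theta sndHom (nor M))
  set dx := π (theta fstHom D)
  set dy := π (theta sndHom D)
  have hsy : sy = 0 := by
    have : π (pS M b) * π (mon (1, 0)) * sy = 0 := by
      linear_combination sy * e1 - sx * e2 + π f * hj'
    simpa [hb0, hx] using this
  have hsx : sx = 0 := by
    have : π (pS M b') * π (mon (0, 1)) * sx = 0 := by
      linear_combination sx * e4 - sy * e3 - π f' * hj'
    simpa [hb0', hy] using this
  simp only [hsx, hsy, mul_zero, add_zero, sub_zero] at e1 e2 e4
  have hf0 : π f ≠ 0 := by
    intro h0
    rw [h0, zero_mul] at e1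
    exact mul_ne_zero hb0 hx e1
  have hdy : dy = 0 := by
    have : π f * dy = 0 := by rw [← e2]
    simpa [hf0] using this
  rw [hdy, mul_zero] at e4
  exact mul_ne_zero hb0' hy e4

theorem tame_div_pow (hS : Transcendental ℂ (π (lau M)))
    (h : π (mon (1, 0)) ∈ IntermediateField.adjoin ℂ {π (lau M)} ∧
      π (mon (0, 1)) ∈ IntermediateField.adjoin ℂ {π (lau M)})
    {D : Laur} (hD : π D = 0) (hker : ∀ f, π f = 0 → D ∣ f) (hper : ∀ w ∈ per M, ev w D ≠ 0)
    (m : ℕ) (f : Laur) : Tame M (emb f * (emb D ^ m)⁻¹) := by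
  have hD0 : emb D ≠ 0 := by
    rw [Ne, emb_eq_zero]
    rintro rfl
    exact hper 1 (one_mem _) (map_zero _)
  induction m generalizing f with
  | zero => simpa using Tame.of_emb M f
  | succ m ih =>
    have key : ∀ g : Laur, emb (D * g) * (emb D ^ (m + 1))⁻¹ = emb g * (emb D ^ m)⁻¹ := by
      intro g
      rw [map_mul]
      field_simp
      ring
    have h1 : Tame M (emb 1 * (emb D ^ (m + 1))⁻¹) := by
      obtain ⟨a, b, hb, hab⟩ := exists_congr_pS h (jac (nor M) D)
      have ha : a ≠ 0 := by
        rintro rfl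
        rw [show pS M 0 = 0 from map_zero _, sub_zero, map_mul] at hab
        exact mul_ne_zero (transcendental_nor hS hb) (jac_ne_zero hS h hD hker) hab
      obtain ⟨g, hg⟩ := hker _ hab
      refine Tame.of_mul_pS ha ?_
      have h2 := ((Tame.of_jac hper m).mul_pS b).sub (ih g)
      convert h2 using 1
      rw [← key g, ← hg, map_sub, map_mul, map_one]
      ring
    obtain ⟨a, b, hb, hab⟩ := exists_congr_pS h f
    obtain ⟨g, hg⟩ := hker _ hab
    refine Tame.of_mul_pS hb ?_
    have h2 := (h1.mul_pS a).add (ih g)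
    convert h2 using 1
    rw [← key g, ← hg, map_sub, map_mul, map_one]
    ring

end Dichotomy

end OrbitSum

end

noncomputable section

namespace OrbitSum

variable (M : StepModel)

instance : UniqueFactorizationMonoid Laur := by
  have h1 : UniqueFactorizationMonoid (LaurentPolynomial ℂ) :=
    UniqueFactorizationMonoid.of_isLocalization
      (Submonoid.powers (Polynomial.X : Polynomial ℂ)) _
  have h2 : UniqueFactorizationMonoid (LaurentPolynomial (LaurentPolynomial ℂ)) :=
    UniqueFactorizationMonoid.of_isLocalization
      (Submonoid.powers (Polynomial.X : Polynomial (LaurentPolynomial ℂ))) _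
  exact MulEquiv.uniqueFactorizationMonoid
    (AddMonoidAlgebra.curryRingEquiv (R := ℂ) (M := ℤ) (N := ℤ)).symm.toMulEquiv h2

/-- Every prime Laurent polynomial is the kernel of a homomorphism into a field. -/
lemma exists_hom_of_prime {D : Laur} (hD : Prime D) :
    ∃ (κ : Type) (_ : Field κ) (_ : Algebra ℂ κ) (π : Laur →ₐ[ℂ] κ), ∀ f, π f = 0 ↔ D ∣ f := by
  have h1 : (Ideal.span {D}).IsPrime := (Ideal.span_singleton_prime hD.ne_zero).2 hD
  refine ⟨FractionRing (Laur ⧸ Ideal.span {D}), inferInstance, inferInstance,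
    (IsScalarTower.toAlgHom ℂ (Laur ⧸ Ideal.span {D}) _).comp (Ideal.Quotient.mkₐ ℂ _),
    fun f => ?_⟩
  rw [← Ideal.mem_span_singleton, ← Ideal.Quotient.eq_zero_iff_mem]
  simp

/-- The coordinates are rational functions of the step polynomial along the curve. -/
def Parametrized {κ : Type} [Field κ] [Algebra ℂ κ] (π : Laur →ₐ[ℂ] κ) : Prop :=
  π (mon (1, 0)) ∈ IntermediateField.adjoin ℂ {π (lau M)} ∧
    π (mon (0, 1)) ∈ IntermediateField.adjoin ℂ {π (lau M)}

variable {M}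

lemma emb_ne_zero_of_per {E : Laur} (hE : ∀ w ∈ per M, ev w E ≠ 0) : emb E ≠ 0 := by
  rw [Ne, emb_eq_zero]
  rintro rfl
  exact hE 1 (one_mem _) (map_zero _)

lemma exists_pS_of_isAlgebraic {κ : Type} [Field κ] [Algebra ℂ κ] {π : Laur →ₐ[ℂ] κ}
    (h : IsAlgebraic ℂ (π (lau M))) : ∃ q : Polynomial ℂ, q ≠ 0 ∧ π (pS M q) = 0 := by
  have h1 : IsAlgebraic ℂ (π (nor M)) := by
    rw [nor, map_smul]
    exact h.smul _
  obtain ⟨q, hq, h2⟩ := h1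
  refine ⟨q, hq, ?_⟩
  rw [pS, ← Polynomial.aeval_algHom_apply]
  exact h2

theorem tame_of_parametrized (E : Laur) (hE : ∀ w ∈ per M, ev w E ≠ 0)
    (h : ∀ D, Prime D → D ∣ E → ∀ (κ : Type) [Field κ] [Algebra ℂ κ] (π : Laur →ₐ[ℂ] κ),
      (∀ f, π f = 0 ↔ D ∣ f) → Transcendental ℂ (π (lau M)) → Parametrized M π) :
    ∀ f, Tame M (emb f * (emb E)⁻¹) := by
  induction E using UniqueFactorizationMonoid.induction_on_prime with
  | h₁ => exact absurd (map_zero _) (hE 1 (one_mem _))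
  | h₂ x hx =>
    intro f
    obtain ⟨u, rfl⟩ := hx
    have h1 : (emb (u : Laur))⁻¹ = emb ((u⁻¹ : Laurˣ) : Laur) := by
      refine inv_eq_of_mul_eq_one_right ?_
      rw [← map_mul, Units.mul_inv, map_one]
    rw [h1, ← map_mul]
    exact Tame.of_emb M _
  | h₃ E₁ D hE1 hD ih =>
    intro f
    have hD0 : ∀ w ∈ per M, ev w D ≠ 0 := fun w hw h0 => hE w hw (by rw [map_mul, h0, zero_mul])
    have hE0 : ∀ w ∈ per M, ev w E₁ ≠ 0 := fun w hw h0 => hE w hw (by rw [map_mul, h0, mul_zero])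
    have ih := ih hE0 fun D' hD' hdvd => h D' hD' (hdvd.mul_left _)
    have eD := emb_ne_zero_of_per hD0
    have eE := emb_ne_zero_of_per hE0
    obtain ⟨κ, _, _, π, hπ⟩ := exists_hom_of_prime hD
    by_cases hS : Transcendental ℂ (π (lau M))
    · have hpar := h D hD (dvd_mul_right _ _) κ π hπ hS
      have hDz : π D = 0 := (hπ D).2 dvd_rfl
      obtain ⟨k, E₂, hE2, hk⟩ := WfDvdMonoid.max_power_factor hE1 hD.irreducible
      have eE2 : emb E₂ ≠ 0 := by
        rw [Ne, emb_eq_zero]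
        rintro rfl
        exact hE2 (dvd_zero _)
      obtain ⟨a, b, hb, hab⟩ := exists_congr_pS hpar f
      obtain ⟨a', b', hb', hab'⟩ := exists_congr_pS hpar E₂
      have ha' : a' ≠ 0 := by
        rintro rfl
        rw [show pS M 0 = 0 from map_zero _, sub_zero, map_mul] at hab'
        rcases mul_eq_zero.1 hab' with h0 | h0
        · exact transcendental_nor hS hb' h0
        · exact hE2 ((hπ _).1 h0)
      obtain ⟨g, hg⟩ := (hπ _).1 hab
      obtain ⟨g', hg'⟩ := (hπ _).1 hab'
      refine Tame.of_mul_pS (mul_ne_zero hb ha') ?_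
      have h2 := ((tame_div_pow hS hpar hDz (fun f => (hπ f).1) hD0 (k + 1) 1).mul_pS
        (a * b')).add (ih (pS M a' * g - pS M a * g'))
      convert h2 using 1
      have e1 := congrArg emb hg
      have e2 := congrArg emb hg'
      have e3 := congrArg emb hk
      simp only [map_sub, map_mul, map_pow] at e1 e2 e3
      rw [map_mul, e3, pS_mul, pS_mul, map_mul, map_mul, map_one, map_sub, map_mul, map_mul]
      field_simp
      linear_combination (emb D ^ (k + 1)) * (emb (pS M a') * e1 - emb (pS M a) * e2)
    · obtain ⟨q, hq, h0⟩ := exists_pS_of_isAlgebraic (not_not.1 hS)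
      obtain ⟨g, hg⟩ := (hπ _).1 h0
      refine Tame.of_mul_pS hq ?_
      convert ih (f * g) using 1
      rw [hg, map_mul, map_mul, map_mul]
      field_simp

/-- A fraction whose denominator does not vanish at the periods is tame if it is regular along
every curve that is not parametrized by the step polynomial. -/
theorem tame_of_res {F : FF} {E f : Laur} (hE : ∀ w ∈ per M, ev w E ≠ 0)
    (hF : emb E * F = emb f)
    (h : ∀ (κ : Type) [Field κ] [Algebra ℂ κ] (π : Laur →ₐ[ℂ] κ),
      Transcendental ℂ (π (lau M)) → (∃ ξ, Res π F ξ) ∨ Parametrized M π) : Tame M F := by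
  have hE0 : E ≠ 0 := fun h0 => emb_ne_zero_of_per hE (by rw [h0, map_zero])
  obtain ⟨E', f', c, hrel, rfl, rfl⟩ := UniqueFactorizationMonoid.exists_reduced_factors E hE0 f
  have hE' : ∀ w ∈ per M, ev w E' ≠ 0 := fun w hw h0 => hE w hw (by rw [map_mul, h0, mul_zero])
  have hc : emb c ≠ 0 := by
    intro h0
    exact emb_ne_zero_of_per hE (by rw [map_mul, h0, zero_mul])
  have hF' : emb E' * F = emb f' := by
    refine mul_left_cancel₀ hc ?_
    rw [← mul_assoc, ← map_mul, hF, map_mul]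
  have key := tame_of_parametrized E' hE' (fun D hD hdvd κ _ _ π hπ hS => ?_) f'
  · convert key using 1
    rw [← hF', mul_comm, inv_mul_cancel_left₀ (emb_ne_zero_of_per hE')]
  · refine (h κ π hS).resolve_left ?_
    rintro ⟨ξ, a, b, hb, hab, -⟩
    have h1 : b * f' = a * E' := by
      apply emb_injective
      rw [map_mul, map_mul, ← hab, ← hF']
      ring
    have h2 : D ∣ f' :=
      (hD.dvd_or_dvd (h1 ▸ hdvd.mul_left a : D ∣ b * f')).resolve_left fun h2 => hb ((hπ b).2 h2)
    exact hD.not_isUnit (hrel hdvd h2)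

end OrbitSum

end

noncomputable section

namespace OrbitSum

variable (M : StepModel)

/-- `X` is a fraction of Laurent polynomials that is multiplied by `c z` if the variables are
rotated by a period `z`; its value at `(1, 1)` is `v` and its derivatives there are given
by `l`. -/
def IsRep (X : FF) (c : Tor → ℂ) (v : ℂ) (l : (ℤ × ℤ →+ ℂ) → ℂ) : Prop :=
  ∃ a b : Laur, emb b * X = emb a ∧ ev 1 b ≠ 0 ∧ ev 1 a = v * ev 1 b ∧
    (∀ φ, ev 1 (theta φ a) = l φ * ev 1 b + v * ev 1 (theta φ b)) ∧
    ∀ z ∈ per M, ∃ χ : ℂ, χ ≠ 0 ∧ scale z b = χ • b ∧ scale z a = (χ * c z) • a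

namespace IsRep

variable {M} {X Y : FF} {c d : Tor → ℂ} {v w : ℂ} {l m : (ℤ × ℤ →+ ℂ) → ℂ}

lemma congr (h : IsRep M X c v l) (hc : ∀ z ∈ per M, c z = d z) (hv : v = w)
    (hl : ∀ φ, l φ = m φ) : IsRep M X d w m := by
  obtain ⟨a, b, h1, h2, h3, h4, h5⟩ := h
  refine ⟨a, b, h1, h2, hv ▸ h3, fun φ => by rw [← hv, ← hl, h4], fun z hz => ?_⟩
  rw [← hc z hz]
  exact h5 z hz

variable (M) in
lemma of_mon (z : ℤ × ℤ) : IsRep M (emb (mon z)) (fun w => chr w z) 1 (fun φ => φ z) := by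
  refine ⟨mon z, 1, by simp, by simp, by simp [ev_mon], fun φ => ?_, fun w _ => ?_⟩
  · simp [theta_mon, ev_mon]
  · exact ⟨1, one_ne_zero, by simp, by simp [scale_mon]⟩

variable (M) in
lemma zero (c : Tor → ℂ) : IsRep M 0 c 0 (fun _ => 0) :=
  ⟨0, 1, by simp, by simp, by simp, by simp, fun _ _ => ⟨1, one_ne_zero, by simp, by simp⟩⟩

lemma const_mul (k : ℂ) (h : IsRep M X c v l) :
    IsRep M (constF k * X) c (k * v) (fun φ => k * l φ) := by
  obtain ⟨a, b, h1, h2, h3, h4, h5⟩ := h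
  refine ⟨k • a, b, ?_, h2, ?_, fun φ => ?_, fun z hz => ?_⟩
  · rw [emb_smul, ← h1]
    ring
  · rw [map_smul, h3, smul_eq_mul]
    ring
  · rw [Derivation.map_smul, map_smul, h4, smul_eq_mul]
    ring
  · obtain ⟨χ, hχ, h6, h7⟩ := h5 z hz
    exact ⟨χ, hχ, h6, by rw [map_smul, h7, smul_comm]⟩

lemma mul (h : IsRep M X c v l) (h' : IsRep M Y d w m) :
    IsRep M (X * Y) (fun z => c z * d z) (v * w) (fun φ => l φ * w + v * m φ) := by
  obtain ⟨a, b, h1, h2, h3, h4, h5⟩ := h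
  obtain ⟨a', b', h1', h2', h3', h4', h5'⟩ := h'
  refine ⟨a * a', b * b', ?_, ?_, ?_, fun φ => ?_, fun z hz => ?_⟩
  · rw [map_mul, map_mul, ← h1, ← h1']
    ring
  · rw [map_mul]
    exact mul_ne_zero h2 h2'
  · rw [map_mul, map_mul, h3, h3']
    ring
  · simp only [Derivation.leibniz, map_add, map_mul, smul_eq_mul, h3, h3', h4, h4']
    ring
  · obtain ⟨χ, hχ, h6, h7⟩ := h5 z hz
    obtain ⟨χ', hχ', h6', h7'⟩ := h5' z hz
    refine ⟨χ * χ', mul_ne_zero hχ hχ', ?_, ?_⟩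
    · rw [map_mul, h6, h6', smul_mul_smul_comm]
    · rw [map_mul, h7, h7', smul_mul_smul_comm]
      congr 1
      ring

lemma inv (h : IsRep M X c v l) (hv : v ≠ 0) (hc : ∀ z ∈ per M, c z ≠ 0) :
    IsRep M X⁻¹ (fun z => (c z)⁻¹) v⁻¹ (fun φ => -l φ / v ^ 2) := by
  obtain ⟨a, b, h1, h2, h3, h4, h5⟩ := h
  have ha : ev 1 a ≠ 0 := by
    rw [h3]
    exact mul_ne_zero hv h2
  have hX : X ≠ 0 := by
    rintro rfl
    rw [mul_zero, eq_comm, emb_eq_zero] at h1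
    rw [h1, map_zero] at ha
    exact ha rfl
  refine ⟨b, a, ?_, ha, ?_, fun φ => ?_, fun z hz => ?_⟩
  · rw [← h1, mul_inv_cancel_right₀ hX]
  · rw [h3, inv_mul_cancel_left₀ hv]
  · rw [h3, h4]
    field_simp
    ring
  · obtain ⟨χ, hχ, h6, h7⟩ := h5 z hz
    refine ⟨χ * c z, mul_ne_zero hχ (hc z hz), h7, ?_⟩
    rw [mul_inv_cancel_right₀ (hc z hz), h6]

lemma add (h : IsRep M X c v l) (h' : IsRep M Y c w m) :
    IsRep M (X + Y) c (v + w) (fun φ => l φ + m φ) := by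
  obtain ⟨a, b, h1, h2, h3, h4, h5⟩ := h
  obtain ⟨a', b', h1', h2', h3', h4', h5'⟩ := h'
  refine ⟨a * b' + a' * b, b * b', ?_, ?_, ?_, fun φ => ?_, fun z hz => ?_⟩
  · rw [map_mul, map_add, map_mul, map_mul, ← h1, ← h1']
    ring
  · rw [map_mul]
    exact mul_ne_zero h2 h2'
  · rw [map_add, map_mul, map_mul, map_mul, h3, h3']
    ring
  · simp only [Derivation.leibniz, map_add, map_mul, smul_eq_mul, h3, h3', h4, h4']
    ring
  · obtain ⟨χ, hχ, h6, h7⟩ := h5 z hz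
    obtain ⟨χ', hχ', h6', h7'⟩ := h5' z hz
    refine ⟨χ * χ', mul_ne_zero hχ hχ', ?_, ?_⟩
    · rw [map_mul, h6, h6', smul_mul_smul_comm]
    · rw [map_add, map_mul, map_mul, h6, h6', h7, h7', smul_mul_smul_comm, smul_mul_smul_comm,
        smul_add]
      congr 2 <;> ring

lemma sum {ι : Type} (s : Finset ι) {X : ι → FF} {v : ι → ℂ} {l : ι → (ℤ × ℤ →+ ℂ) → ℂ}
    (h : ∀ i ∈ s, IsRep M (X i) c (v i) (l i)) :
    IsRep M (∑ i ∈ s, X i) c (∑ i ∈ s, v i) (fun φ => ∑ i ∈ s, l i φ) := by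
  classical
  induction s using Finset.induction_on with
  | empty => simpa using zero M c
  | insert i s hi ih =>
    simp only [Finset.sum_insert hi]
    exact (h i (Finset.mem_insert_self _ _)).add
      (ih fun j hj => h j (Finset.mem_insert_of_mem hj))

lemma ne_zero (h : IsRep M X c v l) (hv : v ≠ 0) : X ≠ 0 := by
  obtain ⟨a, b, h1, h2, h3, -⟩ := h
  rintro rfl
  rw [mul_zero, eq_comm, emb_eq_zero] at h1
  rw [h1, map_zero, eq_comm] at h3
  exact mul_ne_zero hv h2 h3

lemma unique (h : IsRep M X c v l) (h' : IsRep M X d w m) (φ : ℤ × ℤ →+ ℂ) : l φ = m φ := by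
  obtain ⟨a, b, h1, h2, h3, h4, -⟩ := h
  obtain ⟨a', b', h1', h2', h3', h4', -⟩ := h'
  have e : a * b' = a' * b := by
    apply emb_injective
    rw [map_mul, map_mul, ← h1, ← h1']
    ring
  have e1 := congrArg (ev 1) e
  have e2 := congrArg (fun f => ev 1 (theta φ f)) e
  simp only [Derivation.leibniz, map_add, map_mul, smul_eq_mul, h3, h3', h4, h4'] at e1 e2
  have e3 : v = w := by
    apply mul_right_cancel₀ (mul_ne_zero h2 h2')
    linear_combination e1
  subst e3
  apply mul_right_cancel₀ (mul_ne_zero h2 h2')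
  linear_combination e2

lemma zpow_small (h : IsRep M X c 1 l) (hc : ∀ z ∈ per M, c z ≠ 0) {i : ℤ}
    (hi : i ∈ Finset.Icc (-1 : ℤ) 1) :
    IsRep M (X ^ i) (fun z => c z ^ i) 1 (fun φ => i * l φ) := by
  rw [Icc_neg_one_one] at hi
  simp only [Finset.mem_insert, Finset.mem_singleton] at hi
  rcases hi with rfl | rfl | rfl
  · rw [zpow_neg_one]
    exact (h.inv one_ne_zero hc).congr (fun z _ => by simp) (by simp) (fun φ => by simp)
  · rw [zpow_zero, ← map_one emb, ← mon_zero]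
    exact (of_mon M 0).congr (fun z _ => by simp) rfl (fun φ => by simp)
  · rw [zpow_one]
    exact h.congr (fun z _ => by simp) rfl (fun φ => by simp)

end IsRep

/-! ### The group acts by linear maps at the saddle point -/

lemma circle_ne_zero (z : Circle) : (z : ℂ) ≠ 0 := Circle.coe_ne_zero z

lemma isRep_rowPoly {X : StepModel.RatXY} {l : (ℤ × ℤ →+ ℂ) → ℂ}
    (h : IsRep M (ratEmb X) (fun z => z.1) 1 l) (j : ℤ) :
    IsRep M (ratEmb (M.rowPoly j X)) (fun z => zet M z * (z.2 : ℂ) ^ (-j))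
      (∑ i ∈ Finset.Icc (-1 : ℤ) 1, (M.weight (i, j) : ℂ))
      (fun φ => (∑ i ∈ Finset.Icc (-1 : ℤ) 1, (M.weight (i, j) : ℂ) * i) * l φ) := by
  rw [StepModel.rowPoly, map_sum]
  refine (IsRep.sum _ fun i hi => ?_).congr (fun _ _ => rfl) rfl
    (fun φ => (Finset.sum_mul _ _ _).symm)
  rw [map_mul, map_zpow₀, ratEmb_algebraMap]
  by_cases hw : M.weight (i, j) = 0
  · simpa [hw] using IsRep.zero M _
  · refine ((h.zpow_small (fun z _ => circle_ne_zero _) hi).const_mul _).congr (fun z hz => ?_)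
      (mul_one _) (fun φ => by ring)
    have := zet_eq_chr M hz hw
    rw [this, chr, Circle.coe_mul, Circle.coe_zpow, Circle.coe_zpow, mul_assoc,
      ← zpow_add₀ (circle_ne_zero _)]
    simp

lemma isRep_colPoly {Y : StepModel.RatXY} {l : (ℤ × ℤ →+ ℂ) → ℂ}
    (h : IsRep M (ratEmb Y) (fun z => z.2) 1 l) (i : ℤ) :
    IsRep M (ratEmb (M.colPoly i Y)) (fun z => zet M z * (z.1 : ℂ) ^ (-i))
      (∑ j ∈ Finset.Icc (-1 : ℤ) 1, (M.weight (i, j) : ℂ))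
      (fun φ => (∑ j ∈ Finset.Icc (-1 : ℤ) 1, (M.weight (i, j) : ℂ) * j) * l φ) := by
  rw [StepModel.colPoly, map_sum]
  refine (IsRep.sum _ fun j hj => ?_).congr (fun _ _ => rfl) rfl
    (fun φ => (Finset.sum_mul _ _ _).symm)
  rw [map_mul, map_zpow₀, ratEmb_algebraMap]
  by_cases hw : M.weight (i, j) = 0
  · simpa [hw] using IsRep.zero M _
  · refine ((h.zpow_small (fun z _ => circle_ne_zero _) hj).const_mul _).congr (fun z hz => ?_)
      (mul_one _) (fun φ => by ring)
    have := zet_eq_chr M hz hw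
    rw [this, chr, Circle.coe_mul, Circle.coe_zpow, Circle.coe_zpow, mul_comm ((z.1 : ℂ) ^ i),
      mul_assoc, ← zpow_add₀ (circle_ne_zero _)]
    simp

lemma zet_ne_zero {z : Tor} (hz : z ∈ per M) : zet M z ≠ 0 := by
  rw [← norm_pos_iff, norm_zet M hz]
  exact one_pos

/-- The sum of the weights in a row. -/
def rowSum (j : ℤ) : ℂ := ∑ i ∈ Finset.Icc (-1 : ℤ) 1, (M.weight (i, j) : ℂ)

/-- The sum of the weights in a column. -/
def colSum (i : ℤ) : ℂ := ∑ j ∈ Finset.Icc (-1 : ℤ) 1, (M.weight (i, j) : ℂ)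

lemma sum_smallBox {α : Type} [AddCommMonoid α] (f : ℤ × ℤ → α) : ∑ s ∈ smallBox, f s =
    f (-1, -1) + (f (-1, 0) + f (-1, 1)) + ((f (0, -1) + (f (0, 0) + f (0, 1))) +
      (f (1, -1) + (f (1, 0) + f (1, 1)))) := by
  rw [smallBox, Finset.sum_product, sum_Icc_neg_one_one]
  simp only [sum_Icc_neg_one_one]

lemma sm_mul_gam (a b : ℕ) : (sm M a b : ℂ) * gam M =
    ∑ s ∈ smallBox, (M.weight s : ℂ) * (s.1 : ℂ) ^ a * (s.2 : ℂ) ^ b := by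
  have h : sm M a b * gam M = ∑ s ∈ smallBox, M.weight s * (s.1 : ℝ) ^ a * (s.2 : ℝ) ^ b :=
    div_mul_cancel₀ _ (gam_pos M).ne'
  have := congrArg (fun r : ℝ => (r : ℂ)) h
  simpa using this

variable {M}

lemma rowSum_eq (hdrift : M.ZeroDrift) (j : ℤ) (hj : j = 1 ∨ j = -1) :
    2 * rowSum M j = sm M 0 2 * gam M := by
  have h := congrArg (fun r : ℝ => (r : ℂ)) hdrift.2
  rw [sm_mul_gam]
  simp only [sum_smallBox, rowSum, sum_Icc_neg_one_one] at h ⊢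
  push_cast at h ⊢
  rcases hj with rfl | rfl
  · linear_combination h
  · linear_combination -h

lemma colSum_eq (hdrift : M.ZeroDrift) (i : ℤ) (hi : i = 1 ∨ i = -1) :
    2 * colSum M i = sm M 2 0 * gam M := by
  have h := congrArg (fun r : ℝ => (r : ℂ)) hdrift.1
  rw [sm_mul_gam]
  simp only [sum_smallBox, colSum, sum_Icc_neg_one_one] at h ⊢
  push_cast at h ⊢
  rcases hi with rfl | rfl
  · linear_combination h
  · linear_combination -h

lemma sm02_ne_zero : (sm M 0 2 : ℂ) ≠ 0 := by exact_mod_cast (sm02_pos M).ne'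

lemma sm20_ne_zero : (sm M 2 0 : ℂ) ≠ 0 := by exact_mod_cast (sm20_pos M).ne'

lemma rowSum_ne_zero (hdrift : M.ZeroDrift) (j : ℤ) (hj : j = 1 ∨ j = -1) : rowSum M j ≠ 0 := by
  intro h
  have := rowSum_eq hdrift j hj
  rw [h, mul_zero, eq_comm] at this
  exact mul_ne_zero sm02_ne_zero (gam_ne_zero M) this

lemma colSum_ne_zero (hdrift : M.ZeroDrift) (i : ℤ) (hi : i = 1 ∨ i = -1) : colSum M i ≠ 0 := by
  intro h
  have := colSum_eq hdrift i hi
  rw [h, mul_zero, eq_comm] at this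
  exact mul_ne_zero sm20_ne_zero (gam_ne_zero M) this

lemma omg_add : (sm M 0 2 : ℂ) * (omg M + omgBar M) = -2 * sm M 1 1 := by
  have h1 := isRootForm_omg M
  have h2 := isRootForm_omgBar M
  apply mul_left_cancel₀ (sub_ne_zero.2 (omg_ne_omgBar M))
  rw [IsRootForm] at h1 h2
  linear_combination h1 - h2

lemma omg_mul : (sm M 0 2 : ℂ) * (omg M * omgBar M) = sm M 2 0 := by
  have h1 := isRootForm_omg M
  rw [IsRootForm] at h1
  linear_combination omg M * omg_add (M := M) - h1

lemma omg_ne_zero : omg M ≠ 0 := by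
  intro h
  have := omg_mul (M := M)
  rw [h, zero_mul, mul_zero, eq_comm] at this
  exact sm20_ne_zero this

lemma omgBar_ne_zero : omgBar M ≠ 0 := by
  intro h
  have := omg_mul (M := M)
  rw [h, mul_zero, mul_zero, eq_comm] at this
  exact sm20_ne_zero this

variable (M) in
/-- The rotation factor of the group at the saddle point. -/
def rot : ℂ := omg M / omgBar M

lemma rot_ne_one : rot M ≠ 1 := by
  rw [rot, Ne, div_eq_one_iff_eq omgBar_ne_zero]
  exact omg_ne_omgBar M

variable (M) in
/-- The birational map `g` fixes `(1, 1)`, is compatible with the periods, and its derivative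
takes the linear form `y - ω x` to `p` and the conjugate form to `q`. -/
def LinG (g : StepModel.RatXY × StepModel.RatXY) (p q : (ℤ × ℤ →+ ℂ) → ℂ) : Prop :=
  ∃ l m, IsRep M (ratEmb g.1) (fun z => z.1) 1 l ∧ IsRep M (ratEmb g.2) (fun z => z.2) 1 m ∧
    ∀ φ, m φ - omg M * l φ = p φ ∧ m φ - omgBar M * l φ = q φ

lemma Phi_lin (hdrift : M.ZeroDrift) {g : StepModel.RatXY × StepModel.RatXY}
    {p q : (ℤ × ℤ →+ ℂ) → ℂ} (h : LinG M g p q) :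
    LinG M (M.Phi g) (fun φ => -q φ) (fun φ => -p φ) ∧ M.Phi (M.Phi g) = g := by
  obtain ⟨l, m, hl, hm, hpq⟩ := h
  have h1 := isRep_rowPoly M hl 1
  have h2 := isRep_rowPoly M hl (-1)
  have n1 := rowSum_ne_zero hdrift 1 (by simp)
  have n2 := rowSum_ne_zero hdrift (-1) (by simp)
  have e1 := rowSum_eq hdrift 1 (by simp)
  have e2 := rowSum_eq hdrift (-1) (by simp)
  have e3 := omg_add (M := M)
  have hc : ∀ z ∈ per M, zet M z * (z.2 : ℂ) ^ (-1 : ℤ) ≠ 0 := fun z hz =>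
    mul_ne_zero (zet_ne_zero M hz) (zpow_ne_zero _ (circle_ne_zero _))
  refine ⟨⟨l, fun φ => (omg M + omgBar M) * l φ - m φ, hl, ?_, fun φ => ?_⟩, ?_⟩
  · have key := (hm.inv one_ne_zero fun z _ => circle_ne_zero _).mul (h2.mul (h1.inv n1 hc))
    simp only [StepModel.Phi]
    rw [div_eq_mul_inv, map_mul, map_mul, map_inv₀, map_inv₀]
    refine key.congr (fun z hz => ?_) ?_ fun φ => ?_
    · have := zet_ne_zero M hz
      have := circle_ne_zero z.2
      simp only [neg_neg, zpow_one, zpow_neg]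
      field_simp
    · change 1⁻¹ * (rowSum M (-1) * (rowSum M 1)⁻¹) = 1
      field_simp
      linear_combination (e2 - e1) / 2
    · change -m φ / 1 ^ 2 * (rowSum M (-1) * (rowSum M 1)⁻¹) + 1⁻¹ *
        ((∑ i ∈ Finset.Icc (-1 : ℤ) 1, (M.weight (i, -1) : ℂ) * i) * l φ * (rowSum M 1)⁻¹ +
        rowSum M (-1) * (-((∑ i ∈ Finset.Icc (-1 : ℤ) 1, (M.weight (i, 1) : ℂ) * i) * l φ) /
        rowSum M 1 ^ 2)) = _
      have e4 : (∑ i ∈ Finset.Icc (-1 : ℤ) 1, (M.weight (i, -1) : ℂ) * i) -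
          ∑ i ∈ Finset.Icc (-1 : ℤ) 1, (M.weight (i, 1) : ℂ) * i = -(sm M 1 1 * gam M) := by
        rw [sm_mul_gam]
        simp only [sum_smallBox, sum_Icc_neg_one_one]
        push_cast
        ring
      have e5 : rowSum M (-1) = rowSum M 1 := by linear_combination (e2 - e1) / 2
      have e6 : (omg M + omgBar M) * rowSum M 1 = -(sm M 1 1 * gam M) := by
        linear_combination (omg M + omgBar M) * e1 / 2 + gam M * e3 / 2
      rw [e5]
      field_simp
      linear_combination l φ * (e4 - e6)
  · beta_reduce
    rw [← (hpq φ).1, ← (hpq φ).2]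
    constructor <;> ring
  · have hY : g.2 ≠ 0 := by
      intro h0
      exact hm.ne_zero one_ne_zero (by rw [h0, map_zero])
    have hr1 : M.rowPoly 1 g.1 ≠ 0 := by
      intro h0
      exact h1.ne_zero n1 (by rw [h0, map_zero])
    have hr2 : M.rowPoly (-1) g.1 ≠ 0 := by
      intro h0
      exact h2.ne_zero n2 (by rw [h0, map_zero])
    refine Prod.ext rfl ?_
    simp only [StepModel.Phi]
    field_simp

lemma Psi_lin (hdrift : M.ZeroDrift) {g : StepModel.RatXY × StepModel.RatXY}
    {p q : (ℤ × ℤ →+ ℂ) → ℂ} (h : LinG M g p q) :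
    LinG M (M.Psi g) (fun φ => -(rot M * q φ)) (fun φ => -((rot M)⁻¹ * p φ)) ∧
      M.Psi (M.Psi g) = g := by
  obtain ⟨l, m, hl, hm, hpq⟩ := h
  have h1 := isRep_colPoly M hm 1
  have h2 := isRep_colPoly M hm (-1)
  have n1 := colSum_ne_zero hdrift 1 (by simp)
  have n2 := colSum_ne_zero hdrift (-1) (by simp)
  have e1 := colSum_eq hdrift 1 (by simp)
  have e2 := colSum_eq hdrift (-1) (by simp)
  have e3 := omg_add (M := M)
  have e3' := omg_mul (M := M)
  have o1 := omg_ne_zero (M := M)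
  have o2 := omgBar_ne_zero (M := M)
  have hc : ∀ z ∈ per M, zet M z * (z.1 : ℂ) ^ (-1 : ℤ) ≠ 0 := fun z hz =>
    mul_ne_zero (zet_ne_zero M hz) (zpow_ne_zero _ (circle_ne_zero _))
  refine ⟨⟨fun φ => ((omg M)⁻¹ + (omgBar M)⁻¹) * m φ - l φ, m, ?_, hm, fun φ => ?_⟩, ?_⟩
  · have key := (hl.inv one_ne_zero fun z _ => circle_ne_zero _).mul (h2.mul (h1.inv n1 hc))
    simp only [StepModel.Psi]
    rw [div_eq_mul_inv, map_mul, map_mul, map_inv₀, map_inv₀]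
    refine key.congr (fun z hz => ?_) ?_ fun φ => ?_
    · have := zet_ne_zero M hz
      have := circle_ne_zero z.1
      simp only [neg_neg, zpow_one, zpow_neg]
      field_simp
    · change 1⁻¹ * (colSum M (-1) * (colSum M 1)⁻¹) = 1
      field_simp
      linear_combination (e2 - e1) / 2
    · change -l φ / 1 ^ 2 * (colSum M (-1) * (colSum M 1)⁻¹) + 1⁻¹ *
        ((∑ j ∈ Finset.Icc (-1 : ℤ) 1, (M.weight (-1, j) : ℂ) * j) * m φ * (colSum M 1)⁻¹ +
        colSum M (-1) * (-((∑ j ∈ Finset.Icc (-1 : ℤ) 1, (M.weight (1, j) : ℂ) * j) * m φ) /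
        colSum M 1 ^ 2)) = _
      have e4 : (∑ j ∈ Finset.Icc (-1 : ℤ) 1, (M.weight (-1, j) : ℂ) * j) -
          ∑ j ∈ Finset.Icc (-1 : ℤ) 1, (M.weight (1, j) : ℂ) * j = -(sm M 1 1 * gam M) := by
        rw [sm_mul_gam]
        simp only [sum_smallBox, sum_Icc_neg_one_one]
        push_cast
        ring
      have e5 : colSum M (-1) = colSum M 1 := by linear_combination (e2 - e1) / 2
      have e6 : ((omg M)⁻¹ + (omgBar M)⁻¹) * colSum M 1 = -(sm M 1 1 * gam M) := by
        field_simp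
        linear_combination (omg M + omgBar M) * e1 / 2 + gam M * omg M * omgBar M * e3 / 2 -
          (omg M + omgBar M) * gam M * e3' / 2
      rw [e5]
      generalize ((omg M)⁻¹ + (omgBar M)⁻¹) = t at e6 ⊢
      field_simp
      linear_combination m φ * (e4 - e6)
  · beta_reduce
    rw [← (hpq φ).1, ← (hpq φ).2, rot]
    constructor
    · field_simp
      ring
    · field_simp
      ring
  · have hX : g.1 ≠ 0 := by
      intro h0
      exact hl.ne_zero one_ne_zero (by rw [h0, map_zero])
    have hr1 : M.colPoly 1 g.2 ≠ 0 := by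
      intro h0
      exact h1.ne_zero n1 (by rw [h0, map_zero])
    have hr2 : M.colPoly (-1) g.2 ≠ 0 := by
      intro h0
      exact h2.ne_zero n2 (by rw [h0, map_zero])
    refine Prod.ext ?_ rfl
    simp only [StepModel.Psi]
    field_simp

variable (M) in
/-- The derivatives of the local coordinate `(y - 1) - ω (x - 1)`. -/
def dpsi (ω : ℂ) (φ : ℤ × ℤ →+ ℂ) : ℂ := φ (0, 1) - ω * φ (1, 0)

variable (M) in
/-- The powers of the rotation `Φ ∘ Ψ`. -/
def rotG (k : ℕ) : StepModel.RatXY × StepModel.RatXY :=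
  (M.Phi ∘ M.Psi)^[k] (StepModel.ratX, StepModel.ratY)

lemma rotG_succ (k : ℕ) : rotG M (k + 1) = M.Phi (M.Psi (rotG M k)) :=
  Function.iterate_succ_apply' _ _ _

lemma inGroup_rotG (k : ℕ) : M.InGroup (rotG M k) := by
  induction k with
  | zero => exact StepModel.InGroup.one
  | succ k ih =>
    rw [rotG_succ]
    exact (ih.psi _).phi _

lemma LinG.congr {g : StepModel.RatXY × StepModel.RatXY} {p q p' q' : (ℤ × ℤ →+ ℂ) → ℂ}
    (h : LinG M g p q) (hp : ∀ φ, p φ = p' φ) (hq : ∀ φ, q φ = q' φ) : LinG M g p' q' := by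
  rwa [← funext hp, ← funext hq]

lemma rotG_lin (hdrift : M.ZeroDrift) (k : ℕ) :
    LinG M (rotG M k) (fun φ => ((rot M)⁻¹) ^ k * dpsi (omg M) φ)
      (fun φ => rot M ^ k * dpsi (omgBar M) φ) := by
  induction k with
  | zero =>
    refine ⟨fun φ => φ (1, 0), fun φ => φ (0, 1), ?_, ?_, fun φ => ?_⟩
    · change IsRep M (ratEmb StepModel.ratX) _ _ _
      rw [ratEmb_X]
      exact (IsRep.of_mon M _).congr (fun z _ => by simp [chr]) rfl fun φ => rfl
    · change IsRep M (ratEmb StepModel.ratY) _ _ _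
      rw [ratEmb_Y]
      exact (IsRep.of_mon M _).congr (fun z _ => by simp [chr]) rfl fun φ => rfl
    · simp [dpsi]
  | succ k ih =>
    rw [rotG_succ]
    refine (Phi_lin hdrift (Psi_lin hdrift ih).1).1.congr (fun φ => ?_) fun φ => ?_
    · rw [pow_succ]; ring
    · rw [pow_succ]; ring

lemma exists_rotG_eq (hdrift : M.ZeroDrift) (hfin : M.group.Finite) :
    ∃ N, rotG M (N + 1) = rotG M 0 := by
  have h1 : ¬ Function.Injective (rotG M) := by
    intro hinj
    exact Set.infinite_range_of_injective hinj
      (hfin.subset (by rintro _ ⟨k, rfl⟩; exact inGroup_rotG k))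
  have h2 : ∀ a b, rotG M (a + 1) = rotG M (b + 1) → rotG M a = rotG M b := by
    intro a b h
    rw [rotG_succ, rotG_succ] at h
    have h3 := congrArg M.Phi h
    rw [(Phi_lin hdrift (Psi_lin hdrift (rotG_lin hdrift a)).1).2,
      (Phi_lin hdrift (Psi_lin hdrift (rotG_lin hdrift b)).1).2] at h3
    have h4 := congrArg M.Psi h3
    rwa [(Psi_lin hdrift (rotG_lin hdrift a)).2, (Psi_lin hdrift (rotG_lin hdrift b)).2] at h4
  have h3 : ∀ a b, a < b → rotG M a = rotG M b → ∃ N, rotG M (N + 1) = rotG M 0 := by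
    intro a
    induction a with
    | zero =>
      intro b hb h
      exact ⟨b - 1, by rw [Nat.sub_add_cancel hb, h]⟩
    | succ a ih =>
      intro b hb h
      refine ih (b - 1) (by omega) (h2 _ _ ?_)
      rw [h, Nat.sub_add_cancel (by omega)]
  simp only [Function.Injective, not_forall] at h1
  obtain ⟨a, b, hab, hne⟩ := h1
  rcases lt_or_gt_of_ne hne with h | h
  · exact h3 a b h hab
  · exact h3 b a h hab.symm

lemma exists_rot_pow_eq_one (hdrift : M.ZeroDrift) (hfin : M.group.Finite) :
    ∃ N, 0 < N ∧ rot M ^ N = 1 := by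
  obtain ⟨N, hN⟩ := exists_rotG_eq hdrift hfin
  refine ⟨N + 1, Nat.succ_pos _, ?_⟩
  obtain ⟨l, m, hl, hm, hpq⟩ := rotG_lin hdrift (N + 1)
  obtain ⟨l', m', hl', hm', hpq'⟩ := rotG_lin hdrift 0
  rw [hN] at hl hm
  have h1 := (hpq sndHom).2
  have h2 := (hpq' sndHom).2
  rw [hl.unique hl', hm.unique hm', h2] at h1
  simp [dpsi] at h1
  exact h1.symm

lemma group_cases (hdrift : M.ZeroDrift) (hfin : M.group.Finite)
    {g : StepModel.RatXY × StepModel.RatXY} (hg : M.InGroup g) :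
    ∃ k, g = rotG M k ∨ g = M.Psi (rotG M k) := by
  induction hg with
  | one => exact ⟨0, Or.inl rfl⟩
  | phi g _ ih =>
    obtain ⟨k, rfl | rfl⟩ := ih
    · have key : ∀ k, ∃ j, M.Phi (rotG M (k + 1)) = M.Psi (rotG M j) := fun k =>
        ⟨k, by rw [rotG_succ, (Phi_lin hdrift (Psi_lin hdrift (rotG_lin hdrift k)).1).2]⟩
      cases k with
      | zero =>
        obtain ⟨N, hN⟩ := exists_rotG_eq hdrift hfin
        rw [← hN]
        obtain ⟨j, hj⟩ := key N
        exact ⟨j, Or.inr hj⟩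
      | succ k =>
        obtain ⟨j, hj⟩ := key k
        exact ⟨j, Or.inr hj⟩
    · exact ⟨k + 1, Or.inl (rotG_succ k).symm⟩
  | psi g _ ih =>
    obtain ⟨k, rfl | rfl⟩ := ih
    · exact ⟨k, Or.inr rfl⟩
    · exact ⟨k, Or.inl (Psi_lin hdrift (rotG_lin hdrift k)).2⟩

/-- A group element of sign `1` acts as a rotation at the saddle point, one of sign `-1` as a
reflection. -/
theorem group_lin (hdrift : M.ZeroDrift) (hfin : M.group.Finite)
    {g : StepModel.RatXY × StepModel.RatXY} (hg : M.InGroup g) :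
    (M.sgn g = 1 ∧ ∃ k : ℕ, LinG M g (fun φ => ((rot M)⁻¹) ^ k * dpsi (omg M) φ)
      (fun φ => rot M ^ k * dpsi (omgBar M) φ)) ∨
    (M.sgn g = -1 ∧ ∃ k : ℕ, LinG M g (fun φ => -(rot M ^ k * dpsi (omgBar M) φ))
      (fun φ => -(((rot M)⁻¹) ^ k * dpsi (omg M) φ))) := by
  by_cases h : ∃ k : ℕ, g = (M.Phi ∘ M.Psi)^[k] (StepModel.ratX, StepModel.ratY)
  · left
    refine ⟨by rw [StepModel.sgn, if_pos h], ?_⟩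
    obtain ⟨k, rfl⟩ := h
    exact ⟨k, rotG_lin hdrift k⟩
  · right
    refine ⟨by rw [StepModel.sgn, if_neg h], ?_⟩
    obtain ⟨k, rfl | rfl⟩ := group_cases hdrift hfin hg
    · exact absurd ⟨k, rfl⟩ h
    · refine ⟨k + 1, (Psi_lin hdrift (rotG_lin hdrift k)).1.congr (fun φ => ?_) fun φ => ?_⟩
      · rw [pow_succ]; ring
      · rw [pow_succ]; ring

end OrbitSum

end

noncomputable section

namespace OrbitSum

variable (M : StepModel)

/-! ### Approximation of fractions at the periods -/

variable {M} in
lemma exists_inv_mod_van {b : Laur} (hb : ∀ w ∈ per M, ev w b ≠ 0) (N : ℕ) :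
    ∃ β, b * β - 1 ∈ van M N := by
  have := finite_per M
  have := Fintype.ofFinite (per M)
  obtain ⟨A, B, hAB⟩ : IsCoprime (Polynomial.X : Polynomial ℂ)
      (∏ w : per M, (Polynomial.X - Polynomial.C (ev (w : Tor) b)) ^ N) := by
    refine IsCoprime.prod_right fun w _ => IsCoprime.pow_right ?_
    have h := Polynomial.isCoprime_X_sub_C_of_isUnit_sub (R := ℂ) (a := 0) (b := ev (w : Tor) b)
      (by rw [zero_sub]; exact (neg_ne_zero.2 (hb w w.2)).isUnit)
    simpa using h
  have hAB' := congrArg (Polynomial.aeval b) hAB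
  simp only [map_add, map_mul, map_pow, Polynomial.aeval_X, map_one, map_prod, map_sub,
    Polynomial.aeval_C] at hAB'
  refine ⟨Polynomial.aeval b A, ?_⟩
  rw [show b * Polynomial.aeval b A - 1 = -(Polynomial.aeval b B *
    ∏ w : per M, (b - algebraMap ℂ Laur (ev (w : Tor) b)) ^ N) by linear_combination hAB']
  refine neg_mem (Ideal.mul_mem_left _ _ ((mem_van M).2 fun w hw => ?_))
  have h1 : b - algebraMap ℂ Laur (ev w b) ∈ maxId w := by
    rw [mem_maxId, map_sub, AlgHom.commutes]
    simp
  exact Ideal.mem_of_dvd _ (Finset.dvd_prod_of_mem _ (Finset.mem_univ (⟨w, hw⟩ : per M)))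
    (Ideal.pow_mem_pow h1 N)

lemma scale_mem_pow {w : Tor} (z : Tor) {N : ℕ} {f : Laur} (hf : f ∈ maxId w ^ N) :
    scale z f ∈ maxId (z⁻¹ * w) ^ N := by
  have h1 : maxId w ≤ Ideal.comap (scale z) (maxId (z⁻¹ * w)) := by
    intro f hf
    rw [Ideal.mem_comap, mem_maxId, ev_scale, mul_inv_cancel_left]
    exact hf
  exact Ideal.le_comap_pow (scale z) N (Ideal.pow_right_mono h1 N hf)

variable {M}

lemma scale_mem_van {z : Tor} (hz : z ∈ per M) {N : ℕ} {f : Laur} (hf : f ∈ van M N) :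
    scale z f ∈ van M N := by
  rw [mem_van] at hf ⊢
  intro w hw
  have := scale_mem_pow z (hf (z * w) (mul_mem hz hw))
  rwa [inv_mul_cancel_left] at this

variable (M) in
/-- `X` agrees to the order `L` with the Laurent polynomial `f` at the periods. -/
def Approx (L : ℕ) (X : FF) (f : Laur) : Prop :=
  ∃ b v : Laur, (∀ w ∈ per M, ev w b ≠ 0) ∧ v ∈ van M L ∧ emb b * (X - emb f) = emb v

namespace Approx

variable {L : ℕ} {X Y : FF} {f g : Laur}

variable (M L) in
lemma of_emb (f : Laur) : Approx M L (emb f) f :=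
  ⟨1, 0, by simp, zero_mem _, by simp⟩

lemma add (h : Approx M L X f) (h' : Approx M L Y g) : Approx M L (X + Y) (f + g) := by
  obtain ⟨b, v, hb, hv, h⟩ := h
  obtain ⟨b', v', hb', hv', h'⟩ := h'
  refine ⟨b * b', b' * v + b * v', fun w hw => ?_,
    add_mem (Ideal.mul_mem_left _ _ hv) (Ideal.mul_mem_left _ _ hv'), ?_⟩
  · rw [map_mul]
    exact mul_ne_zero (hb w hw) (hb' w hw)
  · simp only [map_mul, map_add]
    rw [← h, ← h']
    ring

lemma mul (h : Approx M L X f) (h' : Approx M L Y g) : Approx M L (X * Y) (f * g) := by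
  obtain ⟨b, v, hb, hv, h⟩ := h
  obtain ⟨b', v', hb', hv', h'⟩ := h'
  refine ⟨b * b', b' * g * v + b * f * v' + v * v', fun w hw => ?_, add_mem (add_mem
    (Ideal.mul_mem_left _ _ hv) (Ideal.mul_mem_left _ _ hv')) (Ideal.mul_mem_left _ _ hv'), ?_⟩
  · rw [map_mul]
    exact mul_ne_zero (hb w hw) (hb' w hw)
  · simp only [map_mul, map_add]
    rw [← h, ← h']
    ring

lemma pow (h : Approx M L X f) (n : ℕ) : Approx M L (X ^ n) (f ^ n) := by
  induction n with
  | zero => simpa using of_emb M L 1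
  | succ n ih =>
    rw [pow_succ, pow_succ]
    exact ih.mul h

lemma sum {ι : Type} (s : Finset ι) {X : ι → FF} {f : ι → Laur}
    (h : ∀ i ∈ s, Approx M L (X i) (f i)) : Approx M L (∑ i ∈ s, X i) (∑ i ∈ s, f i) := by
  classical
  induction s using Finset.induction_on with
  | empty => simpa using of_emb M L 0
  | insert i s hi ih =>
    simp only [Finset.sum_insert hi]
    exact (h i (Finset.mem_insert_self _ _)).add
      (ih fun j hj => h j (Finset.mem_insert_of_mem hj))

lemma mono {L' : ℕ} (h : Approx M L X f) (hL : L' ≤ L) : Approx M L' X f := by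
  obtain ⟨b, v, hb, hv, h⟩ := h
  exact ⟨b, v, hb, van_anti hL hv, h⟩

lemma sub_mem_van (h : Approx M L X f) (h' : Approx M L X g) : f - g ∈ van M L := by
  obtain ⟨b, v, hb, hv, h⟩ := h
  obtain ⟨b', v', hb', hv', h'⟩ := h'
  have e : b * b' * (f - g) = b * v' - b' * v := by
    apply emb_injective
    simp only [map_mul, map_sub]
    rw [← h, ← h']
    ring
  obtain ⟨β, hβ⟩ := exists_inv_mod_van (M := M) (b := b * b') (fun w hw => by
    rw [map_mul]; exact mul_ne_zero (hb w hw) (hb' w hw)) L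
  rw [show f - g = β * (b * b' * (f - g)) - (f - g) * (b * b' * β - 1) by ring, e]
  exact sub_mem (Ideal.mul_mem_left _ _ (sub_mem (Ideal.mul_mem_left _ _ hv')
    (Ideal.mul_mem_left _ _ hv))) (Ideal.mul_mem_left _ _ hβ)

end Approx

lemma IsRep.ev_ne_zero {a b : Laur} (hb : ev 1 b ≠ 0)
    (h : ∀ z ∈ per M, ∃ χ : ℂ, χ ≠ 0 ∧ scale z b = χ • b ∧ scale z a = χ • a) :
    ∀ w ∈ per M, ev w b ≠ 0 := by
  intro w hw
  obtain ⟨χ, hχ, h1, -⟩ := h w hw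
  have := congrArg (ev 1) h1
  rw [ev_scale, mul_one, map_smul, smul_eq_mul] at this
  rw [this]
  exact mul_ne_zero hχ hb

theorem IsRep.exists_approx {X : FF} {c : Tor → ℂ} {l : (ℤ × ℤ →+ ℂ) → ℂ} (h : IsRep M X c 1 l)
    {L : ℕ} (hL : 2 ≤ L) : ∃ f : Laur, Approx M L X f ∧ ev 1 f = 1 ∧
      (∀ φ, ev 1 (theta φ f) = l φ) ∧ ∀ z ∈ per M, scale z f = c z • f := by
  have := finite_per M
  have := Fintype.ofFinite (per M)
  obtain ⟨a, b, h1, h2, h3, h4, h5⟩ := h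
  have hb : ∀ w ∈ per M, ev w b ≠ 0 := by
    refine IsRep.ev_ne_zero (a := 0) h2 fun z hz => ?_
    obtain ⟨χ, hχ, h6, -⟩ := h5 z hz
    exact ⟨χ, hχ, h6, by simp⟩
  obtain ⟨β, hβ⟩ := exists_inv_mod_van hb L
  set χ : Tor → ℂ := fun z => ev z b / ev 1 b with hχdef
  have hχ : ∀ z ∈ per M, χ z ≠ 0 := fun z hz => div_ne_zero (hb z hz) h2
  have hχb : ∀ z ∈ per M, scale z b = χ z • b ∧ scale z a = (χ z * c z) • a := by
    intro z hz
    obtain ⟨χ', hχ', h6, h7⟩ := h5 z hz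
    have h8 : χ' = χ z := by
      have := congrArg (ev 1) h6
      rw [ev_scale, mul_one, map_smul, smul_eq_mul] at this
      rw [hχdef]
      simp only
      rw [this, mul_div_cancel_right₀ _ h2]
    exact ⟨h8 ▸ h6, h8 ▸ h7⟩
  have hmul : ∀ z ∈ per M, ∀ w, χ (z * w) = χ z * χ w := by
    intro z hz w
    have := congrArg (ev w) (hχb z hz).1
    rw [ev_scale, map_smul, smul_eq_mul] at this
    simp only [hχdef] at this ⊢
    rw [this]
    ring
  have hn : ((Fintype.card (per M) : ℕ) : ℂ) ≠ 0 := Nat.cast_ne_zero.2 Fintype.card_ne_zero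
  set β' : Laur := ((Fintype.card (per M) : ℂ)⁻¹) • ∑ z : per M, χ z • scale (z : Tor) β with hβ'
  have key1 : ∀ w ∈ per M, scale w β' = (χ w)⁻¹ • β' := by
    intro w hw
    have e : ∑ z : per M, χ z • scale (z : Tor) β =
        ∑ z : per M, χ (w * z) • scale (w * z : Tor) β :=
      (Equiv.sum_comp (Equiv.mulLeft (⟨w, hw⟩ : per M))
        fun z : per M => χ z • scale (z : Tor) β).symm
    have e2 : scale w (∑ z : per M, χ z • scale (z : Tor) β) =
        (χ w)⁻¹ • ∑ z : per M, χ (w * z) • scale (w * z : Tor) β := by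
      rw [map_sum, Finset.smul_sum]
      refine Finset.sum_congr rfl fun z _ => ?_
      rw [map_smul, scale_scale, hmul w hw, smul_smul, ← mul_assoc, inv_mul_cancel₀ (hχ w hw),
        one_mul]
    rw [hβ', map_smul, e2, ← e, smul_comm]
  have key2 : b * β' - 1 ∈ van M L := by
    have e : b * β' - 1 = ((Fintype.card (per M) : ℂ)⁻¹) •
        ∑ z : per M, scale (z : Tor) (b * β - 1) := by
      have e1 : ∀ z : per M, scale (z : Tor) (b * β - 1) = b * (χ z • scale (z : Tor) β) - 1 := by
        intro z
        rw [map_sub, map_mul, map_one, (hχb z z.2).1, smul_mul_assoc, mul_smul_comm]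
      simp only [e1, Finset.sum_sub_distrib, ← Finset.mul_sum]
      rw [smul_sub, hβ', mul_smul_comm]
      congr 1
      simp only [Finset.sum_const, Finset.card_univ, nsmul_eq_mul, mul_one]
      have e2 : ((Fintype.card (per M) : ℕ) : Laur) = (Fintype.card (per M) : ℂ) • (1 : Laur) := by
        rw [Nat.cast_smul_eq_nsmul, nsmul_one]
      rw [e2, smul_smul, inv_mul_cancel₀ hn, one_smul]
    rw [e]
    exact smul_mem_ideal _ _ (sum_mem fun z _ => scale_mem_van z.2 hβ)
  have key3 : b * (a * β') - a ∈ van M L := by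
    rw [show b * (a * β') - a = a * (b * β' - 1) by ring]
    exact Ideal.mul_mem_left _ _ key2
  have key4 := (mem_van M).1 (van_anti hL key3) 1 (one_mem _)
  have e1 : ev 1 (a * β') = 1 := by
    have := mem_maxId.1 (Ideal.pow_le_self two_ne_zero key4)
    rw [map_sub, map_mul, h3, one_mul, sub_eq_zero] at this
    exact mul_left_cancel₀ h2 (by rw [this, mul_one])
  refine ⟨a * β', ⟨b, -(b * (a * β') - a), hb, neg_mem key3, ?_⟩, e1, fun φ => ?_,
    fun z hz => ?_⟩
  · rw [mul_sub, h1, map_neg, map_sub, map_mul emb b]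
    ring
  · have := theta_mem_pow φ key4
    rw [show 2 - 1 = 1 from rfl, pow_one, mem_maxId, map_sub, map_sub, (theta φ).leibniz b,
      map_add, smul_eq_mul, smul_eq_mul, map_mul (ev 1) b, map_mul (ev 1) (a * β'), h4, e1] at this
    apply mul_left_cancel₀ h2
    linear_combination this
  · rw [map_mul, (hχb z hz).2, key1 z hz, smul_mul_smul_comm]
    congr 1
    have := hχ z hz
    field_simp

lemma IsRep.pow {X : FF} {c : Tor → ℂ} {l : (ℤ × ℤ →+ ℂ) → ℂ} (h : IsRep M X c 1 l) (n : ℕ) :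
    IsRep M (X ^ n) (fun z => c z ^ n) 1 (fun φ => n * l φ) := by
  induction n with
  | zero =>
    rw [pow_zero, ← map_one emb, ← mon_zero]
    exact (IsRep.of_mon M 0).congr (fun z _ => by simp) rfl (fun φ => by simp)
  | succ n ih =>
    rw [pow_succ]
    exact (ih.mul h).congr (fun z _ => by rw [pow_succ]) (by ring) (fun φ => by push_cast; ring)

lemma IsRep.exists_fraction {X : FF} {c : Tor → ℂ} {v : ℂ} {l : (ℤ × ℤ →+ ℂ) → ℂ}
    (h : IsRep M X c v l) :
    ∃ a b : Laur, (∀ w ∈ per M, ev w b ≠ 0) ∧ emb b * X = emb a := by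
  obtain ⟨a, b, h1, h2, h3, h4, h5⟩ := h
  refine ⟨a, b, IsRep.ev_ne_zero (a := 0) h2 fun z hz => ?_, h1⟩
  obtain ⟨χ, hχ, h6, -⟩ := h5 z hz
  exact ⟨χ, hχ, h6, by simp⟩

/-! ### Linear recurrences -/

lemma isBigO_of_recurrence {K : ℕ} {r : ℂ} {τ : ℕ → ℂ} (h0 : Tendsto τ atTop (nhds 0))
    (h : (fun n => τ (n + 1) - r * τ n) =O[atTop] err (K + 2)) : τ =O[atTop] err (K + 1) := by
  obtain ⟨C, hC, hb⟩ := exists_bound_err h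
  rcases le_or_gt 1 ‖r‖ with hr | hr
  · refine IsBigO.of_bound (8 * C) (Eventually.of_forall fun n => ?_)
    rw [Real.norm_of_nonneg (err_pos _ n).le]
    have step : ∀ n, ‖τ n‖ - 8 * C * err (K + 1) n ≤
        ‖τ (n + 1)‖ - 8 * C * err (K + 1) (n + 1) := by
      intro n
      have h1 : ‖τ n‖ ≤ ‖r * τ n‖ := by
        rw [norm_mul]
        exact le_mul_of_one_le_left (norm_nonneg _) hr
      have h2 : ‖r * τ n‖ ≤ ‖τ (n + 1)‖ + ‖τ (n + 1) - r * τ n‖ := by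
        have := norm_sub_le (τ (n + 1)) (τ (n + 1) - r * τ n)
        rwa [sub_sub_cancel] at this
      have h3 := err_telescope K n
      nlinarith [hb n]
    have hmono : Monotone fun n => ‖τ n‖ - 8 * C * err (K + 1) n := monotone_nat_of_le_succ step
    have hlim : Tendsto (fun n => ‖τ n‖ - 8 * C * err (K + 1) n) atTop (nhds 0) := by
      simpa using h0.norm.sub (tendsto_err.const_mul (8 * C))
    have := hmono.ge_of_tendsto hlim n
    linarith
  · obtain ⟨ρ, hρ1, hρ2⟩ := exists_between hr
    have hρ0 : 0 < ρ := (norm_nonneg r).trans_lt hρ1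
    have hratio : ∀ᶠ n in atTop, ‖r‖ * err (K + 1) n ≤ ρ * err (K + 1) (n + 1) := by
      have hl : Tendsto (fun n : ℕ => ‖r‖ * (1 + 1 / ((n : ℝ) + 1)) ^ (K + 1)) atTop
          (nhds (‖r‖ * (1 + 0) ^ (K + 1))) :=
        ((tendsto_const_nhds.add tendsto_one_div_add_atTop_nhds_zero_nat).pow _).const_mul _
      rw [add_zero, one_pow, mul_one] at hl
      filter_upwards [hl.eventually_le_const hρ1] with n hn
      have hn1 : (0 : ℝ) < (n : ℝ) + 1 := by positivity
      have h1 : √((n : ℝ) + 1) ≤ √(((n + 1 : ℕ) : ℝ) + 1) := Real.sqrt_le_sqrt (by push_cast; linarith)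
      rw [err, err, ← mul_div_assoc, ← mul_div_assoc, div_le_div_iff₀ (by positivity)
        (by positivity)]
      have h2 : (((n + 1 : ℕ) : ℝ) + 1) ^ (K + 1) =
          (1 + 1 / ((n : ℝ) + 1)) ^ (K + 1) * ((n : ℝ) + 1) ^ (K + 1) := by
        rw [← mul_pow]
        congr 1
        push_cast
        field_simp
      rw [h2]
      calc ‖r‖ * √((n : ℝ) + 1) * ((1 + 1 / ((n : ℝ) + 1)) ^ (K + 1) * ((n : ℝ) + 1) ^ (K + 1))
          = (‖r‖ * (1 + 1 / ((n : ℝ) + 1)) ^ (K + 1)) *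
            (√((n : ℝ) + 1) * ((n : ℝ) + 1) ^ (K + 1)) := by ring
        _ ≤ ρ * (√(((n + 1 : ℕ) : ℝ) + 1) * ((n : ℝ) + 1) ^ (K + 1)) := by gcongr
        _ = _ := by ring
    have hsmall : ∀ᶠ n in atTop, err (K + 2) n ≤ 8 * (2 : ℝ) ^ (K + 1) * err (K + 1) (n + 1) := by
      refine Eventually.of_forall fun n => ?_
      have h1 : err (K + 2) n ≤ err (K + 1) n := err_anti (Nat.le_succ _) n
      refine h1.trans ?_
      have hn1 : (1 : ℝ) ≤ (n : ℝ) + 1 := by linarith [(Nat.cast_nonneg n : (0 : ℝ) ≤ n)]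
      have h2 : √((n : ℝ) + 1) ≤ √(((n + 1 : ℕ) : ℝ) + 1) :=
        Real.sqrt_le_sqrt (by push_cast; linarith)
      rw [err, err, ← mul_div_assoc, div_le_div_iff₀ (by positivity) (by positivity)]
      have h3 : (((n + 1 : ℕ) : ℝ) + 1) ^ (K + 1) ≤ 2 ^ (K + 1) * ((n : ℝ) + 1) ^ (K + 1) := by
        rw [← mul_pow]
        refine pow_le_pow_left₀ (by positivity) ?_ _
        push_cast
        linarith
      calc √((n : ℝ) + 1) * (((n + 1 : ℕ) : ℝ) + 1) ^ (K + 1)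
          ≤ √(((n + 1 : ℕ) : ℝ) + 1) * (2 ^ (K + 1) * ((n : ℝ) + 1) ^ (K + 1)) := by gcongr
        _ ≤ 8 * (√(((n + 1 : ℕ) : ℝ) + 1) * (2 ^ (K + 1) * ((n : ℝ) + 1) ^ (K + 1))) := by
          have : 0 ≤ √(((n + 1 : ℕ) : ℝ) + 1) * (2 ^ (K + 1) * ((n : ℝ) + 1) ^ (K + 1)) := by
            positivity
          linarith
        _ = _ := by ring
    obtain ⟨n₀, hn₀⟩ := eventually_atTop.1 (hratio.and hsmall)
    set C' := C * (8 * 2 ^ (K + 1)) with hC'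
    have hC'0 : 0 ≤ C' := by positivity
    have h1ρ : 0 < 1 - ρ := by linarith
    set B := max (‖τ n₀‖ / err (K + 1) n₀) (C' / (1 - ρ)) with hB
    have hB2 : C' ≤ (1 - ρ) * B := by
      rw [mul_comm, ← div_le_iff₀ h1ρ]
      exact le_max_right _ _
    have hB0 : 0 ≤ B := (div_nonneg hC'0 h1ρ.le).trans (le_max_right _ _)
    refine IsBigO.of_bound B ?_
    filter_upwards [eventually_ge_atTop n₀] with n hn
    rw [Real.norm_of_nonneg (err_pos _ n).le]
    induction n, hn using Nat.le_induction with
    | base => exact (div_le_iff₀ (err_pos _ _)).1 (le_max_left _ _)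
    | succ n hn ih =>
      obtain ⟨h1, h2⟩ := hn₀ n hn
      have e := err_pos (K + 1) (n + 1)
      calc ‖τ (n + 1)‖ ≤ ‖r * τ n‖ + ‖τ (n + 1) - r * τ n‖ := by
            have := norm_add_le (r * τ n) (τ (n + 1) - r * τ n)
            rwa [add_sub_cancel] at this
        _ ≤ ‖r‖ * (B * err (K + 1) n) + C * (8 * 2 ^ (K + 1) * err (K + 1) (n + 1)) := by
            rw [norm_mul]
            refine add_le_add (mul_le_mul_of_nonneg_left ih (norm_nonneg _)) ((hb n).trans ?_)
            exact mul_le_mul_of_nonneg_left h2 hC.le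
        _ = B * (‖r‖ * err (K + 1) n) + C' * err (K + 1) (n + 1) := by rw [hC']; ring
        _ ≤ B * (ρ * err (K + 1) (n + 1)) + (1 - ρ) * B * err (K + 1) (n + 1) := by gcongr
        _ = B * err (K + 1) (n + 1) := by ring

open Polynomial in
/-- A functional on polynomials that is small on the multiples of a polynomial is small. -/
theorem isBigO_of_functional (ℓ : ℂ[X] →ₗ[ℂ] ℂ)
    (h0 : ∀ p, Tendsto (fun n => ℓ (p * X ^ n)) atTop (nhds 0)) {q : ℂ[X]} (hq : q ≠ 0) {K : ℕ}
    (h : (fun n => ℓ (q * X ^ n)) =O[atTop] err (K + 1 + q.natDegree)) :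
    (fun n => ℓ (X ^ n)) =O[atTop] err (K + 1) := by
  induction hd : q.natDegree generalizing q with
  | zero =>
    obtain ⟨c, rfl⟩ : ∃ c, q = C c := ⟨_, eq_C_of_natDegree_eq_zero hd⟩
    have hc : c ≠ 0 := by
      rintro rfl
      simp at hq
    rw [hd] at h
    refine (h.const_mul_left c⁻¹).congr_left fun n => ?_
    rw [← smul_eq_C_mul, map_smul, smul_eq_mul, inv_mul_cancel_left₀ hc]
  | succ d ih =>
    obtain ⟨r, hr⟩ := IsAlgClosed.exists_root q (by
      rw [degree_eq_natDegree hq, hd]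
      exact_mod_cast Nat.succ_ne_zero d)
    obtain ⟨q', rfl⟩ := dvd_iff_isRoot.2 hr
    have hq' : q' ≠ 0 := right_ne_zero_of_mul hq
    have hd' : q'.natDegree = d := by
      rw [natDegree_mul (X_sub_C_ne_zero r) hq', natDegree_X_sub_C] at hd
      omega
    refine ih hq' ?_ hd'
    rw [hd', show K + 1 + d = K + d + 1 by ring]
    refine isBigO_of_recurrence (r := r) (h0 q') ?_
    rw [hd, show K + 1 + (d + 1) = K + d + 2 by ring] at h
    refine h.congr_left fun n => ?_
    rw [← smul_eq_mul (a := r), ← map_smul, ← map_sub]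
    congr 1
    rw [smul_eq_C_mul]
    ring

end OrbitSum

end

noncomputable section

namespace OrbitSum

variable (M : StepModel)

/-! ### Reduction to the saddle point `(1, 1)` -/

instance : Fintype (per M) := @Fintype.ofFinite _ (finite_per M)

/-- The sum of the characters of the group of periods, in the direction `e` and the time `n`. -/
def perSum (e : ℤ × ℤ) (n : ℕ) : ℂ := ∑ z : per M, (chr (z : Tor) e : ℂ) * zet M z ^ n

variable {M}

lemma IsCutoff.sum_sub_one_mem {L : ℕ} {E : Laur} (hE : IsCutoff M L E) :
    ∑ z : per M, scale (z : Tor)⁻¹ E - 1 ∈ van M L := by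
  classical
  rw [mem_van]
  intro w hw
  rw [← Finset.add_sum_erase _ _ (Finset.mem_univ (⟨w, hw⟩ : per M)), add_sub_right_comm]
  refine add_mem ?_ (sum_mem fun z hz => ?_)
  · have := scale_mem_pow w⁻¹ hE.sub_one_mem
    simpa using this
  · have hne : (z : Tor)⁻¹ * w ≠ 1 := by
      intro h
      rw [inv_mul_eq_one] at h
      exact (Finset.mem_erase.1 hz).1 (Subtype.ext h)
    have := scale_mem_pow (z : Tor)⁻¹ (hE.mem _ (mul_mem (inv_mem z.2) hw) hne)
    simpa using this

lemma ct_scale_inv_mul {z : Tor} (hz : z ∈ per M) (E f : Laur) (n : ℕ) :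
    ct (scale z⁻¹ E * f * nor M ^ n) = zet M z ^ n * loc M E (scale z f) n := by
  rw [← ct_scale z, map_mul (scale z), map_mul (scale z), map_pow, scale_scale, mul_inv_cancel, scale_nor M hz,
    smul_pow, mul_smul_comm, map_smul, smul_eq_mul, loc]
  have h1 : scale 1 E = E := by
    have : scale 1 = AlgHom.id ℂ Laur := laur_algHom_ext fun w => by simp [scale_mon]
    rw [this, AlgHom.id_apply]
  rw [h1]

theorem IsCutoff.isBigO_partition {L : ℕ} {E : Laur} (hE : IsCutoff M L E) {K : ℕ}
    (hL : 2 * K ≤ L) (f : Laur) : (fun n : ℕ => ct (f * nor M ^ n) -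
      ∑ z : per M, zet M z ^ n * loc M E (scale (z : Tor) f) n) =O[atTop] err K := by
  have h := (ct_mul_pow_isBigO' (M := M) (K := K) (Ideal.mul_mem_right f _ hE.sum_sub_one_mem)
    hL).neg_left
  refine h.congr_left fun n => ?_
  rw [sub_mul, one_mul, sub_mul, map_sub, neg_sub]
  congr 1
  rw [Finset.sum_mul, Finset.sum_mul, map_sum]
  exact Finset.sum_congr rfl fun z _ => ct_scale_inv_mul z.2 E f n

theorem IsCutoff.isBigO_of_homogeneous {L : ℕ} {E : Laur} (hE : IsCutoff M L E) {K : ℕ}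
    (hL : 2 * K ≤ L) {f : Laur} {e : ℤ × ℤ}
    (hf : ∀ z ∈ per M, scale z f = (chr z e : ℂ) • f) :
    (fun n : ℕ => ct (f * nor M ^ n) - perSum M e n * loc M E f n) =O[atTop] err K := by
  refine (hE.isBigO_partition hL f).congr_left fun n => ?_
  congr 1
  rw [perSum, Finset.sum_mul]
  refine Finset.sum_congr rfl fun z _ => ?_
  rw [hf z z.2, loc_smul]
  ring

lemma tendsto_succ_inv : Tendsto (fun n : ℕ => ((n : ℂ) + 1)⁻¹) atTop (nhds 0) := by
  rw [tendsto_zero_iff_norm_tendsto_zero]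
  simp only [norm_succ_inv]
  exact tendsto_inv_atTop_zero.comp
    (tendsto_atTop_add_const_right _ 1 tendsto_natCast_atTop_atTop)

lemma HasExp.tendsto {b : ℂ} {K d : ℕ} {f : ℕ → ℂ} (h : HasExp b (K + 1) (d + 1) f) :
    Tendsto f atTop (nhds 0) := by
  obtain ⟨R, hR, h⟩ := h
  have h1 : Tendsto (fun n : ℕ => b * R.eval ((n : ℂ) + 1)⁻¹) atTop (nhds (b * R.eval 0)) :=
    ((R.continuous.tendsto 0).comp tendsto_succ_inv).const_mul b
  have h2 : R.eval 0 = 0 := by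
    rw [← Polynomial.coeff_zero_eq_eval_zero, ← Polynomial.X_dvd_iff]
    exact (dvd_pow_self _ (Nat.succ_ne_zero d)).trans hR
  have h3 := (h.trans_tendsto tendsto_err).add h1
  rw [h2, mul_zero, add_zero] at h3
  exact h3.congr fun n => by ring

theorem tendsto_ct_mul_pow (hdrift : M.ZeroDrift) (f : Laur) :
    Tendsto (fun n : ℕ => ct (f * nor M ^ n)) atTop (nhds 0) := by
  obtain ⟨E, hE⟩ := exists_isCutoff M 6
  obtain ⟨b, -, hb⟩ := hE.exists_locExp hdrift le_rfl
  have h1 := (hE.isBigO_partition (K := 1) (by norm_num) f).trans_tendsto (tendsto_err (K := 0))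
  have h2 : Tendsto (fun n : ℕ => ∑ z : per M, zet M z ^ n * loc M E (scale (z : Tor) f) n) atTop
      (nhds (∑ z : per M, 0)) := by
    refine tendsto_finsetSum _ fun z _ => ?_
    have h3 := (hb 1 (by norm_num) 0 (scale (z : Tor) f) (by simp)).tendsto
    rw [tendsto_zero_iff_norm_tendsto_zero] at h3 ⊢
    refine h3.congr fun n => ?_
    rw [norm_mul, norm_pow, norm_zet M z.2, one_pow, one_mul]
  have h3 := h1.add h2
  rw [Finset.sum_const_zero, add_zero] at h3
  exact h3.congr fun n => by ring

/-- The constant terms of a tame series times the powers of the step polynomial are determined, up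
to an error, by a Laurent polynomial which agrees with the series at the periods. -/
theorem Tame.isBigO (hdrift : M.ZeroDrift) {F : FF} (hF : Tame M F)
    (happ : ∀ L, ∃ f, Approx M L F f)
    (hlim : Tendsto (fun n : ℕ => ctF (F * emb (nor M ^ n))) atTop (nhds 0)) {K : ℕ} {f : Laur}
    (hf : Approx M (2 * (K + 1)) F f) :
    (fun n : ℕ => ctF (F * emb (nor M ^ n)) - ct (f * nor M ^ n)) =O[atTop] err (K + 1) := by
  obtain ⟨q, hq, h⟩ := hF
  set L := 2 * (K + 1 + q.natDegree) with hL
  obtain ⟨g, hg⟩ := happ L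
  obtain ⟨f', b, v, hb, hct, hv, he⟩ := h L
  have h1 : f' - pS M q * g ∈ van M L := by
    refine Approx.sub_mem_van (X := emb (pS M q) * F) ⟨b, v, hb, hv, he⟩ ?_
    exact (Approx.of_emb M L _).mul hg
  let ℓ : Polynomial ℂ →ₗ[ℂ] ℂ :=
    { toFun := fun p => ctF (F * emb (pS M p)) - ct (g * pS M p)
      map_add' := fun p r => by
        simp only [pS, map_add, mul_add]
        ring
      map_smul' := fun c p => by
        simp only [pS, map_smul, emb_smul, mul_smul_comm, RingHom.id_apply, smul_eq_mul]
        rw [mul_left_comm, ctF_constF_mul]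
        ring }
  have hpow : ∀ n, pS M (Polynomial.X ^ n) = nor M ^ n := fun n => by
    rw [pS, map_pow, Polynomial.aeval_X]
  have hℓ : ∀ p, ℓ p = ctF (F * emb (pS M p)) - ct (g * pS M p) := fun p => rfl
  have h0 : ∀ p, Tendsto (fun n => ℓ (p * Polynomial.X ^ n)) atTop (nhds 0) := by
    intro p
    have base : Tendsto (fun n => ℓ (Polynomial.X ^ n)) atTop (nhds 0) := by
      simp only [hℓ, hpow]
      simpa using hlim.sub (tendsto_ct_mul_pow hdrift g)
    induction p using Polynomial.induction_on' with
    | add p r hp hr =>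
      simp only [add_mul, map_add]
      simpa using hp.add hr
    | monomial k c =>
      have e : ∀ n, ℓ (Polynomial.monomial k c * Polynomial.X ^ n) =
          c * ℓ (Polynomial.X ^ (n + k)) := by
        intro n
        rw [← smul_eq_mul (a := c), ← map_smul, ← Polynomial.C_mul_X_pow_eq_monomial,
          Polynomial.smul_eq_C_mul, pow_add]
        congr 1
        ring
      simp only [e]
      simpa using (base.comp (tendsto_add_atTop_nat k)).const_mul c
  have h2 : (fun n => ℓ (q * Polynomial.X ^ n)) =O[atTop] err (K + 1 + q.natDegree) := by
    refine (ct_mul_pow_isBigO' h1 le_rfl).congr_left fun n => ?_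
    have h3 := hct (Polynomial.X ^ n)
    rw [hpow] at h3
    rw [hℓ, pS_mul, hpow, map_mul emb, ← mul_assoc, mul_comm F, h3, sub_mul, map_sub]
    congr 2
    ring
  have h3 := isBigO_of_functional ℓ h0 hq h2
  have h4 := ct_mul_pow_isBigO' (K := K + 1) ((hg.mono (by omega)).sub_mem_van hf) le_rfl
  refine (h3.add h4).congr_left fun n => ?_
  rw [hℓ, hpow, sub_mul, map_sub]
  ring

/-! ### Walks and orbit sums -/

lemma cf_eq_ctF (F : FF) (z : ℤ × ℤ) : cf F z = ctF (emb (mon (-z)) * F) := by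
  rw [emb_mon]
  change _ = ((HahnSeries.single (-z.2) (HahnSeries.single (-z.1) (1 : ℂ)) *
    (show LaurentSeries (LaurentSeries ℂ) from F)).coeff 0).coeff 0
  have h1 := HahnSeries.coeff_single_mul (R := LaurentSeries ℂ)
    (r := HahnSeries.single (-z.1) (1 : ℂ)) (x := F) (a := 0) (b := -z.2)
  rw [h1, HahnSeries.coeff_single_mul, one_mul, zero_sub, zero_sub, neg_neg, neg_neg]
  rfl

lemma ratEmb_stepPoly : ratEmb (M.stepPoly StepModel.ratX StepModel.ratY) = emb (lau M) := by
  rw [StepModel.stepPoly, lau, map_sum, map_sum]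
  refine Finset.sum_congr rfl fun s _ => ?_
  have hz : ∀ z : ℤ × ℤ, emb (mon z) = emb (mon (1, 0)) ^ z.1 * emb (mon (0, 1)) ^ z.2 := by
    intro z
    have h1 : emb (mon (1, 0)) ≠ 0 := ((isUnit_mon _).map emb).ne_zero
    have h2 : emb (mon (0, 1)) ≠ 0 := ((isUnit_mon _).map emb).ne_zero
    induction z using mon_induction with
    | h10 => simp
    | h01 => simp
    | h0 => simp [mon_zero]
    | hadd z w hz hw =>
      rw [mon_add, map_mul, hz, hw, Prod.fst_add, Prod.snd_add, zpow_add₀ h1, zpow_add₀ h2]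
      ring
    | hneg z hz =>
      have h3 : emb (mon z) * emb (mon (-z)) = 1 := by rw [← map_mul, mon_mul_mon_neg, map_one]
      rw [← inv_eq_of_mul_eq_one_right h3, hz, Prod.fst_neg, Prod.snd_neg, zpow_neg, zpow_neg,
        mul_inv]
  rw [map_mul, map_mul, map_zpow₀, map_zpow₀, ratEmb_algebraMap, ratEmb_X, ratEmb_Y, emb_smul,
    hz s, mul_assoc]

variable (M) in
/-- The orbit sum divided by `x^(k+1) y^(l+1)`. -/
def orbF (k l u v : ℕ) : FF :=
  emb (mon (-((k : ℤ) + 1, (l : ℤ) + 1))) * ratEmb (M.orbitSum u v)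

lemma ctF_orbF (hsum : M.IsOrbitSummable) (k l u v n : ℕ) :
    ctF (orbF M k l u v * emb (nor M ^ n)) =
      (M.walkCount u v n ((k : ℤ), (l : ℤ)) : ℂ) / (gam M : ℂ) ^ n := by
  rw [hsum.2 u v k l n]
  have h := cf_ratEmb (M.orbitSum u v * M.stepPoly StepModel.ratX StepModel.ratY ^ n)
    ((k : ℤ) + 1, (l : ℤ) + 1)
  rw [← h, cf_eq_ctF, map_mul ratEmb, map_pow ratEmb, ratEmb_stepPoly, ← gam_smul_nor,
    ← map_pow emb, smul_pow, emb_smul, orbF, eq_div_iff (pow_ne_zero _ (gam_ne_zero M)),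
    mul_comm (ctF _), ← ctF_constF_mul]
  congr 1
  ring

lemma walkCount_le (u v n : ℕ) (z : ℤ × ℤ) :
    0 ≤ M.walkCount u v n z ∧
      M.walkCount u v n z ≤ ((lau M ^ n).coeff (z - ((u : ℤ), (v : ℤ)))).re := by
  induction n generalizing z with
  | zero =>
    rw [StepModel.walkCount, pow_zero, ← mon_zero]
    have : (mon 0).coeff (z - ((u : ℤ), (v : ℤ))) = if z = ((u : ℤ), (v : ℤ)) then 1 else 0 := by
      rw [← ct_mon_mul, ← mon_add, ct_mon]
      simp only [add_zero, neg_sub, sub_eq_zero]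
      congr 1
      exact propext eq_comm
    rw [this]
    split_ifs <;> simp
  | succ n ih =>
    rw [StepModel.walkCount]
    have e : ((lau M ^ (n + 1)).coeff (z - ((u : ℤ), (v : ℤ)))).re =
        ∑ s ∈ smallBox, M.weight s * ((lau M ^ n).coeff (z - s - ((u : ℤ), (v : ℤ)))).re := by
      simp only [← ct_mon_mul]
      rw [pow_succ, lau, Finset.mul_sum, Finset.mul_sum, map_sum, Complex.re_sum, ← lau]
      refine Finset.sum_congr rfl fun s _ => ?_
      rw [mul_smul_comm, mul_smul_comm, map_smul, smul_eq_mul, Complex.re_ofReal_mul]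
      congr 3
      rw [mul_comm _ (mon s), ← mul_assoc, ← mon_add]
      congr 2
      abel
    rw [e]
    have h0 : ∀ s ∈ smallBox, 0 ≤ M.weight s * M.walkCount u v n (z - s) := fun s _ =>
      mul_nonneg (M.weight_nonneg s) (ih _).1
    have h1 : ∑ s ∈ smallBox, M.weight s * M.walkCount u v n (z - s) ≤
        ∑ s ∈ smallBox, M.weight s * ((lau M ^ n).coeff (z - s - ((u : ℤ), (v : ℤ)))).re :=
      Finset.sum_le_sum fun s _ => mul_le_mul_of_nonneg_left (ih _).2 (M.weight_nonneg s)
    split_ifs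
    · exact ⟨Finset.sum_nonneg h0, h1⟩
    · exact ⟨le_rfl, (Finset.sum_nonneg h0).trans h1⟩

lemma tendsto_orbF (hsum : M.IsOrbitSummable) (hdrift : M.ZeroDrift) (k l u v : ℕ) :
    Tendsto (fun n : ℕ => ctF (orbF M k l u v * emb (nor M ^ n))) atTop (nhds 0) := by
  simp only [ctF_orbF hsum]
  rw [tendsto_zero_iff_norm_tendsto_zero]
  set e : ℤ × ℤ := ((k : ℤ), (l : ℤ)) - ((u : ℤ), (v : ℤ)) with he
  have h := (tendsto_ct_mul_pow hdrift (mon (-e))).norm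
  rw [norm_zero] at h
  refine squeeze_zero (fun n => norm_nonneg _) (fun n => ?_) h
  obtain ⟨h1, h2⟩ := walkCount_le (M := M) u v n ((k : ℤ), (l : ℤ))
  rw [← ct_mon_mul, ← he] at h2
  have h3 : ct (mon (-e) * lau M ^ n) = (gam M : ℂ) ^ n * ct (mon (-e) * nor M ^ n) := by
    rw [← gam_smul_nor, smul_pow, mul_smul_comm, map_smul, smul_eq_mul]
  have hg := gam_pos M
  rw [norm_div, norm_pow, Complex.norm_real, Complex.norm_real, Real.norm_of_nonneg h1,
    Real.norm_of_nonneg hg.le, div_le_iff₀ (by positivity)]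
  refine h2.trans ((Complex.re_le_norm _).trans ?_)
  rw [h3, norm_mul, norm_pow, Complex.norm_real, Real.norm_of_nonneg hg.le, mul_comm]

lemma orbF_eq (hfin : M.group.Finite) (k l u v : ℕ) : orbF M k l u v =
    ∑ g ∈ hfin.toFinset, constF (M.sgn g) * (ratEmb g.1 ^ (u + 1) * ratEmb g.2 ^ (v + 1) *
      emb (mon (-((k : ℤ) + 1, (l : ℤ) + 1)))) := by
  rw [orbF, StepModel.orbitSum, finsum_mem_eq_finite_toFinset_sum _ hfin, map_sum, Finset.mul_sum]
  refine Finset.sum_congr rfl fun g _ => ?_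
  rw [map_mul, map_mul, map_pow, map_pow, map_intCast, map_intCast]
  ring

lemma LinG.isRep_term {g : StepModel.RatXY × StepModel.RatXY} {p q : (ℤ × ℤ →+ ℂ) → ℂ}
    (h : LinG M g p q) (k l u v : ℕ) :
    ∃ m, IsRep M (ratEmb g.1 ^ (u + 1) * ratEmb g.2 ^ (v + 1) *
      emb (mon (-((k : ℤ) + 1, (l : ℤ) + 1))))
      (fun z => (chr z ((u : ℤ) - k, (v : ℤ) - l) : ℂ)) 1 m := by
  obtain ⟨m, m', h1, h2, -⟩ := h
  refine ⟨_, (((h1.pow (u + 1)).mul (h2.pow (v + 1))).mul (IsRep.of_mon M _)).congr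
    (fun z _ => ?_) (by simp) fun φ => rfl⟩
  simp only [chr, Circle.coe_mul, Circle.coe_zpow, Prod.fst_neg, Prod.snd_neg]
  have e1 := circle_ne_zero z.1
  have e2 := circle_ne_zero z.2
  rw [show ((u : ℤ) - k) = ((u + 1 : ℕ) : ℤ) + -((k : ℤ) + 1) by push_cast; ring,
    show ((v : ℤ) - l) = ((v + 1 : ℕ) : ℤ) + -((l : ℤ) + 1) by push_cast; ring,
    zpow_add₀ e1, zpow_add₀ e2, zpow_natCast, zpow_natCast]
  ring

lemma exists_linG (hdrift : M.ZeroDrift) (hfin : M.group.Finite)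
    {g : StepModel.RatXY × StepModel.RatXY} (hg : M.InGroup g) : ∃ p q, LinG M g p q := by
  rcases group_lin hdrift hfin hg with ⟨-, k, h⟩ | ⟨-, k, h⟩
  · exact ⟨_, _, h⟩
  · exact ⟨_, _, h⟩

lemma exists_isRep_orbF (hdrift : M.ZeroDrift) (hfin : M.group.Finite) (k l u v : ℕ) :
    ∃ w m, IsRep M (orbF M k l u v) (fun z => (chr z ((u : ℤ) - k, (v : ℤ) - l) : ℂ)) w m := by
  rw [orbF_eq hfin]
  have h : ∀ g, ∃ m, g ∈ hfin.toFinset → IsRep M (ratEmb g.1 ^ (u + 1) * ratEmb g.2 ^ (v + 1) *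
      emb (mon (-((k : ℤ) + 1, (l : ℤ) + 1))))
      (fun z => (chr z ((u : ℤ) - k, (v : ℤ) - l) : ℂ)) 1 m := by
    intro g
    by_cases hg : g ∈ hfin.toFinset
    · obtain ⟨p, q, h⟩ := exists_linG hdrift hfin (hfin.mem_toFinset.1 hg)
      obtain ⟨m, hm⟩ := h.isRep_term k l u v
      exact ⟨m, fun _ => hm⟩
    · exact ⟨fun _ => 0, fun h => absurd h hg⟩
  choose m hm using h
  exact ⟨_, _, IsRep.sum _ fun g hg => (hm g hg).const_mul _⟩

theorem tame_orbF (hdrift : M.ZeroDrift) (hfin : M.group.Finite) (k l u v : ℕ) :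
    Tame M (orbF M k l u v) := by
  obtain ⟨w, m, hrep⟩ := exists_isRep_orbF hdrift hfin k l u v
  obtain ⟨a, b, hb, hab⟩ := hrep.exists_fraction
  refine tame_of_res hb hab fun κ _ _ π hS => ?_
  by_cases hpar : Parametrized M π
  · exact Or.inr hpar
  · left
    rw [orbF_eq hfin]
    have h : ∀ g, ∃ ξ, g ∈ hfin.toFinset → Res π (constF (M.sgn g) *
        (ratEmb g.1 ^ (u + 1) * ratEmb g.2 ^ (v + 1) *
          emb (mon (-((k : ℤ) + 1, (l : ℤ) + 1))))) ξ := by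
      intro g
      by_cases hg : g ∈ hfin.toFinset
      · rcases group_dichotomy hS (hfin.mem_toFinset.1 hg) with ⟨ξ, η, h1, h2, -⟩ | h
        · exact ⟨_, fun _ => (Res.of_const _).mul (((h1.pow _).mul (h2.pow _)).mul
            (Res.of_emb _))⟩
        · exact absurd h hpar
      · exact ⟨0, fun h => absurd h hg⟩
    choose ξ hξ using h
    exact ⟨_, Res.sum _ hξ⟩

theorem exists_approx_orbF (hdrift : M.ZeroDrift) (hfin : M.group.Finite) (L : ℕ) :
    ∃ ξ η : StepModel.RatXY × StepModel.RatXY → Laur,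
      (∀ g ∈ hfin.toFinset, ∀ z ∈ per M,
        scale z (ξ g) = (z.1 : ℂ) • ξ g ∧ scale z (η g) = (z.2 : ℂ) • η g) ∧
      (∀ g ∈ hfin.toFinset, ev 1 (ξ g) = 1 ∧ ev 1 (η g) = 1) ∧
      (∀ g ∈ hfin.toFinset, ∀ p q, LinG M g p q → ∀ φ,
        ev 1 (theta φ (η g)) - omg M * ev 1 (theta φ (ξ g)) = p φ ∧
        ev 1 (theta φ (η g)) - omgBar M * ev 1 (theta φ (ξ g)) = q φ) ∧
      ∀ k l u v : ℕ, Approx M L (orbF M k l u v) (∑ g ∈ hfin.toFinset,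
        (M.sgn g : ℂ) • (ξ g ^ (u + 1) * η g ^ (v + 1) *
          mon (-((k : ℤ) + 1, (l : ℤ) + 1)))) := by
  have h : ∀ g, ∃ ξ η : Laur, g ∈ hfin.toFinset →
      (∀ z ∈ per M, scale z ξ = (z.1 : ℂ) • ξ ∧ scale z η = (z.2 : ℂ) • η) ∧
      (ev 1 ξ = 1 ∧ ev 1 η = 1) ∧
      (∀ p q, LinG M g p q → ∀ φ, ev 1 (theta φ η) - omg M * ev 1 (theta φ ξ) = p φ ∧
        ev 1 (theta φ η) - omgBar M * ev 1 (theta φ ξ) = q φ) ∧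
      Approx M L (ratEmb g.1) ξ ∧ Approx M L (ratEmb g.2) η := by
    intro g
    by_cases hg : g ∈ hfin.toFinset
    · obtain ⟨p, q, l, m, hl, hm, hpq⟩ := exists_linG hdrift hfin (hfin.mem_toFinset.1 hg)
      obtain ⟨ξ, h1, h2, h3, h4⟩ := hl.exists_approx (le_max_right L 2)
      obtain ⟨η, h1', h2', h3', h4'⟩ := hm.exists_approx (le_max_right L 2)
      refine ⟨ξ, η, fun _ => ⟨fun z hz => ⟨h4 z hz, h4' z hz⟩, ⟨h2, h2'⟩, ?_,
        h1.mono (le_max_left _ _), h1'.mono (le_max_left _ _)⟩⟩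
      rintro p' q' ⟨l', m', hl', hm', hpq'⟩ φ
      rw [h3, h3', hl.unique hl', hm.unique hm']
      exact hpq' φ
    · exact ⟨0, 0, fun h => absurd h hg⟩
  choose ξ η h using h
  refine ⟨ξ, η, fun g hg => (h g hg).1, fun g hg => (h g hg).2.1, fun g hg => (h g hg).2.2.1,
    fun k l u v => ?_⟩
  rw [orbF_eq hfin]
  refine Approx.sum _ fun g hg => ?_
  obtain ⟨-, -, -, h1, h2⟩ := h g hg
  rw [← one_mul (ξ g ^ (u + 1) * _ * _), ← smul_mul_assoc]
  refine Approx.mul ?_ (((h1.pow _).mul (h2.pow _)).mul (Approx.of_emb M L _))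
  have := Approx.of_emb M L ((M.sgn g : ℂ) • (1 : Laur))
  rwa [emb_smul, map_one, mul_one] at this

/-- The number of walks is determined, up to an error, by a Laurent polynomial which agrees with
the orbit sum at the periods. -/
theorem isBigO_walkCount (hsum : M.IsOrbitSummable) (hdrift : M.ZeroDrift) (k l u v : ℕ) {K : ℕ}
    {f : Laur} (hf : Approx M (2 * (K + 1)) (orbF M k l u v) f) :
    (fun n : ℕ => (M.walkCount u v n ((k : ℤ), (l : ℤ)) : ℂ) / (gam M : ℂ) ^ n -
      ct (f * nor M ^ n)) =O[atTop] err (K + 1) := by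
  simp only [← ctF_orbF hsum]
  refine (tame_orbF hdrift hsum.1 k l u v).isBigO hdrift (fun L => ?_)
    (tendsto_orbF hsum hdrift k l u v) hf
  obtain ⟨ξ, η, -, -, -, h⟩ := exists_approx_orbF hdrift hsum.1 L
  exact ⟨_, h k l u v⟩

end OrbitSum

end

noncomputable section

namespace OrbitSum

/-! ### Asymptotic expansions along a filter -/

section Asy

open Polynomial

variable {F : Filter ℕ} {K : ℕ} {A B : ℕ → ℂ} {P Q : ℂ[X]}

/-- The values of `B` are those of the polynomial `P` at `1 / (n + 1)`, up to an error
of order `K`. -/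
def Asy (F : Filter ℕ) (K : ℕ) (B : ℕ → ℂ) (P : ℂ[X]) : Prop :=
  (fun n : ℕ => B n - P.eval ((n : ℂ) + 1)⁻¹) =O[F] err K

lemma Asy.add (h : Asy F K A P) (h' : Asy F K B Q) : Asy F K (fun n => A n + B n) (P + Q) := by
  refine (IsBigO.add h h').congr_left fun n => ?_
  rw [eval_add]
  ring

lemma Asy.const_mul (c : ℂ) (h : Asy F K A P) : Asy F K (fun n => c * A n) (C c * P) := by
  refine (IsBigO.const_mul_left h c).congr_left fun n => ?_
  rw [eval_mul, eval_C]
  ring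

lemma Asy.sum {ι : Type} (s : Finset ι) {A : ι → ℕ → ℂ} {P : ι → ℂ[X]}
    (h : ∀ i ∈ s, Asy F K (A i) (P i)) : Asy F K (fun n => ∑ i ∈ s, A i n) (∑ i ∈ s, P i) := by
  refine (IsBigO.sum (s := s) h).congr_left fun n => ?_
  simp only [Finset.sum_apply, eval_finsetSum, Finset.sum_sub_distrib]

lemma Asy.congr' (h : Asy F K A P) (hAB : ∀ᶠ n in F, A n = B n) : Asy F K B P := by
  refine IsBigO.congr' h ?_ EventuallyEq.rfl
  filter_upwards [hAB] with n hn
  rw [hn]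

lemma Asy.mono_filter {F' : Filter ℕ} (h : Asy F K A P) (hF : F' ≤ F) : Asy F' K A P :=
  IsBigO.mono h hF

lemma err_isBigO {K K' : ℕ} (h : K' ≤ K) : err K =O[F] err K' := by
  refine IsBigO.of_bound 1 (Eventually.of_forall fun n => ?_)
  rw [one_mul, Real.norm_of_nonneg (err_pos _ n).le, Real.norm_of_nonneg (err_pos _ n).le]
  exact err_anti h n

lemma Asy.mono {K' : ℕ} (h : Asy F K A P) (hK : K' ≤ K) : Asy F K' A P :=
  IsBigO.trans h (err_isBigO hK)

lemma isBigO_eval_of_X_pow_dvd (hF : F ≤ atTop) (h : X ^ K ∣ P) :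
    (fun n : ℕ => P.eval ((n : ℂ) + 1)⁻¹) =O[F] err K :=
  (isBigO_err_of_inv (isBigO_of_X_pow_dvd h)).mono hF

lemma Asy.congr_poly (h : Asy F K A P) (hF : F ≤ atTop) (hPQ : X ^ K ∣ P - Q) : Asy F K A Q := by
  refine (IsBigO.add h (isBigO_eval_of_X_pow_dvd hF hPQ)).congr_left fun n => ?_
  rw [eval_sub]
  ring

lemma X_pow_dvd_of_isBigO [F.NeBot] (hF : F ≤ atTop)
    (h : (fun n : ℕ => P.eval ((n : ℂ) + 1)⁻¹) =O[F] err K) : X ^ K ∣ P := by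
  induction K generalizing P with
  | zero => simp
  | succ K ih =>
    have h1 : Tendsto (fun n : ℕ => P.eval ((n : ℂ) + 1)⁻¹) F (nhds (P.eval 0)) :=
      (P.continuous.tendsto 0).comp (tendsto_succ_inv.mono_left hF)
    have h2 := tendsto_nhds_unique h1 (h.trans_tendsto (tendsto_err.mono_left hF))
    rw [← coeff_zero_eq_eval_zero, ← X_dvd_iff] at h2
    obtain ⟨Q, rfl⟩ := h2
    rw [pow_succ']
    refine mul_dvd_mul_left X (ih ?_)
    have h3 : (fun n : ℕ => (n : ℂ) + 1) =O[F] fun n : ℕ => (n : ℝ) + 1 := by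
      refine IsBigO.of_bound 1 (Eventually.of_forall fun n => ?_)
      rw [one_mul]
      exact_mod_cast le_rfl
    refine (h3.mul h).congr (fun n => ?_) fun n => ?_
    · have hn : (n : ℂ) + 1 ≠ 0 := by exact_mod_cast n.succ_ne_zero
      rw [eval_mul, eval_X, mul_inv_cancel_left₀ hn]
    · have hn : (n : ℝ) + 1 ≠ 0 := by positivity
      rw [err_succ, mul_div_cancel₀ _ hn]

lemma Asy.unique [F.NeBot] (hF : F ≤ atTop) (h : Asy F K A P) (h' : Asy F K A Q) :
    X ^ K ∣ P - Q := by
  refine X_pow_dvd_of_isBigO hF ((IsBigO.sub h' h).congr_left fun n => ?_)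
  rw [eval_sub]
  ring

lemma isBigO_err_shift (K : ℕ) : (fun n => err K (n + 1)) =O[atTop] err K := by
  refine IsBigO.of_bound 2 (Eventually.of_forall fun n => ?_)
  rw [Real.norm_of_nonneg (err_pos _ _).le, Real.norm_of_nonneg (err_pos _ _).le, err, err]
  have h1 : √(((n + 1 : ℕ) : ℝ) + 1) ≤ 2 * √((n : ℝ) + 1) := by
    rw [show (2 : ℝ) = √4 by rw [show (4 : ℝ) = 2 ^ 2 by norm_num, Real.sqrt_sq zero_le_two],
      ← Real.sqrt_mul (by norm_num)]
    refine Real.sqrt_le_sqrt ?_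
    push_cast
    linarith [(Nat.cast_nonneg n : (0 : ℝ) ≤ n)]
  rw [← mul_div_assoc]
  refine div_le_div₀ (by positivity) h1 (by positivity) (pow_le_pow_left₀ (by positivity) ?_ _)
  push_cast
  linarith

/-- `1 / (n + 2)` as a polynomial in `1 / (n + 1)`, to a given order. -/
def shiftPoly (K : ℕ) : ℂ[X] := X * ∑ i ∈ Finset.range K, (-X) ^ i

lemma shiftPoly_eval (K n : ℕ) : (shiftPoly K).eval ((n : ℂ) + 1)⁻¹ =
    ((n : ℂ) + 1 + 1)⁻¹ * (1 - (-((n : ℂ) + 1)⁻¹) ^ K) := by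
  have h1 : (n : ℂ) + 1 ≠ 0 := by exact_mod_cast n.succ_ne_zero
  have h2 : (n : ℂ) + 1 + 1 ≠ 0 := by exact_mod_cast (n + 1).succ_ne_zero
  have h3 : -((n : ℂ) + 1)⁻¹ ≠ 1 := by
    intro h
    rw [neg_eq_iff_eq_neg, inv_eq_iff_eq_inv] at h
    apply h2
    rw [h]
    norm_num
  simp only [shiftPoly, eval_mul, eval_X, eval_finsetSum, eval_pow, eval_neg]
  rw [geom_sum_eq h3]
  generalize (-((n : ℂ) + 1)⁻¹) ^ K = t
  have h4 : -((n : ℂ) + 1)⁻¹ - 1 = -(((n : ℂ) + 1 + 1) * ((n : ℂ) + 1)⁻¹) := by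
    field_simp
    ring
  rw [h4]
  field_simp
  ring

lemma asy_shift (K : ℕ) (P : ℂ[X]) :
    Asy atTop K (fun n : ℕ => P.eval (((n + 1 : ℕ) : ℂ) + 1)⁻¹) (P.comp (shiftPoly K)) := by
  obtain ⟨C, hC, hP⟩ := exists_bound_eval_sub P
  have h1 : (fun n : ℕ => P.eval (((n + 1 : ℕ) : ℂ) + 1)⁻¹ -
      (P.comp (shiftPoly K)).eval ((n : ℂ) + 1)⁻¹) =O[atTop]
      fun n : ℕ => (((n : ℝ) + 1) ^ K)⁻¹ := by
    refine IsBigO.of_bound C (Eventually.of_forall fun n => ?_)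
    have e1 : ‖(((n + 1 : ℕ) : ℂ) + 1)⁻¹‖ ≤ 1 := norm_succ_inv_le _
    have e2 : (shiftPoly K).eval ((n : ℂ) + 1)⁻¹ = (((n + 1 : ℕ) : ℂ) + 1)⁻¹ -
        (((n + 1 : ℕ) : ℂ) + 1)⁻¹ * (-((n : ℂ) + 1)⁻¹) ^ K := by
      rw [shiftPoly_eval]
      push_cast
      ring
    have e3 : ‖(((n + 1 : ℕ) : ℂ) + 1)⁻¹ * (-((n : ℂ) + 1)⁻¹) ^ K‖ ≤
        (((n : ℝ) + 1) ^ K)⁻¹ := by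
      rw [norm_mul, norm_pow, norm_neg, norm_succ_inv n, inv_pow]
      exact mul_le_of_le_one_left (by positivity) e1
    have e4 : (((n : ℝ) + 1) ^ K)⁻¹ ≤ 1 :=
      inv_le_one_of_one_le₀ (one_le_pow₀ (by linarith [(Nat.cast_nonneg n : (0 : ℝ) ≤ n)]))
    rw [eval_comp, Real.norm_of_nonneg (by positivity)]
    refine (hP _ _ (by linarith) ?_).trans ?_
    · rw [e2]
      exact (norm_sub_le _ _).trans (by linarith)
    · rw [e2, sub_sub_cancel]
      exact mul_le_mul_of_nonneg_left e3 hC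
  exact isBigO_err_of_inv h1

lemma coeff_shiftPoly_pow (K p q : ℕ) (hK : p < q ∨ (p = q ∧ 0 < K)) :
    (shiftPoly K ^ q).coeff p = if p = q then 1 else 0 := by
  rw [shiftPoly, mul_pow, mul_comm, coeff_mul_X_pow']
  rcases hK with h | ⟨rfl, h⟩
  · rw [if_neg (by omega), if_neg (by omega)]
  · rw [if_pos le_rfl, if_pos rfl, Nat.sub_self, coeff_zero_eq_eval_zero, eval_pow,
      eval_finsetSum]
    have : ∑ i ∈ Finset.range K, eval 0 ((-X : ℂ[X]) ^ i) = 1 := by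
      rw [Finset.sum_eq_single_of_mem 0 (Finset.mem_range.2 h)]
      · simp
      · intro i _ hi
        simp [hi]
    rw [this, one_pow]

lemma Asy.tendsto (h : Asy atTop K A P) {p : ℕ} (hp : p < K) (hP : X ^ p ∣ P) :
    Tendsto (fun n : ℕ => ((n : ℂ) + 1) ^ p * A n) atTop (nhds (P.coeff p)) := by
  obtain ⟨Q, rfl⟩ := hP
  have h1 : Tendsto (fun n : ℕ => Q.eval ((n : ℂ) + 1)⁻¹) atTop (nhds (Q.eval 0)) :=
    (Q.continuous.tendsto 0).comp tendsto_succ_inv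
  have h2 : Tendsto (fun n : ℕ => ((n : ℂ) + 1) ^ p * (A n - (X ^ p * Q).eval ((n : ℂ) + 1)⁻¹))
      atTop (nhds 0) := by
    obtain ⟨k, rfl⟩ := Nat.exists_eq_add_of_lt hp
    have h3 : (fun n : ℕ => ((n : ℂ) + 1) ^ p) =O[atTop] fun n : ℕ => ((n : ℝ) + 1) ^ p := by
      refine IsBigO.of_bound 1 (Eventually.of_forall fun n => ?_)
      rw [one_mul, norm_pow, norm_pow]
      refine pow_le_pow_left₀ (norm_nonneg _) ?_ _
      exact_mod_cast le_rfl
    refine (h3.mul h).trans_tendsto ((tendsto_err (K := k)).congr fun n => ?_)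
    have hn : (n : ℝ) + 1 ≠ 0 := by positivity
    rw [err, err, show p + k + 1 = p + (k + 1) by ring, pow_add]
    field_simp
    ring
  have h4 : (X ^ p * Q).coeff p = Q.eval 0 := by
    rw [← coeff_zero_eq_eval_zero, mul_comm, coeff_mul_X_pow', if_pos le_rfl, Nat.sub_self]
  rw [h4]
  have h5 := h2.add h1
  rw [zero_add] at h5
  refine h5.congr fun n => ?_
  have hn : (n : ℂ) + 1 ≠ 0 := by exact_mod_cast n.succ_ne_zero
  rw [eval_mul, eval_pow, eval_X, inv_pow]
  field_simp
  ring

end Asy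

/-! ### The expansion functionals at the saddle point -/

variable {M : StepModel} {L : ℕ} {E : Laur}

open Polynomial in
variable (M E) in
/-- `J p f` is the coefficient of `n ^ (-p)` in the expansion of the constant terms of
`E f nor M ^ n`. -/
structure IsJet (K : ℕ) (b : ℂ) (J : ℕ → Laur →ₗ[ℂ] ℂ) : Prop where
  asy : ∀ f, Asy atTop K (fun n => loc M E f (n + 1))
    (∑ p ∈ Finset.range K, monomial p (J p f))
  vanish : ∀ p j f, f ∈ maxId 1 ^ j → p < (j + 1) / 2 + 1 → J p f = 0
  one : 1 < K → J 1 1 = b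
  zero : b = 0 → ∀ p, J p = 0

open Polynomial in
lemma coeff_sum_monomial (K p : ℕ) (a : ℕ → ℂ) :
    (∑ i ∈ Finset.range K, monomial i (a i)).coeff p = if p < K then a p else 0 := by
  rw [finsetSum_coeff]
  simp only [coeff_monomial]
  rw [Finset.sum_ite_eq' (Finset.range K) p]
  simp

lemma tendsto_succ_div :
    Tendsto (fun n : ℕ => ((n : ℂ) + 1) / (((n + 1 : ℕ) : ℂ) + 1)) atTop (nhds 1) := by
  have := (tendsto_const_nhds (x := (1 : ℂ))).sub
    (tendsto_succ_inv.comp (tendsto_add_atTop_nat 1))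
  rw [sub_zero] at this
  refine this.congr fun n => ?_
  have h2 : ((n + 1 : ℕ) : ℂ) + 1 ≠ 0 := by exact_mod_cast (n + 1).succ_ne_zero
  simp only [Function.comp_apply]
  field_simp
  push_cast
  ring

open Polynomial in
theorem IsCutoff.exists_isJet (hE : IsCutoff M L E) (hdrift : M.ZeroDrift) {K : ℕ} (hL6 : 6 ≤ L)
    (hL : 2 * K + 2 ≤ L) : ∃ b J, IsJet M E K b J := by
  obtain ⟨b, hb, hexp⟩ := hE.exists_locExp hdrift hL6
  have hex : ∀ f, ∃ a : ℕ → ℂ, (∀ p, K ≤ p → a p = 0) ∧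
      Asy atTop K (fun n => loc M E f (n + 1)) (∑ p ∈ Finset.range K, monomial p (a p)) ∧
      (b = 0 → ∀ p, a p = 0) ∧ ∀ j, f ∈ maxId 1 ^ j → ∀ p, p < (j + 1) / 2 + 1 → a p = 0 := by
    intro f
    have key : ∀ j, f ∈ maxId 1 ^ j → ∃ a : ℕ → ℂ, (∀ p, K ≤ p → a p = 0) ∧
        Asy atTop K (fun n => loc M E f (n + 1)) (∑ p ∈ Finset.range K, monomial p (a p)) ∧
        (b = 0 → ∀ p, a p = 0) ∧ ∀ p, p < (j + 1) / 2 + 1 → a p = 0 := by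
      intro j hf
      obtain ⟨R, hR, h⟩ := hexp K hL j (nor M * f) (Ideal.mul_mem_left _ _ hf)
      refine ⟨fun p => if p < K then b * R.coeff p else 0, fun p hp => if_neg (by omega), ?_,
        fun h0 p => by simp [h0], fun p hp => ?_⟩
      · refine Asy.congr_poly (P := C b * R) ?_ le_rfl (X_pow_dvd_iff.2 fun p hp => ?_)
        · refine IsBigO.congr_left h fun n => ?_
          simp only [loc_succ, eval_mul, eval_C]
        · rw [coeff_sub, coeff_sum_monomial, if_pos hp, if_pos hp, Polynomial.coeff_C_mul, sub_self]
      · simp only [X_pow_dvd_iff.1 hR p hp, mul_zero, ite_self]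
    obtain ⟨a, ha1, ha2, ha3, -⟩ := key 0 (by simp)
    refine ⟨a, ha1, ha2, ha3, fun j hf p hp => ?_⟩
    obtain ⟨a', ha1', ha2', -, ha4'⟩ := key j hf
    by_cases hpK : p < K
    · have := X_pow_dvd_iff.1 (ha2.unique le_rfl ha2') p hpK
      rw [coeff_sub, coeff_sum_monomial, coeff_sum_monomial, if_pos hpK, if_pos hpK,
        ha4' p hp, sub_zero] at this
      exact this
    · exact ha1 p (by omega)
  choose a ha1 ha2 ha3 ha4 using hex
  have huniq : ∀ f (a' : ℕ → ℂ), (∀ p, K ≤ p → a' p = 0) →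
      Asy atTop K (fun n => loc M E f (n + 1)) (∑ p ∈ Finset.range K, monomial p (a' p)) →
      ∀ p, a f p = a' p := by
    intro f a' h1 h2 p
    by_cases hpK : p < K
    · have := X_pow_dvd_iff.1 ((ha2 f).unique le_rfl h2) p hpK
      rw [coeff_sub, coeff_sum_monomial, coeff_sum_monomial, if_pos hpK, if_pos hpK,
        sub_eq_zero] at this
      exact this
    · rw [ha1 f p (by omega), h1 p (by omega)]
  refine ⟨b, fun p =>
    { toFun := fun f => a f p
      map_add' := fun f g => ?_
      map_smul' := fun c f => ?_ }, ha2, fun p j f hf hp => ha4 f j hf p hp, fun hK => ?_,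
    fun h0 p => LinearMap.ext fun f => ha3 f h0 p⟩
  · refine huniq (f + g) (fun p => a f p + a g p) (fun p hp => ?_) ?_ p
    · rw [ha1 f p hp, ha1 g p hp, add_zero]
    · simp only [map_add, Finset.sum_add_distrib, loc_add]
      exact (ha2 f).add (ha2 g)
  · refine huniq (c • f) (fun p => c * a f p) (fun p hp => ?_) ?_ p
    · rw [ha1 f p hp, mul_zero]
    · simp only [loc_smul]
      have := (ha2 f).const_mul c
      rw [Finset.mul_sum] at this
      simpa only [C_mul_monomial] using this
  · change a 1 1 = b
    have h1 : Tendsto (fun n : ℕ => (((n + 1 : ℕ) : ℂ) + 1) * loc M E 1 (n + 1)) atTop (nhds b) :=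
      hb.comp (tendsto_add_atTop_nat 1)
    have h2 := h1.mul tendsto_succ_div
    rw [mul_one] at h2
    refine tendsto_nhds_unique ?_ (h2.congr fun n => ?_)
      (f := fun n : ℕ => ((n : ℂ) + 1) ^ 1 * loc M E 1 (n + 1))
    · have h3 := (ha2 1).tendsto hK (X_pow_dvd_iff.2 fun p hp => ?_)
      · rwa [coeff_sum_monomial, if_pos hK] at h3
      · rw [coeff_sum_monomial, ha4 1 0 (by simp) p (by omega), ite_self]
    · have h3 : ((n + 1 : ℕ) : ℂ) + 1 ≠ 0 := by exact_mod_cast (n + 1).succ_ne_zero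
      rw [pow_one]
      field_simp

section Jet

variable {K : ℕ} {b : ℂ} {J : ℕ → Laur →ₗ[ℂ] ℂ}

open Polynomial in
lemma IsJet.tendsto (hJ : IsJet M E K b J) {p : ℕ} (hp : p + 1 < K) {f : Laur}
    (hf : f ∈ maxId 1 ^ (2 * p)) :
    Tendsto (fun n : ℕ => ((n : ℂ) + 1) ^ (p + 1) * loc M E f (n + 1)) atTop
      (nhds (J (p + 1) f)) := by
  have h := (hJ.asy f).tendsto hp (X_pow_dvd_iff.2 fun q hq => ?_)
  · rwa [coeff_sum_monomial, if_pos hp] at h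
  · rw [coeff_sum_monomial, hJ.vanish q (2 * p) f hf (by omega), ite_self]

lemma IsJet.by_parts (hJ : IsJet M E K b J) (hE : IsCutoff M L E) (hdrift : M.ZeroDrift)
    (hL : 2 * K + 2 ≤ L) {p : ℕ} (hp : p + 2 < K) (φ : ℤ × ℤ →+ ℂ) {f : Laur}
    (hf : f ∈ maxId 1 ^ (2 * p + 1)) :
    J (p + 2) (f * theta φ (nor M)) = -J (p + 1) (theta φ f) := by
  have hθ : theta φ f ∈ maxId 1 ^ (2 * p) := by simpa using theta_mem_pow φ hf
  have hθs : theta φ (nor M) ∈ maxId 1 := by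
    have h1 := theta_mem_pow φ (nor_sub_one_mem M hdrift)
    rwa [map_sub, Derivation.map_one_eq_zero, sub_zero, show 2 - 1 = 1 from rfl, pow_one] at h1
  have h1 := hJ.tendsto (p := p + 1) (by omega) (f := f * theta φ (nor M)) (by
    rw [show 2 * (p + 1) = 2 * p + 1 + 1 by ring, pow_succ]
    exact Ideal.mul_mem_mul hf hθs)
  have h2 := hJ.tendsto (p := p) (by omega) (f := nor M * theta φ f) (Ideal.mul_mem_left _ _ hθ)
  have h3 : J (p + 1) (nor M * theta φ f) = J (p + 1) (theta φ f) := by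
    rw [← sub_eq_zero, ← map_sub]
    refine hJ.vanish _ (2 * p + 1) _ ?_ (by omega)
    rw [show nor M * theta φ f - theta φ f = (nor M - 1) * theta φ f by ring]
    have := Ideal.mul_mem_mul (nor_sub_one_mem M hdrift) hθ
    rw [← pow_add] at this
    exact Ideal.pow_le_pow_right (by omega) this
  rw [h3] at h2
  have h4 : (fun n : ℕ => ct (theta φ E * (f * nor M) * nor M ^ (n + 1))) =O[atTop] err K :=
    ((ct_mul_pow_isBigO' (M := M) (K := K) (Ideal.mul_mem_right _ _ (hE.theta_mem_van φ))
      (by omega)).comp_tendsto (tendsto_add_atTop_nat 1)).trans (isBigO_err_shift K)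
  have h5 := Asy.tendsto (P := 0) (p := p + 1) (by simpa [Asy] using h4) (by omega) (dvd_zero _)
  rw [Polynomial.coeff_zero] at h5
  have h6 := (h2.neg.sub h5).mul tendsto_succ_div
  rw [sub_zero, mul_one] at h6
  refine tendsto_nhds_unique h1 (h6.congr fun n => ?_)
  have h7 := loc_by_parts (M := M) (E := E) φ f (n + 1)
  have h8 : ((n + 1 : ℕ) : ℂ) + 1 ≠ 0 := by exact_mod_cast (n + 1).succ_ne_zero
  rw [show p + 1 + 1 = p + 2 from rfl, pow_succ _ (p + 1)]
  field_simp
  linear_combination -h7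

end Jet

end OrbitSum

end

noncomputable section

namespace OrbitSum

variable {M : StepModel}

/-! ### The sums of characters -/

lemma perSum_eq_sum_chr {s : ℤ × ℤ} (hs : M.weight s ≠ 0) (e : ℤ × ℤ) (n : ℕ) :
    perSum M e n = ∑ z : per M, (chr (z : Tor) (e + (n : ℤ) • s) : ℂ) := by
  refine Finset.sum_congr rfl fun z _ => ?_
  rw [zet_eq_chr M z.2 hs, chr_add, chr_zsmul, zpow_natCast]
  simp

lemma perSum_add_step {s : ℤ × ℤ} (hs : M.weight s ≠ 0) (e : ℤ × ℤ) (n : ℕ) :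
    perSum M (e + s) n = perSum M e (n + 1) := by
  rw [perSum_eq_sum_chr hs, perSum_eq_sum_chr hs]
  refine Finset.sum_congr rfl fun z _ => ?_
  rw [show e + s + (n : ℤ) • s = e + ((n + 1 : ℕ) : ℤ) • s by push_cast; module]

lemma perSum_eq_zero_or (e : ℤ × ℤ) (n : ℕ) :
    perSum M e n = 0 ∨ perSum M e n = (Fintype.card (per M) : ℂ) := by
  classical
  obtain ⟨s, hs⟩ := exists_step M
  rw [perSum_eq_sum_chr hs]
  let f : per M →* ℂ :=
    { toFun := fun z => (chr (z : Tor) (e + (n : ℤ) • s) : ℂ)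
      map_one' := by simp
      map_mul' := fun a b => by simp [chr_mul] }
  have h := sum_hom_units f
  change ∑ z, f z = 0 ∨ ∑ z, f z = _
  rw [h]
  split_ifs <;> simp

lemma chr_card_smul (z : per M) (a : ℤ × ℤ) :
    chr (z : Tor) ((Fintype.card (per M) : ℤ) • a) = 1 := by
  have h : ((z : Tor)) ^ Fintype.card (per M) = 1 := by
    rw [← Subgroup.coe_pow, pow_card_eq_one, OneMemClass.coe_one]
  have h1 : (z : Tor).1 ^ Fintype.card (per M) = 1 := congrArg Prod.fst h
  have h2 : (z : Tor).2 ^ Fintype.card (per M) = 1 := congrArg Prod.snd h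
  rw [chr, Prod.smul_fst, Prod.smul_snd, smul_eq_mul, smul_eq_mul, zpow_mul, zpow_mul,
    zpow_natCast, zpow_natCast, h1, h2]
  simp

lemma perSum_eq_card {e : ℤ × ℤ} {n : ℕ} (h1 : (Fintype.card (per M) : ℤ) ∣ e.1)
    (h2 : (Fintype.card (per M) : ℤ) ∣ e.2) (hn : Fintype.card (per M) ∣ n) :
    perSum M e n = (Fintype.card (per M) : ℂ) := by
  obtain ⟨s, hs⟩ := exists_step M
  obtain ⟨a, ha⟩ := h1
  obtain ⟨b, hb⟩ := h2
  obtain ⟨m, rfl⟩ := hn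
  rw [perSum_eq_sum_chr hs]
  have : e + ((Fintype.card (per M) * m : ℕ) : ℤ) • s =
      (Fintype.card (per M) : ℤ) • ((a, b) + (m : ℤ) • s) := by
    have : e = (Fintype.card (per M) : ℤ) • ((a, b) : ℤ × ℤ) := Prod.ext ha hb
    rw [this, smul_add, smul_smul, Nat.cast_mul]
  rw [this]
  simp only [chr_card_smul, Circle.coe_one]
  simp

lemma norm_perSum_le (e : ℤ × ℤ) (n : ℕ) : ‖perSum M e n‖ ≤ Fintype.card (per M) := by
  rcases perSum_eq_zero_or (M := M) e n with h | h <;> rw [h] <;> simp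

lemma card_per_ne_zero : (Fintype.card (per M) : ℂ) ≠ 0 := by
  exact_mod_cast Fintype.card_ne_zero

/-- Times `n` for which `n + r` is divisible by `h`. -/
def cls (h r : ℕ) : Filter ℕ := atTop ⊓ 𝓟 {n | h ∣ n + r}

lemma cls_le (h r : ℕ) : cls h r ≤ atTop := inf_le_left

lemma eventually_cls (h r : ℕ) : ∀ᶠ n in cls h r, h ∣ n + r :=
  mem_inf_of_right (mem_principal_self _)

lemma cls_neBot {h : ℕ} (hh : 0 < h) (r : ℕ) : (cls h r).NeBot := by
  rw [cls, ← frequently_mem_iff_neBot]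
  refine frequently_atTop.2 fun N => ⟨N * h + (r * h - r), ?_, ?_⟩
  · exact (Nat.le_mul_of_pos_right N hh).trans (Nat.le_add_right _ _)
  · refine ⟨N + r, ?_⟩
    have : r ≤ r * h := Nat.le_mul_of_pos_right r hh
    rw [Nat.add_assoc, Nat.sub_add_cancel this]
    ring

/-! ### Polynomial dependence on exponents -/

lemma exists_eval_eq {σ K R : Type} [CommRing K] [CommRing R] [Algebra K R]
    (ℓ : R →ₗ[K] K) (P : MvPolynomial σ R) : ∃ Q : MvPolynomial σ K, ∀ x : σ → ℕ,
      MvPolynomial.eval (fun i => (x i : K)) Q = ℓ (MvPolynomial.eval (fun i => (x i : R)) P) := by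
  induction P using MvPolynomial.induction_on' with
  | monomial m a =>
    refine ⟨MvPolynomial.monomial m (ℓ a), fun x => ?_⟩
    rw [MvPolynomial.eval_monomial, MvPolynomial.eval_monomial]
    have : a * (m.prod fun i k => (x i : R) ^ k) = (m.prod fun i k => (x i : K) ^ k) • a := by
      rw [Algebra.smul_def, mul_comm]
      simp [Finsupp.prod, map_prod]
    rw [this, map_smul, smul_eq_mul, mul_comm]
  | add p q hp hq =>
    obtain ⟨P, hP⟩ := hp
    obtain ⟨Q, hQ⟩ := hq
    exact ⟨P + Q, fun x => by rw [map_add, hP, hQ, map_add, map_add]⟩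

lemma exists_binomial {R : Type} [CommRing R] [Algebra ℂ R] {I : Ideal R} (D : ℕ) {a : R}
    (ha : a - 1 ∈ I) : ∃ P : Polynomial R, ∀ n : ℕ, a ^ n - P.eval (n : R) ∈ I ^ D := by
  refine ⟨∑ i ∈ Finset.range D, Polynomial.C ((i.factorial : ℂ)⁻¹ • (a - 1) ^ i) *
    descPochhammer R i, fun n => ?_⟩
  have h1 : ∀ i, Polynomial.eval (n : R) (Polynomial.C ((i.factorial : ℂ)⁻¹ • (a - 1) ^ i) *
      descPochhammer R i) = (n.choose i : R) * (a - 1) ^ i := by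
    intro i
    rw [Polynomial.eval_mul, Polynomial.eval_C, descPochhammer_eval_eq_descFactorial,
      Nat.descFactorial_eq_factorial_mul_choose, Nat.cast_mul, Algebra.smul_def]
    have h2 : algebraMap ℂ R (i.factorial : ℂ)⁻¹ * (i.factorial : R) = 1 := by
      rw [← map_natCast (algebraMap ℂ R), ← map_mul, inv_mul_cancel₀, map_one]
      exact_mod_cast i.factorial_ne_zero
    linear_combination (a - 1) ^ i * (n.choose i : R) * h2
  rw [Polynomial.eval_finsetSum, Finset.sum_congr rfl fun i _ => h1 i]
  have h3 : a ^ n = ∑ i ∈ Finset.range (D + (n + 1)), (n.choose i : R) * (a - 1) ^ i := by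
    conv_lhs => rw [show a = (a - 1) + 1 by ring, add_pow]
    rw [← Finset.sum_subset (Finset.range_subset_range.2 (Nat.le_add_left (n + 1) D))]
    · exact Finset.sum_congr rfl fun i _ => by rw [one_pow, mul_one, mul_comm]
    · intro i _ hi
      rw [Finset.mem_range, not_lt] at hi
      rw [Nat.choose_eq_zero_of_lt (by omega), Nat.cast_zero, zero_mul]
  rw [h3, Finset.sum_range_add, add_sub_cancel_left]
  refine sum_mem fun i _ => Ideal.mul_mem_left _ _ ?_
  exact Ideal.pow_le_pow_right (Nat.le_add_right D i) (Ideal.pow_mem_pow ha _)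

lemma exists_polynomial_prod_pow {R : Type} [CommRing R] [Algebra ℂ R] {I : Ideal R} {D : ℕ}
    {σ : Type} [Fintype σ] (a : σ → R) (ha : ∀ i, a i - 1 ∈ I) (G : R) (ℓ : R →ₗ[ℂ] ℂ)
    (hℓ : ∀ f ∈ I ^ D, ℓ f = 0) : ∃ Q : MvPolynomial σ ℂ, ∀ x : σ → ℕ,
      MvPolynomial.eval (fun i => (x i : ℂ)) Q = ℓ ((∏ i, a i ^ x i) * G) := by
  choose P hP using fun i => exists_binomial D (ha i)
  obtain ⟨Q, hQ⟩ := exists_eval_eq ℓ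
    ((∏ i, Polynomial.aeval (MvPolynomial.X i : MvPolynomial σ R) (P i)) * MvPolynomial.C G)
  refine ⟨Q, fun x => ?_⟩
  rw [hQ, ← sub_eq_zero, ← map_sub]
  have h1 : ∀ i, MvPolynomial.eval (fun i => (x i : R))
      (Polynomial.aeval (MvPolynomial.X i : MvPolynomial σ R) (P i)) =
      (P i).eval ((x i : ℕ) : R) := by
    intro i
    have := Polynomial.hom_eval₂ (P i) (algebraMap R (MvPolynomial σ R))
      (MvPolynomial.eval fun i => (x i : R)) (MvPolynomial.X i)
    have hid : (MvPolynomial.eval fun i => (x i : R)).comp (algebraMap R (MvPolynomial σ R)) =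
        RingHom.id R := RingHom.ext fun r => MvPolynomial.eval_C r
    rw [Polynomial.aeval_def, this, MvPolynomial.eval_X, hid, Polynomial.eval₂_id]
  rw [map_mul, map_prod, MvPolynomial.eval_C, ← sub_mul]
  refine hℓ _ (Ideal.mul_mem_right _ _ ?_)
  rw [Finset.prod_congr rfl fun i _ => h1 i, ← Ideal.Quotient.eq, map_prod, map_prod]
  refine Finset.prod_congr rfl fun i _ => (Ideal.Quotient.eq.2 ?_).symm
  exact hP i (x i)

/-! ### The expansion functionals of a model -/

/-- The orbit sum for the starting point `(u, v)`, up to a high order at the saddle points. -/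
def Lam (hfin : M.group.Finite) (ξ η : StepModel.RatXY × StepModel.RatXY → Laur) (u v : ℕ) :
    Laur := ∑ g ∈ hfin.toFinset, (M.sgn g : ℂ) • (ξ g ^ (u + 1) * η g ^ (v + 1))

open Polynomial in
/-- The data of an expansion of order `K` for the numbers of walks: functionals `J` and
approximations `ξ`, `η` to the components of the elements of the group. -/
structure IsDatum (hfin : M.group.Finite) (K : ℕ) (b : ℂ) (J : ℕ → Laur →ₗ[ℂ] ℂ)
    (ξ η : StepModel.RatXY × StepModel.RatXY → Laur) (E : Laur) : Prop where
  cutoff : IsCutoff M (2 * K + 6) E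
  jet : IsJet M E K b J
  one : ∀ g ∈ hfin.toFinset, ev 1 (ξ g) = 1 ∧ ev 1 (η g) = 1
  lin : ∀ g ∈ hfin.toFinset, ∀ p q, LinG M g p q → ∀ φ,
    ev 1 (theta φ (η g)) - omg M * ev 1 (theta φ (ξ g)) = p φ ∧
    ev 1 (theta φ (η g)) - omgBar M * ev 1 (theta φ (ξ g)) = q φ
  asy : ∀ k l u v : ℕ, (fun n : ℕ =>
    (M.walkCount u v (n + 1) ((k : ℤ), (l : ℤ)) : ℂ) / (gam M : ℂ) ^ (n + 1) -
      perSum M ((u : ℤ) - k, (v : ℤ) - l) (n + 1) * (∑ p ∈ Finset.range K,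
        monomial p (J p (Lam hfin ξ η u v * mon (-((k : ℤ) + 1, (l : ℤ) + 1))))).eval
          ((n : ℂ) + 1)⁻¹) =O[atTop] err K

theorem exists_isDatum (hsum : M.IsOrbitSummable) (hdrift : M.ZeroDrift) (K : ℕ) :
    ∃ b J ξ η E, IsDatum hsum.1 K b J ξ η E := by
  obtain ⟨E, hE⟩ := exists_isCutoff M (2 * K + 6)
  obtain ⟨b, J, hJ⟩ := hE.exists_isJet hdrift (K := K) (by omega) (by omega)
  obtain ⟨ξ, η, h1, h2, h3, h4⟩ := exists_approx_orbF hdrift hsum.1 (2 * K + 6)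
  refine ⟨b, J, ξ, η, E, hE, hJ, h2, h3, fun k l u v => ?_⟩
  set f := Lam hsum.1 ξ η u v * mon (-((k : ℤ) + 1, (l : ℤ) + 1)) with hf
  have hApp : Approx M (2 * K + 6) (orbF M k l u v) f := by
    have := h4 k l u v
    rwa [show ∑ g ∈ hsum.1.toFinset, (M.sgn g : ℂ) • (ξ g ^ (u + 1) * η g ^ (v + 1) *
      mon (-((k : ℤ) + 1, (l : ℤ) + 1))) = f by
        rw [hf, Lam, Finset.sum_mul]
        exact Finset.sum_congr rfl fun g _ => (smul_mul_assoc _ _ _).symm] at this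
  have hscale : ∀ z ∈ per M, scale z f = (chr z ((u : ℤ) - k, (v : ℤ) - l) : ℂ) • f := by
    intro z hz
    rw [hf, Lam, map_mul, map_sum, scale_mon, Finset.sum_mul, Finset.sum_mul, Finset.smul_sum]
    refine Finset.sum_congr rfl fun g hg => ?_
    obtain ⟨e1, e2⟩ := h1 g hg z hz
    have e3 : ((u : ℤ) - k, (v : ℤ) - l) =
        (((u + 1 : ℕ) : ℤ), ((v + 1 : ℕ) : ℤ)) + -((k : ℤ) + 1, (l : ℤ) + 1) := by
      ext <;> simp [sub_eq_add_neg]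
    have e4 : (chr z ((u : ℤ) - k, (v : ℤ) - l) : ℂ) = (z.1 : ℂ) ^ (u + 1) * (z.2 : ℂ) ^ (v + 1) *
        (chr z (-((k : ℤ) + 1, (l : ℤ) + 1)) : ℂ) := by
      rw [e3, chr_add, chr]
      push_cast
      rfl
    rw [map_smul, map_mul, map_pow, map_pow, e1, e2, e4]
    simp only [Algebra.smul_def, map_mul, map_pow]
    ring
  have a1 : (fun n : ℕ => (M.walkCount u v n ((k : ℤ), (l : ℤ)) : ℂ) / (gam M : ℂ) ^ n -
      ct (f * nor M ^ n)) =O[atTop] err K :=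
    (isBigO_walkCount hsum hdrift k l u v (K := K) (hApp.mono (by omega))).trans
      (err_isBigO (Nat.le_succ K))
  have a2 := hE.isBigO_of_homogeneous (K := K) (by omega) hscale
  have a3 := ((a1.add a2).comp_tendsto (tendsto_add_atTop_nat 1)).trans (isBigO_err_shift K)
  have a4 : (fun n : ℕ => perSum M ((u : ℤ) - k, (v : ℤ) - l) (n + 1)) =O[atTop]
      fun _ => (1 : ℝ) :=
    IsBigO.of_bound (Fintype.card (per M)) (Eventually.of_forall fun n => by
      rw [norm_one, mul_one]
      exact norm_perSum_le _ _)
  have a5 := a4.mul (hJ.asy f)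
  simp only [one_mul] at a5
  refine (a3.add a5).congr_left fun n => ?_
  simp only [Function.comp_apply]
  ring

/-! ### Polynomial expansions -/

open Polynomial in
variable (M) in
/-- The polynomials `V p`, for `p < K`, are the coefficients of an expansion of order `K` of
the numbers of walks. -/
def WalkExp (K : ℕ) (V : ℕ → MvPolynomial (Fin 4) ℂ) : Prop :=
  ∀ k l u v : ℕ, (fun n : ℕ =>
    (M.walkCount u v (n + 1) ((k : ℤ), (l : ℤ)) : ℂ) / (gam M : ℂ) ^ (n + 1) -
      perSum M ((u : ℤ) - k, (v : ℤ) - l) (n + 1) * (∑ p ∈ Finset.range K,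
        monomial p (MvPolynomial.eval (fun i => ((![k, l, u, v] i : ℕ) : ℂ)) (V p))).eval
          ((n : ℂ) + 1)⁻¹) =O[atTop] err K

theorem IsDatum.exists_walkExp {hfin : M.group.Finite} {K : ℕ} {b : ℂ} {J : ℕ → Laur →ₗ[ℂ] ℂ}
    {ξ η : StepModel.RatXY × StepModel.RatXY → Laur} {E : Laur}
    (h : IsDatum hfin K b J ξ η E) : ∃ V, WalkExp M K V ∧ ∀ p k l u v,
      MvPolynomial.eval (fun i => ((![k, l, u, v] i : ℕ) : ℂ)) (V p) =
        J p (Lam hfin ξ η u v * mon (-((k : ℤ) + 1, (l : ℤ) + 1))) := by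
  have key : ∀ p, ∃ Q : MvPolynomial (Fin 4) ℂ, ∀ k l u v : ℕ,
      MvPolynomial.eval (fun i => ((![k, l, u, v] i : ℕ) : ℂ)) Q =
        J p (Lam hfin ξ η u v * mon (-((k : ℤ) + 1, (l : ℤ) + 1))) := by
    intro p
    have hg : ∀ g ∈ hfin.toFinset, ∃ Q : MvPolynomial (Fin 4) ℂ, ∀ k l u v : ℕ,
        MvPolynomial.eval (fun i => ((![k, l, u, v] i : ℕ) : ℂ)) Q =
          J p ((ξ g ^ (u + 1) * η g ^ (v + 1)) * mon (-((k : ℤ) + 1, (l : ℤ) + 1))) := by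
      intro g hg
      have hmem : ∀ i : Fin 4, (![mon (-1, 0), mon (0, -1), ξ g, η g] : Fin 4 → Laur) i - 1 ∈
          maxId 1 := by
        intro i
        obtain ⟨h1, h2⟩ := h.one g hg
        fin_cases i <;> simp [mem_maxId, ev_mon, h1, h2]
      obtain ⟨Q, hQ⟩ := exists_polynomial_prod_pow (D := 2 * p)
        (![mon (-1, 0), mon (0, -1), ξ g, η g] : Fin 4 → Laur) hmem
        (ξ g * η g * mon (-1, -1)) (J p) fun f hf => h.jet.vanish p _ f hf (by omega)
      refine ⟨Q, fun k l u v => ?_⟩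
      refine (hQ ![k, l, u, v]).trans (congrArg (J p) ?_)
      rw [Fin.prod_univ_four]
      have e : mon (-((k : ℤ) + 1, (l : ℤ) + 1)) = mon (-1, 0) ^ k * mon (0, -1) ^ l *
          mon (-1, -1) := by
        rw [mon_pow, mon_pow, ← mon_add, ← mon_add]
        congr 1
        ext <;> simp [add_comm]
      rw [e]
      simp only [Matrix.cons_val]
      ring
    choose! Q hQ using hg
    refine ⟨∑ g ∈ hfin.toFinset, MvPolynomial.C (M.sgn g : ℂ) * Q g, fun k l u v => ?_⟩
    rw [Lam, Finset.sum_mul, map_sum, map_sum]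
    refine Finset.sum_congr rfl fun g hg => ?_
    rw [map_mul, MvPolynomial.eval_C, hQ g hg, smul_mul_assoc, map_smul, smul_eq_mul]
  choose V hV using key
  refine ⟨V, fun k l u v => ?_, hV⟩
  simp only [hV]
  exact h.asy k l u v

/-- Multiples of a positive number, as complex numbers. -/
lemma infinite_multiples {h : ℕ} (hh : 0 < h) (a : ℕ) :
    (Set.range fun n : ℕ => ((a + n * h : ℕ) : ℂ)).Infinite := by
  refine Set.infinite_range_of_injective fun m n hmn => ?_
  have h1 : a + m * h = a + n * h := by exact_mod_cast hmn
  exact Nat.eq_of_mul_eq_mul_right hh (Nat.add_left_cancel h1)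

lemma WalkExp.asy {K : ℕ} {V : ℕ → MvPolynomial (Fin 4) ℂ} (h : WalkExp M K V) (k l u v : ℕ)
    {F : Filter ℕ} (hF : F ≤ atTop) (hp : ∀ᶠ n in F, perSum M ((u : ℤ) - k, (v : ℤ) - l) (n + 1) =
      (Fintype.card (per M) : ℂ)) :
    Asy F K (fun n => (M.walkCount u v (n + 1) ((k : ℤ), (l : ℤ)) : ℂ) / (gam M : ℂ) ^ (n + 1))
      (Polynomial.C (Fintype.card (per M) : ℂ) * ∑ p ∈ Finset.range K, Polynomial.monomial p
        (MvPolynomial.eval (fun i => ((![k, l, u, v] i : ℕ) : ℂ)) (V p))) := by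
  refine IsBigO.congr' ((h k l u v).mono hF) ?_ EventuallyEq.rfl
  filter_upwards [hp] with n hn
  rw [hn, Polynomial.eval_mul, Polynomial.eval_C]

theorem WalkExp.unique {K K' : ℕ} {V V' : ℕ → MvPolynomial (Fin 4) ℂ} (h : WalkExp M K V)
    (h' : WalkExp M K' V') {p : ℕ} (hp : p < K) (hp' : p < K') : V p = V' p := by
  set c := Fintype.card (per M) with hc
  have hc0 : 0 < c := Fintype.card_pos
  refine MvPolynomial.funext_set (fun _ => Set.range fun n : ℕ => ((0 + n * c : ℕ) : ℂ))
    (fun _ => infinite_multiples hc0 0) fun x hx => ?_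
  choose y hy using fun i => hx i (Set.mem_univ i)
  obtain rfl : (fun i => ((![y 0 * c, y 1 * c, y 2 * c, y 3 * c] i : ℕ) : ℂ)) = x := by
    funext i
    rw [← hy i]
    fin_cases i <;> simp
  have hper : ∀ᶠ n in cls c 1, perSum M (((y 2 * c : ℕ) : ℤ) - (y 0 * c : ℕ),
      ((y 3 * c : ℕ) : ℤ) - (y 1 * c : ℕ)) (n + 1) = (c : ℂ) := by
    filter_upwards [eventually_cls c 1] with n hn
    refine perSum_eq_card ?_ ?_ hn
    · exact dvd_sub (Int.natCast_dvd_natCast.2 (dvd_mul_left _ _))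
        (Int.natCast_dvd_natCast.2 (dvd_mul_left _ _))
    · exact dvd_sub (Int.natCast_dvd_natCast.2 (dvd_mul_left _ _))
        (Int.natCast_dvd_natCast.2 (dvd_mul_left _ _))
  have h1 := (h.asy _ _ _ _ (cls_le c 1) hper).mono (min_le_left K K')
  have h2 := (h'.asy _ _ _ _ (cls_le c 1) hper).mono (min_le_right K K')
  have := cls_neBot hc0 1
  have h3 := Polynomial.X_pow_dvd_iff.1 (h1.unique (cls_le c 1) h2) p (lt_min hp hp')
  rw [Polynomial.coeff_sub, Polynomial.coeff_C_mul, Polynomial.coeff_C_mul, coeff_sum_monomial,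
    coeff_sum_monomial, if_pos hp, if_pos hp', ← mul_sub] at h3
  exact sub_eq_zero.1 ((mul_eq_zero.1 h3).resolve_left card_per_ne_zero)

lemma exists_real_part {σ : Type} (V : MvPolynomial σ ℂ) : ∃ W : MvPolynomial σ ℝ,
    ∀ x : σ → ℕ, MvPolynomial.eval (fun i => (x i : ℝ)) W =
      (MvPolynomial.eval (fun i => (x i : ℂ)) V).re := by
  obtain ⟨Q, hQ⟩ := exists_eval_eq Complex.reLm V
  exact ⟨Q, fun x => hQ x⟩

lemma eval_map_ofReal {σ : Type} (W : MvPolynomial σ ℝ) (x : σ → ℕ) :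
    MvPolynomial.eval (fun i => (x i : ℂ)) (MvPolynomial.map Complex.ofRealHom W) =
      ((MvPolynomial.eval (fun i => (x i : ℝ)) W : ℝ) : ℂ) := by
  have := MvPolynomial.map_eval Complex.ofRealHom (fun i => (x i : ℝ)) W
  rw [Complex.ofRealHom_eq_coe] at this
  rw [this]
  congr 2

theorem WalkExp.exists_real {K : ℕ} {V : ℕ → MvPolynomial (Fin 4) ℂ} (h : WalkExp M K V) :
    ∃ W : ℕ → MvPolynomial (Fin 4) ℝ,
      WalkExp M K fun p => MvPolynomial.map Complex.ofRealHom (W p) := by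
  choose W hW using fun p => exists_real_part (V p)
  refine ⟨W, fun k l u v => ?_⟩
  refine (IsBigO.of_bound 1 (Eventually.of_forall fun n => ?_)).trans (h k l u v)
  rw [one_mul]
  have hr : ∃ r : ℝ, perSum M ((u : ℤ) - k, (v : ℤ) - l) (n + 1) = r := by
    rcases perSum_eq_zero_or (M := M) ((u : ℤ) - k, (v : ℤ) - l) (n + 1) with e | e
    · exact ⟨0, by simpa using e⟩
    · exact ⟨Fintype.card (per M), by simpa using e⟩
  obtain ⟨r, hr⟩ := hr
  rw [hr]
  simp only [Polynomial.eval_finsetSum, Polynomial.eval_monomial, eval_map_ofReal, hW]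
  refine le_trans (le_of_eq ?_) (Complex.abs_re_le_norm _)
  rw [← Real.norm_eq_abs, ← Complex.norm_real]
  congr 1
  have e1 : ∀ p, (((n : ℂ) + 1)⁻¹) ^ p = (((((n : ℝ) + 1)⁻¹) ^ p : ℝ) : ℂ) := fun p => by
    push_cast
    rfl
  rw [show (M.walkCount u v (n + 1) ((k : ℤ), (l : ℤ)) : ℂ) / (gam M : ℂ) ^ (n + 1) =
    ((M.walkCount u v (n + 1) ((k : ℤ), (l : ℤ)) / gam M ^ (n + 1) : ℝ) : ℂ) by push_cast; rfl]
  simp only [e1]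
  rw [Complex.sub_re, Complex.ofReal_re, Complex.re_ofReal_mul, Complex.re_sum]
  simp only [Complex.re_mul_ofReal]
  push_cast
  rfl

/-- The numbers of walks have a full expansion. -/
theorem exists_walkExp (hsum : M.IsOrbitSummable) (hdrift : M.ZeroDrift) :
    ∃ W : ℕ → MvPolynomial (Fin 4) ℝ, ∀ K,
      WalkExp M K fun p => MvPolynomial.map Complex.ofRealHom (W p) := by
  have key : ∀ K, ∃ W : ℕ → MvPolynomial (Fin 4) ℝ,
      WalkExp M K fun p => MvPolynomial.map Complex.ofRealHom (W p) := by
    intro K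
    obtain ⟨b, J, ξ, η, E, h⟩ := exists_isDatum hsum hdrift K
    obtain ⟨V, hV, -⟩ := h.exists_walkExp
    exact hV.exists_real
  choose W hW using key
  refine ⟨fun p => W (p + 1) p, fun K k l u v => (hW K k l u v).congr_left fun n => ?_⟩
  congr 3
  refine Finset.sum_congr rfl fun p hp => ?_
  exact congrArg (fun P => Polynomial.monomial p (MvPolynomial.eval _ P))
    ((hW K).unique (hW (p + 1)) (Finset.mem_range.1 hp) (Nat.lt_succ_self p))

end OrbitSum

end

noncomputable section

namespace OrbitSum

variable {M : StepModel}

/-! ### The saddle points -/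

lemma stepPoly_one : M.stepPoly (1 : ℝ) 1 = gam M := by
  simp [StepModel.stepPoly, gam]

lemma stepPoly_one_complex : M.stepPoly ((1 : ℝ) : ℂ) ((1 : ℝ) : ℂ) = (gam M : ℂ) := by
  simp [StepModel.stepPoly, gam]

theorem eq_one_of_isDominantSaddlePoint (hdrift : M.ZeroDrift) {x₀ y₀ : ℝ}
    (h : M.IsDominantSaddlePoint x₀ y₀) : x₀ = 1 ∧ y₀ = 1 := by
  obtain ⟨hx, hy, hmin⟩ := h
  obtain ⟨a, rfl⟩ : ∃ a, Real.exp a = x₀ := ⟨_, Real.exp_log hx⟩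
  obtain ⟨b, rfl⟩ : ∃ b, Real.exp b = y₀ := ⟨_, Real.exp_log hy⟩
  have h1 := hmin 1 1 one_pos one_pos
  rw [stepPoly_one] at h1
  have hS : M.stepPoly (Real.exp a) (Real.exp b) =
      ∑ s ∈ smallBox, M.weight s * Real.exp (a * s.1 + b * s.2) := by
    refine Finset.sum_congr rfl fun s _ => ?_
    rw [← Real.rpow_intCast, ← Real.rpow_intCast, ← Real.exp_mul, ← Real.exp_mul, mul_assoc,
      ← Real.exp_add]
    rfl
  have hlin : ∑ s ∈ smallBox, M.weight s * (a * s.1 + b * s.2 + 1) = gam M := by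
    have e : ∀ s ∈ smallBox, M.weight s * (a * s.1 + b * s.2 + 1) =
        a * ((s.1 : ℝ) * M.weight s) + b * ((s.2 : ℝ) * M.weight s) + M.weight s :=
      fun s _ => by ring
    rw [Finset.sum_congr rfl e, Finset.sum_add_distrib, Finset.sum_add_distrib, ← Finset.mul_sum,
      ← Finset.mul_sum, hdrift.1, hdrift.2, gam]
    ring
  rw [hS, ← hlin] at h1
  have h2 : ∀ s ∈ smallBox, M.weight s * (a * s.1 + b * s.2 + 1) ≤
      M.weight s * Real.exp (a * s.1 + b * s.2) := fun s _ =>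
    mul_le_mul_of_nonneg_left (Real.add_one_le_exp _) (M.weight_nonneg s)
  have h3 := (Finset.sum_eq_sum_iff_of_le h2).1 (le_antisymm (Finset.sum_le_sum h2) h1)
  have h4 : (a, b) = (0, 0) := by
    by_contra hab
    obtain ⟨s, hs, hneg⟩ := M.nondegenerate a b hab
    have h5 := mul_left_cancel₀ hs (h3 s (M.small s hs))
    have := Real.add_one_lt_exp (x := a * s.1 + b * s.2) hneg.ne
    linarith
  rw [Prod.mk.injEq] at h4
  simp [h4.1, h4.2]

lemma stepPoly_coe (z : Tor) : M.stepPoly (z.1 : ℂ) (z.2 : ℂ) = (gam M : ℂ) * ev z (nor M) := by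
  rw [← smul_eq_mul, ← map_smul, gam_smul_nor, ev_lau]
  refine Finset.sum_congr rfl fun s _ => ?_
  rw [chr]
  push_cast
  rw [mul_assoc]
  rfl

lemma mem_per_iff_norm {z : Tor} : z ∈ per M ↔ ‖ev z (nor M)‖ = 1 := by
  rw [mem_per_iff_gap, gap, Real.sqrt_eq_zero (gapSq_nonneg M z), gapSq, sub_eq_zero, eq_comm]
  exact pow_eq_one_iff_of_nonneg (norm_nonneg _) two_ne_zero

variable (M) in
open Classical in
/-- The saddle points on the unit torus. -/
def saddles : Finset (ℂ × ℂ) :=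
  Finset.univ.image fun z : per M => (((z : Tor).1 : ℂ), ((z : Tor).2 : ℂ))

lemma mem_saddles (z : ℂ × ℂ) : z ∈ saddles M ↔ M.IsAssociatedSaddlePoint 1 1 z := by
  rw [StepModel.IsAssociatedSaddlePoint, stepPoly_one, saddles, Finset.mem_image]
  have hg := gam_pos M
  constructor
  · rintro ⟨z, -, rfl⟩
    refine ⟨Circle.norm_coe _, Circle.norm_coe _, ?_⟩
    rw [stepPoly_coe, norm_mul, mem_per_iff_norm.1 z.2, mul_one, Complex.norm_real,
      Real.norm_of_nonneg hg.le]
  · rintro ⟨h1, h2, h3⟩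
    obtain ⟨p, hp⟩ : ∃ p : Tor, ((p.1 : ℂ), (p.2 : ℂ)) = z :=
      ⟨(⟨z.1, mem_sphere_zero_iff_norm.2 h1⟩, ⟨z.2, mem_sphere_zero_iff_norm.2 h2⟩), rfl⟩
    subst hp
    rw [stepPoly_coe, norm_mul, Complex.norm_real, Real.norm_of_nonneg hg.le] at h3
    exact ⟨⟨p, mem_per_iff_norm.2 ((mul_eq_left₀ hg.ne').1 h3)⟩, Finset.mem_univ _, rfl⟩

lemma periodicFactor_saddles (k l u v n : ℕ) :
    M.periodicFactor 1 1 (saddles M) k l u v n = perSum M ((u : ℤ) - k, (v : ℤ) - l) n := by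
  rw [StepModel.periodicFactor, saddles, Finset.sum_image, perSum]
  · refine Finset.sum_congr rfl fun z _ => ?_
    have h1 : M.stepPoly (((z : Tor).1 : ℂ)) ((z : Tor).2 : ℂ) /
        M.stepPoly ((1 : ℝ) : ℂ) ((1 : ℝ) : ℂ) = zet M z := by
      rw [stepPoly_coe, stepPoly_one_complex, mul_div_cancel_left₀ _ (gam_ne_zero M)]
      rfl
    change _ * _ * (M.stepPoly (((z : Tor).1 : ℂ)) ((z : Tor).2 : ℂ) /
      M.stepPoly ((1 : ℝ) : ℂ) ((1 : ℝ) : ℂ)) ^ n = _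
    rw [h1, chr, Complex.ofReal_one, div_one, div_one]
    push_cast
    rfl
  · intro z _ w _ h
    rw [Prod.mk.injEq] at h
    exact Subtype.ext (Prod.ext (Circle.ext h.1) (Circle.ext h.2))

/-! ### Expansions in powers of `1 / n` -/

lemma inv_pow_isBigO_err {K K' : ℕ} (h : K' ≤ K) :
    (fun n : ℕ => (((n : ℝ) + 1) ^ K)⁻¹) =O[atTop] err K' := by
  refine IsBigO.of_bound 1 (Eventually.of_forall fun n => ?_)
  have hn : (1 : ℝ) ≤ (n : ℝ) + 1 := by linarith [(Nat.cast_nonneg n : (0 : ℝ) ≤ n)]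
  rw [one_mul, Real.norm_of_nonneg (by positivity), Real.norm_of_nonneg (err_pos _ n).le, err,
    inv_eq_one_div]
  refine div_le_div₀ (Real.sqrt_nonneg _) ?_ (by positivity) (pow_le_pow_right₀ hn h)
  rw [Real.one_le_sqrt]
  exact hn

lemma err_isBigO_inv_pow (K : ℕ) :
    err (K + 1) =O[atTop] fun n : ℕ => (((n : ℝ) + 1) ^ K)⁻¹ := by
  refine IsBigO.of_bound 1 (Eventually.of_forall fun n => ?_)
  have hn : (1 : ℝ) ≤ (n : ℝ) + 1 := by linarith [(Nat.cast_nonneg n : (0 : ℝ) ≤ n)]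
  rw [one_mul, Real.norm_of_nonneg (err_pos _ n).le, Real.norm_of_nonneg (by positivity), err,
    div_le_iff₀ (by positivity), pow_succ, inv_mul_cancel_left₀ (by positivity)]
  rw [Real.sqrt_le_left (by positivity)]
  nlinarith

lemma evalAt_eq (W : MvPolynomial (Fin 4) ℝ) (k l u v : ℕ) :
    StepModel.evalAt W k l u v = MvPolynomial.eval (fun i => ((![k, l, u, v] i : ℕ) : ℝ)) W := by
  rw [StepModel.evalAt]
  congr 2
  funext i
  fin_cases i <;> rfl

lemma ofReal_evalAt (W : MvPolynomial (Fin 4) ℝ) (k l u v : ℕ) :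
    (StepModel.evalAt W k l u v : ℂ) = MvPolynomial.eval
      (fun i => ((![k, l, u, v] i : ℕ) : ℂ)) (MvPolynomial.map Complex.ofRealHom W) := by
  rw [evalAt_eq]
  exact (eval_map_ofReal W ![k, l, u, v]).symm

lemma WalkExp.zero {K : ℕ} {V : ℕ → MvPolynomial (Fin 4) ℂ} (hsum : M.IsOrbitSummable)
    (hdrift : M.ZeroDrift) (h : WalkExp M K V) (hK : 0 < K) (k l u v : ℕ) :
    MvPolynomial.eval (fun i => ((![k, l, u, v] i : ℕ) : ℂ)) (V 0) = 0 := by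
  obtain ⟨b, J, ξ, η, E, hJ⟩ := exists_isDatum hsum hdrift 1
  obtain ⟨V', hV, hV'⟩ := hJ.exists_walkExp
  rw [h.unique hV hK one_pos, hV']
  exact hJ.jet.vanish 0 0 _ (by simp) (by simp)

lemma isBigO_shift_iff {f : ℕ → ℂ} {g : ℕ → ℝ} :
    (fun n => f (n + 1)) =O[atTop] (fun n => g (n + 1)) ↔ f =O[atTop] g := by
  conv_rhs => rw [← map_add_atTop_eq_nat 1, isBigO_map]
  rfl

theorem isExpansion_of_walkExp (hsum : M.IsOrbitSummable) (hdrift : M.ZeroDrift)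
    {W : ℕ → MvPolynomial (Fin 4) ℝ}
    (hW : ∀ K, WalkExp M K fun p => MvPolynomial.map Complex.ofRealHom (W p)) :
    M.IsExpansion 1 1 (saddles M) 0 W := by
  intro m k l u v
  rw [← isBigO_shift_iff]
  simp only [periodicFactor_saddles, stepPoly_one, stepPoly_one_complex, pow_zero, div_one, ofReal_evalAt]
  have hg := gam_ne_zero M
  have hg' := (gam_pos M).ne'
  set e : ℕ → ℂ := fun p => MvPolynomial.eval (fun i => ((![k, l, u, v] i : ℕ) : ℂ))
    (MvPolynomial.map Complex.ofRealHom (W p)) with he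
  have h1 := (hW (m + 1) k l u v).trans (err_isBigO_inv_pow m)
  have h2 : (fun n : ℕ => perSum M ((u : ℤ) - k, (v : ℤ) - l) (n + 1) *
      (e m * ((n : ℂ) + 1)⁻¹ ^ m)) =O[atTop] fun n : ℕ => (((n : ℝ) + 1) ^ m)⁻¹ := by
    refine IsBigO.of_bound (Fintype.card (per M) * ‖e m‖) (Eventually.of_forall fun n => ?_)
    rw [norm_mul, norm_mul, norm_pow, norm_succ_inv, inv_pow, mul_assoc,
      Real.norm_of_nonneg (by positivity)]
    exact mul_le_mul_of_nonneg_right (norm_perSum_le _ _) (by positivity)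
  have h4 : (fun n : ℕ => (gam M : ℂ) ^ (n + 1)) =O[atTop] fun n : ℕ => gam M ^ (n + 1) :=
    IsBigO.of_bound 1 (Eventually.of_forall fun n => by simp)
  rcases Nat.eq_zero_or_pos m with rfl | hm
  · have h0 := (hW 0 k l u v).trans (err_isBigO (Nat.zero_le 0))
    simp only [zero_add, Finset.range_one, Finset.sum_singleton] at h1
    refine (h4.mul h1).congr (fun n => ?_) fun n => ?_
    · have hz : e 0 = 0 := (hW 1).zero hsum hdrift one_pos k l u v
      rw [show MvPolynomial.eval (fun i => ((![k, l, u, v] i : ℕ) : ℂ))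
        ((fun p => MvPolynomial.map Complex.ofRealHom (W p)) 0) = e 0 from rfl, hz]
      simp only [map_zero, Polynomial.eval_zero, mul_zero, sub_zero]
      rw [mul_div_cancel₀ _ (pow_ne_zero _ hg)]
      simp
    · push_cast
      simp
  · refine (h4.mul (h1.add h2)).congr (fun n => ?_) fun n => ?_
    · have h5 : (∑ p ∈ Finset.range (m + 1), Polynomial.monomial p (MvPolynomial.eval
          (fun i => ((![k, l, u, v] i : ℕ) : ℂ))
          ((fun p => MvPolynomial.map Complex.ofRealHom (W p)) p))).eval ((n : ℂ) + 1)⁻¹ =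
          ∑ p ∈ Finset.Ico 1 m, e p * ((n : ℂ) + 1)⁻¹ ^ p + e m * ((n : ℂ) + 1)⁻¹ ^ m := by
        rw [Polynomial.eval_finsetSum, Finset.sum_range_succ, Finset.range_eq_Ico,
          Finset.sum_eq_sum_Ico_succ_bot hm]
        simp only [Polynomial.eval_monomial]
        have hz : e 0 = 0 := (hW 1).zero hsum hdrift one_pos k l u v
        change e 0 * _ + _ + _ = _
        rw [hz, zero_mul, zero_add]
      rw [h5]
      have h6 : ∑ p ∈ Finset.Ico 1 m, e p * perSum M ((u : ℤ) - k, (v : ℤ) - l) (n + 1) /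
          ((n + 1 : ℕ) : ℂ) ^ p = perSum M ((u : ℤ) - k, (v : ℤ) - l) (n + 1) *
            ∑ p ∈ Finset.Ico 1 m, e p * ((n : ℂ) + 1)⁻¹ ^ p := by
        rw [Finset.mul_sum]
        refine Finset.sum_congr rfl fun p _ => ?_
        push_cast
        rw [inv_pow, div_eq_mul_inv]
        ring
      rw [h6, mul_add, mul_sub, mul_div_cancel₀ _ (pow_ne_zero _ hg)]
      ring
    · push_cast
      rw [one_div]

theorem exists_isExpansion (hsum : M.IsOrbitSummable) (hdrift : M.ZeroDrift) :
    ∃ (c : ℕ) (w : ℕ → MvPolynomial (Fin 4) ℝ), M.IsExpansion 1 1 (saddles M) c w := by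
  obtain ⟨W, hW⟩ := exists_walkExp hsum hdrift
  exact ⟨0, W, isExpansion_of_walkExp hsum hdrift hW⟩

theorem walkExp_of_isExpansion {c : ℕ} {w : ℕ → MvPolynomial (Fin 4) ℝ}
    (h : M.IsExpansion 1 1 (saddles M) c w) (m : ℕ) : WalkExp M (c + (m + 1)) fun p =>
      if c < p then MvPolynomial.map Complex.ofRealHom (w (p - c)) else 0 := by
  intro k l u v
  have h1 := isBigO_shift_iff.2 (h (m + 1) k l u v)
  simp only [periodicFactor_saddles, stepPoly_one, stepPoly_one_complex, ofReal_evalAt] at h1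
  have hg := gam_ne_zero M
  have h4 : (fun n : ℕ => ((gam M : ℂ) ^ (n + 1))⁻¹) =O[atTop]
      fun n : ℕ => (gam M ^ (n + 1))⁻¹ :=
    IsBigO.of_bound 1 (Eventually.of_forall fun n => by simp)
  refine ((h4.mul h1).trans (IsBigO.of_bound 1 (Eventually.of_forall fun n => ?_)
    (g := fun n : ℕ => (((n : ℝ) + 1) ^ (c + (m + 1)))⁻¹))).trans
    (inv_pow_isBigO_err le_rfl) |>.congr_left fun n => ?_
  · rw [one_mul]
    refine le_of_eq (congrArg _ ?_)
    have := (gam_pos M).ne'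
    push_cast
    rw [pow_add _ c]
    field_simp
  · rw [mul_sub, Polynomial.eval_finsetSum]
    congr 1
    · rw [div_eq_mul_inv, mul_comm]
    · rw [Finset.sum_range_add, Finset.sum_eq_zero (s := Finset.range c), zero_add,
        Finset.range_eq_Ico, Finset.sum_eq_sum_Ico_succ_bot (Nat.succ_pos m)]
      · beta_reduce
        rw [add_zero, if_neg (lt_irrefl c), map_zero, map_zero, Polynomial.eval_zero, zero_add,
          Finset.mul_sum, Finset.mul_sum, Finset.mul_sum]
        refine Finset.sum_congr rfl fun p hp => ?_
        have hp1 := (Finset.mem_Ico.1 hp).1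
        rw [if_pos (by omega), Nat.add_sub_cancel_left, Polynomial.eval_monomial]
        have hn : (n : ℂ) + 1 ≠ 0 := by exact_mod_cast n.succ_ne_zero
        push_cast
        rw [inv_pow, pow_add _ c]
        field_simp
      · intro p hp
        beta_reduce
        rw [if_neg (by have := Finset.mem_range.1 hp; omega), map_zero, map_zero,
          Polynomial.eval_zero]

end OrbitSum

end

noncomputable section

namespace OrbitSum

/-! ### Functionals on Laurent polynomials of finite order at `(1, 1)` -/

lemma int_const_of_succ {F : ℤ → ℂ} (h : ∀ i, F (i + 1) = F i) (i j : ℤ) : F i = F j := by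
  have key : ∀ i, F i = F 0 := by
    intro i
    induction i using Int.induction_on with
    | zero => rfl
    | succ i ih => rw [h, ih]
    | pred i ih => rw [← ih, ← h, sub_add_cancel]
  rw [key i, key j]

section Density

variable {t : Laur →ₗ[ℂ] ℂ} {D : ℕ} {ε : ℤ} {ν : Laur} {d : ℤ × ℤ}

lemma mon_smul_mul_sub_one (d : ℤ × ℤ) (i : ℤ) (ν : Laur) :
    t (mon (i • d) * ((mon d - 1) * ν)) = t (mon ((i + 1) • d) * ν) - t (mon (i • d) * ν) := by
  rw [← map_sub]
  congr 1
  rw [add_smul, one_smul, mon_add]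
  ring

lemma eq_zero_of_half_line (hε : ε * ε = 1)
    (hD : ∀ i : ℤ, t (mon (i • d) * ((mon d - 1) ^ D * ν)) = 0) {a : ℤ}
    (h : ∀ i, a ≤ i → t (mon ((ε * i) • d) * ν) = 0) (i : ℤ) : t (mon (i • d) * ν) = 0 := by
  induction D generalizing ν a i with
  | zero => simpa using hD i
  | succ D ih =>
    have hε' : ε = 1 ∨ ε = -1 := mul_self_eq_one_iff.1 hε
    have h1 := ih (ν := (mon d - 1) * ν) (a := a + 1)
      (fun i => by simpa only [pow_succ, mul_assoc] using hD i) (fun i hi => by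
        rw [mon_smul_mul_sub_one, h i (by omega), sub_zero,
          show ε * i + 1 = ε * (i + ε) by rw [mul_add, hε]]
        exact h _ (by omega))
    rw [int_const_of_succ (F := fun i => t (mon (i • d) * ν)) (fun i => by
      have := h1 i
      rw [mon_smul_mul_sub_one] at this
      exact sub_eq_zero.1 this) i (ε * a)]
    exact h a le_rfl

lemma eq_zero_of_line {ι : Type} {s : Finset ι} {c : ι → ℂ} {j : ι → ℤ} (hc : ∑ x ∈ s, c x ≠ 0)
    (hD : ∀ i : ℤ, t (mon (i • d) * ((mon d - 1) ^ D * ν)) = 0)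
    (h : ∀ i, ∑ x ∈ s, c x * t (mon ((i + j x) • d) * ν) = 0) (i : ℤ) :
    t (mon (i • d) * ν) = 0 := by
  induction D generalizing ν i with
  | zero => simpa using hD i
  | succ D ih =>
    have h1 := ih (ν := (mon d - 1) * ν)
      (fun i => by simpa only [pow_succ, mul_assoc] using hD i) (fun i => by
        simp only [mon_smul_mul_sub_one, mul_sub, Finset.sum_sub_distrib]
        rw [h i, sub_zero]
        simpa only [add_right_comm] using h (i + 1))
    have h2 := int_const_of_succ (F := fun i => t (mon (i • d) * ν)) (fun i => by
      have := h1 i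
      rw [mon_smul_mul_sub_one] at this
      exact sub_eq_zero.1 this)
    have h3 := h i
    rw [Finset.sum_congr rfl fun x _ => by rw [show t (mon ((i + j x) • d) * ν) =
      t (mon (i • d) * ν) from h2 _ _], ← Finset.sum_mul] at h3
    exact (mul_eq_zero.1 h3).resolve_left hc

lemma mon_sub_one_pow_mul_mem (d : ℤ × ℤ) (D : ℕ) (μ ν : Laur) :
    μ * ((mon d - 1) ^ D * ν) ∈ maxId 1 ^ D :=
  Ideal.mul_mem_left _ _ (Ideal.mul_mem_right _ _ (Ideal.pow_mem_pow (mon_sub_one_mem d) _))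

theorem eq_zero_of_quadrant (hε : ε * ε = 1) (ht : ∀ f ∈ maxId 1 ^ D, t f = 0) {a : ℤ}
    (h : ∀ z : ℤ × ℤ, a ≤ z.1 → a ≤ z.2 → t (mon (ε • z)) = 0) : t = 0 := by
  have h1 : ∀ j, a ≤ j → ∀ i : ℤ, t (mon (i • (1, 0)) * mon (0, ε * j)) = 0 := fun j hj =>
    eq_zero_of_half_line hε (D := D) (a := a)
      (fun i => ht _ (mon_sub_one_pow_mul_mem _ _ _ _)) fun i hi => by
        rw [← mon_add]
        simpa using h (i, j) hi hj
  have h2 : ∀ i j : ℤ, t (mon (j • (0, 1)) * mon (i, 0)) = 0 := fun i =>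
    eq_zero_of_half_line hε (D := D) (a := a)
      (fun i => ht _ (mon_sub_one_pow_mul_mem _ _ _ _)) fun j hj => by
        have := h1 j hj i
        rw [← mon_add] at this ⊢
        simpa using this
  refine LinearMap.ext fun f => ?_
  induction f using laur_induction with
  | hmon z =>
    have := h2 z.1 z.2
    rw [← mon_add] at this
    simpa using this
  | hadd f g hf hg => rw [map_add, hf, hg, map_add]
  | hsmul c f hf => rw [map_smul, hf, map_smul]

end Density

/-! ### Functions on the quarter plane given by functionals -/

section Dirichlet

variable {M : StepModel} {t t₁ : Laur →ₗ[ℂ] ℂ} {D : ℕ} {ε : ℤ} {f : ℤ × ℤ → ℂ}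

open Classical in
lemma sum_boundary_eq_zero (hε : ε * ε = 1)
    (hf : ∀ z ∈ quarterPlane, f z = t (mon (ε • (z + (1, 1)))))
    (hf0 : ∀ z ∉ quarterPlane, f z = 0) {z : ℤ × ℤ}
    (h : ∑ s ∈ smallBox, (M.weight s : ℂ) * f (z + ε • s) =
      ∑ s ∈ smallBox, (M.weight s : ℂ) * t (mon (ε • (z + (1, 1)) + s))) :
    ∑ s ∈ smallBox with z + ε • s ∉ quarterPlane,
      (M.weight s : ℂ) * t (mon (ε • (z + (1, 1)) + s)) = 0 := by
  have e : ∀ s : ℤ × ℤ, ε • (z + ε • s + (1, 1)) = ε • (z + (1, 1)) + s := fun s => by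
    rw [smul_add, smul_add, smul_add, smul_smul, hε, one_smul]
    abel
  rw [← Finset.sum_filter_add_sum_filter_not smallBox (fun s => z + ε • s ∉ quarterPlane),
    ← Finset.sum_filter_add_sum_filter_not smallBox (fun s => z + ε • s ∉ quarterPlane)
      (fun s => (M.weight s : ℂ) * t (mon (ε • (z + (1, 1)) + s)))] at h
  rw [Finset.sum_eq_zero (s := smallBox.filter fun s => z + ε • s ∉ quarterPlane), zero_add] at h
  · rw [Finset.sum_congr rfl (g := fun s => (M.weight s : ℂ) *
      t (mon (ε • (z + (1, 1)) + s)))] at h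
    · exact (add_eq_right.1 h.symm)
    · intro s hs
      rw [hf _ (not_not.1 (Finset.mem_filter.1 hs).2), e]
  · intro s hs
    rw [hf0 _ (Finset.mem_filter.1 hs).2, mul_zero]

lemma sum_smul_mon (t : Laur →ₗ[ℂ] ℂ) (w : ℤ × ℤ) :
    ∑ s ∈ smallBox, (M.weight s : ℂ) * t (mon (w + s)) = t (lau M * mon w) := by
  rw [lau, Finset.sum_mul, map_sum]
  refine Finset.sum_congr rfl fun s _ => ?_
  rw [smul_mul_assoc, map_smul, smul_eq_mul, add_comm w, mon_add]

theorem functional_of_laplacian (hε : ε * ε = 1) (ht : ∀ f ∈ maxId 1 ^ D, t f = 0)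
    (ht₁ : ∀ f ∈ maxId 1 ^ D, t₁ f = 0)
    (hf : ∀ z ∈ quarterPlane, f z = t (mon (ε • (z + (1, 1)))))
    (hf0 : ∀ z ∉ quarterPlane, f z = 0)
    (h : ∀ z ∈ quarterPlane, ∑ s ∈ smallBox, (M.weight s : ℂ) * f (z + ε • s) -
      (gam M : ℂ) * f z = t₁ (mon (ε • (z + (1, 1))))) :
    (∀ g, t₁ g = (gam M : ℂ) * t ((nor M - 1) * g)) ∧ (∀ j : ℤ, t (mon (0, j)) = 0) ∧
      ∀ j : ℤ, t (mon (j, 0)) = 0 := by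
  classical
  have hε' : ε = 1 ∨ ε = -1 := mul_self_eq_one_iff.1 hε
  have e : ∀ z s : ℤ × ℤ, ε • (z + ε • s + (1, 1)) = ε • (z + (1, 1)) + s := fun z s => by
    rw [smul_add, smul_add, smul_add, smul_smul, hε, one_smul]
    abel
  have hsmall : ∀ s ∈ smallBox, (-1 ≤ ε * s.1 ∧ ε * s.1 ≤ 1) ∧ -1 ≤ ε * s.2 ∧ ε * s.2 ≤ 1 := by
    intro s hs
    simp only [smallBox, Finset.mem_product, Finset.mem_Icc] at hs
    rcases hε' with rfl | rfl <;> omega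
  have h1 : t₁ = t ∘ₗ LinearMap.mulLeft ℂ (lau M - (gam M : ℂ) • 1) := by
    rw [← sub_eq_zero]
    refine eq_zero_of_quadrant hε (D := D) (a := 2) (fun g hg => ?_) fun z h1 h2 => ?_
    · simp only [LinearMap.sub_apply, LinearMap.comp_apply, LinearMap.mulLeft_apply]
      rw [ht₁ g hg, ht _ (Ideal.mul_mem_left _ _ hg), sub_zero]
    · have h3 := h (z - (1, 1)) ⟨by simp; omega, by simp; omega⟩
      rw [hf (z - (1, 1)) ⟨by simp; omega, by simp; omega⟩] at h3
      rw [Finset.sum_congr rfl (g := fun s => (M.weight s : ℂ) * t (mon (ε • z + s))),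
        sum_smul_mon, sub_add_cancel] at h3
      · simp only [LinearMap.sub_apply, LinearMap.comp_apply, LinearMap.mulLeft_apply]
        rw [← h3, sub_mul, smul_mul_assoc, one_mul, map_sub, map_smul, smul_eq_mul, sub_self]
      · intro s hs
        have := hsmall s hs
        rw [hf _ ⟨by simp; omega, by simp; omega⟩, e, sub_add_cancel]
  have h2 : ∀ z ∈ quarterPlane, ∑ s ∈ smallBox, (M.weight s : ℂ) * f (z + ε • s) =
      ∑ s ∈ smallBox, (M.weight s : ℂ) * t (mon (ε • (z + (1, 1)) + s)) := by
    intro z hz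
    have h3 := h z hz
    rw [h1, hf z hz] at h3
    simp only [LinearMap.comp_apply, LinearMap.mulLeft_apply] at h3
    rw [sub_mul, smul_mul_assoc, one_mul, map_sub, map_smul, smul_eq_mul] at h3
    rw [sum_smul_mon]
    exact sub_left_inj.1 h3
  refine ⟨fun g => ?_, fun j => ?_, fun j => ?_⟩
  · have h3 : (lau M - (gam M : ℂ) • 1) * g = (gam M : ℂ) • ((nor M - 1) * g) := by
      rw [← smul_mul_assoc, smul_sub, gam_smul_nor]
    rw [h1, LinearMap.comp_apply, LinearMap.mulLeft_apply, h3, map_smul, smul_eq_mul]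
  · have hne : ∑ s ∈ smallBox with s.1 = -ε, (M.weight s : ℂ) ≠ 0 := by
      rw [← Complex.ofReal_sum, Complex.ofReal_ne_zero]
      obtain ⟨s, hs, hs1⟩ := M.nondegenerate ε 0 (by rcases hε' with rfl | rfl <;> simp)
      refine (Finset.sum_pos' (fun s _ => M.weight_nonneg s)
        ⟨s, Finset.mem_filter.2 ⟨M.small s hs, ?_⟩, weight_pos M hs⟩).ne'
      have h4 : ε * s.1 < 0 := by
        rw [zero_mul, add_zero] at hs1
        exact_mod_cast hs1
      have := hsmall s (M.small s hs)
      rcases hε' with rfl | rfl <;> omega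
    have key := eq_zero_of_half_line (t := t) (d := (0, 1)) (D := D) (a := 2) hε
      (ν := ∑ s ∈ smallBox with s.1 = -ε, (M.weight s : ℂ) • mon (0, s.2))
      (fun i => ht _ (mon_sub_one_pow_mul_mem _ _ _ _)) fun i hi => by
        have h3 := sum_boundary_eq_zero hε hf hf0 (h2 (0, i - 1) ⟨by simp, by simp; omega⟩)
        rw [Finset.mul_sum, map_sum, ← h3]
        refine Finset.sum_congr (Finset.filter_congr fun s hs => ?_) fun s hs => ?_
        · have := hsmall s hs
          simp only [quarterPlane, Set.mem_ofPred_eq, Prod.fst_add, Prod.smul_fst, smul_eq_mul,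
            Prod.snd_add, Prod.smul_snd]
          rcases hε' with rfl | rfl <;> omega
        · rw [mul_smul_comm, map_smul, smul_eq_mul, ← mon_add]
          congr 3
          have hs0 := (Finset.mem_filter.1 hs).2
          ext
          · have := hsmall s (Finset.mem_filter.1 hs).1
            simp only [quarterPlane, Set.mem_ofPred_eq, Prod.fst_add, Prod.smul_fst, smul_eq_mul,
              Prod.snd_add, Prod.smul_snd] at hs0
            simp
            rcases hε' with rfl | rfl <;> omega
          · simp
    have h3 := eq_zero_of_line (t := t) (d := (0, 1)) (D := D) (ν := 1) hne (j := fun s => s.2)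
      (fun i => ht _ (mon_sub_one_pow_mul_mem _ _ _ _)) (fun i => by
        have h4 := key i
        rw [Finset.mul_sum, map_sum] at h4
        rw [← h4]
        refine Finset.sum_congr rfl fun s _ => ?_
        rw [mul_smul_comm, map_smul, smul_eq_mul, ← mon_add, mul_one]
        congr 3
        ext <;> simp) j
    simpa using h3
  · have hne : ∑ s ∈ smallBox with s.2 = -ε, (M.weight s : ℂ) ≠ 0 := by
      rw [← Complex.ofReal_sum, Complex.ofReal_ne_zero]
      obtain ⟨s, hs, hs1⟩ := M.nondegenerate 0 ε (by rcases hε' with rfl | rfl <;> simp)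
      refine (Finset.sum_pos' (fun s _ => M.weight_nonneg s)
        ⟨s, Finset.mem_filter.2 ⟨M.small s hs, ?_⟩, weight_pos M hs⟩).ne'
      have h4 : ε * s.2 < 0 := by
        rw [zero_mul, zero_add] at hs1
        exact_mod_cast hs1
      have := hsmall s (M.small s hs)
      rcases hε' with rfl | rfl <;> omega
    have key := eq_zero_of_half_line (t := t) (d := (1, 0)) (D := D) (a := 2) hε
      (ν := ∑ s ∈ smallBox with s.2 = -ε, (M.weight s : ℂ) • mon (s.1, 0))
      (fun i => ht _ (mon_sub_one_pow_mul_mem _ _ _ _)) fun i hi => by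
        have h3 := sum_boundary_eq_zero hε hf hf0 (h2 (i - 1, 0) ⟨by simp; omega, by simp⟩)
        rw [Finset.mul_sum, map_sum, ← h3]
        refine Finset.sum_congr (Finset.filter_congr fun s hs => ?_) fun s hs => ?_
        · have := hsmall s hs
          simp only [quarterPlane, Set.mem_ofPred_eq, Prod.fst_add, Prod.smul_fst, smul_eq_mul,
            Prod.snd_add, Prod.smul_snd]
          rcases hε' with rfl | rfl <;> omega
        · rw [mul_smul_comm, map_smul, smul_eq_mul, ← mon_add]
          congr 3
          have hs0 := (Finset.mem_filter.1 hs).2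
          ext
          · simp
          · have := hsmall s (Finset.mem_filter.1 hs).1
            simp only [quarterPlane, Set.mem_ofPred_eq, Prod.fst_add, Prod.smul_fst, smul_eq_mul,
              Prod.snd_add, Prod.smul_snd] at hs0
            simp
            rcases hε' with rfl | rfl <;> omega
    have h3 := eq_zero_of_line (t := t) (d := (1, 0)) (D := D) (ν := 1) hne (j := fun s => s.1)
      (fun i => ht _ (mon_sub_one_pow_mul_mem _ _ _ _)) (fun i => by
        have h4 := key i
        rw [Finset.mul_sum, map_sum] at h4
        rw [← h4]
        refine Finset.sum_congr rfl fun s _ => ?_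
        rw [mul_smul_comm, map_smul, smul_eq_mul, ← mon_add, mul_one]
        congr 3
        ext <;> simp) j
    simpa using h3

end Dirichlet

end OrbitSum

end

noncomputable section

namespace OrbitSum

variable {M : StepModel}

/-! ### The local form of the step polynomial -/

lemma ev_theta_theta {f g : Laur} (hf : f ∈ maxId 1) (hg : g ∈ maxId 1) (h : Laur)
    (φ χ : ℤ × ℤ →+ ℂ) : ev 1 (theta φ (theta χ (f * g * h))) =
      (ev 1 (theta φ f) * ev 1 (theta χ g) + ev 1 (theta χ f) * ev 1 (theta φ g)) * ev 1 h := by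
  rw [mem_maxId] at hf hg
  simp only [Derivation.leibniz, smul_eq_mul, map_add, map_mul, hf, hg]
  ring

lemma ev_theta_of_mem_sq {f : Laur} (hf : f ∈ maxId 1 ^ 2) (φ : ℤ × ℤ →+ ℂ) :
    ev 1 (theta φ f) = 0 := by
  have := theta_mem_pow φ hf
  rwa [show 2 - 1 = 1 from rfl, pow_one, mem_maxId] at this

lemma sub_const_smul_mem {f : Laur} {n : ℕ} (hf : f ∈ maxId 1 ^ n) (u : Laur) :
    u * f - ev 1 u • f ∈ maxId 1 ^ (n + 1) := by
  rw [show u * f - ev 1 u • f = (u - ev 1 u • 1) * f by rw [sub_mul, smul_mul_assoc, one_mul],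
    pow_succ']
  refine Ideal.mul_mem_mul ?_ hf
  rw [mem_maxId, map_sub, map_smul, map_one, smul_eq_mul, mul_one, sub_self]

theorem exists_nor_third_order (hdrift : M.ZeroDrift) : ∃ κ : ℂ, κ ≠ 0 ∧
    nor M - 1 - κ • (psi (omg M) * psi (omgBar M)) ∈ maxId 1 ^ 3 := by
  obtain ⟨a, ha, b, hb, hab⟩ := exists_eq_psi M (nor_sub_one_mem M hdrift)
  obtain ⟨a₁, -, a₂, -, rfl⟩ := exists_eq_psi M (j := 0) ha
  obtain ⟨b₁, -, b₂, -, rfl⟩ := exists_eq_psi M (j := 0) hb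
  have hω := psi_mem (omg M)
  have hω' := psi_mem (omgBar M)
  have hne := sub_ne_zero.2 (omg_ne_omgBar M)
  have hexp : nor M - 1 = psi (omg M) * psi (omg M) * a₁ +
      psi (omg M) * psi (omgBar M) * (a₂ + b₁) + psi (omgBar M) * psi (omgBar M) * b₂ := by
    rw [hab]
    ring
  have hth : ∀ ω, IsRootForm M ω → ∀ φ, ev 1 (theta φ (theta (linHom ω) (nor M - 1))) =
      mu M ω * ev 1 (theta φ (psi ω)) := by
    intro ω hω φ
    have := ev_theta_of_mem_sq (theta_nor_sub_mem M hdrift hω) φ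
    rw [map_sub, map_sub, Derivation.map_smul, map_smul, sub_eq_zero, smul_eq_mul] at this
    rw [map_sub, Derivation.map_one_eq_zero, sub_zero, this]
  have h1 := hth _ (isRootForm_omg M) (linHom (omg M))
  have h2 := hth _ (isRootForm_omgBar M) (linHom (omgBar M))
  have h3 := hth _ (isRootForm_omg M) (linHom (omgBar M))
  rw [hexp, map_add, map_add, map_add, map_add, map_add, map_add, ev_theta_theta hω hω,
    ev_theta_theta hω hω', ev_theta_theta hω' hω'] at h1 h2 h3
  simp only [ev_theta_psi, sub_self, mul_zero, zero_mul, add_zero, zero_add] at h1 h2 h3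
  have e1 : ev 1 b₂ = 0 := by
    have : (omg M - omgBar M) * (omg M - omgBar M) * (2 * ev 1 b₂) = 0 := by
      linear_combination h1
    simpa [hne] using this
  have e2 : ev 1 a₁ = 0 := by
    have : (omg M - omgBar M) * (omg M - omgBar M) * (2 * ev 1 a₁) = 0 := by
      linear_combination h2
    simpa [hne] using this
  refine ⟨ev 1 (a₂ + b₁), fun h0 => ?_, ?_⟩
  · rw [h0, mul_zero] at h3
    refine mul_ne_zero (mu_omg_ne_zero M) (sub_ne_zero.2 (omg_ne_omgBar M).symm) h3.symm
  · have m1 := sub_const_smul_mem (pow_two (maxId 1) ▸ Ideal.mul_mem_mul hω hω) a₁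
    have m2 := sub_const_smul_mem (pow_two (maxId 1) ▸ Ideal.mul_mem_mul hω hω') (a₂ + b₁)
    have m3 := sub_const_smul_mem (pow_two (maxId 1) ▸ Ideal.mul_mem_mul hω' hω') b₂
    rw [e2, zero_smul, sub_zero] at m1
    rw [e1, zero_smul, sub_zero] at m3
    have := add_mem (add_mem m1 m2) m3
    convert this using 1
    rw [hexp]
    ring

lemma exists_pow_decomp (m : ℕ) {f : Laur} (hf : f ∈ maxId 1 ^ (m + 1)) :
    ∃ u v w, (m = 0 → w = 0) ∧ w ∈ maxId 1 ^ (m - 1) ∧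
      f = u * psi (omg M) ^ (m + 1) + v * psi (omgBar M) ^ (m + 1) +
        psi (omg M) * psi (omgBar M) * w := by
  induction m generalizing f with
  | zero =>
    obtain ⟨a, -, b, -, rfl⟩ := exists_eq_psi M hf
    exact ⟨a, b, 0, fun _ => rfl, zero_mem _, by ring⟩
  | succ m ih =>
    obtain ⟨a, ha, b, hb, rfl⟩ := exists_eq_psi M hf
    obtain ⟨u, v, w, hw0, hw, rfl⟩ := ih ha
    obtain ⟨u', v', w', hw0', hw', rfl⟩ := ih hb
    have hpsi : ∀ (ω : ℂ) {w : Laur}, (m = 0 → w = 0) → w ∈ maxId 1 ^ (m - 1) →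
        psi ω * w ∈ maxId 1 ^ m := by
      intro ω w h0 h1
      rcases Nat.eq_zero_or_pos m with rfl | hm
      · rw [pow_zero, Ideal.one_eq_top]
        exact Submodule.mem_top
      · have := Ideal.mul_mem_mul (psi_mem ω) h1
        rwa [← pow_succ', Nat.sub_add_cancel hm] at this
    refine ⟨u, v', v * psi (omgBar M) ^ m + psi (omg M) * w + (u' * psi (omg M) ^ m +
      psi (omgBar M) * w'), by simp, ?_, by ring⟩
    exact add_mem (add_mem (Ideal.mul_mem_left _ _ (Ideal.pow_mem_pow (psi_mem _) _))
      (hpsi _ hw0 hw)) (add_mem (Ideal.mul_mem_left _ _ (Ideal.pow_mem_pow (psi_mem _) _))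
      (hpsi _ hw0' hw'))

lemma exists_add_pow_decomp (m : ℕ) (a b : ℂ) : ∃ w, (m = 0 → w = 0) ∧ w ∈ maxId 1 ^ (m - 1) ∧
    (a • psi (omg M) + b • psi (omgBar M)) ^ (m + 1) =
      a ^ (m + 1) • psi (omg M) ^ (m + 1) + b ^ (m + 1) • psi (omgBar M) ^ (m + 1) +
        psi (omg M) * psi (omgBar M) * w := by
  induction m with
  | zero => exact ⟨0, fun _ => rfl, zero_mem _, by simp⟩
  | succ m ih =>
    obtain ⟨w, hw0, hw, h⟩ := ih
    refine ⟨(a * b ^ (m + 1)) • psi (omgBar M) ^ m + (b * a ^ (m + 1)) • psi (omg M) ^ m +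
      (a • psi (omg M) + b • psi (omgBar M)) * w, by simp, ?_, ?_⟩
    · refine add_mem (add_mem (smul_mem_ideal _ _ (Ideal.pow_mem_pow (psi_mem _) _))
        (smul_mem_ideal _ _ (Ideal.pow_mem_pow (psi_mem _) _))) ?_
      rcases Nat.eq_zero_or_pos m with rfl | hm
      · rw [hw0 rfl, mul_zero]
        exact zero_mem _
      · have := Ideal.mul_mem_mul (add_mem (smul_mem_ideal _ a (psi_mem (omg M)))
          (smul_mem_ideal _ b (psi_mem (omgBar M)))) hw
        rwa [← pow_succ', Nat.sub_add_cancel hm] at this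
    · rw [pow_succ, h]
      simp only [Algebra.smul_def, map_mul, map_pow]
      ring

/-! ### Harmonic functionals -/

section Harmonic

variable {t : Laur →ₗ[ℂ] ℂ} {m : ℕ}

lemma apply_psi_mul_eq_zero (hdrift : M.ZeroDrift) (ht : ∀ f ∈ maxId 1 ^ (m + 2), t f = 0)
    (hh : ∀ f, t ((nor M - 1) * f) = 0) {w : Laur} (hw0 : m = 0 → w = 0)
    (hw : w ∈ maxId 1 ^ (m - 1)) : t (psi (omg M) * psi (omgBar M) * w) = 0 := by
  rcases Nat.eq_zero_or_pos m with h | hm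
  · rw [hw0 h, mul_zero, map_zero]
  obtain ⟨κ, hκ, h⟩ := exists_nor_third_order hdrift
  have h1 := ht _ (show (nor M - 1 - κ • (psi (omg M) * psi (omgBar M))) * w ∈
    maxId 1 ^ (m + 2) by
      have := Ideal.mul_mem_mul h hw
      rwa [← pow_add, show 3 + (m - 1) = m + 2 by omega] at this)
  rw [sub_mul, map_sub, hh, smul_mul_assoc, map_smul, zero_sub, neg_eq_zero, smul_eq_mul] at h1
  exact (mul_eq_zero.1 h1).resolve_left hκ

lemma apply_add_pow (hdrift : M.ZeroDrift) (ht : ∀ f ∈ maxId 1 ^ (m + 2), t f = 0)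
    (hh : ∀ f, t ((nor M - 1) * f) = 0) (a b : ℂ) :
    t ((a • psi (omg M) + b • psi (omgBar M)) ^ (m + 1)) =
      a ^ (m + 1) * t (psi (omg M) ^ (m + 1)) + b ^ (m + 1) * t (psi (omgBar M) ^ (m + 1)) := by
  obtain ⟨w, hw0, hw, h⟩ := exists_add_pow_decomp (M := M) m a b
  rw [h, map_add, apply_psi_mul_eq_zero hdrift ht hh hw0 hw, add_zero, map_add, map_smul,
    map_smul, smul_eq_mul, smul_eq_mul]

variable (t) in
/-- The functional vanishes on the powers of `x` and on the powers of `y`. -/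
def LinesZero : Prop := (∀ j : ℤ, t (mon (0, j)) = 0) ∧ ∀ j : ℤ, t (mon (j, 0)) = 0

lemma LinesZero.apply_lx_pow (h : LinesZero t) (n : ℕ) : t (lx ^ n) = 0 := by
  rw [lx, sub_eq_add_neg, add_pow, map_sum]
  refine Finset.sum_eq_zero fun i _ => ?_
  have : mon (1, 0) ^ i * (-1) ^ (n - i) * (n.choose i : Laur) =
      ((-1) ^ (n - i) * (n.choose i : ℂ)) • mon ((i : ℤ), 0) := by
    rw [mon_pow, show i • ((1, 0) : ℤ × ℤ) = ((i : ℤ), 0) by simp, Algebra.smul_def]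
    simp only [map_mul, map_pow, map_neg, map_one, map_natCast]
    ring
  rw [this, map_smul, h.2, smul_zero]

lemma LinesZero.apply_ly_pow (h : LinesZero t) (n : ℕ) : t (ly ^ n) = 0 := by
  rw [ly, sub_eq_add_neg, add_pow, map_sum]
  refine Finset.sum_eq_zero fun i _ => ?_
  have : mon (0, 1) ^ i * (-1) ^ (n - i) * (n.choose i : Laur) =
      ((-1) ^ (n - i) * (n.choose i : ℂ)) • mon (0, (i : ℤ)) := by
    rw [mon_pow, show i • ((0, 1) : ℤ × ℤ) = (0, (i : ℤ)) by simp, Algebra.smul_def]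
    simp only [map_mul, map_pow, map_neg, map_one, map_natCast]
    ring
  rw [this, map_smul, h.1, smul_zero]

theorem LinesZero.apply_psiBar_pow (hl : LinesZero t) (hdrift : M.ZeroDrift)
    (ht : ∀ f ∈ maxId 1 ^ (m + 2), t f = 0) (hh : ∀ f, t ((nor M - 1) * f) = 0) :
    t (psi (omgBar M) ^ (m + 1)) = -((-1) ^ (m + 1) * t (psi (omg M) ^ (m + 1))) := by
  have h1 := apply_add_pow hdrift ht hh (-1) 1
  rw [show (-1 : ℂ) • psi (omg M) + (1 : ℂ) • psi (omgBar M) = (omg M - omgBar M) • lx by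
    simp only [psi]; module, smul_pow, map_smul, hl.apply_lx_pow, smul_zero, one_pow, one_mul] at h1
  linear_combination -h1

theorem LinesZero.rot_pow_eq_one (hl : LinesZero t) (hdrift : M.ZeroDrift)
    (ht : ∀ f ∈ maxId 1 ^ (m + 2), t f = 0) (hh : ∀ f, t ((nor M - 1) * f) = 0)
    (h0 : t (psi (omg M) ^ (m + 1)) ≠ 0) : rot M ^ (m + 1) = 1 := by
  have h1 := apply_add_pow hdrift ht hh (-omgBar M) (omg M)
  rw [show (-omgBar M) • psi (omg M) + omg M • psi (omgBar M) = (omg M - omgBar M) • ly by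
    simp only [psi]; module, smul_pow, map_smul, hl.apply_ly_pow, smul_zero,
    hl.apply_psiBar_pow hdrift ht hh, neg_pow (omgBar M)] at h1
  have hs : (-1 : ℂ) ^ (m + 1) ≠ 0 := pow_ne_zero _ (by norm_num)
  have h2 : (omg M ^ (m + 1) - omgBar M ^ (m + 1)) *
      ((-1) ^ (m + 1) * t (psi (omg M) ^ (m + 1))) = 0 := by linear_combination h1
  rw [rot, div_pow, div_eq_one_iff_eq (pow_ne_zero _ omgBar_ne_zero)]
  exact sub_eq_zero.1 ((mul_eq_zero.1 h2).resolve_right (mul_ne_zero hs h0))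

lemma LinesZero.lower (hl : LinesZero t) (hdrift : M.ZeroDrift)
    (ht : ∀ f ∈ maxId 1 ^ (m + 2), t f = 0) (hh : ∀ f, t ((nor M - 1) * f) = 0)
    (h0 : t (psi (omg M) ^ (m + 1)) = 0) : ∀ f ∈ maxId 1 ^ (m + 1), t f = 0 := by
  intro f hf
  obtain ⟨u, v, w, hw0, hw, rfl⟩ := exists_pow_decomp (M := M) m hf
  have key : ∀ (u : Laur) (ω : ℂ), t (psi ω ^ (m + 1)) = 0 → t (u * psi ω ^ (m + 1)) = 0 := by
    intro u ω h
    have := ht _ (sub_const_smul_mem (Ideal.pow_mem_pow (psi_mem ω) (m + 1)) u)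
    rw [map_sub, map_smul, h, smul_zero, sub_zero] at this
    exact this
  have h1 := hl.apply_psiBar_pow hdrift ht hh
  rw [h0, mul_zero, neg_zero] at h1
  rw [map_add, map_add, apply_psi_mul_eq_zero hdrift ht hh hw0 hw, key _ _ h0, key _ _ h1,
    add_zero, add_zero]

theorem LinesZero.eq_zero (hl : LinesZero t) (hdrift : M.ZeroDrift)
    (hh : ∀ f, t ((nor M - 1) * f) = 0) {D : ℕ} (ht : ∀ f ∈ maxId 1 ^ D, t f = 0)
    (h : ∀ d, 0 < d → d < D → rot M ^ d = 1 → (∀ f ∈ maxId 1 ^ (d + 1), t f = 0) →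
      t (psi (omg M) ^ d) = 0) : t = 0 := by
  induction D with
  | zero => exact LinearMap.ext fun f => ht f (by simp)
  | succ D ih =>
    rcases D with _ | m
    · have h1 : ∀ f, t f = 0 := by
        intro f
        have h2 := ht _ (sub_const_smul_mem (f := 1) (n := 0) (by simp) f)
        have h3 := hl.1 0
        rw [show ((0, 0) : ℤ × ℤ) = 0 from rfl, mon_zero] at h3
        rwa [map_sub, map_smul, h3, smul_zero, sub_zero, mul_one] at h2
      exact LinearMap.ext h1
    · refine ih (hl.lower hdrift ht hh ?_) fun d h1 h2 => h d h1 (by omega)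
      by_contra h0
      exact h0 (h _ m.succ_pos (Nat.lt_succ_self _) (hl.rot_pow_eq_one hdrift ht hh h0) ht)

end Harmonic

/-! ### The expansion functionals on the products of local coordinates -/

section Jet

variable {K L : ℕ} {b : ℂ} {J : ℕ → Laur →ₗ[ℂ] ℂ} {E : Laur}

lemma IsJet.psi_step (hJ : IsJet M E K b J) (hE : IsCutoff M L E) (hdrift : M.ZeroDrift)
    (hL : 2 * K + 2 ≤ L) {p : ℕ} (hp : p + 2 < K) {ω ω' : ℂ} (hω : IsRootForm M ω) {i j : ℕ}
    (hij : i + j = 2 * p + 1) :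
    mu M ω * J (p + 2) (psi ω ^ (i + 1) * psi ω' ^ j) =
      -(j * (ω - ω') * J (p + 1) (psi ω ^ i * psi ω' ^ (j - 1))) := by
  have hf : psi ω ^ i * psi ω' ^ j ∈ maxId 1 ^ (2 * p + 1) := by
    rw [← hij, pow_add]
    exact Ideal.mul_mem_mul (Ideal.pow_mem_pow (psi_mem _) _) (Ideal.pow_mem_pow (psi_mem _) _)
  have h1 := hJ.by_parts hE hdrift hL hp (linHom ω) hf
  have h2 := hJ.vanish (p + 2) (2 * p + 3) _ (show psi ω ^ i * psi ω' ^ j *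
      (theta (linHom ω) (nor M) - mu M ω • psi ω) ∈ maxId 1 ^ (2 * p + 3) by
    rw [show 2 * p + 3 = 2 * p + 1 + 2 by ring, pow_add]
    exact Ideal.mul_mem_mul hf (theta_nor_sub_mem M hdrift hω)) (by omega)
  rw [mul_sub, map_sub, h1, mul_smul_comm, map_smul, smul_eq_mul,
    show psi ω ^ i * psi ω' ^ j * psi ω = psi ω ^ (i + 1) * psi ω' ^ j by ring] at h2
  have hmem : ∀ (a b : ℕ) {c : Laur}, a + b + 1 = 2 * p + 1 → c ∈ maxId 1 →
      psi ω ^ a * psi ω' ^ b * c ∈ maxId 1 ^ (2 * p + 1) := by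
    intro a b c hab hc
    rw [← hab, pow_add, pow_add, pow_one]
    exact Ideal.mul_mem_mul (Ideal.mul_mem_mul (Ideal.pow_mem_pow (psi_mem _) _)
      (Ideal.pow_mem_pow (psi_mem _) _)) hc
  have hi : i ≠ 0 → psi ω ^ (i - 1) * psi ω' ^ j * theta (linHom ω) (psi ω) ∈
      maxId 1 ^ (2 * p + 1) := fun hi => hmem _ _ (by omega) (by
    rw [mem_maxId, ev_theta_psi, sub_self])
  have hj : j ≠ 0 → psi ω ^ i * psi ω' ^ (j - 1) * (theta (linHom ω) (psi ω') -
      (ω - ω') • 1) ∈ maxId 1 ^ (2 * p + 1) := fun hj => hmem _ _ (by omega) (by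
    rw [mem_maxId, map_sub, ev_theta_psi, map_smul, map_one, smul_eq_mul, mul_one, sub_self])
  have h3 : J (p + 1) (theta (linHom ω) (psi ω ^ i * psi ω' ^ j)) =
      j * (ω - ω') * J (p + 1) (psi ω ^ i * psi ω' ^ (j - 1)) := by
    have e : theta (linHom ω) (psi ω ^ i * psi ω' ^ j) =
        (i : ℂ) • (psi ω ^ (i - 1) * psi ω' ^ j * theta (linHom ω) (psi ω)) +
        (j : ℂ) • (psi ω ^ i * psi ω' ^ (j - 1) * (theta (linHom ω) (psi ω') - (ω - ω') • 1)) +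
        ((j : ℂ) * (ω - ω')) • (psi ω ^ i * psi ω' ^ (j - 1)) := by
      rw [Derivation.leibniz, Derivation.leibniz_pow, Derivation.leibniz_pow]
      simp only [smul_eq_mul, nsmul_eq_mul]
      simp only [Algebra.smul_def, map_mul, map_natCast]
      ring
    have hv : ∀ (a : ℕ) {c : Laur}, (a ≠ 0 → c ∈ maxId 1 ^ (2 * p + 1)) →
        (a : ℂ) * J (p + 1) c = 0 := by
      intro a c h
      rcases eq_or_ne a 0 with rfl | ha
      · simp
      · rw [hJ.vanish (p + 1) _ _ (h ha) (by omega), mul_zero]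
    rw [e, map_add, map_add, map_smul, map_smul, map_smul, smul_eq_mul, smul_eq_mul, hv i hi,
      hv j hj, zero_add, zero_add, smul_eq_mul]
  rw [h3] at h2
  linear_combination -h2

theorem IsJet.psi_mul_psi_ne_zero (hJ : IsJet M E K b J) (hE : IsCutoff M L E)
    (hdrift : M.ZeroDrift) (hL : 2 * K + 2 ≤ L) (hb : b ≠ 0) {p : ℕ} (hp : p + 1 < K) :
    J (p + 1) (psi (omg M) ^ p * psi (omgBar M) ^ p) ≠ 0 := by
  induction p with
  | zero => simpa [hJ.one hp] using hb
  | succ p ih =>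
    intro h
    have h1 := hJ.psi_step hE hdrift hL hp (isRootForm_omg M) (ω' := omgBar M) (i := p)
      (j := p + 1) (by omega)
    rw [h, mul_zero, eq_comm, neg_eq_zero, Nat.add_sub_cancel] at h1
    refine mul_ne_zero (mul_ne_zero ?_ (sub_ne_zero.2 (omg_ne_omgBar M))) (ih (by omega)) h1
    exact_mod_cast p.succ_ne_zero

theorem IsJet.psiBar_pow_eq_zero (hJ : IsJet M E K b J) (hE : IsCutoff M L E)
    (hdrift : M.ZeroDrift) (hL : 2 * K + 2 ≤ L) {p : ℕ} (hp : p + 2 < K) :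
    J (p + 2) (psi (omgBar M) ^ (2 * (p + 1))) = 0 := by
  have h1 := hJ.psi_step hE hdrift hL hp (isRootForm_omgBar M) (ω' := omg M) (i := 2 * p + 1)
      (j := 0) rfl
  rw [Nat.cast_zero, zero_mul, zero_mul, neg_zero, pow_zero, mul_one] at h1
  exact (mul_eq_zero.1 h1).resolve_left (mu_omgBar_ne_zero M)

end Jet

end OrbitSum

end

noncomputable section

namespace OrbitSum

variable {M : StepModel}

/-! ### First steps and last steps -/

lemma natCast_mem_quarterPlane (k l : ℕ) : ((k : ℤ), (l : ℤ)) ∈ quarterPlane :=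
  ⟨Int.natCast_nonneg k, Int.natCast_nonneg l⟩

lemma exists_natCast_eq {z : ℤ × ℤ} (hz : z ∈ quarterPlane) :
    ∃ k l : ℕ, z = ((k : ℤ), (l : ℤ)) :=
  ⟨z.1.toNat, z.2.toNat, Prod.ext (Int.toNat_of_nonneg hz.1).symm (Int.toNat_of_nonneg hz.2).symm⟩

variable (M) in
open Classical in
/-- The number of walks from `w` to `z`, defined to be `0` if `w` is not in the quarter plane. -/
def walks (n : ℕ) (z w : ℤ × ℤ) : ℝ :=
  if w ∈ quarterPlane then M.walkCount w.1.toNat w.2.toNat n z else 0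

lemma walks_natCast (n : ℕ) (z : ℤ × ℤ) (u v : ℕ) :
    walks M n z ((u : ℤ), (v : ℤ)) = M.walkCount u v n z := by
  rw [walks, if_pos (natCast_mem_quarterPlane u v)]
  rfl

lemma walks_of_notMem_start (n : ℕ) (z : ℤ × ℤ) {w : ℤ × ℤ} (hw : w ∉ quarterPlane) :
    walks M n z w = 0 := if_neg hw

lemma walks_of_notMem_end (n : ℕ) {z : ℤ × ℤ} (w : ℤ × ℤ) (hz : z ∉ quarterPlane) :
    walks M n z w = 0 := by
  by_cases hw : w ∈ quarterPlane
  · obtain ⟨u, v, rfl⟩ := exists_natCast_eq hw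
    rw [walks_natCast]
    cases n with
    | zero =>
      rw [StepModel.walkCount, if_neg]
      rintro rfl
      exact hz hw
    | succ n => rw [StepModel.walkCount, if_neg hz]
  · exact walks_of_notMem_start n z hw

lemma walks_zero (z : ℤ × ℤ) {w : ℤ × ℤ} (hw : w ∈ quarterPlane) :
    walks M 0 z w = if z = w then 1 else 0 := by
  obtain ⟨u, v, rfl⟩ := exists_natCast_eq hw
  rw [walks_natCast, StepModel.walkCount]

lemma walks_succ_end (n : ℕ) {z : ℤ × ℤ} (w : ℤ × ℤ) (hz : z ∈ quarterPlane) :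
    walks M (n + 1) z w = ∑ s ∈ smallBox, M.weight s * walks M n (z - s) w := by
  by_cases hw : w ∈ quarterPlane
  · obtain ⟨u, v, rfl⟩ := exists_natCast_eq hw
    simp only [walks_natCast]
    rw [StepModel.walkCount, if_pos hz]
  · simp [walks_of_notMem_start _ _ hw]

lemma walks_succ_start (n : ℕ) (z : ℤ × ℤ) {w : ℤ × ℤ} (hw : w ∈ quarterPlane) :
    walks M (n + 1) z w = ∑ s ∈ smallBox, M.weight s * walks M n z (w + s) := by
  by_cases hz : z ∈ quarterPlane
  · induction n generalizing z with
    | zero =>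
      rw [walks_succ_end _ _ hz]
      refine Finset.sum_congr rfl fun s _ => ?_
      rw [walks_zero _ hw]
      congr 1
      by_cases h : w + s ∈ quarterPlane
      · rw [walks_zero _ h]
        exact if_congr sub_eq_iff_eq_add rfl rfl
      · rw [walks_of_notMem_start _ _ h, if_neg]
        rintro h'
        rw [sub_eq_iff_eq_add] at h'
        exact h (h' ▸ hz)
    | succ n ih =>
      have key : ∀ z, walks M (n + 1) z w =
          ∑ s ∈ smallBox, M.weight s * walks M n z (w + s) := by
        intro z
        by_cases hz : z ∈ quarterPlane
        · exact ih z hz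
        · simp [walks_of_notMem_end _ _ hz]
      rw [walks_succ_end _ _ hz]
      simp only [key, walks_succ_end _ _ hz, Finset.mul_sum]
      rw [Finset.sum_comm]
      exact Finset.sum_congr rfl fun s _ => Finset.sum_congr rfl fun s' _ => by ring
  · simp [walks_of_notMem_end _ _ hz]

/-! ### The recurrences for the coefficients -/

open Classical in
/-- The values of a polynomial in four variables on pairs of points of the quarter plane, extended
by zero. -/
def val {K : Type} [CommRing K] (V : MvPolynomial (Fin 4) K) (z w : ℤ × ℤ) : K :=
  if z ∈ quarterPlane ∧ w ∈ quarterPlane then MvPolynomial.eval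
    (fun i => ((![z.1.toNat, z.2.toNat, w.1.toNat, w.2.toNat] i : ℕ) : K)) V else 0

section Val

variable {K : Type} [CommRing K] (V : MvPolynomial (Fin 4) K)

lemma val_natCast (k l u v : ℕ) : val V ((k : ℤ), (l : ℤ)) ((u : ℤ), (v : ℤ)) =
    MvPolynomial.eval (fun i => ((![k, l, u, v] i : ℕ) : K)) V := by
  rw [val, if_pos ⟨natCast_mem_quarterPlane k l, natCast_mem_quarterPlane u v⟩]
  rfl

lemma val_of_notMem_end {z : ℤ × ℤ} (w : ℤ × ℤ) (hz : z ∉ quarterPlane) : val V z w = 0 :=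
  if_neg fun h => hz h.1

lemma val_of_notMem_start (z : ℤ × ℤ) {w : ℤ × ℤ} (hw : w ∉ quarterPlane) : val V z w = 0 :=
  if_neg fun h => hw h.2

lemma val_zero (z w : ℤ × ℤ) : val (0 : MvPolynomial (Fin 4) K) z w = 0 := by
  rw [val, map_zero, ite_self]

lemma exists_val_start (z : ℤ × ℤ) : ∃ Q : MvPolynomial (Fin 2) K, ∀ u v : ℕ,
    val V z ((u : ℤ), (v : ℤ)) = MvPolynomial.eval (fun i => ((![u, v] i : ℕ) : K)) Q := by
  by_cases hz : z ∈ quarterPlane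
  · obtain ⟨k, l, rfl⟩ := exists_natCast_eq hz
    refine ⟨MvPolynomial.bind₁ ![MvPolynomial.C (k : K), MvPolynomial.C (l : K),
      MvPolynomial.X 0, MvPolynomial.X 1] V, fun u v => ?_⟩
    refine (val_natCast V k l u v).trans
      (Eq.trans ?_ (MvPolynomial.eval₂Hom_bind₁ (RingHom.id K) _ _ V).symm)
    rw [MvPolynomial.eval]
    congr 2
    funext i
    fin_cases i <;> simp
  · exact ⟨0, fun u v => by rw [val_of_notMem_end _ _ hz, map_zero]⟩

lemma exists_val_end (w : ℤ × ℤ) : ∃ Q : MvPolynomial (Fin 2) K, ∀ k l : ℕ,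
    val V ((k : ℤ), (l : ℤ)) w = MvPolynomial.eval (fun i => ((![k, l] i : ℕ) : K)) Q := by
  by_cases hw : w ∈ quarterPlane
  · obtain ⟨u, v, rfl⟩ := exists_natCast_eq hw
    refine ⟨MvPolynomial.bind₁ ![MvPolynomial.X 0, MvPolynomial.X 1, MvPolynomial.C (u : K),
      MvPolynomial.C (v : K)] V, fun k l => ?_⟩
    refine (val_natCast V k l u v).trans
      (Eq.trans ?_ (MvPolynomial.eval₂Hom_bind₁ (RingHom.id K) _ _ V).symm)
    rw [MvPolynomial.eval]
    congr 2
    funext i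
    fin_cases i <;> simp
  · exact ⟨0, fun k l => by rw [val_of_notMem_start _ _ hw, map_zero]⟩

end Val

lemma eq_zero_of_class {Q : MvPolynomial (Fin 2) ℂ} {h : ℕ} (hh : 0 < h) (k l : ℕ)
    (hQ : ∀ i j : ℕ, MvPolynomial.eval (fun x => ((![k + i * h, l + j * h] x : ℕ) : ℂ)) Q = 0) :
    Q = 0 := by
  refine MvPolynomial.funext_set
    (fun x : Fin 2 => Set.range fun n : ℕ => ((![k, l] x + n * h : ℕ) : ℂ))
    (fun x => infinite_multiples hh _) fun x hx => ?_
  choose y hy using fun i => hx i (Set.mem_univ i)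
  rw [map_zero, ← hQ (y 0) (y 1)]
  congr 2
  funext i
  rw [← hy i]
  fin_cases i <;> simp

open Polynomial in
lemma Asy.shift_filter {F G : Filter ℕ} {K : ℕ} {A : ℕ → ℂ} {P : ℂ[X]} (hP : Asy F K A P)
    (hG : G ≤ atTop) (hFG : Tendsto (fun n => n + 1) G F) :
    Asy G K (fun n => A (n + 1)) (P.comp (shiftPoly K)) := by
  have h1 := ((show (fun n : ℕ => A n - P.eval ((n : ℂ) + 1)⁻¹) =O[F] err K from
    hP).comp_tendsto hFG).trans ((isBigO_err_shift K).mono hG)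
  refine (h1.add ((asy_shift K P).mono_filter hG)).congr_left fun n => ?_
  simp only [Function.comp_apply]
  ring

lemma tendsto_cls (h : ℕ) : Tendsto (fun n => n + 1) (cls h 2) (cls h 1) := by
  refine tendsto_inf.2 ⟨(tendsto_add_atTop_nat 1).mono_left inf_le_left, tendsto_principal.2 ?_⟩
  filter_upwards [eventually_cls h 2] with n hn using hn

open Polynomial in
lemma coeff_comp_shiftPoly (K p : ℕ) (c : ℂ) (a : ℕ → ℂ) :
    ((C c * ∑ q ∈ Finset.range K, monomial q (a q)).comp (shiftPoly K)).coeff p =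
      c * ∑ q ∈ Finset.range K, (shiftPoly K ^ q).coeff p * a q := by
  rw [mul_comp, C_comp, Polynomial.coeff_C_mul, Polynomial.sum_comp, finsetSum_coeff]
  congr 1
  refine Finset.sum_congr rfl fun q _ => ?_
  rw [monomial_comp, Polynomial.coeff_C_mul, mul_comm]

open Polynomial in
lemma coeff_eq_of_X_pow_dvd_sub {K p : ℕ} {P Q : ℂ[X]} (h : X ^ K ∣ P - Q) (hp : p < K) :
    P.coeff p = Q.coeff p := by
  have := X_pow_dvd_iff.1 h p hp
  rwa [coeff_sub, sub_eq_zero] at this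

section Recurrence

variable {K : ℕ} {V : ℕ → MvPolynomial (Fin 4) ℂ}

lemma WalkExp.asy_walks (h : WalkExp M K V) (z w : ℤ × ℤ) {F : Filter ℕ} (hF : F ≤ atTop)
    (hp : ∀ᶠ n in F, perSum M (w - z) (n + 1) = (Fintype.card (per M) : ℂ)) :
    Asy F K (fun n => (walks M (n + 1) z w : ℂ) / (gam M : ℂ) ^ (n + 1))
      (Polynomial.C (Fintype.card (per M) : ℂ) * ∑ p ∈ Finset.range K, Polynomial.monomial p
        (val (V p) z w)) := by
  by_cases hzw : z ∈ quarterPlane ∧ w ∈ quarterPlane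
  · obtain ⟨k, l, rfl⟩ := exists_natCast_eq hzw.1
    obtain ⟨u, v, rfl⟩ := exists_natCast_eq hzw.2
    simp only [walks_natCast, val_natCast]
    exact h.asy k l u v hF hp
  · have h1 : ∀ n, walks M n z w = 0 := fun n => by
      rw [not_and_or] at hzw
      rcases hzw with h | h
      · exact walks_of_notMem_end n w h
      · exact walks_of_notMem_start n z h
    have h2 : ∀ p, val (V p) z w = 0 := fun p => if_neg hzw
    simp only [h1, h2, map_zero, Finset.sum_const_zero, mul_zero, Complex.ofReal_zero, zero_div]
    refine IsBigO.congr_left (isBigO_zero _ _) fun n => ?_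
    rw [Polynomial.eval_zero, sub_zero]

lemma WalkExp.recurrence_of_dvd (h : WalkExp M K V) {z w : ℤ × ℤ} {a b : ℤ × ℤ → ℤ × ℤ}
    (hab : ∀ s, b s - a s = w - z + s)
    (hw : ∀ n, walks M (n + 1) z w = ∑ s ∈ smallBox, M.weight s * walks M n (a s) (b s))
    (h1 : (Fintype.card (per M) : ℤ) ∣ (w - z).1) (h2 : (Fintype.card (per M) : ℤ) ∣ (w - z).2)
    {p : ℕ} (hp : p < K) :
    ∑ s ∈ smallBox, (M.weight s : ℂ) * val (V p) (a s) (b s) =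
      (gam M : ℂ) * ∑ q ∈ Finset.range K, (shiftPoly K ^ q).coeff p * val (V q) z w := by
  have hg := gam_ne_zero M
  have hn := cls_neBot (h := Fintype.card (per M)) Fintype.card_pos 2
  have e1 := (h.asy_walks z w (cls_le _ 1) (by
    filter_upwards [eventually_cls (Fintype.card (per M)) 1] with n hn using
      perSum_eq_card h1 h2 hn)).shift_filter (cls_le _ 2) (tendsto_cls _)
  have e2 : Asy (cls (Fintype.card (per M)) 2) K
      (fun n => ∑ s ∈ smallBox, ((M.weight s : ℂ) / (gam M : ℂ)) *
        ((walks M (n + 1) (a s) (b s) : ℂ) / (gam M : ℂ) ^ (n + 1)))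
      (∑ s ∈ smallBox, Polynomial.C ((M.weight s : ℂ) / (gam M : ℂ)) *
        (Polynomial.C (Fintype.card (per M) : ℂ) * ∑ p ∈ Finset.range K, Polynomial.monomial p
          (val (V p) (a s) (b s)))) := by
    refine Asy.sum _ fun s _ => ?_
    by_cases hs : M.weight s = 0
    · simp only [hs, Complex.ofReal_zero, zero_div, zero_mul, map_zero]
      refine IsBigO.congr_left (isBigO_zero _ _) fun n => ?_
      rw [Polynomial.eval_zero, sub_zero]
    · refine (h.asy_walks (a s) (b s) (cls_le _ 2) ?_).const_mul _
      filter_upwards [eventually_cls (Fintype.card (per M)) 2] with n hn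
      rw [hab, perSum_add_step hs]
      exact perSum_eq_card h1 h2 hn
  have e0 : ∀ n, ∑ s ∈ smallBox, ((M.weight s : ℂ) / (gam M : ℂ)) *
      ((walks M (n + 1) (a s) (b s) : ℂ) / (gam M : ℂ) ^ (n + 1)) =
      (walks M (n + 1 + 1) z w : ℂ) / (gam M : ℂ) ^ (n + 1 + 1) := by
    intro n
    rw [hw (n + 1), Complex.ofReal_sum, Finset.sum_div]
    refine Finset.sum_congr rfl fun s _ => ?_
    push_cast
    field_simp
    ring
  have e3 := coeff_eq_of_X_pow_dvd_sub (e1.unique (cls_le _ 2)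
    (e2.congr' (Eventually.of_forall e0))) hp
  rw [coeff_comp_shiftPoly, Polynomial.finsetSum_coeff] at e3
  simp only [Polynomial.coeff_C_mul, coeff_sum_monomial, if_pos hp] at e3
  have e4 : ∑ s ∈ smallBox, (M.weight s : ℂ) / gam M *
      ((Fintype.card (per M) : ℂ) * val (V p) (a s) (b s)) =
      (Fintype.card (per M) : ℂ) * ((gam M : ℂ)⁻¹ *
        ∑ s ∈ smallBox, (M.weight s : ℂ) * val (V p) (a s) (b s)) := by
    rw [Finset.mul_sum, Finset.mul_sum]
    exact Finset.sum_congr rfl fun s _ => by ring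
  rw [e4] at e3
  have e5 := mul_left_cancel₀ card_per_ne_zero e3
  rw [e5, mul_inv_cancel_left₀ hg]

theorem WalkExp.recurrence_end (h : WalkExp M K V) {z w : ℤ × ℤ} (hz : z ∈ quarterPlane)
    (hw : w ∈ quarterPlane) {p : ℕ} (hp : p < K) :
    ∑ s ∈ smallBox, (M.weight s : ℂ) * val (V p) (z - s) w =
      (gam M : ℂ) * ∑ q ∈ Finset.range K, (shiftPoly K ^ q).coeff p * val (V q) z w := by
  obtain ⟨k, l, rfl⟩ := exists_natCast_eq hz
  obtain ⟨u, v, rfl⟩ := exists_natCast_eq hw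
  choose Q hQ using fun p z => exists_val_start (V p) z
  have key : ∑ s ∈ smallBox, MvPolynomial.C (M.weight s : ℂ) * Q p (((k : ℤ), (l : ℤ)) - s) -
      MvPolynomial.C (gam M : ℂ) * ∑ q ∈ Finset.range K,
        MvPolynomial.C ((shiftPoly K ^ q).coeff p) * Q q ((k : ℤ), (l : ℤ)) = 0 := by
    refine eq_zero_of_class (h := Fintype.card (per M)) Fintype.card_pos k l fun i j => ?_
    simp only [map_sub, map_sum, map_mul, MvPolynomial.eval_C, ← hQ]
    rw [sub_eq_zero]
    refine h.recurrence_of_dvd (a := fun s => ((k : ℤ), (l : ℤ)) - s) (fun s => by abel)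
      (fun n => walks_succ_end n _ hz) ?_ ?_ hp <;> simp
  have := congrArg (MvPolynomial.eval fun i => ((![u, v] i : ℕ) : ℂ)) key
  simpa only [map_sub, map_sum, map_mul, MvPolynomial.eval_C, ← hQ, map_zero, sub_eq_zero]
    using this

theorem WalkExp.recurrence_start (h : WalkExp M K V) {z w : ℤ × ℤ} (hz : z ∈ quarterPlane)
    (hw : w ∈ quarterPlane) {p : ℕ} (hp : p < K) :
    ∑ s ∈ smallBox, (M.weight s : ℂ) * val (V p) z (w + s) =
      (gam M : ℂ) * ∑ q ∈ Finset.range K, (shiftPoly K ^ q).coeff p * val (V q) z w := by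
  obtain ⟨k, l, rfl⟩ := exists_natCast_eq hz
  obtain ⟨u, v, rfl⟩ := exists_natCast_eq hw
  choose Q hQ using fun p w => exists_val_end (V p) w
  have key : ∑ s ∈ smallBox, MvPolynomial.C (M.weight s : ℂ) * Q p (((u : ℤ), (v : ℤ)) + s) -
      MvPolynomial.C (gam M : ℂ) * ∑ q ∈ Finset.range K,
        MvPolynomial.C ((shiftPoly K ^ q).coeff p) * Q q ((u : ℤ), (v : ℤ)) = 0 := by
    refine eq_zero_of_class (h := Fintype.card (per M)) Fintype.card_pos u v fun i j => ?_
    simp only [map_sub, map_sum, map_mul, MvPolynomial.eval_C, ← hQ]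
    rw [sub_eq_zero]
    refine h.recurrence_of_dvd (b := fun s => ((u : ℤ), (v : ℤ)) + s) (fun s => by abel)
      (fun n => walks_succ_start n _ hw) ?_ ?_ hp <;> simp
  have := congrArg (MvPolynomial.eval fun i => ((![k, l] i : ℕ) : ℂ)) key
  simpa only [map_sub, map_sum, map_mul, MvPolynomial.eval_C, ← hQ, map_zero, sub_eq_zero]
    using this

end Recurrence

lemma val_map_ofReal (W : MvPolynomial (Fin 4) ℝ) (z w : ℤ × ℤ) :
    val (MvPolynomial.map Complex.ofRealHom W) z w = ((val W z w : ℝ) : ℂ) := by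
  rw [val, val]
  split_ifs
  · exact eval_map_ofReal W _
  · simp

/-- The recurrences for the coefficients of an expansion. -/
theorem exists_recurrence {c : ℕ} {w : ℕ → MvPolynomial (Fin 4) ℝ}
    (h : M.IsExpansion 1 1 (saddles M) c w) : ∃ κ : ℕ → ℕ → ℝ, ∀ q, 1 ≤ q →
      ∀ z ∈ quarterPlane, ∀ y ∈ quarterPlane,
        ∑ s ∈ smallBox, M.weight s * val (w q) (z - s) y - gam M * val (w q) z y =
          ∑ r ∈ Finset.Ico 1 q, κ q r * val (w r) z y ∧
        ∑ s ∈ smallBox, M.weight s * val (w q) z (y + s) - gam M * val (w q) z y =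
          ∑ r ∈ Finset.Ico 1 q, κ q r * val (w r) z y := by
  refine ⟨fun q r => gam M * ((shiftPoly (c + (q + 1)) ^ (c + r)).coeff (c + q)).re,
    fun q hq z hz y hy => ?_⟩
  have hexp := walkExp_of_isExpansion h q
  set V : ℕ → MvPolynomial (Fin 4) ℂ := fun p =>
    if c < p then MvPolynomial.map Complex.ofRealHom (w (p - c)) else 0 with hV
  have hVq : ∀ r, 1 ≤ r → ∀ z y, val (V (c + r)) z y = ((val (w r) z y : ℝ) : ℂ) := by
    intro r hr z y
    rw [hV]
    beta_reduce
    rw [if_pos (by omega), Nat.add_sub_cancel_left, val_map_ofReal]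
  have hsum : ∑ P ∈ Finset.range (c + (q + 1)), (shiftPoly (c + (q + 1)) ^ P).coeff (c + q) *
      val (V P) z y = ∑ r ∈ Finset.Ico 1 q, (shiftPoly (c + (q + 1)) ^ (c + r)).coeff (c + q) *
        ((val (w r) z y : ℝ) : ℂ) + ((val (w q) z y : ℝ) : ℂ) := by
    rw [Finset.sum_range_add, Finset.sum_eq_zero (s := Finset.range c), zero_add,
      Finset.range_eq_Ico, Finset.sum_eq_sum_Ico_succ_bot (Nat.succ_pos q), Finset.sum_Ico_succ_top
      hq, hVq q hq, coeff_shiftPoly_pow _ _ _ (Or.inr ⟨rfl, by omega⟩), if_pos rfl, one_mul]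
    · have h0 : val (V (c + 0)) z y = 0 := by
        rw [hV]
        beta_reduce
        rw [if_neg (by omega), val_zero]
      rw [h0, mul_zero, zero_add]
      congr 1
      refine Finset.sum_congr rfl fun r hr => ?_
      rw [hVq r (Finset.mem_Ico.1 hr).1]
    · intro P hP
      have : val (V P) z y = 0 := by
        rw [hV]
        beta_reduce
        rw [if_neg (by have := Finset.mem_range.1 hP; omega), val_zero]
      rw [this, mul_zero]
  have hre : ∀ a : ℝ, (a : ℂ) = (gam M : ℂ) * (∑ r ∈ Finset.Ico 1 q,
      (shiftPoly (c + (q + 1)) ^ (c + r)).coeff (c + q) * ((val (w r) z y : ℝ) : ℂ) +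
        ((val (w q) z y : ℝ) : ℂ)) → a - gam M * val (w q) z y = ∑ r ∈ Finset.Ico 1 q,
      gam M * ((shiftPoly (c + (q + 1)) ^ (c + r)).coeff (c + q)).re * val (w r) z y := by
    intro a ha
    have := congrArg Complex.re ha
    rw [Complex.ofReal_re, Complex.re_ofReal_mul, Complex.add_re, Complex.re_sum,
      Complex.ofReal_re] at this
    simp only [Complex.re_mul_ofReal] at this
    rw [this, mul_add, add_sub_cancel_right, Finset.mul_sum]
    exact Finset.sum_congr rfl fun r _ => (mul_assoc _ _ _).symm
  constructor
  · refine hre _ ?_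
    rw [← hsum, ← hexp.recurrence_end hz hy (by omega : c + q < c + (q + 1))]
    push_cast
    exact Finset.sum_congr rfl fun s _ => by rw [hVq q hq]
  · refine hre _ ?_
    rw [← hsum, ← hexp.recurrence_start hz hy (by omega : c + q < c + (q + 1))]
    push_cast
    exact Finset.sum_congr rfl fun s _ => by rw [hVq q hq]

end OrbitSum

end

noncomputable section

namespace OrbitSum

variable {M : StepModel}

/-! ### Substitution of units, to a given order -/

lemma isUnit_mk_of_ev_eq_one {L : ℕ} {f : Laur} (hf : ev 1 f = 1) :
    IsUnit (Ideal.Quotient.mk (maxId 1 ^ L) f) := by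
  have h : IsNilpotent (Ideal.Quotient.mk (maxId 1 ^ L) (f - 1)) := by
    refine ⟨L, ?_⟩
    rw [← map_pow, Ideal.Quotient.eq_zero_iff_mem]
    refine Ideal.pow_mem_pow ?_ _
    rw [mem_maxId, map_sub, hf, map_one, sub_self]
  have := h.isUnit_one_add
  rwa [map_sub, map_one, add_sub_cancel] at this

theorem exists_substitution {ξ η : Laur} (hξ : ev 1 ξ = 1) (hη : ev 1 η = 1) (L : ℕ) :
    ∃ σ : Laur →ₗ[ℂ] Laur, (∀ a b : ℕ, σ (mon ((a : ℤ), (b : ℤ))) - ξ ^ a * η ^ b ∈ maxId 1 ^ L) ∧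
      (∀ f g, σ (f * g) - σ f * σ g ∈ maxId 1 ^ L) ∧
      ∀ j, j ≤ L → ∀ f ∈ maxId 1 ^ j, σ f ∈ maxId 1 ^ j := by
  set π := Ideal.Quotient.mkₐ ℂ (maxId 1 ^ L) with hπ
  have hsurj : Function.Surjective π := Ideal.Quotient.mkₐ_surjective ℂ _
  obtain ⟨a, ha⟩ := isUnit_mk_of_ev_eq_one (L := L) hξ
  obtain ⟨b, hb⟩ := isUnit_mk_of_ev_eq_one (L := L) hη
  set τ := liftUnits a b with hτ
  obtain ⟨s, hs⟩ := π.toLinearMap.exists_rightInverse_of_surjective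
    (LinearMap.range_eq_top.2 hsurj)
  have hs' : ∀ r, π (s r) = r := fun r => LinearMap.congr_fun hs r
  have hmem : ∀ {f g : Laur}, π f = π g → f - g ∈ maxId 1 ^ L := fun h => Ideal.Quotient.eq.1 h
  have hτI : maxId 1 ≤ ((maxId 1).map π).comap τ := by
    refine maxId_one_le.trans (Ideal.span_le.2 ?_)
    rintro f (rfl | rfl)
    · change τ lx ∈ (maxId 1).map π
      have : τ lx = π (ξ - 1) := by
        rw [lx, map_sub, map_one, map_sub, map_one, hτ, liftUnits_mon]
        simp [ha, hπ]
      rw [this]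
      exact Ideal.mem_map_of_mem _ (by rw [mem_maxId, map_sub, hξ, map_one, sub_self])
    · change τ ly ∈ (maxId 1).map π
      have : τ ly = π (η - 1) := by
        rw [ly, map_sub, map_one, map_sub, map_one, hτ, liftUnits_mon]
        simp [hb, hπ]
      rw [this]
      exact Ideal.mem_map_of_mem _ (by rw [mem_maxId, map_sub, hη, map_one, sub_self])
  refine ⟨s ∘ₗ τ.toLinearMap, fun i j => hmem ?_, fun f g => hmem ?_, fun j hj f hf => ?_⟩
  · rw [LinearMap.comp_apply, hs', AlgHom.toLinearMap_apply, hτ, liftUnits_mon]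
    simp [ha, hb, hπ]
  · simp only [map_mul, LinearMap.comp_apply, hs', AlgHom.toLinearMap_apply]
  · have h1 : τ f ∈ ((maxId 1 : Ideal Laur) ^ j).map π := by
      rw [Ideal.map_pow]
      exact Ideal.le_comap_pow τ j (Ideal.pow_right_mono hτI j hf)
    obtain ⟨g, hg, hgf⟩ := (Ideal.mem_map_iff_of_surjective π hsurj).1 h1
    have h2 : s (τ f) - g ∈ maxId 1 ^ L := hmem (by rw [hs', hgf])
    have h3 := add_mem (Ideal.pow_le_pow_right hj h2) hg
    rwa [sub_add_cancel] at h3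

lemma mem_sq_of_ev_theta (M : StepModel) {f : Laur} (hf : f ∈ maxId 1) (h : ∀ φ, ev 1 (theta φ f) = 0) :
    f ∈ maxId 1 ^ 2 := by
  obtain ⟨a, -, b, -, rfl⟩ := exists_eq_psi M (j := 0) (by simpa using hf)
  have hne := sub_ne_zero.2 (omg_ne_omgBar M)
  have hne' := sub_ne_zero.2 (omg_ne_omgBar M).symm
  have hψ : ∀ ω, ev 1 (psi ω) = 0 := fun ω => mem_maxId.1 (psi_mem ω)
  have h1 := h (linHom (omg M))
  have h2 := h (linHom (omgBar M))
  simp only [map_add, Derivation.leibniz, smul_eq_mul, map_mul, hψ, ev_theta_psi, zero_mul, zero_add,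
    sub_self, mul_zero, add_zero] at h1 h2
  rw [pow_two]
  exact add_mem (Ideal.mul_mem_mul (psi_mem _) (mem_maxId.2 ((mul_eq_zero.1 h2).resolve_right hne')))
    (Ideal.mul_mem_mul (psi_mem _) (mem_maxId.2 ((mul_eq_zero.1 h1).resolve_right hne)))

lemma pow_sub_pow_mem {f g : Laur} (hf : f ∈ maxId 1) (hg : g ∈ maxId 1)
    (h : f - g ∈ maxId 1 ^ 2) (n : ℕ) : f ^ n - g ^ n ∈ maxId 1 ^ (n + 1) := by
  induction n with
  | zero => simp
  | succ n ih =>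
    have h1 := Ideal.mul_mem_mul (Ideal.pow_mem_pow hf n) h
    have h2 := Ideal.mul_mem_mul ih hg
    rw [← pow_add] at h1
    rw [← pow_succ] at h2
    convert add_mem h1 h2 using 1
    ring

lemma ev_theta_psi_apply (φ : ℤ × ℤ →+ ℂ) (ω : ℂ) : ev 1 (theta φ (psi ω)) = dpsi ω φ := by
  simp [psi, lx, ly, theta_mon, ev_mon, dpsi]

/-! ### The orbit sum as a substitution -/

section Datum

variable {hfin : M.group.Finite} {K : ℕ} {b : ℂ} {J : ℕ → Laur →ₗ[ℂ] ℂ}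
  {ξ η : StepModel.RatXY × StepModel.RatXY → Laur} {E : Laur}

lemma substitution_psi_pow (hJ : IsDatum hfin K b J ξ η E) (hdrift : M.ZeroDrift) {L N : ℕ}
    (hL : N + 2 ≤ L) (hN : rot M ^ N = 1) {g : StepModel.RatXY × StepModel.RatXY}
    (hg : g ∈ hfin.toFinset) {σ : Laur →ₗ[ℂ] Laur}
    (h1 : ∀ a b : ℕ, σ (mon ((a : ℤ), (b : ℤ))) - ξ g ^ a * η g ^ b ∈ maxId 1 ^ L)
    (h2 : ∀ f g, σ (f * g) - σ f * σ g ∈ maxId 1 ^ L) :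
    (M.sgn g = 1 ∧ σ (psi (omg M) ^ N) - psi (omg M) ^ N ∈ maxId 1 ^ (N + 1)) ∨
    (M.sgn g = -1 ∧
      σ (psi (omg M) ^ N) - ((-1 : ℂ) ^ N) • psi (omgBar M) ^ N ∈ maxId 1 ^ (N + 1)) := by
  have hle : ∀ {n f}, n ≤ L → f ∈ maxId 1 ^ L → f ∈ maxId 1 ^ n := fun hn hf =>
    Ideal.pow_le_pow_right hn hf
  have hpow : ∀ n, σ (psi (omg M) ^ n) - σ (psi (omg M)) ^ n ∈ maxId 1 ^ L := by
    intro n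
    induction n with
    | zero => simpa [show mon ((0 : ℤ), (0 : ℤ)) = 1 from mon_zero] using h1 0 0
    | succ n ih =>
      have e1 := h2 (psi (omg M) ^ n) (psi (omg M))
      have e2 := Ideal.mul_mem_right (σ (psi (omg M))) _ ih
      convert add_mem e1 e2 using 1
      rw [pow_succ, pow_succ]
      ring
  set h := (η g - 1) - omg M • (ξ g - 1) with hh
  have hσψ : σ (psi (omg M)) - h ∈ maxId 1 ^ L := by
    have e0 := h1 0 0
    have e1 := h1 1 0
    have e2 := h1 0 1
    simp only [Nat.cast_zero, Nat.cast_one, pow_zero, pow_one, mul_one, one_mul] at e0 e1 e2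
    have e3 := sub_mem (sub_mem e2 e0) (smul_mem_ideal _ (omg M) (sub_mem e1 e0))
    convert e3 using 1
    rw [hh, psi, lx, ly, map_sub, map_smul, map_sub, map_sub,
      show (mon ((0 : ℤ), (0 : ℤ))) = 1 from mon_zero]
    module
  obtain ⟨hξ, hη⟩ := hJ.one g hg
  have hhmem : h ∈ maxId 1 := by
    rw [mem_maxId, hh, map_sub, map_smul, map_sub, map_sub, hξ, hη, map_one, sub_self, smul_zero,
      sub_zero]
  have hth : ∀ φ, ev 1 (theta φ h) = ev 1 (theta φ (η g)) - omg M * ev 1 (theta φ (ξ g)) := by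
    intro φ
    simp [hh]
  have hσmem : σ (psi (omg M)) ∈ maxId 1 := by
    have := add_mem (hle (n := 1) (by omega) hσψ) (by simpa using hhmem)
    simpa using this
  have key : ∀ (c : ℂ) (ω : ℂ), (∀ φ, ev 1 (theta φ h) = c * dpsi ω φ) →
      σ (psi (omg M) ^ N) - c ^ N • psi ω ^ N ∈ maxId 1 ^ (N + 1) := by
    intro c ω hc
    have hm := smul_mem_ideal (maxId 1) c (psi_mem ω)
    have e1 : h - c • psi ω ∈ maxId 1 ^ 2 := by
      refine mem_sq_of_ev_theta M (sub_mem hhmem hm) fun φ => ?_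
      rw [map_sub, map_sub, hc, Derivation.map_smul, map_smul, ev_theta_psi_apply, smul_eq_mul,
        sub_self]
    have e2 := add_mem (hle (n := 2) (by omega) hσψ) e1
    rw [sub_add_sub_cancel] at e2
    have e3 := add_mem (hle (n := N + 1) (by omega) (hpow N)) (pow_sub_pow_mem hσmem hm e2 N)
    rwa [sub_add_sub_cancel, smul_pow] at e3
  rcases group_lin hdrift hfin (hfin.mem_toFinset.1 hg) with ⟨hs, k, hk⟩ | ⟨hs, k, hk⟩
  · refine Or.inl ⟨hs, ?_⟩
    have := key ((rot M)⁻¹ ^ k) (omg M) fun φ => by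
      rw [hth]
      exact (hJ.lin g hg _ _ hk φ).1
    rwa [← pow_mul, mul_comm, pow_mul, inv_pow, hN, inv_one, one_pow, one_smul] at this
  · refine Or.inr ⟨hs, ?_⟩
    have := key (-(rot M ^ k)) (omgBar M) fun φ => by
      rw [hth, neg_mul]
      exact (hJ.lin g hg _ _ hk φ).1
    rwa [neg_pow, ← pow_mul, mul_comm k, pow_mul, hN, one_pow, mul_one] at this

lemma sgn_one : M.sgn (StepModel.ratX, StepModel.ratY) = 1 := by
  rw [StepModel.sgn, if_pos ⟨0, rfl⟩]

theorem exists_orbit_substitution (hJ : IsDatum hfin K b J ξ η E) (hdrift : M.ZeroDrift)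
    {L N : ℕ} (hL : N + 2 ≤ L) (hN : rot M ^ N = 1) : ∃ Γ : Laur →ₗ[ℂ] Laur,
      (∀ u v : ℕ, Γ (mon ((u : ℤ) + 1, (v : ℤ) + 1)) - Lam hfin ξ η u v ∈ maxId 1 ^ L) ∧
      (∀ j, j ≤ L → ∀ f ∈ maxId 1 ^ j, Γ f ∈ maxId 1 ^ j) ∧
      ∃ n m : ℂ, n ≠ 0 ∧ Γ (psi (omg M) ^ N) -
        (n • psi (omg M) ^ N + m • psi (omgBar M) ^ N) ∈ maxId 1 ^ (N + 1) := by
  have hex : ∀ g ∈ hfin.toFinset, ∃ σ : Laur →ₗ[ℂ] Laur,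
      (∀ a b : ℕ, σ (mon ((a : ℤ), (b : ℤ))) - ξ g ^ a * η g ^ b ∈ maxId 1 ^ L) ∧
      (∀ f g, σ (f * g) - σ f * σ g ∈ maxId 1 ^ L) ∧
      ∀ j, j ≤ L → ∀ f ∈ maxId 1 ^ j, σ f ∈ maxId 1 ^ j := fun g hg =>
    exists_substitution (hJ.one g hg).1 (hJ.one g hg).2 L
  choose! σ h1 h2 h3 using hex
  refine ⟨∑ g ∈ hfin.toFinset, (M.sgn g : ℂ) • σ g, fun u v => ?_, fun j hj f hf => ?_,
    ∑ g ∈ hfin.toFinset, (if M.sgn g = 1 then 1 else 0 : ℂ),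
    ∑ g ∈ hfin.toFinset, (if M.sgn g = 1 then 0 else -(-1) ^ N : ℂ), ?_, ?_⟩
  · rw [LinearMap.sum_apply, Lam, ← Finset.sum_sub_distrib]
    refine sum_mem fun g hg => ?_
    rw [LinearMap.smul_apply, ← smul_sub]
    exact smul_mem_ideal _ _ (by simpa using h1 g hg (u + 1) (v + 1))
  · rw [LinearMap.sum_apply]
    exact sum_mem fun g hg => smul_mem_ideal _ _ (h3 g hg j hj f hf)
  · rw [Finset.sum_boole, Nat.cast_ne_zero, Finset.card_ne_zero]
    exact ⟨(StepModel.ratX, StepModel.ratY), Finset.mem_filter.2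
      ⟨hfin.mem_toFinset.2 StepModel.InGroup.one, sgn_one⟩⟩
  · rw [LinearMap.sum_apply, Finset.sum_smul, Finset.sum_smul, ← Finset.sum_add_distrib,
      ← Finset.sum_sub_distrib]
    refine sum_mem fun g hg => ?_
    rcases substitution_psi_pow hJ hdrift hL hN hg (h1 g hg) (h2 g hg) with ⟨hs, h⟩ | ⟨hs, h⟩
    · simpa [hs] using h
    · have := neg_mem h
      simpa [hs, neg_add_eq_sub] using this

lemma IsDatum.jet_comp_mul_eq_zero (hJ : IsDatum hfin K b J ξ η E) {p : ℕ} {g : Laur}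
    (h : ∀ k l : ℕ, J p (g * mon (-((k : ℤ) + 1, (l : ℤ) + 1))) = 0) (f : Laur) :
    J p (g * f) = 0 := by
  have : J p ∘ₗ LinearMap.mulLeft ℂ g = 0 := by
    refine eq_zero_of_quadrant (ε := -1) (D := 2 * p) (a := 1) (by norm_num) (fun f hf => ?_)
      fun z h1 h2 => ?_
    · exact hJ.jet.vanish p _ _ (Ideal.mul_mem_left _ _ hf) (by omega)
    · obtain ⟨k, l, hkl⟩ := exists_natCast_eq (z := z - (1, 1)) ⟨by simp; omega, by simp; omega⟩
      rw [sub_eq_iff_eq_add] at hkl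
      subst hkl
      simpa using h k l
  exact LinearMap.congr_fun this f

lemma IsDatum.jet_comp_substitution_eq_zero (hJ : IsDatum hfin K b J ξ η E) {p L : ℕ} {μ : Laur}
    (hL : 2 * p ≤ L) {Γ : Laur →ₗ[ℂ] Laur}
    (hΓ : ∀ u v : ℕ, Γ (mon ((u : ℤ) + 1, (v : ℤ) + 1)) - Lam hfin ξ η u v ∈ maxId 1 ^ L)
    (hΓ' : ∀ j, j ≤ L → ∀ f ∈ maxId 1 ^ j, Γ f ∈ maxId 1 ^ j)
    (h : ∀ u v : ℕ, J p (Lam hfin ξ η u v * μ) = 0) (f : Laur) : J p (Γ f * μ) = 0 := by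
  have : J p ∘ₗ LinearMap.mulRight ℂ μ ∘ₗ Γ = 0 := by
    refine eq_zero_of_quadrant (ε := 1) (D := 2 * p) (a := 1) (by norm_num) (fun f hf => ?_)
      fun z h1 h2 => ?_
    · exact hJ.jet.vanish p _ _ (Ideal.mul_mem_right _ _ (hΓ' _ hL f hf)) (by omega)
    · obtain ⟨k, l, hkl⟩ := exists_natCast_eq (z := z - (1, 1)) ⟨by simp; omega, by simp; omega⟩
      rw [sub_eq_iff_eq_add] at hkl
      subst hkl
      have e := hJ.jet.vanish p L _ (Ideal.mul_mem_right μ _ (hΓ k l)) (by omega)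
      rw [sub_mul, map_sub, h, sub_zero] at e
      simpa using e
  exact LinearMap.congr_fun this f

/-- The coefficient of index `N + 1` does not vanish identically. -/
theorem IsDatum.exists_jet_ne_zero (hJ : IsDatum hfin K b J ξ η E) (hdrift : M.ZeroDrift)
    (hb : b ≠ 0) {N : ℕ} (hN0 : 0 < N) (hN : rot M ^ N = 1) (hK : N + 1 < K) :
    ∃ k l u v : ℕ, J (N + 1) (Lam hfin ξ η u v * mon (-((k : ℤ) + 1, (l : ℤ) + 1))) ≠ 0 := by
  by_contra! hall
  obtain ⟨Γ, h1, h2, n, m, hn, h3⟩ := exists_orbit_substitution hJ hdrift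
    (show N + 2 ≤ 2 * (N + 1) by omega) hN
  have h4 := hJ.jet_comp_substitution_eq_zero le_rfl h1 h2 (fun u v =>
    hJ.jet_comp_mul_eq_zero (fun k l => hall k l u v) (psi (omgBar M) ^ N)) (psi (omg M) ^ N)
  have h5 := hJ.jet.vanish (N + 1) (2 * N + 1) _ (show (Γ (psi (omg M) ^ N) -
      (n • psi (omg M) ^ N + m • psi (omgBar M) ^ N)) * psi (omgBar M) ^ N ∈
        maxId 1 ^ (2 * N + 1) by
    have := Ideal.mul_mem_mul h3 (Ideal.pow_mem_pow (psi_mem (omgBar M)) N)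
    rwa [← pow_add, show N + 1 + N = 2 * N + 1 by ring] at this) (by omega)
  obtain ⟨p, rfl⟩ := Nat.exists_eq_succ_of_ne_zero hN0.ne'
  have h6 := hJ.jet.psiBar_pow_eq_zero hJ.cutoff hdrift (by omega) (p := p) (by omega)
  rw [sub_mul, map_sub, h4, add_mul, map_add, smul_mul_assoc, smul_mul_assoc, map_smul, map_smul,
    ← pow_add, ← two_mul, h6, smul_zero, add_zero, zero_sub, neg_eq_zero, smul_eq_mul] at h5
  exact mul_ne_zero hn (hJ.jet.psi_mul_psi_ne_zero hJ.cutoff hdrift (by omega) hb hK) h5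

end Datum

end OrbitSum

end

noncomputable section

namespace OrbitSum

variable {M : StepModel}

/-! ### Conjugation of functionals -/

/-- Complex conjugation of the coefficients. -/
def conjL : Laur →+* Laur := AddMonoidAlgebra.mapRingHom (ℤ × ℤ) (starRingEnd ℂ)

lemma conjL_mon (z : ℤ × ℤ) : conjL (mon z) = mon z := by simp [conjL, mon]

lemma conjL_smul (a : ℂ) (f : Laur) : conjL (a • f) = (starRingEnd ℂ) a • conjL f := by
  have : conjL (a • 1) = (starRingEnd ℂ) a • 1 := by
    rw [← mon_zero, mon, AddMonoidAlgebra.smul_single, conjL, AddMonoidAlgebra.mapRingHom_single,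
      AddMonoidAlgebra.smul_single]
    simp
  rw [show a • f = (a • 1) * f by rw [smul_mul_assoc, one_mul], map_mul, this, smul_mul_assoc,
    one_mul]

lemma conjL_psi (ω : ℂ) : conjL (psi ω) = psi ((starRingEnd ℂ) ω) := by
  rw [psi, map_sub, conjL_smul, lx, ly, map_sub, map_sub, conjL_mon, conjL_mon, map_one, psi, lx, ly]

lemma conjL_mem {f : Laur} {D : ℕ} (hf : f ∈ maxId 1 ^ D) : conjL f ∈ maxId 1 ^ D := by
  have h : maxId 1 ≤ (maxId 1).comap conjL := by
    refine maxId_one_le.trans (Ideal.span_le.2 ?_)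
    rintro g (rfl | rfl)
    · change conjL lx ∈ maxId 1
      rw [lx, map_sub, conjL_mon, map_one]
      exact lx_mem
    · change conjL ly ∈ maxId 1
      rw [ly, map_sub, conjL_mon, map_one]
      exact ly_mem
  exact Ideal.le_comap_pow conjL D (Ideal.pow_right_mono h D hf)

/-- The conjugate of a functional. -/
def conjT (t : Laur →ₗ[ℂ] ℂ) : Laur →ₗ[ℂ] ℂ where
  toFun f := (starRingEnd ℂ) (t (conjL f))
  map_add' f g := by simp
  map_smul' a f := by simp [conjL_smul]

/-! ### The slices of the coefficients -/

section Slices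

open Classical in
/-- `Lam` for starting points in `ℤ²`, extended by zero. -/
def LamE (hfin : M.group.Finite) (ξ η : StepModel.RatXY × StepModel.RatXY → Laur) (y : ℤ × ℤ) :
    Laur := if y ∈ quarterPlane then Lam hfin ξ η y.1.toNat y.2.toNat else 0

variable {hfin : M.group.Finite} {K : ℕ} {b : ℂ} {J : ℕ → Laur →ₗ[ℂ] ℂ}
  {ξ η : StepModel.RatXY × StepModel.RatXY → Laur} {E : Laur} {c : ℕ}
  {w : ℕ → MvPolynomial (Fin 4) ℝ}

lemma LamE_natCast (u v : ℕ) : LamE hfin ξ η ((u : ℤ), (v : ℤ)) = Lam hfin ξ η u v := by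
  rw [LamE, if_pos (natCast_mem_quarterPlane u v)]
  rfl

lemma LamE_of_notMem {y : ℤ × ℤ} (hy : y ∉ quarterPlane) : LamE hfin ξ η y = 0 := if_neg hy

lemma IsDatum.jet_eq (hJ : IsDatum hfin K b J ξ η E) (hexp : M.IsExpansion 1 1 (saddles M) c w)
    {P : ℕ} (hP : P < K) (k l u v : ℕ) :
    J P (Lam hfin ξ η u v * mon (-((k : ℤ) + 1, (l : ℤ) + 1))) =
      if c < P then ((val (w (P - c)) ((k : ℤ), (l : ℤ)) ((u : ℤ), (v : ℤ)) : ℝ) : ℂ) else 0 := by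
  obtain ⟨V, hV, hV'⟩ := hJ.exists_walkExp
  rw [← hV', hV.unique (walkExp_of_isExpansion hexp K) hP (by omega)]
  split_ifs with h
  · rw [← val_map_ofReal, val_natCast]
  · rw [map_zero]

lemma IsDatum.val_eq (hJ : IsDatum hfin K b J ξ η E) (hexp : M.IsExpansion 1 1 (saddles M) c w)
    {q : ℕ} (hq : 1 ≤ q) (hK : c + q < K) {z : ℤ × ℤ} (hz : z ∈ quarterPlane) (y : ℤ × ℤ) :
    ((val (w q) z y : ℝ) : ℂ) =
      J (c + q) (LamE hfin ξ η y * mon ((-1 : ℤ) • (z + (1, 1)))) := by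
  by_cases hy : y ∈ quarterPlane
  · obtain ⟨k, l, rfl⟩ := exists_natCast_eq hz
    obtain ⟨u, v, rfl⟩ := exists_natCast_eq hy
    have h := hJ.jet_eq hexp hK k l u v
    rw [if_pos (by omega), Nat.add_sub_cancel_left] at h
    rw [LamE_natCast, ← h]
    simp
  · rw [val_of_notMem_start _ _ hy, LamE_of_notMem hy, zero_mul, map_zero, Complex.ofReal_zero]

lemma orderOf_rot_pos (hdrift : M.ZeroDrift) (hfin : M.group.Finite) : 0 < orderOf (rot M) :=
  orderOf_pos_iff.2 (isOfFinOrder_iff_pow_eq_one.2 (exists_rot_pow_eq_one hdrift hfin))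

lemma IsDatum.le_orderOf (hJ : IsDatum hfin K b J ξ η E)
    (hexp : M.IsExpansion 1 1 (saddles M) c w) (hdrift : M.ZeroDrift) (hb : b ≠ 0)
    (hK : orderOf (rot M) + 1 < K) : c ≤ orderOf (rot M) := by
  by_contra! h
  obtain ⟨k, l, u, v, hne⟩ := hJ.exists_jet_ne_zero hdrift hb (orderOf_rot_pos hdrift hfin)
    (pow_orderOf_eq_one _) hK
  exact hne (by rw [hJ.jet_eq hexp hK, if_neg (by omega)])

lemma IsDatum.recurrence_jet (hJ : IsDatum hfin K b J ξ η E)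
    (hexp : M.IsExpansion 1 1 (saddles M) c w) {κ : ℕ → ℝ} {q : ℕ} (hq : 1 ≤ q) (hK : c + q < K)
    {y : ℤ × ℤ} (hκ : ∀ z ∈ quarterPlane,
      ∑ s ∈ smallBox, M.weight s * val (w q) z (y + s) - gam M * val (w q) z y =
        ∑ r ∈ Finset.Ico 1 q, κ r * val (w r) z y) (f : Laur) :
    ∑ s ∈ smallBox, (M.weight s : ℂ) * J (c + q) (LamE hfin ξ η (y + s) * f) -
      (gam M : ℂ) * J (c + q) (LamE hfin ξ η y * f) =
        ∑ r ∈ Finset.Ico 1 q, (κ r : ℂ) * J (c + r) (LamE hfin ξ η y * f) := by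
  have : ∑ s ∈ smallBox, (M.weight s : ℂ) • (J (c + q) ∘ₗ
      LinearMap.mulLeft ℂ (LamE hfin ξ η (y + s))) -
      (gam M : ℂ) • (J (c + q) ∘ₗ LinearMap.mulLeft ℂ (LamE hfin ξ η y)) -
        ∑ r ∈ Finset.Ico 1 q, (κ r : ℂ) • (J (c + r) ∘ₗ
          LinearMap.mulLeft ℂ (LamE hfin ξ η y)) = 0 := by
    have hkill : ∀ r ≤ q, ∀ g, ∀ f ∈ maxId 1 ^ (2 * (c + q)), J (c + r) (g * f) = 0 :=
      fun r hr g f hf => hJ.jet.vanish _ _ _ (Ideal.mul_mem_left _ _ hf) (by omega)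
    refine eq_zero_of_quadrant (ε := -1) (D := 2 * (c + q)) (a := 1) (by norm_num)
      (fun f hf => ?_) fun z h1 h2 => ?_
    · simp only [LinearMap.sub_apply, LinearMap.sum_apply, LinearMap.smul_apply,
        LinearMap.comp_apply, LinearMap.mulLeft_apply]
      rw [Finset.sum_eq_zero fun s _ => by rw [hkill q le_rfl _ f hf, smul_zero],
        hkill q le_rfl _ f hf, Finset.sum_eq_zero fun r hr => by
          rw [hkill r (Finset.mem_Ico.1 hr).2.le _ f hf, smul_zero]]
      simp
    · have hz : z - (1, 1) ∈ quarterPlane := ⟨by simp; omega, by simp; omega⟩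
      have h := congrArg (fun r : ℝ => (r : ℂ)) (hκ _ hz)
      push_cast at h
      simp only [LinearMap.sub_apply, LinearMap.sum_apply, LinearMap.smul_apply,
        LinearMap.comp_apply, LinearMap.mulLeft_apply, smul_eq_mul]
      rw [sub_eq_zero]
      simp only [hJ.val_eq hexp hq hK hz, sub_add_cancel] at h
      rw [h]
      refine Finset.sum_congr rfl fun r hr => ?_
      have hr' := Finset.mem_Ico.1 hr
      rw [hJ.val_eq hexp hr'.1 (by omega) hz, sub_add_cancel]
  have h := LinearMap.congr_fun this f
  simpa only [LinearMap.sub_apply, LinearMap.sum_apply, LinearMap.smul_apply,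
    LinearMap.comp_apply, LinearMap.mulLeft_apply, smul_eq_mul, LinearMap.zero_apply,
    sub_eq_zero] using h

/-- The slices of the coefficients are of smaller order than the coefficients. -/
theorem IsDatum.jet_slice_eq_zero (hJ : IsDatum hfin K b J ξ η E)
    (hexp : M.IsExpansion 1 1 (saddles M) c w) (hdrift : M.ZeroDrift) {q D : ℕ}
    (hK : c + q < K) (hD : 2 * (c + q) ≤ D + orderOf (rot M) + 1) {f : Laur}
    (hf : f ∈ maxId 1 ^ D) {r : ℕ} (hr : 1 ≤ r) (hrq : r ≤ q) (y : ℤ × ℤ) :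
    J (c + r) (LamE hfin ξ η y * f) = 0 := by
  obtain ⟨κ, hκ⟩ := exists_recurrence hexp
  set N := orderOf (rot M) with hN
  have hN0 : 0 < N := orderOf_rot_pos hdrift hfin
  obtain ⟨Γ, h1, h2, -⟩ := exists_orbit_substitution hJ hdrift (N := N)
    (le_max_left (N + 2) (2 * (c + q))) (pow_orderOf_eq_one _)
  have hL := le_max_right (N + 2) (2 * (c + q))
  have hLN := le_max_left (N + 2) (2 * (c + q))
  set L := max (N + 2) (2 * (c + q)) with hLdef
  induction r using Nat.strong_induction_on generalizing y with
  | _ r ih =>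
    set t := J (c + r) ∘ₗ LinearMap.mulRight ℂ f ∘ₗ Γ with ht
    have htF : ∀ y ∈ quarterPlane, J (c + r) (LamE hfin ξ η y * f) =
        t (mon ((1 : ℤ) • (y + (1, 1)))) := by
      intro y hy
      obtain ⟨u, v, rfl⟩ := exists_natCast_eq hy
      have e := hJ.jet.vanish (c + r) L _ (Ideal.mul_mem_right f _ (h1 u v)) (by omega)
      rw [sub_mul, map_sub, sub_eq_zero] at e
      rw [LamE_natCast, ← e]
      simp [ht]
    have hfun := functional_of_laplacian (M := M) (t := t) (t₁ := 0) (D := 2 * (c + q)) (ε := 1)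
      (f := fun y => J (c + r) (LamE hfin ξ η y * f)) (by norm_num)
      (fun g hg => hJ.jet.vanish _ _ _ (Ideal.mul_mem_right _ _ (h2 _ hL g hg)) (by omega))
      (fun _ _ => rfl) htF (fun y hy => by rw [LamE_of_notMem hy, zero_mul, map_zero])
      fun y hy => by
        simp only [one_smul]
        rw [hJ.recurrence_jet hexp hr (by omega) (fun z hz => (hκ r hr z hz y hy).2) f]
        refine Finset.sum_eq_zero fun r' hr' => ?_
        have := Finset.mem_Ico.1 hr'
        rw [ih r' this.2 this.1 (by omega), mul_zero]
    obtain ⟨hh, hl⟩ := hfun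
    have ht0 : t = 0 := by
      refine LinesZero.eq_zero (M := M) hl hdrift (D := N) (fun g => ?_) (fun g hg => ?_)
        fun d hd0 hdN hd => ?_
      · exact (mul_eq_zero.1 (hh g).symm).resolve_left (gam_ne_zero M)
      · have := Ideal.mul_mem_mul (h2 N (by omega) g hg) hf
        rw [← pow_add] at this
        exact hJ.jet.vanish _ _ _ this (by omega)
      · exact absurd (orderOf_le_of_pow_eq_one hd0 hd) (by omega)
    by_cases hy : y ∈ quarterPlane
    · rw [htF y hy, ht0, LinearMap.zero_apply]
    · rw [LamE_of_notMem hy, zero_mul, map_zero]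

end Slices

/-! ### Spaces of harmonic functions spanned by slices -/

/-- The function `z ↦ w q (z, y)`. -/
def slice (w : ℕ → MvPolynomial (Fin 4) ℝ) (q : ℕ) (y : ℤ × ℤ) : ℤ × ℤ → ℝ :=
  fun z => val (w q) z y

/-- The space spanned by the slices of `w 1, …, w q`. -/
def sliceSpan (w : ℕ → MvPolynomial (Fin 4) ℝ) (q : ℕ) : Submodule ℝ (ℤ × ℤ → ℝ) :=
  Submodule.span ℝ {f | ∃ r y, 1 ≤ r ∧ r ≤ q ∧ f = slice w r y}

lemma slice_mem {w : ℕ → MvPolynomial (Fin 4) ℝ} {r q : ℕ} (hr : 1 ≤ r) (hrq : r ≤ q)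
    (y : ℤ × ℤ) : slice w r y ∈ sliceSpan w q := Submodule.subset_span ⟨r, y, hr, hrq, rfl⟩

lemma sliceSpan_eq_zero {w : ℕ → MvPolynomial (Fin 4) ℝ} {q : ℕ} {f : ℤ × ℤ → ℝ}
    (hf : f ∈ sliceSpan w q) {z : ℤ × ℤ} (hz : z ∉ quarterPlane) : f z = 0 := by
  induction hf using Submodule.span_induction with
  | mem f hf =>
    obtain ⟨r, y, -, -, rfl⟩ := hf
    exact val_of_notMem_end _ _ hz
  | zero => rfl
  | add f g _ _ hf hg => rw [Pi.add_apply, hf, hg, add_zero]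
  | smul a f _ hf => rw [Pi.smul_apply, hf, smul_zero]

instance finiteDimensional_sliceSpan (w : ℕ → MvPolynomial (Fin 4) ℝ) (q : ℕ) :
    FiniteDimensional ℝ (sliceSpan w q) := by
  classical
  let mono : (Fin 4 →₀ ℕ) → ℤ × ℤ → ℝ := fun d z =>
    if z ∈ quarterPlane then (z.1.toNat : ℝ) ^ d 0 * (z.2.toNat : ℝ) ^ d 1 else 0
  let s : Finset (ℤ × ℤ → ℝ) := ((Finset.range (q + 1)).biUnion fun r => (w r).support).image mono
  refine Submodule.finiteDimensional_of_le (S₂ := Submodule.span ℝ (s : Set (ℤ × ℤ → ℝ))) ?_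
  refine Submodule.span_le.2 ?_
  rintro f ⟨r, y, -, hrq, rfl⟩
  by_cases hy : y ∈ quarterPlane
  · obtain ⟨u, v, rfl⟩ := exists_natCast_eq hy
    have : slice w r ((u : ℤ), (v : ℤ)) = ∑ d ∈ (w r).support,
        ((w r).coeff d * ((u : ℝ) ^ d 2 * (v : ℝ) ^ d 3)) • mono d := by
      funext z
      rw [Finset.sum_apply]
      by_cases hz : z ∈ quarterPlane
      · obtain ⟨k, l, rfl⟩ := exists_natCast_eq hz
        rw [slice, val_natCast, MvPolynomial.eval_eq']
        refine Finset.sum_congr rfl fun d _ => ?_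
        rw [Fin.prod_univ_four]
        simp only [Matrix.cons_val, Pi.smul_apply, smul_eq_mul, mono, hz, if_true, Int.toNat_natCast]
        ring
      · rw [slice, val_of_notMem_end _ _ hz]
        simp [mono, hz]
    rw [this]
    refine sum_mem fun d hd => Submodule.smul_mem _ _ (Submodule.subset_span ?_)
    exact Finset.mem_coe.2 (Finset.mem_image_of_mem _
      (Finset.mem_biUnion.2 ⟨r, Finset.mem_range.2 (by omega), hd⟩))
  · have : slice w r y = 0 := funext fun z => val_of_notMem_start _ _ hy
    rw [this]
    exact zero_mem _

section Harmonic

variable {hfin : M.group.Finite} {K : ℕ} {b : ℂ} {J : ℕ → Laur →ₗ[ℂ] ℂ}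
  {ξ η : StepModel.RatXY × StepModel.RatXY → Laur} {E : Laur} {c : ℕ}
  {w : ℕ → MvPolynomial (Fin 4) ℝ}

lemma IsDatum.exists_functional (hJ : IsDatum hfin K b J ξ η E)
    (hexp : M.IsExpansion 1 1 (saddles M) c w) (hdrift : M.ZeroDrift) {q D : ℕ}
    (hK : c + q < K) (hD : 2 * (c + q) ≤ D + orderOf (rot M) + 1) {f : ℤ × ℤ → ℝ}
    (hf : f ∈ sliceSpan w q) : ∃ t : Laur →ₗ[ℂ] ℂ, (∀ g ∈ maxId 1 ^ D, t g = 0) ∧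
      ∀ z ∈ quarterPlane, (f z : ℂ) = t (mon ((-1 : ℤ) • (z + (1, 1)))) := by
  induction hf using Submodule.span_induction with
  | mem f hf =>
    obtain ⟨r, y, hr, hrq, rfl⟩ := hf
    exact ⟨J (c + r) ∘ₗ LinearMap.mulLeft ℂ (LamE hfin ξ η y),
      fun g hg => hJ.jet_slice_eq_zero hexp hdrift hK hD hg hr hrq y,
      fun z hz => hJ.val_eq hexp hr (by omega) hz y⟩
  | zero => exact ⟨0, fun _ _ => rfl, fun _ _ => by simp⟩
  | add f g _ _ hf hg =>
    obtain ⟨t, h1, h2⟩ := hf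
    obtain ⟨t', h1', h2'⟩ := hg
    exact ⟨t + t', fun g hg => by rw [LinearMap.add_apply, h1 g hg, h1' g hg, add_zero],
      fun z hz => by rw [Pi.add_apply, Complex.ofReal_add, h2 z hz, h2' z hz]; rfl⟩
  | smul a f _ hf =>
    obtain ⟨t, h1, h2⟩ := hf
    exact ⟨(a : ℂ) • t, fun g hg => by rw [LinearMap.smul_apply, h1 g hg, smul_zero],
      fun z hz => by rw [Pi.smul_apply, smul_eq_mul, Complex.ofReal_mul, h2 z hz]; rfl⟩

lemma eq_of_eq_on_quadrant {t t' : Laur →ₗ[ℂ] ℂ} {D : ℕ} (ht : ∀ g ∈ maxId 1 ^ D, t g = 0)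
    (ht' : ∀ g ∈ maxId 1 ^ D, t' g = 0) (h : ∀ z ∈ quarterPlane,
      t (mon ((-1 : ℤ) • (z + (1, 1)))) = t' (mon ((-1 : ℤ) • (z + (1, 1))))) : t = t' := by
  rw [← sub_eq_zero]
  refine eq_zero_of_quadrant (ε := -1) (D := D) (a := 1) (by norm_num) (fun f hf => ?_)
    fun z h1 h2 => ?_
  · rw [LinearMap.sub_apply, ht f hf, ht' f hf, sub_zero]
  · have := h (z - (1, 1)) ⟨by simp; omega, by simp; omega⟩
    rw [sub_add_cancel] at this
    rw [LinearMap.sub_apply, this, sub_self]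

lemma conj_apply_psi_pow {t : Laur →ₗ[ℂ] ℂ} {D : ℕ} (ht : ∀ g ∈ maxId 1 ^ D, t g = 0)
    {f : ℤ × ℤ → ℝ} (h : ∀ z ∈ quarterPlane, (f z : ℂ) = t (mon ((-1 : ℤ) • (z + (1, 1)))))
    (d : ℕ) : (starRingEnd ℂ) (t (psi (omg M) ^ d)) = t (psi (omgBar M) ^ d) := by
  have e : conjT t = t := by
    refine eq_of_eq_on_quadrant (D := D) (fun g hg => ?_) ht fun z hz => ?_
    · change (starRingEnd ℂ) (t (conjL g)) = 0
      rw [ht _ (conjL_mem hg), map_zero]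
    · change (starRingEnd ℂ) (t (conjL _)) = _
      rw [conjL_mon, ← h z hz, Complex.conj_ofReal]
  conv_rhs => rw [← e]
  change _ = (starRingEnd ℂ) (t (conjL _))
  rw [show conjL (psi (omgBar M) ^ d) = psi (omg M) ^ d by
    rw [map_pow, conjL_psi, omgBar, Complex.conj_conj]]

theorem IsDatum.finrank_le (hJ : IsDatum hfin K b J ξ η E)
    (hexp : M.IsExpansion 1 1 (saddles M) c w) (hdrift : M.ZeroDrift) (hb : b ≠ 0) {q : ℕ}
    (hK : c + q < K) (hK' : orderOf (rot M) + 1 < K) {U : Submodule ℝ (ℤ × ℤ → ℝ)}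
    (hU : U ≤ sliceSpan w q) (hU0 : ∀ f ∈ U, M.laplacian (gam M) f = 0) :
    Module.finrank ℝ U ≤ q := by
  classical
  set N := orderOf (rot M) with hN
  have hcN : c ≤ N := hJ.le_orderOf hexp hdrift hb hK'
  have hN2 : 2 ≤ N := by
    have h1 : 0 < N := orderOf_rot_pos hdrift hfin
    have h2 : N ≠ 1 := fun h => rot_ne_one (M := M) (orderOf_eq_one_iff.1 h)
    omega
  set D := 2 * (c + q) - 1 - N with hD
  choose t ht1 ht2 using fun f : U => hJ.exists_functional hexp hdrift (D := D) hK (by omega)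
    (hU f.2)
  set S := (Finset.range D).filter fun d => 0 < d ∧ rot M ^ d = 1 with hS
  let T : U →ₗ[ℝ] (S → ℝ) :=
    { toFun := fun f d => (t f (psi (omg M) ^ (d : ℕ))).re + (t f (psi (omg M) ^ (d : ℕ))).im
      map_add' := fun f g => by
        have : t (f + g) = t f + t g := eq_of_eq_on_quadrant (ht1 _)
          (fun x hx => by rw [LinearMap.add_apply, ht1 f x hx, ht1 g x hx, add_zero])
          fun z hz => by
            rw [LinearMap.add_apply, ← ht2 _ z hz, ← ht2 _ z hz, ← ht2 _ z hz]
            push_cast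
            simp
        funext d
        simp only [this, LinearMap.add_apply, Complex.add_re, Complex.add_im, Pi.add_apply]
        ring
      map_smul' := fun a f => by
        have : t (a • f) = (a : ℂ) • t f := eq_of_eq_on_quadrant (ht1 _)
          (fun x hx => by rw [LinearMap.smul_apply, ht1 f x hx, smul_zero])
          fun z hz => by
            rw [LinearMap.smul_apply, ← ht2 _ z hz, ← ht2 _ z hz]
            simp
        funext d
        simp only [this, LinearMap.smul_apply, smul_eq_mul, Complex.re_ofReal_mul,
          Complex.im_ofReal_mul, Pi.smul_apply, RingHom.id_apply]
        ring }
  have hinj : Function.Injective T := by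
    rw [injective_iff_map_eq_zero]
    intro f hf
    have hfun := functional_of_laplacian (M := M) (t := t f) (t₁ := 0) (D := D) (ε := -1)
      (f := fun z => ((f : ℤ × ℤ → ℝ) z : ℂ)) (by norm_num) (ht1 f) (fun _ _ => rfl) (ht2 f)
      (fun z hz => by rw [sliceSpan_eq_zero (hU f.2) hz, Complex.ofReal_zero]) fun z hz => by
        have h := congrFun (hU0 f f.2) z
        rw [StepModel.laplacian, if_pos hz] at h
        have h' := congrArg (fun r : ℝ => (r : ℂ)) h
        push_cast at h'
        simpa [sub_eq_add_neg] using h'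
    obtain ⟨hh, hl⟩ := hfun
    have hh' : ∀ g, t f ((nor M - 1) * g) = 0 := fun g =>
      (mul_eq_zero.1 (hh g).symm).resolve_left (gam_ne_zero M)
    have ht0 : t f = 0 := by
      refine LinesZero.eq_zero (M := M) hl hdrift (D := D) hh' (ht1 f) fun d hd0 hdD hd hkill => ?_
      have h1 := congrFun hf ⟨d, Finset.mem_filter.2 ⟨Finset.mem_range.2 hdD, hd0, hd⟩⟩
      change (t f (psi (omg M) ^ d)).re + (t f (psi (omg M) ^ d)).im = 0 at h1
      obtain ⟨m, rfl⟩ := Nat.exists_eq_succ_of_ne_zero hd0.ne'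
      have h2 := LinesZero.apply_psiBar_pow (M := M) hl hdrift hkill hh'
      rw [← conj_apply_psi_pow (ht1 f) (ht2 f)] at h2
      have h3 := congrArg Complex.re h2
      have h4 := congrArg Complex.im h2
      rcases Nat.even_or_odd (m + 1) with he | ho
      · rw [he.neg_one_pow, one_mul, Complex.neg_re, Complex.conj_re] at h3
        refine Complex.ext ?_ ?_ <;> simp only [Complex.zero_re, Complex.zero_im] <;> linarith
      · rw [ho.neg_one_pow, neg_one_mul, neg_neg, Complex.conj_im] at h4
        refine Complex.ext ?_ ?_ <;> simp only [Complex.zero_re, Complex.zero_im] <;> linarith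
    refine Subtype.ext (funext fun z => ?_)
    by_cases hz : z ∈ quarterPlane
    · have := ht2 f z hz
      rw [ht0, LinearMap.zero_apply] at this
      exact_mod_cast this
    · exact sliceSpan_eq_zero (hU f.2) hz
  have hcard : S.card ≤ q := by
    have h1 : S.card ≤ (Finset.Icc 1 q).card := by
      refine Finset.card_le_card_of_injOn (fun d => d / N) (fun d hd => ?_) fun d hd d' hd' h => ?_
      · obtain ⟨h1, h2, h3⟩ := Finset.mem_filter.1 (Finset.mem_coe.1 hd)
        rw [Finset.mem_range] at h1
        obtain ⟨j, rfl⟩ := orderOf_dvd_of_pow_eq_one h3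
        rw [← hN] at h1 h2 ⊢
        have hj : 0 < j := Nat.pos_of_mul_pos_left h2
        simp only [Finset.coe_Icc, Set.mem_Icc]
        rw [Nat.mul_div_cancel_left _ (by omega)]
        refine ⟨hj, ?_⟩
        by_contra! hq
        obtain ⟨i, rfl⟩ := Nat.exists_eq_add_of_lt hq
        have : N * (q + i + 1) ≤ 2 * q + N - 2 := by omega
        have h4 : N * (q + i + 1) = N * q + N * i + N := by ring
        have h5 := Nat.mul_le_mul_right q hN2
        omega
      · obtain ⟨-, -, h3⟩ := Finset.mem_filter.1 (Finset.mem_coe.1 hd)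
        obtain ⟨-, -, h3'⟩ := Finset.mem_filter.1 (Finset.mem_coe.1 hd')
        obtain ⟨j, rfl⟩ := orderOf_dvd_of_pow_eq_one h3
        obtain ⟨j', rfl⟩ := orderOf_dvd_of_pow_eq_one h3'
        rw [← hN] at h ⊢
        beta_reduce at h
        rw [Nat.mul_div_cancel_left _ (by omega), Nat.mul_div_cancel_left _ (by omega)] at h
        rw [h]
    simpa using h1
  have h1 := LinearMap.finrank_le_finrank_of_injective hinj
  rw [Module.finrank_fintype_fun_eq_card, Fintype.card_coe] at h1
  exact h1.trans hcard

end Harmonic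

end OrbitSum

end

noncomputable section

namespace OrbitSum

/-! ### Nilpotent endomorphisms -/

section Nilpotent

variable {k Y : Type*} [Field k] [AddCommGroup Y] [Module k Y] [FiniteDimensional k Y]

lemma exists_rank_factorization (e : Y →ₗ[k] Y) (s : Finset ℕ)
    (hs : Module.finrank k (LinearMap.range e) ≤ s.card) :
    ∃ (h : ℕ → Y) (φ : ℕ → Module.Dual k Y), (∀ j, h j ∈ LinearMap.range e) ∧
      (∀ j f, e f = 0 → φ j f = 0) ∧ ∀ f, e f = ∑ j ∈ s, φ j f • h j := by
  obtain ⟨s', hs', hcard⟩ := Finset.exists_subset_card_eq hs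
  let b := (Module.finBasisOfFinrankEq k (LinearMap.range e) hcard.symm).reindex
    s'.equivFin.symm
  classical
  refine ⟨fun j => if hj : j ∈ s' then b ⟨j, hj⟩ else 0,
    fun j => if hj : j ∈ s' then b.coord ⟨j, hj⟩ ∘ₗ e.rangeRestrict else 0, fun j => ?_,
    fun j f hf => ?_, fun f => ?_⟩
  · beta_reduce
    split_ifs with hj
    · exact (b ⟨j, hj⟩).2
    · exact zero_mem _
  · beta_reduce
    split_ifs with hj
    · have : e.rangeRestrict f = 0 := Subtype.ext hf
      rw [LinearMap.comp_apply, this, map_zero]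
    · rfl
  · beta_reduce
    rw [← Finset.sum_subset hs' fun j _ hj => by rw [dif_neg hj, dif_neg hj, smul_zero],
      ← Finset.sum_coe_sort]
    have := congrArg (Submodule.subtype _) (b.sum_repr (e.rangeRestrict f))
    rw [map_sum] at this
    refine this.symm.trans (Finset.sum_congr rfl fun j _ => ?_)
    rw [dif_pos j.2, dif_pos j.2]
    rfl

variable {D : Y →ₗ[k] Y} {p : ℕ}

lemma exists_decomposition_of_projection (hD : D ^ p = 0)
    (hrank : ∀ i < p, Module.finrank k ↥(LinearMap.ker D ⊓ LinearMap.range (D ^ i)) ≤ p - i)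
    {i : ℕ} (hi : i ≤ p) (P : Y →ₗ[k] Y) (hP : ∀ f, (D ^ i) (P f) = 0)
    (hP' : ∀ f, (D ^ i) f = 0 → P f = f) :
    ∃ (h : ℕ → ℕ → Y) (φ : ℕ → ℕ → Module.Dual k Y), (∀ m j, (D ^ m) (h m j) = 0) ∧
      (∀ m j f, m ≤ p → φ m j ((D ^ (p + 1 - m)) f) = 0) ∧
      ∀ f, P f = ∑ m ∈ Finset.Icc 1 i, ∑ j ∈ Finset.Icc 1 (p + 1 - m), φ m j f • h m j := by
  classical
  induction i generalizing P with
  | zero => exact ⟨0, 0, by simp, by simp, fun f => by simpa using hP f⟩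
  | succ i ih =>
    obtain ⟨Q', hQ'⟩ := (LinearMap.ker (D ^ i)).subtype.exists_leftInverse_of_injective
      (Submodule.ker_subtype _)
    set Q := (LinearMap.ker (D ^ i)).subtype ∘ₗ Q' with hQdef
    have hQ1 : ∀ f, (D ^ i) (Q f) = 0 := fun f => (Q' f).2
    have hQ2 : ∀ f, (D ^ i) f = 0 → Q f = f := fun f hf =>
      congrArg Subtype.val (LinearMap.congr_fun hQ' ⟨f, hf⟩)
    have hup : ∀ f, (D ^ i) f = 0 → (D ^ (i + 1)) f = 0 := fun f hf => by
      rw [pow_succ', Module.End.mul_apply, hf, map_zero]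
    obtain ⟨h, φ, h1, h2, h3⟩ := ih (by omega) (Q ∘ₗ P) (fun f => hQ1 _) fun f hf => by
      rw [LinearMap.comp_apply, hP' f (hup f hf), hQ2 f hf]
    set e := P - Q ∘ₗ P with he
    have he1 : ∀ f, (D ^ (i + 1)) (e f) = 0 := fun f => by
      rw [he, LinearMap.sub_apply, map_sub, hP f, LinearMap.comp_apply, hup _ (hQ1 _), sub_zero]
    have he2 : ∀ f, (D ^ i) f = 0 → e f = 0 := fun f hf => by
      rw [he, LinearMap.sub_apply, LinearMap.comp_apply, hP' f (hup f hf), hQ2 f hf, sub_self]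
    have he3 : ∀ f ∈ LinearMap.range e, (D ^ i) f = 0 → f = 0 := by
      rintro _ ⟨f, rfl⟩ hf
      have : Q (e f) = Q (P f) - Q (Q (P f)) := map_sub Q _ _
      rw [← hQ2 _ hf, this, hQ2 (Q (P f)) (hQ1 _), sub_self]
    let T : LinearMap.range e →ₗ[k] ↥(LinearMap.ker D ⊓ LinearMap.range (D ^ i)) :=
      ((D ^ i).domRestrict (LinearMap.range e)).codRestrict _ fun f => by
        refine ⟨?_, LinearMap.mem_range_self _ _⟩
        obtain ⟨_, f, rfl⟩ := f
        have := he1 f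
        rw [pow_succ', Module.End.mul_apply] at this
        exact this
    have hT : Function.Injective T := by
      rw [injective_iff_map_eq_zero]
      exact fun f hf => Subtype.ext (he3 f f.2 (congrArg Subtype.val hf))
    have hcard := (LinearMap.finrank_le_finrank_of_injective hT).trans (hrank i hi)
    obtain ⟨h', φ', h1', h2', h3'⟩ := exists_rank_factorization e
      (Finset.Icc 1 (p + 1 - (i + 1))) (by rw [Nat.card_Icc]; omega)
    refine ⟨Function.update h (i + 1) h', Function.update φ (i + 1) φ', fun m j => ?_,
      fun m j f hm => ?_, fun f => ?_⟩
    · rcases eq_or_ne m (i + 1) with rfl | hne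
      · obtain ⟨f, hf⟩ := h1' j
        rw [Function.update_self, ← hf, he1]
      · rw [Function.update_of_ne hne, h1]
    · rcases eq_or_ne m (i + 1) with rfl | hne
      · rw [Function.update_self]
        refine h2' _ _ (he2 _ ?_)
        rw [← Module.End.mul_apply, ← pow_add, show i + (p + 1 - (i + 1)) = p by omega, hD,
          LinearMap.zero_apply]
      · rw [Function.update_of_ne hne, h2 m j f hm]
    · have : P f = Q (P f) + e f := (add_sub_cancel (Q (P f)) (P f)).symm
      rw [Finset.sum_Icc_succ_top (by omega), this, Function.update_self, Function.update_self,
        h3' f, ← LinearMap.comp_apply, h3 f]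
      congr 1
      refine Finset.sum_congr rfl fun m hm => Finset.sum_congr rfl fun j _ => ?_
      have : m ≠ i + 1 := by have := Finset.mem_Icc.1 hm; omega
      rw [Function.update_of_ne this, Function.update_of_ne this]

/-- An adapted decomposition of the identity for a nilpotent endomorphism. -/
theorem exists_nilpotent_decomposition (hD : D ^ p = 0)
    (hrank : ∀ i < p, Module.finrank k ↥(LinearMap.ker D ⊓ LinearMap.range (D ^ i)) ≤ p - i) :
    ∃ (h : ℕ → ℕ → Y) (φ : ℕ → ℕ → Module.Dual k Y), (∀ m j, (D ^ m) (h m j) = 0) ∧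
      (∀ m j f, m ≤ p → φ m j ((D ^ (p + 1 - m)) f) = 0) ∧
      ∀ f, f = ∑ m ∈ Finset.Icc 1 p, ∑ j ∈ Finset.Icc 1 (p + 1 - m), φ m j f • h m j :=
  exists_decomposition_of_projection hD hrank le_rfl LinearMap.id (fun f => by simp [hD])
    fun _ _ => rfl

lemma sum_indexSet {A : Type*} [AddCommMonoid A] (p : ℕ) (F : ℕ → ℕ → A) :
    ∑ ij ∈ StepModel.indexSet p, F ij.1 ij.2 =
      ∑ m ∈ Finset.Icc 1 p, ∑ j ∈ Finset.Icc 1 (p + 1 - m), F m j := by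
  rw [Finset.sum_sigma']
  refine Finset.sum_bij' (fun ij _ => ⟨ij.1, ij.2⟩) (fun x _ => (x.1, x.2)) ?_ ?_ ?_ ?_ ?_
  · intro ij h
    simp only [StepModel.indexSet, Finset.mem_filter, Finset.mem_product, Finset.mem_Icc] at h
    simp only [Finset.mem_sigma, Finset.mem_Icc]
    omega
  · intro x h
    simp only [Finset.mem_sigma, Finset.mem_Icc] at h
    simp only [StepModel.indexSet, Finset.mem_filter, Finset.mem_product, Finset.mem_Icc]
    omega
  all_goals intros; rfl

end Nilpotent

/-! ### The decomposition of the coefficients -/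

variable {M : StepModel} {c : ℕ} {w : ℕ → MvPolynomial (Fin 4) ℝ}

/-- The discrete Laplacian as a linear map. -/
def lapL (M : StepModel) (t : ℝ) : (ℤ × ℤ → ℝ) →ₗ[ℝ] (ℤ × ℤ → ℝ) where
  toFun := M.laplacian t
  map_add' f g := by
    funext z
    simp only [StepModel.laplacian, Pi.add_apply]
    split_ifs
    · rw [Finset.sum_congr rfl fun s _ => mul_add _ _ _, Finset.sum_add_distrib]
      ring
    · rw [add_zero]
  map_smul' a f := by
    funext z
    simp only [StepModel.laplacian, Pi.smul_apply, smul_eq_mul, RingHom.id_apply]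
    split_ifs
    · rw [mul_sub, Finset.mul_sum]
      congr 1
      · exact Finset.sum_congr rfl fun s _ => by ring
      · ring
    · rw [mul_zero]

lemma lapL_slice {κ : ℕ → ℕ → ℝ} {q : ℕ} {y : ℤ × ℤ} (hκ : ∀ z ∈ quarterPlane,
    y ∈ quarterPlane → ∑ s ∈ smallBox, M.weight s * val (w q) (z - s) y - gam M * val (w q) z y =
      ∑ r ∈ Finset.Ico 1 q, κ q r * val (w r) z y) :
    lapL M (gam M) (slice w q y) = ∑ r ∈ Finset.Ico 1 q, κ q r • slice w r y := by
  by_cases hy : y ∈ quarterPlane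
  · funext z
    rw [Finset.sum_apply]
    by_cases hz : z ∈ quarterPlane
    · exact (if_pos hz).trans (hκ z hz hy)
    · refine (if_neg hz).trans (Finset.sum_eq_zero fun r _ => ?_).symm
      rw [Pi.smul_apply, slice, val_of_notMem_end _ _ hz, smul_zero]
  · have : ∀ r, slice w r y = 0 := fun r => funext fun z => val_of_notMem_start _ _ hy
    simp only [this, map_zero, smul_zero, Finset.sum_const_zero]

lemma lapL_mem (hexp : M.IsExpansion 1 1 (saddles M) c w) {q : ℕ} {f : ℤ × ℤ → ℝ}
    (hf : f ∈ sliceSpan w q) : lapL M (gam M) f ∈ sliceSpan w (q - 1) := by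
  obtain ⟨κ, hκ⟩ := exists_recurrence hexp
  have : sliceSpan w q ≤ (sliceSpan w (q - 1)).comap (lapL M (gam M)) := by
    refine Submodule.span_le.2 ?_
    rintro _ ⟨r, y, hr, hrq, rfl⟩
    change lapL M (gam M) (slice w r y) ∈ sliceSpan w (q - 1)
    rw [lapL_slice fun z hz hy => (hκ r hr z hz y hy).1]
    refine sum_mem fun r' hr' => Submodule.smul_mem _ _ (slice_mem ?_ ?_ _) <;>
    · have := Finset.mem_Ico.1 hr'
      omega
  exact this hf

lemma sliceSpan_zero : sliceSpan w 0 = ⊥ := by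
  refine Submodule.span_eq_bot.2 ?_
  rintro _ ⟨r, y, h1, h2, rfl⟩
  omega

lemma sliceSpan_mono {q q' : ℕ} (h : q ≤ q') : sliceSpan w q ≤ sliceSpan w q' :=
  Submodule.span_mono fun _ ⟨r, y, h1, h2, e⟩ => ⟨r, y, h1, h2.trans h, e⟩

/-- The discrete Laplacian on the space spanned by the slices. -/
def sliceLap (hexp : M.IsExpansion 1 1 (saddles M) c w) (p : ℕ) :
    sliceSpan w p →ₗ[ℝ] sliceSpan w p :=
  (lapL M (gam M)).restrict fun _ hf => sliceSpan_mono (by omega) (lapL_mem hexp hf)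

lemma coe_sliceLap_pow (hexp : M.IsExpansion 1 1 (saddles M) c w) (p i : ℕ)
    (f : sliceSpan w p) :
    (((sliceLap hexp p) ^ i) f : ℤ × ℤ → ℝ) = (M.laplacian (gam M))^[i] f := by
  induction i with
  | zero => rfl
  | succ i ih =>
    rw [pow_succ', Module.End.mul_apply, Function.iterate_succ_apply', ← ih]
    rfl

lemma coe_sliceLap_pow_mem (hexp : M.IsExpansion 1 1 (saddles M) c w) (p i : ℕ)
    (f : sliceSpan w p) :
    (((sliceLap hexp p) ^ i) f : ℤ × ℤ → ℝ) ∈ sliceSpan w (p - i) := by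
  induction i with
  | zero => exact f.2
  | succ i ih =>
    rw [pow_succ', Module.End.mul_apply]
    exact lapL_mem hexp ih

lemma reverse_laplacian_apply {p : ℕ} (hp : 1 ≤ p) (hexp : M.IsExpansion 1 1 (saddles M) c w)
    (φ : Module.Dual ℝ (sliceSpan w p)) :
    M.reverse.laplacian (gam M) (fun y => φ ⟨slice w p y, slice_mem hp le_rfl y⟩) =
      fun y => φ (sliceLap hexp p ⟨slice w p y, slice_mem hp le_rfl y⟩) := by
  obtain ⟨κ, hκ⟩ := exists_recurrence hexp
  funext y
  by_cases hy : y ∈ quarterPlane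
  · refine (if_pos hy).trans ?_
    have hsum : ∑ s ∈ smallBox, M.reverse.weight s *
        φ ⟨slice w p (y - s), slice_mem hp le_rfl (y - s)⟩ =
        ∑ s ∈ smallBox, M.weight s * φ ⟨slice w p (y + s), slice_mem hp le_rfl (y + s)⟩ := by
      refine Finset.sum_nbij' (fun s => -s) (fun s => -s) ?_ ?_ (fun s _ => neg_neg s)
        (fun s _ => neg_neg s) fun s _ => ?_
      iterate 2
        intro s hs
        simp only [smallBox, Finset.mem_product, Finset.mem_Icc, Prod.fst_neg, Prod.snd_neg] at hs ⊢
        omega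
      simp only [StepModel.reverse, sub_eq_add_neg]
    rw [hsum]
    simp only [← smul_eq_mul, ← map_smul, ← map_sum, ← map_sub]
    congr 1
    refine Subtype.ext ?_
    rw [Submodule.coe_sub, Submodule.coe_sum]
    change _ = lapL M (gam M) (slice w p y)
    rw [lapL_slice fun z hz hy => (hκ p hp z hz y hy).1]
    funext z
    simp only [Pi.sub_apply, Finset.sum_apply, Submodule.coe_smul, Pi.smul_apply, smul_eq_mul]
    by_cases hz : z ∈ quarterPlane
    · exact (hκ p hp z hz y hy).2
    · simp [slice, val_of_notMem_end _ _ hz]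
  · refine (if_neg hy).trans ?_
    have : (⟨slice w p y, slice_mem hp le_rfl y⟩ : sliceSpan w p) = 0 :=
      Subtype.ext (funext fun z => val_of_notMem_start _ _ hy)
    rw [this, map_zero, map_zero]

lemma isAdjointPolyharmonic_apply {p : ℕ} (hp : 1 ≤ p)
    (hexp : M.IsExpansion 1 1 (saddles M) c w) (φ : Module.Dual ℝ (sliceSpan w p)) {d : ℕ}
    (hφ : ∀ f, φ ((sliceLap hexp p ^ d) f) = 0) :
    M.IsAdjointPolyharmonic (gam M) d fun y => φ ⟨slice w p y, slice_mem hp le_rfl y⟩ := by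
  have key : ∀ d (φ : Module.Dual ℝ (sliceSpan w p)), (M.reverse.laplacian (gam M))^[d]
      (fun y => φ ⟨slice w p y, slice_mem hp le_rfl y⟩) =
        fun y => φ ((sliceLap hexp p ^ d) ⟨slice w p y, slice_mem hp le_rfl y⟩) := by
    intro d
    induction d with
    | zero => exact fun φ => rfl
    | succ d ih =>
      intro φ
      rw [Function.iterate_succ_apply, reverse_laplacian_apply hp hexp φ]
      have := ih (φ ∘ₗ sliceLap hexp p)
      simp only [LinearMap.comp_apply] at this
      simp only [this, pow_succ', Module.End.mul_apply]
  refine ⟨fun y _ => ?_, fun y hy => ?_⟩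
  · rw [key]
    exact hφ _
  · have : (⟨slice w p y, slice_mem hp le_rfl y⟩ : sliceSpan w p) = 0 :=
      Subtype.ext (funext fun z => val_of_notMem_start _ _ hy)
    beta_reduce
    rw [this, map_zero]

lemma finrank_ker_inf_range_le (hsum : M.IsOrbitSummable) (hdrift : M.ZeroDrift)
    (hexp : M.IsExpansion 1 1 (saddles M) c w) {p i : ℕ} (hi : i < p) :
    Module.finrank ℝ ↥(LinearMap.ker (sliceLap hexp p) ⊓
      LinearMap.range (sliceLap hexp p ^ i)) ≤ p - i := by
  obtain ⟨b, J, ξ, η, E, hJ⟩ := exists_isDatum hsum hdrift (c + p + orderOf (rot M) + 2)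
  set W := LinearMap.ker (sliceLap hexp p) ⊓ LinearMap.range (sliceLap hexp p ^ i) with hW
  set U := W.map (sliceSpan w p).subtype with hU
  have hfin : Module.finrank ℝ W = Module.finrank ℝ U :=
    (Submodule.equivMapOfInjective _ (Submodule.injective_subtype _) W).finrank_eq
  rw [hfin]
  have hU1 : U ≤ sliceSpan w (p - i) := by
    rintro _ ⟨_, ⟨-, f, rfl⟩, rfl⟩
    exact coe_sliceLap_pow_mem hexp p i f
  rcases eq_or_ne b 0 with rfl | hb
  · have h0 : sliceSpan w (p - i) = ⊥ := by
      refine Submodule.span_eq_bot.2 ?_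
      rintro _ ⟨r, y, hr, hrp, rfl⟩
      funext z
      by_cases hz : z ∈ quarterPlane
      · have := hJ.val_eq hexp hr (by omega) hz y
        rw [hJ.jet.zero rfl, LinearMap.zero_apply] at this
        exact_mod_cast this
      · exact val_of_notMem_end _ _ hz
    rw [h0, le_bot_iff] at hU1
    rw [hU1, finrank_bot]
    exact Nat.zero_le _
  · refine hJ.finrank_le hexp hdrift hb (by omega) (by omega) hU1 ?_
    rintro _ ⟨f, ⟨hf, -⟩, rfl⟩
    exact congrArg Subtype.val hf

/-- The coefficients of the expansion decompose into polyharmonic functions. -/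
theorem exists_polyharmonic_decomposition (hsum : M.IsOrbitSummable) (hdrift : M.ZeroDrift)
    (hexp : M.IsExpansion 1 1 (saddles M) c w) {p : ℕ} (hp : 1 ≤ p) :
    ∃ h g : ℕ → ℕ → ℤ × ℤ → ℝ, (∀ ij ∈ StepModel.indexSet p,
        M.IsPolyharmonic (gam M) ij.1 (h ij.1 ij.2) ∧
        M.IsAdjointPolyharmonic (gam M) (p + 1 - ij.1) (g ij.1 ij.2)) ∧
      ∀ k l u v : ℕ, StepModel.evalAt (w p) k l u v = ∑ ij ∈ StepModel.indexSet p,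
        h ij.1 ij.2 ((k : ℤ), (l : ℤ)) * g ij.1 ij.2 ((u : ℤ), (v : ℤ)) := by
  have hnil : sliceLap hexp p ^ p = 0 := LinearMap.ext fun f => Subtype.ext (by
    have := coe_sliceLap_pow_mem hexp p p f
    rw [Nat.sub_self, sliceSpan_zero] at this
    exact (Submodule.mem_bot ℝ).1 this)
  obtain ⟨h, φ, h1, h2, h3⟩ := exists_nilpotent_decomposition hnil
    fun i hi => finrank_ker_inf_range_le hsum hdrift hexp hi
  refine ⟨fun i j => h i j, fun i j y => φ i j ⟨slice w p y, slice_mem hp le_rfl y⟩,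
    fun ij hij => ⟨⟨fun z _ => ?_, fun z hz => sliceSpan_eq_zero (h ij.1 ij.2).2 hz⟩,
      isAdjointPolyharmonic_apply hp hexp _ fun f => ?_⟩, fun k l u v => ?_⟩
  · rw [← coe_sliceLap_pow hexp, h1]
    rfl
  · refine h2 _ _ _ ?_
    simp only [StepModel.indexSet, Finset.mem_filter, Finset.mem_product, Finset.mem_Icc] at hij
    omega
  · have h4 := congrArg (fun f : sliceSpan w p => (f : ℤ × ℤ → ℝ) ((k : ℤ), (l : ℤ)))
      (h3 ⟨slice w p ((u : ℤ), (v : ℤ)), slice_mem hp le_rfl _⟩)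
    rw [evalAt_eq, ← val_natCast]
    refine h4.trans ?_
    rw [← sum_indexSet p fun i j => φ i j ⟨slice w p ((u : ℤ), (v : ℤ)), slice_mem hp le_rfl _⟩ •
      h i j]
    beta_reduce
    rw [Submodule.coe_sum, Finset.sum_apply]
    exact Finset.sum_congr rfl fun ij _ => mul_comm _ _

end OrbitSum
end

theorem theorem3 (M : StepModel) (hsum : M.IsOrbitSummable) (hdrift : M.ZeroDrift)
    (x₀ y₀ : ℝ) (hsaddle : M.IsDominantSaddlePoint x₀ y₀) :
    ∃ T : Finset (ℂ × ℂ), (∀ z, z ∈ T ↔ M.IsAssociatedSaddlePoint x₀ y₀ z) ∧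
      (∃ (c : ℕ) (w : ℕ → MvPolynomial (Fin 4) ℝ), M.IsExpansion x₀ y₀ T c w) ∧
      ∀ (c : ℕ) (w : ℕ → MvPolynomial (Fin 4) ℝ), M.IsExpansion x₀ y₀ T c w →
        ∀ p : ℕ, 1 ≤ p →
          ∃ (a : ℕ → ℕ → ℝ) (h g : ℕ → ℕ → ℤ × ℤ → ℝ),
            (∀ ij ∈ StepModel.indexSet p,
              M.IsPolyharmonic (M.stepPoly x₀ y₀) ij.1 (h ij.1 ij.2) ∧
              M.IsAdjointPolyharmonic (M.stepPoly x₀ y₀) (p + 1 - ij.1) (g ij.1 ij.2)) ∧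
            ∀ k l u v : ℕ,
              StepModel.evalAt (w p) k l u v =
                ∑ ij ∈ StepModel.indexSet p, a ij.1 ij.2 *
                  h ij.1 ij.2 ((k : ℤ), (l : ℤ)) * g ij.1 ij.2 ((u : ℤ), (v : ℤ)) := by
  obtain ⟨rfl, rfl⟩ := OrbitSum.eq_one_of_isDominantSaddlePoint hdrift hsaddle
  refine ⟨OrbitSum.saddles M, OrbitSum.mem_saddles, OrbitSum.exists_isExpansion hsum hdrift,
    fun c w hexp p hp => ?_⟩
  obtain ⟨h, g, hpoly, hsum⟩ := OrbitSum.exists_polyharmonic_decomposition hsum hdrift hexp hp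
  rw [OrbitSum.stepPoly_one]
  exact ⟨fun _ _ => 1, h, g, hpoly, fun k l u v => by simp only [one_mul, hsum]⟩
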